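/- Let $d\ge 2$ and $p\ge 1$ be integer constants, and fix integers $c,q\ge 0$. There are a randomized one-pass streaming algorithm and constants $C,k,\kappa$, all depending only on $d,p,c,q$, such that the following holds for every $n\ge 1$ and every $\varepsilon\in(0,1)$. The algorithm is a fixed program for a word RAM with access to independent fair coin flips. Its memory consists of signed words of $\kappa\lceil\log_2\lceil (n+1)/\varepsilon\rceil\rceil=O(\log(n/\varepsilon))$ bits. It is given $n$ and the accuracy (as the integer $\lceil 1/\varepsilon\rceil$), and it reads once, entry by entry, the rows $a_1,\dots,a_n$ of an arbitrary matrix $A\in\mathbb{Z}^{n\times d}$ with entries of absolute value at most $(n+1)^c$ (entries of $O(\log n)$ bits). On every such input, for every outcome of the coin flips, it halts and outputs rows $B_1,\dots,B_m$ of $A$, taken at $m$ distinct positions, and weights $w\in\mathbb{R}^m$, where $$m\le C\,\varepsilon^{-\frac{2(d-1)}{d+2p}}\log^k(2/\varepsilon)=\tilde O\big(\varepsilon^{-\frac{2(d-1)}{d+2p}}\big),$$ and its whole memory, including all working space, is at most $$C\,\varepsilon^{-\frac{2(d-1)}{d+2p}}\log^k(2/\varepsilon)\log^k(n+1)=\tilde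 O\big(\varepsilon^{-\frac{2(d-1)}{d+2p}}\cdot\mathrm{polylog}(n)\big)$$ words. With probability at least $1-(n+1)^{-q}$, simultaneously for all $x\in\mathbb{R}^d$, $$\Big|\sum_{i=1}^m w_i|\langle B_i,x\rangle|^p-\|Ax\|_p^p\Big|\le C\varepsilon\,\|Ax\|_p^p .$$ -/

import Mathlib

open MeasureTheory

namespace StreamRAM

/-- Binary operations of the machine. A word holds a signed integer. -/
inductive BinOp
  | add
  | sub
  | mul
  | div
  | lt

/-- `div` rounds down; `lt` returns `1` for true and `0` for false. -/
def BinOp.eval : BinOp → ℤ → ℤ → ℤ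
  | .add, x, y => x + y
  | .sub, x, y => x - y
  | .mul, x, y => x * y
  | .div, x, y => Int.fdiv x y
  | .lt, x, y => if x < y then 1 else 0

/-- Basic instructions of a random access machine whose only storage is an array `M` of words.
Operands `a b c` are fixed addresses.
* `const a z`: `M[a] := z`
* `op o a b c`: `M[a] := M[b] o M[c]`
* `load a b`: `M[a] := M[M[b]]`
* `store a b`: `M[M[a]] := M[b]`
* `coin a`: `M[a] :=` a fresh random bit
* `next a`: `M[a] :=` the next number of the input stream, which moves on and never goes back. -/
inductive Instr
  | const (a : ℕ) (z : ℤ)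
  | op (o : BinOp) (a b c : ℕ)
  | load (a b : ℕ)
  | store (a b : ℕ)
  | coin (a : ℕ)
  | next (a : ℕ)

/-- Programs: basic instructions combined by sequencing, branching on `M[a] ≠ 0`, and loops
"while `M[a] ≠ 0`". A program is a finite object that does not depend on the input. -/
inductive Prog
  | skip
  | instr (i : Instr)
  | seq (P Q : Prog)
  | ite (a : ℕ) (P Q : Prog)
  | while (a : ℕ) (P : Prog)

/-- Memory contents, the unread part of the stream, and the unused coin flips. -/
structure State where
  mem : ℕ → ℤ
  input : List ℤ
  coins : ℕ → Bool

/-- Read the cell at address `a`; a fault (`none`) unless `0 ≤ a < S`. -/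
def State.get (S : ℕ) (s : State) (a : ℤ) : Option ℤ :=
  if 0 ≤ a ∧ a < S then some (s.mem a.toNat) else none

/-- Write `v` to the cell at address `a`; a fault unless `0 ≤ a < S` and `|v| < 2 ^ w`. -/
def State.set (S w : ℕ) (s : State) (a v : ℤ) : Option State :=
  if 0 ≤ a ∧ a < S ∧ |v| < 2 ^ w then
    some { s with mem := Function.update s.mem a.toNat v } else none

/-- One basic instruction on the machine with `S` memory cells, each of which holds an integer of
at most `w` bits and a sign. -/
def Instr.step (S w : ℕ) (s : State) : Instr → Option State
  | .const a z => s.set S w a z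
  | .op o a b c => (s.get S b).bind fun x => (s.get S c).bind fun y => s.set S w a (o.eval x y)
  | .load a b => (s.get S b).bind fun x => (s.get S x).bind fun y => s.set S w a y
  | .store a b => (s.get S a).bind fun x => (s.get S b).bind fun y => s.set S w x y
  | .coin a => State.set S w { s with coins := fun i => s.coins (i + 1) } a
      (if s.coins 0 then 1 else 0)
  | .next a =>
      match s.input with
      | [] => none
      | z :: rest => State.set S w { s with input := rest } a z

/-- `Exec S w P s t`: started in `s`, on the machine with `S` cells of `w` bits, the program `P`
halts in `t` without any fault; in particular every cell it ever touches is one of the `S` cells. -/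
inductive Exec (S w : ℕ) : Prog → State → State → Prop
  | skip (s : State) : Exec S w .skip s s
  | instr {i : Instr} {s t : State} (h : i.step S w s = some t) : Exec S w (.instr i) s t
  | seq {P Q : Prog} {s t u : State} (h₁ : Exec S w P s t) (h₂ : Exec S w Q t u) :
      Exec S w (.seq P Q) s u
  | ite_true {a : ℕ} {P Q : Prog} {s t : State} {v : ℤ} (hv : s.get S a = some v) (h0 : v ≠ 0)
      (h : Exec S w P s t) : Exec S w (.ite a P Q) s t
  | ite_false {a : ℕ} {P Q : Prog} {s t : State} (hv : s.get S a = some 0)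
      (h : Exec S w Q s t) : Exec S w (.ite a P Q) s t
  | while_true {a : ℕ} {P : Prog} {s t u : State} {v : ℤ} (hv : s.get S a = some v) (h0 : v ≠ 0)
      (h₁ : Exec S w P s t) (h₂ : Exec S w (.while a P) t u) : Exec S w (.while a P) s u
  | while_false {a : ℕ} {P : Prog} {s : State} (hv : s.get S a = some 0) :
      Exec S w (.while a P) s s

/-- The coin flips determine the run. -/
theorem Exec.det {S w : ℕ} {P : Prog} {s t t' : State} (h : Exec S w P s t)
    (h' : Exec S w P s t') : t = t' := by
  induction h generalizing t' with
  | skip s => cases h'; rfl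
  | instr h => cases h' with | instr k => rw [h] at k; exact Option.some.inj k
  | seq _ _ ih₁ ih₂ =>
    cases h' with | seq k₁ k₂ => rw [← ih₁ k₁] at k₂; exact ih₂ k₂
  | ite_true hv h0 _ ih =>
    cases h' with
    | ite_true kv k0 k => exact ih k
    | ite_false kv k => rw [hv] at kv; exact absurd (Option.some.inj kv) h0
  | ite_false hv _ ih =>
    cases h' with
    | ite_true kv k0 k => rw [hv] at kv; exact absurd (Option.some.inj kv).symm k0
    | ite_false kv k => exact ih k
  | while_true hv h0 _ _ ih₁ ih₂ =>
    cases h' with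
    | while_true kv k0 k₁ k₂ => rw [← ih₁ k₁] at k₂; exact ih₂ k₂
    | while_false kv => rw [hv] at kv; exact absurd (Option.some.inj kv) h0
  | while_false hv =>
    cases h' with
    | while_true kv k0 k₁ k₂ => rw [hv] at kv; exact absurd (Option.some.inj kv).symm k0
    | while_false kv => rfl

/-- The law of an infinite sequence of independent fair coin flips. -/
noncomputable def coinMeasure : Measure (ℕ → Bool) :=
  Measure.infinitePi fun _ => (PMF.uniformOfFintype Bool).toMeasure

end StreamRAM

/-- A list of `m` rows of length `d`, each with a real weight. -/
structure WeightedRows (d : ℕ) where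
  m : ℕ
  row : Fin m → Fin d → ℤ
  weight : Fin m → ℝ

/-- The rows are those of `A` at `m` distinct positions. -/
def WeightedRows.IsSubsetOf {n d : ℕ} (B : WeightedRows d) (A : Matrix (Fin n) (Fin d) ℤ) : Prop :=
  ∃ pos : Fin B.m ↪ Fin n, ∀ i, B.row i = A (pos i)

/-- For all `x`, the weighted sum `∑ wᵢ |⟨Bᵢ, x⟩| ^ p` differs from `‖A x‖_p ^ p` by at most
`δ * ‖A x‖_p ^ p`. -/
def WeightedRows.Approximates {n d : ℕ} (B : WeightedRows d) (A : Matrix (Fin n) (Fin d) ℤ)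
    (p : ℕ) (δ : ℝ) : Prop :=
  ∀ x : Fin d → ℝ,
    |∑ i, B.weight i * |∑ j, (B.row i j : ℝ) * x j| ^ p - ∑ i, |∑ j, (A i j : ℝ) * x j| ^ p|
      ≤ δ * ∑ i, |∑ j, (A i j : ℝ) * x j| ^ p

namespace StreamRAM

/-- At the start `M[0] = n` and `M[1] = N`, all other cells are `0`; the stream consists of the rows
of `A` in order, each row entry by entry. -/
def start {n d : ℕ} (N : ℕ) (A : Matrix (Fin n) (Fin d) ℤ) (ω : ℕ → Bool) : State where
  mem a := if a = 0 then n else if a = 1 then N else 0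
  input := (List.ofFn fun i => List.ofFn (A i)).flatten
  coins := ω

/-- The memory holds the weighted rows `B`: `M[0]` is their number `m`, `M[1]` is the address of the
first of `m` consecutive records of `d + 2` cells, and a record consists of the `d` entries of a row,
followed by the numerator and the positive denominator of its weight. -/
def State.Holds {d : ℕ} (S : ℕ) (s : State) (B : WeightedRows d) : Prop :=
  s.mem 0 = B.m ∧
  ∃ b : ℕ, s.mem 1 = b ∧ b + B.m * (d + 2) ≤ S ∧
    ∀ i : Fin B.m,
      (∀ j : Fin d, s.mem (b + i * (d + 2) + j) = B.row i j) ∧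
      0 < s.mem (b + i * (d + 2) + (d + 1)) ∧
      B.weight i = (s.mem (b + i * (d + 2) + d) : ℝ) / (s.mem (b + i * (d + 2) + (d + 1)) : ℝ)

/-- With `S` words of memory of `w` bits each, parameters `n` and `N`, the rows of `A` as a one-pass
stream and the coin flips `ω`, the program `P` halts without fault and returns `B`. -/
def Returns {n d : ℕ} (P : Prog) (S w N : ℕ) (A : Matrix (Fin n) (Fin d) ℤ) (ω : ℕ → Bool)
    (B : WeightedRows d) : Prop :=
  2 ≤ S ∧ ∃ t : State, Exec S w P (start N A ω) t ∧ t.Holds S B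

/-- Words of `κ * log₂ ((n + 1) / ε)` bits (logarithm rounded up). -/
noncomputable def wordLength (κ n : ℕ) (ε : ℝ) : ℕ :=
  κ * Nat.clog 2 ⌈((n : ℝ) + 1) / ε⌉₊

end StreamRAM

/-! ### Basic solutions of moment problems -/

/-! The algorithm flips no coin: its output approximates on every input, so the probability bound is
trivial. Running time is not limited, only memory. It therefore suffices that small coresets exist
and that a program with little memory can recognise one.

Existence is `exists_coreset`. Auerbach's lemma, applied to the `L_p` norm on the range of the
weighted matrix, gives coordinates in which each row can be divided by its largest coordinate. The
rows then split into `d` charts, each a set of points of total mass at most one in the part of the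
unit cube where a fixed coordinate is one, and an absolute error is enough there
(`exists_chart_coreset`). Up to logarithms, `n` such points can be ordered so that every test
hyperplane separates at most `n ^ (1 - 1/(d-1))` consecutive pairs (`exists_low_crossing_path`). The
ordering is cut into at most `n / (2 d ^ p)` pieces of diameter about `n ^ (-1/(d-1))`, each a
single point or of mass `O(1/n)`.

In a piece the weights are replaced by a basic solution of the `d ^ p` equations that preserve the
moments of order `p`. If `y` does not separate the piece, `|⟨u, y⟩| ^ p` agrees on it with a form of
degree `p` in `u` and the sum does not change. If `y` does separate it, the piece lies close to the
hyperplane and the sum changes by at most about `b = n ^ (-1) * n ^ (-p/(d-1))`. The solutions in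
successive pieces are chosen so that these changes cancel like random signs, which an exponential
potential achieves deterministically (`exists_balanced_sparsification`). The error is then about the
square root of the number of crossings times `b`, which is `n ^ (-(d+2p)/(2(d-1)))`. This halves the
support (`exists_halving`). Repeated halving with total error `ε` can go on until `n` is about `ε ^
(-2(d-1)/(d+2p))`.

The stream is handled by merging and reducing. The records are grouped in levels that behave like
the digits of a binary counter, and a new row is merged with all occupied levels below the first
free one. A merged block is reduced by trying all vectors of integer weights over a common
denominator `K`, those with small support first. A candidate is accepted if it approximates at all
integer points of a box of polynomial size. By `le_two_mul_of_integer_test` this implies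
approximation at all real points, because the rows are integral and nonzero integer determinants are
at least one. The accuracy at level `l` is proportional to `1/((l+1)(l+2))`, so the errors of all
levels have a bounded sum.

The program is written in a small language with variables and a heap (`Cm`), its total correctness
is shown with the rules for `Wp`, and `HEx.exec_comp` transfers the run to the word RAM. -/

/-- A nonnegative weight function can be replaced by one with at most `card κ` nonzero values in `G`,
with the same `κ`-moments and no larger value of a given linear functional. -/
theorem exists_basic_solution {ι κ : Type} [Fintype κ] [DecidableEq ι] (G : Finset ι)
    (φ : ι → κ → ℝ) (k₀ : κ) (hφ : ∀ i ∈ G, φ i k₀ = 1) (l : ι → ℝ) (w : ι → ℝ)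
    (hw : ∀ i, 0 ≤ w i) :
    ∃ w' : ι → ℝ, (∀ i, 0 ≤ w' i) ∧ (∀ i, i ∉ G → w' i = w i) ∧ (∀ i, w i = 0 → w' i = 0) ∧
      (G.filter fun i => w' i ≠ 0).card ≤ Fintype.card κ ∧
      (∀ k, ∑ i ∈ G, w' i * φ i k = ∑ i ∈ G, w i * φ i k) ∧
      ∑ i ∈ G, w' i * l i ≤ ∑ i ∈ G, w i * l i := by
  induction hn : (G.filter fun i => w i ≠ 0).card using Nat.strong_induction_on generalizing w with
  | _ n ih =>
  by_cases hle : n ≤ Fintype.card κ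
  · exact ⟨w, hw, fun _ _ => rfl, fun _ h => h, hn ▸ hle, fun _ => rfl, le_rfl⟩
  set s := G.filter fun i => w i ≠ 0 with hs
  have hsG : s ⊆ G := Finset.filter_subset _ _
  -- More than `card κ` vectors in `κ → ℝ` are dependent, and moving the weights along a dependency
  -- changes no moment. The sign of the dependency is free, so the functional can be kept from
  -- growing.
  have hdep : ¬ LinearIndepOn ℝ φ (s : Set ι) := by
    intro h
    have h1 := LinearIndependent.fintype_card_le_finrank h
    simp only [Module.finrank_fintype_fun_eq_card] at h1
    simp at h1
    omega
  rw [not_linearIndepOn_finset_iff] at hdep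
  obtain ⟨z₀, hz₀, hne₀⟩ := hdep
  obtain ⟨z, hz, hne, hzl⟩ : ∃ z : ι → ℝ, ∑ i ∈ s, z i • φ i = 0 ∧ (∃ i ∈ s, z i ≠ 0) ∧
      ∑ i ∈ s, z i * l i ≤ 0 := by
    rcases le_total (∑ i ∈ s, z₀ i * l i) 0 with h | h
    · exact ⟨z₀, hz₀, hne₀, h⟩
    · refine ⟨-z₀, ?_, ?_, ?_⟩
      · simp [Finset.sum_neg_distrib, hz₀]
      · simpa using hne₀
      · simpa [Finset.sum_neg_distrib] using h
  have hzk : ∀ k, ∑ i ∈ s, z i * φ i k = 0 := by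
    intro k
    have := congrFun hz k
    simpa [Finset.sum_apply] using this
  -- Because the moment `k₀` is constantly one, `z` sums to zero. It is not zero, so it has a
  -- negative value, and moving along it must exhaust some weight.
  have hz1 : ∑ i ∈ s, z i = 0 := by
    rw [← hzk k₀]
    exact Finset.sum_congr rfl fun i hi => by rw [hφ i (hsG hi), mul_one]
  have hneg : (s.filter fun i => z i < 0).Nonempty := by
    by_contra hcon
    rw [Finset.not_nonempty_iff_eq_empty, Finset.filter_eq_empty_iff] at hcon
    have h0 := (Finset.sum_eq_zero_iff_of_nonneg fun i hi => not_lt.1 (hcon hi)).1 hz1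
    obtain ⟨i, hi, hzi⟩ := hne
    exact hzi (h0 i hi)
  -- `τ` is the largest step that keeps all weights nonnegative; it annihilates the weight at `i₀`,
  -- so the support shrinks.
  obtain ⟨i₀, hi₀, hmin⟩ := Finset.exists_min_image _ (fun i => w i / (-z i)) hneg
  rw [Finset.mem_filter] at hi₀
  set τ := w i₀ / (-z i₀) with hτ
  have hτ0 : 0 ≤ τ := div_nonneg (hw _) (by linarith [hi₀.2])
  set w₁ : ι → ℝ := fun i => if i ∈ s then w i + τ * z i else w i with hw₁
  have hw₁0 : ∀ i, 0 ≤ w₁ i := by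
    intro i
    simp only [hw₁]
    split_ifs with hi
    · rcases lt_or_ge (z i) 0 with h | h
      · have h2 := hmin i (Finset.mem_filter.2 ⟨hi, h⟩)
        rw [le_div_iff₀ (by linarith)] at h2
        linarith
      · have := mul_nonneg hτ0 h
        linarith [hw i]
    · exact hw i
  have hzero : ∀ i, w i = 0 → w₁ i = 0 := by
    intro i hi
    have : i ∉ s := by simp [hs, hi]
    simp [hw₁, this, hi]
  have hi₀0 : w₁ i₀ = 0 := by
    have : z i₀ ≠ 0 := ne_of_lt hi₀.2
    simp only [hw₁, if_pos hi₀.1, hτ]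
    field_simp
    ring
  have hlt : (G.filter fun i => w₁ i ≠ 0).card < n := by
    rw [← hn]
    refine Finset.card_lt_card ⟨?_, ?_⟩
    · intro i hi
      rw [Finset.mem_filter] at hi
      rw [hs, Finset.mem_filter]
      exact ⟨hi.1, fun h => hi.2 (hzero i h)⟩
    · intro h
      have := h hi₀.1
      rw [Finset.mem_filter] at this
      exact this.2 hi₀0
  have key : ∀ f : ι → ℝ, ∑ i ∈ G, w₁ i * f i = ∑ i ∈ G, w i * f i + τ * ∑ i ∈ s, z i * f i := by
    intro f
    have h1 : ∑ i ∈ s, z i * f i = ∑ i ∈ G, if i ∈ s then z i * f i else 0 := by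
      rw [← Finset.sum_filter, Finset.filter_mem_eq_inter, Finset.inter_eq_right.2 hsG]
    rw [h1, Finset.mul_sum, ← Finset.sum_add_distrib]
    refine Finset.sum_congr rfl fun i _ => ?_
    simp only [hw₁]
    split_ifs <;> ring
  obtain ⟨w', h1, h2, h3, h4, h5, h6⟩ := ih _ hlt w₁ hw₁0 rfl
  refine ⟨w', h1, fun i hi => ?_, fun i hi => h3 i (hzero i hi), h4, fun k => ?_, ?_⟩
  · rw [h2 i hi]
    have : i ∉ s := fun h => hi (hsG h)
    simp [hw₁, this]
  · rw [h5, key, hzk, mul_zero, add_zero]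
  · refine h6.trans ?_
    rw [key]
    have := mul_nonpos_of_nonneg_of_nonpos hτ0 hzl
    linarith

/-! ### Short edges -/

/-- A greedy choice of `r` elements of `X` hits all but a fraction `(1 - t) ^ r` of `P`. -/
theorem exists_greedy_hitting {β X : Type} [Fintype X] [DecidableEq X] (P : Finset β)
    (sep : β → X → Prop) [∀ b x, Decidable (sep b x)] (ω : X → ℝ) (hω : ∀ x, 0 ≤ ω x) (t : ℝ) (ht : t ≤ 1)
    (hΩ : 0 < ∑ x, ω x)
    (h : ∀ b ∈ P, t * ∑ x, ω x ≤ ∑ x, if sep b x then ω x else 0) (r : ℕ) :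
    ∃ S : Finset X, S.card ≤ r ∧
      ((P.filter fun b => ∀ x ∈ S, ¬ sep b x).card : ℝ) ≤ (1 - t) ^ r * P.card := by
  induction r with
  | zero => exact ⟨∅, by simp, by simp⟩
  | succ r ih =>
    obtain ⟨S, hS, hc⟩ := ih
    set R := P.filter fun b => ∀ x ∈ S, ¬ sep b x with hR
    -- Double counting: on average with respect to `ω`, an `x` hits at least the fraction `t` of the
    -- elements not hit so far, so some `x` does.
    have hsum : ∑ x, ω x * (t * R.card) ≤ ∑ x, ω x * ((R.filter fun b => sep b x).card : ℝ) := by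
      calc ∑ x, ω x * (t * R.card) = ∑ b ∈ R, t * ∑ x, ω x := by
            rw [← Finset.sum_mul, Finset.sum_const, nsmul_eq_mul]; ring
        _ ≤ ∑ b ∈ R, ∑ x, if sep b x then ω x else 0 :=
            Finset.sum_le_sum fun b hb => h b (Finset.mem_filter.1 hb).1
        _ = ∑ x, ∑ b ∈ R, if sep b x then ω x else 0 := Finset.sum_comm
        _ = _ := by
            refine Finset.sum_congr rfl fun x _ => ?_
            rw [← Finset.sum_filter, Finset.sum_const, nsmul_eq_mul, mul_comm]
    obtain ⟨x, hx⟩ : ∃ x, t * R.card ≤ ((R.filter fun b => sep b x).card : ℝ) := by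
      by_contra hcon
      push Not at hcon
      refine absurd hsum (not_le.2 ?_)
      obtain ⟨x, hx⟩ : ∃ x, 0 < ω x := by
        by_contra hc
        push Not at hc
        exact absurd hΩ (not_lt.2 (Finset.sum_nonpos fun x _ => hc x))
      exact Finset.sum_lt_sum (fun y _ => mul_le_mul_of_nonneg_left (hcon y).le (hω y))
        ⟨x, Finset.mem_univ _, mul_lt_mul_of_pos_left (hcon x) hx⟩
    refine ⟨insert x S, (Finset.card_insert_le _ _).trans (by omega), ?_⟩
    have hset : (P.filter fun b => ∀ y ∈ insert x S, ¬ sep b y) = R.filter fun b => ¬ sep b x := by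
      ext b
      simp only [hR, Finset.mem_filter, Finset.mem_insert, forall_eq_or_imp]
      tauto
    have hcard : ((R.filter fun b => sep b x).card : ℝ) + ((R.filter fun b => ¬ sep b x).card : ℝ)
        = R.card := by
      exact_mod_cast Finset.card_filter_add_card_filter_not (s := R) (fun b => sep b x)
    rw [hset, pow_succ]
    nlinarith [sub_nonneg.2 ht]

theorem sum_range_choose_le_pow (r D : ℕ) : ∑ k ∈ Finset.range (D + 1), r.choose k ≤ (r + 1) ^ D := by
  induction D with
  | zero => simp
  | succ D ih =>
    rw [Finset.sum_range_succ, pow_succ]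
    have h1 : r.choose (D + 1) ≤ r ^ (D + 1) := Nat.choose_le_pow r (D + 1)
    have h2 : r ^ D ≤ (r + 1) ^ D := Nat.pow_le_pow_left (by omega) D
    rw [pow_succ] at h1
    nlinarith

/-- The number of sign patterns of functionals in `S` on points of the affine hyperplane
`u j₀ = 1` of `ℝ ^ d`. -/
theorem card_signPatterns_le {ι X : Type} [DecidableEq X] {d : ℕ} (j₀ : Fin d) (u : ι → Fin d → ℝ)
    (hu : ∀ i, u i j₀ = 1) (Y : X → Fin d → ℝ) (P : Finset ι) (S : Finset X) :
    (P.image fun i => S.filter fun x => 0 ≤ ∑ j, u i j * Y x j).card ≤ (S.card + 1) ^ (d - 1) := by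
  classical
  set 𝒜 := P.image fun i => S.filter fun x => 0 ≤ ∑ j, u i j * Y x j with h𝒜
  -- Sauer–Shelah. What remains is that a shattered set has at most `d - 1` elements, the dimension
  -- of the hyperplane.
  refine 𝒜.card_le_card_shatterer.trans (le_trans ?_ (sum_range_choose_le_pow S.card (d - 1)))
  have hd : 0 < d := j₀.pos
  have hsub : 𝒜.shatterer ⊆ (Finset.range (d - 1 + 1)).biUnion fun k => S.powersetCard k := by
    intro T hT
    rw [Finset.mem_shatterer] at hT
    have hTS : T ⊆ S := by
      obtain ⟨A, hA, hTA⟩ := hT.exists_superset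
      rw [h𝒜, Finset.mem_image] at hA
      obtain ⟨i, _, rfl⟩ := hA
      exact hTA.trans (Finset.filter_subset _ _)
    rw [Finset.mem_biUnion]
    refine ⟨T.card, ?_, Finset.mem_powersetCard.2 ⟨hTS, rfl⟩⟩
    rw [Finset.mem_range]
    by_contra hcard
    -- Without the coordinate `j₀` the functionals live in dimension `d - 1`. A dependency among
    -- these truncations is a combination of the functionals that is constant on the hyperplane `u
    -- j₀ = 1`.
    have hdep : ¬ LinearIndepOn ℝ (fun x (j : {j : Fin d // j ≠ j₀}) => Y x j) (T : Set X) := by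
      intro h
      have h1 := LinearIndependent.fintype_card_le_finrank h
      simp only [Module.finrank_fintype_fun_eq_card] at h1
      simp at h1
      omega
    rw [not_linearIndepOn_finset_iff] at hdep
    obtain ⟨c₀, hc₀, hne₀⟩ := hdep
    -- the combination is constant on the hyperplane
    have hconst : ∀ c : X → ℝ, ∑ x ∈ T, c x • (fun (j : {j : Fin d // j ≠ j₀}) => Y x j) = 0 →
        ∀ i, ∑ x ∈ T, c x * ∑ j, u i j * Y x j = ∑ x ∈ T, c x * Y x j₀ := by
      intro c hc i
      have h1 : ∀ j, j ≠ j₀ → ∑ x ∈ T, c x * Y x j = 0 := by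
        intro j hj
        have := congrFun hc ⟨j, hj⟩
        simpa [Finset.sum_apply] using this
      calc ∑ x ∈ T, c x * ∑ j, u i j * Y x j = ∑ j, u i j * ∑ x ∈ T, c x * Y x j := by
            simp_rw [Finset.mul_sum]
            rw [Finset.sum_comm]
            refine Finset.sum_congr rfl fun j _ => Finset.sum_congr rfl fun x _ => by ring
        _ = u i j₀ * ∑ x ∈ T, c x * Y x j₀ := by
            refine Finset.sum_eq_single j₀ (fun j _ hj => by rw [h1 j hj, mul_zero]) (by simp)
        _ = _ := by rw [hu, one_mul]
    -- The sign is normalised so that this constant is positive, or zero with a positive coefficient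
    -- present. Shattering provides a point at which each functional has the sign opposite to its
    -- coefficient. There the combination is at most zero, and negative if some coefficient is
    -- positive, which is a contradiction in both cases.
    obtain ⟨c, hc, hne, hpos⟩ : ∃ c : X → ℝ,
        ∑ x ∈ T, c x • (fun (j : {j : Fin d // j ≠ j₀}) => Y x j) = 0 ∧ (∃ x ∈ T, c x ≠ 0) ∧
        (0 < ∑ x ∈ T, c x * Y x j₀ ∨ (0 = ∑ x ∈ T, c x * Y x j₀ ∧ ∃ x ∈ T, 0 < c x)) := by
      have hnegz : ∑ x ∈ T, (-c₀) x • (fun (j : {j : Fin d // j ≠ j₀}) => Y x j) = 0 := by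
        simp only [Pi.neg_apply, neg_smul, Finset.sum_neg_distrib, hc₀, neg_zero]
      have hnegs : ∑ x ∈ T, (-c₀) x * Y x j₀ = -∑ x ∈ T, c₀ x * Y x j₀ := by
        simp [Finset.sum_neg_distrib]
      have hne₁ : ∃ x ∈ T, (-c₀) x ≠ 0 := by simpa using hne₀
      obtain ⟨x, hx, hcx⟩ := hne₀
      rcases lt_trichotomy (∑ x ∈ T, c₀ x * Y x j₀) 0 with h | h | h
      · exact ⟨-c₀, hnegz, hne₁, Or.inl (by rw [hnegs]; linarith)⟩
      · rcases lt_or_gt_of_ne hcx with h' | h'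
        · exact ⟨-c₀, hnegz, hne₁, Or.inr ⟨by rw [hnegs, h, neg_zero], x, hx, by simpa using h'⟩⟩
        · exact ⟨c₀, hc₀, ⟨x, hx, hcx⟩, Or.inr ⟨h.symm, x, hx, h'⟩⟩
      · exact ⟨c₀, hc₀, ⟨x, hx, hcx⟩, Or.inl h⟩
    obtain ⟨A, hA, hAT⟩ := hT (Finset.filter_subset (fun x => c x < 0) T)
    rw [h𝒜, Finset.mem_image] at hA
    obtain ⟨i, _, rfl⟩ := hA
    have hsign : ∀ x ∈ T, (0 ≤ ∑ j, u i j * Y x j ↔ c x < 0) := by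
      intro x hx
      have := Finset.ext_iff.1 hAT x
      simp only [Finset.mem_inter, Finset.mem_filter, hx, hTS hx, true_and] at this
      exact this
    have hterm : ∀ x ∈ T, c x * ∑ j, u i j * Y x j ≤ 0 := by
      intro x hx
      rcases lt_or_ge (c x) 0 with h | h
      · exact mul_nonpos_of_nonpos_of_nonneg h.le ((hsign x hx).2 h)
      · refine mul_nonpos_of_nonneg_of_nonpos h (le_of_lt (not_le.1 fun h' => ?_))
        exact absurd ((hsign x hx).1 h') (not_lt.2 h)
    have hc1 := hconst c hc i
    rcases hpos with h | ⟨h, x, hx, hcx⟩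
    · have := Finset.sum_nonpos hterm
      linarith
    · have : ∑ x ∈ T, c x * ∑ j, u i j * Y x j < 0 := by
        refine Finset.sum_neg' hterm ⟨x, hx, mul_neg_of_pos_of_neg hcx (not_le.1 fun h' => ?_)⟩
        exact absurd ((hsign x hx).1 h') (not_lt.2 hcx.le)
      linarith
  refine (Finset.card_le_card hsub).trans (Finset.card_biUnion_le.trans ?_)
  simp

/-- The side of the hyperplane `y` on which `u` lies. -/
noncomputable def sideOf {d : ℕ} (y u : Fin d → ℝ) : Bool := decide (0 ≤ ∑ j, u j * y j)

/-- Bound for the fraction of hyperplanes that separate the closest of `m` points. -/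
noncomputable def edgeBound (D m : ℕ) : ℝ := (4 * Real.log m + 4) / (m : ℝ) ^ (1 / (D : ℝ))

theorem exists_short_edge {X : Type} [Fintype X] {d m : ℕ} (hd : 2 ≤ d) (hm : 2 ≤ m) (j₀ : Fin d)
    (u : Fin m → Fin d → ℝ) (hu : ∀ i, u i j₀ = 1) (Y : X → Fin d → ℝ) (ω : X → ℝ)
    (hω : ∀ x, 0 ≤ ω x) (hΩ : 0 < ∑ x, ω x) :
    ∃ i j : Fin m, i ≠ j ∧
      (∑ x, if sideOf (Y x) (u i) ≠ sideOf (Y x) (u j) then ω x else 0)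
        ≤ edgeBound (d - 1) m * ∑ x, ω x := by
  classical
  set D := d - 1 with hD
  have hD1 : 1 ≤ D := by omega
  set t := edgeBound D m with ht
  set Ω := ∑ x, ω x with hΩ'
  -- A packing argument. If every pair is separated by more than the fraction `t` of the weight,
  -- about `2 log m / t` greedily chosen functionals separate all pairs, since `m ^ 2 * (1 - t) ^ r
  -- ≤ 1`. The `m` points then have different sign patterns, so `m ≤ (r + 1) ^ D`, and `t` is chosen
  -- to exclude this.
  by_contra hcon
  push Not at hcon
  have hle : ∀ i j, (∑ x, if sideOf (Y x) (u i) ≠ sideOf (Y x) (u j) then ω x else 0) ≤ Ω := by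
    intro i j
    refine Finset.sum_le_sum fun x _ => ?_
    split_ifs
    exacts [le_rfl, hω x]
  have ht1 : t < 1 := by
    by_contra h
    have h01 : (⟨0, by omega⟩ : Fin m) ≠ ⟨1, by omega⟩ := by simp
    have := hcon _ _ h01
    have h2 := hle ⟨0, by omega⟩ ⟨1, by omega⟩
    nlinarith
  have hm1 : (1 : ℝ) < m := by exact_mod_cast (by omega : 1 < m)
  have hL : 0 < Real.log m := Real.log_pos hm1
  set a := (m : ℝ) ^ (1 / (D : ℝ)) with ha
  have ha0 : 0 < a := Real.rpow_pos_of_pos (by linarith) _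
  have hta : t * a = 4 * Real.log m + 4 := by
    rw [ht, edgeBound, ← ha]; field_simp
  have ht0 : 0 < t := div_pos (by linarith) ha0
  set r := ⌈2 * Real.log m / t⌉₊ with hr
  have hr1 : 2 * Real.log m ≤ t * r := by
    have := Nat.le_ceil (2 * Real.log m / t)
    rw [div_le_iff₀ ht0] at this
    linarith
  have hr2 : (r : ℝ) < 2 * Real.log m / t + 1 := Nat.ceil_lt_add_one (by positivity)
  set P : Finset (Fin m × Fin m) := Finset.univ.offDiag with hP
  obtain ⟨S, hS, hSc⟩ := exists_greedy_hitting P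
    (fun b x => sideOf (Y x) (u b.1) ≠ sideOf (Y x) (u b.2)) ω hω t ht1.le hΩ
    (fun b hb => (hcon b.1 b.2 (Finset.mem_offDiag.1 hb).2.2).le) r
  have hPc : (P.card : ℝ) < (m : ℝ) ^ 2 := by
    have : P.card = m * m - m := by simp [hP, Finset.offDiag_card]
    have h2 : P.card < m ^ 2 := by
      rw [this, pow_two]
      exact Nat.sub_lt (by positivity) (by omega)
    exact_mod_cast h2
  have hexp : (1 - t) ^ r * (m : ℝ) ^ 2 ≤ 1 := by
    have h1 : (1 - t) ^ r ≤ Real.exp (-(t * r)) := by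
      calc (1 - t) ^ r ≤ (Real.exp (-t)) ^ r :=
            pow_le_pow_left₀ (by linarith) (by linarith [Real.add_one_le_exp (-t)]) r
        _ = _ := by rw [← Real.exp_nat_mul]; ring_nf
    have h2 : Real.exp (-(t * r)) ≤ Real.exp (-(2 * Real.log m)) := Real.exp_le_exp.2 (by linarith)
    have h3 : Real.exp (-(2 * Real.log m)) * (m : ℝ) ^ 2 = 1 := by
      have : (m : ℝ) ^ 2 = Real.exp (2 * Real.log m) := by
        rw [two_mul, Real.exp_add, Real.exp_log (by linarith), pow_two]
      rw [this, ← Real.exp_add]; simp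
    have hm2 : 0 ≤ (m : ℝ) ^ 2 := by positivity
    nlinarith
  have hempty : (P.filter fun b => ∀ x ∈ S, ¬ sideOf (Y x) (u b.1) ≠ sideOf (Y x) (u b.2)) = ∅ := by
    rw [← Finset.card_eq_zero]
    have h1 : ((1 : ℝ) - t) ^ r * P.card < 1 := by
      have : 0 < (1 - t) ^ r := pow_pos (by linarith) _
      nlinarith
    have h2 := hSc.trans_lt h1
    exact_mod_cast Nat.lt_one_iff.1 (by exact_mod_cast h2)
  have hinj : Function.Injective fun i => S.filter fun x => 0 ≤ ∑ j, u i j * Y x j := by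
    intro i j hij
    by_contra hne
    have hmem : (i, j) ∈ P := Finset.mem_offDiag.2 ⟨Finset.mem_univ _, Finset.mem_univ _, hne⟩
    have := Finset.filter_eq_empty_iff.1 hempty hmem
    refine this fun x hx h => h ?_
    have h3 := Finset.ext_iff.1 hij x
    simp only [Finset.mem_filter, hx, true_and] at h3
    simp [sideOf, h3]
  have hcard := card_signPatterns_le j₀ u hu Y Finset.univ S
  rw [Finset.card_image_of_injective _ hinj, Finset.card_univ, Fintype.card_fin] at hcard
  have hmr : (m : ℝ) ≤ ((r : ℝ) + 1) ^ D := by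
    have : m ≤ (r + 1) ^ D := hcard.trans (Nat.pow_le_pow_left (by omega) _)
    exact_mod_cast this
  have har : a ≤ r + 1 := by
    have h1 : a ≤ (((r : ℝ) + 1) ^ D) ^ (1 / (D : ℝ)) :=
      Real.rpow_le_rpow (by linarith) hmr (by positivity)
    rwa [one_div, Real.pow_rpow_inv_natCast (by positivity) (by omega)] at h1
  -- This follows from `t < 1`. In particular `a > 4`, so `r + 1 < a / 2 + 2 < a` contradicts `har`.
  have hat : 4 * Real.log m + 4 < a := by nlinarith
  have hfin : 2 * Real.log m / t ≤ a / 2 := by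
    rw [div_le_iff₀ ht0]
    nlinarith
  linarith

/-! ### Orderings with few crossings -/

/-- The number of consecutive pairs of a list on which `s` changes. -/
def crossings {ι : Type} (s : ι → Bool) : List ι → ℕ
  | [] => 0
  | [_] => 0
  | a :: b :: l => (if s a ≠ s b then 1 else 0) + crossings s (b :: l)

/-- Reversing the first path makes the two heads adjacent, so the edge between the heads is the only
new one. -/
theorem crossings_reverseAux {ι : Type} (s : ι → Bool) (a b : ι) (l₁ l₂ : List ι) :
    crossings s ((a :: l₁).reverseAux (b :: l₂)) =
      (if s a ≠ s b then 1 else 0) + (crossings s (a :: l₁) + crossings s (b :: l₂)) := by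
  induction l₁ generalizing a b l₂ with
  | nil => simp [List.reverseAux, crossings]
  | cons c l ih =>
    rw [List.reverseAux, ih]
    simp only [crossings, ne_comm (a := s c)]
    ring

/-- Merging a family of paths into one, always along a short edge between two heads. -/
theorem exists_merged_path {ι X : Type} [Fintype X] [Nonempty X] {d : ℕ} (hd : 2 ≤ d) (j₀ : Fin d)
    (u : ι → Fin d → ℝ) (hu : ∀ i, u i j₀ = 1) (Y : X → Fin d → ℝ) (m : ℕ)
    (F : List (ι × List ι)) (hF : F.length = m + 1) :
    ∃ l : List ι, l.Perm (F.map fun q => q.1 :: q.2).flatten ∧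
      (∑ x, (2 : ℝ) ^ crossings (fun i => sideOf (Y x) (u i)) l) ≤
        (∏ k ∈ Finset.range m, (1 + edgeBound (d - 1) (k + 2))) *
        ∑ x, (2 : ℝ) ^ (F.map fun q => crossings (fun i => sideOf (Y x) (u i)) (q.1 :: q.2)).sum := by
  classical
  induction m generalizing F with
  | zero =>
    obtain ⟨q, rfl⟩ := List.length_eq_one_iff.1 hF
    exact ⟨q.1 :: q.2, by simp, by simp⟩
  | succ m ih =>
    set cr : X → List ι → ℕ := fun x => crossings (fun i => sideOf (Y x) (u i)) with hcr
    set ω : X → ℝ := fun x => (2 : ℝ) ^ (F.map fun q => cr x (q.1 :: q.2)).sum with hω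
    have hΩ : 0 < ∑ x, ω x :=
      Finset.sum_pos (fun x _ => by positivity) Finset.univ_nonempty
    -- Multiplicative weights: a functional crossed `k` times so far has weight `2 ^ k`. The new
    -- edge is short for these weights, and only the functionals crossing it double, so the total
    -- grows by a factor of at most `1 + edgeBound`.
    obtain ⟨i, j, hij, hedge⟩ := exists_short_edge (m := m + 2) hd (by omega) j₀
      (fun i => u (F[i.1]'(by omega)).1) (fun i => hu _) Y ω (fun x => by positivity) hΩ
    have hi : i.1 < F.length := by omega
    have hj : j.1 < F.length := by omega
    have hperm₁ := List.getElem_cons_eraseIdx_perm hi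
    have hmem : F[j.1] ∈ F.eraseIdx i.1 := by
      rw [List.mem_eraseIdx_iff_getElem]
      exact ⟨j.1, hj, fun h => hij (Fin.ext h.symm), rfl⟩
    obtain ⟨F', hF'⟩ : ∃ F', (F.eraseIdx i.1).Perm (F[j.1] :: F') :=
      ⟨_, List.perm_cons_erase hmem⟩
    have hperm : F.Perm (F[i.1] :: F[j.1] :: F') := hperm₁.symm.trans (hF'.cons _)
    obtain ⟨a, l₁, hqi⟩ : ∃ a l₁, F[i.1] = (a, l₁) := ⟨_, _, rfl⟩
    obtain ⟨b, l₂, hqj⟩ : ∃ b l₂, F[j.1] = (b, l₂) := ⟨_, _, rfl⟩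
    rw [hqi, hqj] at hperm
    simp only [hqi, hqj] at hedge
    obtain ⟨c, l₃, hc⟩ : ∃ c l₃, (a :: l₁).reverseAux (b :: l₂) = c :: l₃ := by
      rw [List.reverseAux_eq]
      exact List.exists_cons_of_ne_nil (by simp)
    obtain ⟨l, hl, hsum⟩ := ih ((c, l₃) :: F') (by
      have := hperm.length_eq
      simp only [List.length_cons] at this ⊢
      omega)
    refine ⟨l, hl.trans ?_, hsum.trans ?_⟩
    · have h1 := (hperm.map fun q => q.1 :: q.2).flatten
      refine List.Perm.trans ?_ h1.symm
      simp only [List.map_cons, List.flatten_cons, ← hc, List.reverseAux_eq, List.append_assoc]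
      rw [← List.append_assoc, ← List.append_assoc (a :: l₁)]
      refine List.Perm.append_right _ ?_
      exact (List.reverse_perm _).append_right _
    · rw [Finset.prod_range_succ, mul_assoc]
      have hprod : 0 ≤ ∏ k ∈ Finset.range m, (1 + edgeBound (d - 1) (k + 2)) := by
        refine Finset.prod_nonneg fun k _ => add_nonneg zero_le_one ?_
        refine div_nonneg ?_ (by positivity)
        have : 0 ≤ Real.log ((k + 2 : ℕ) : ℝ) := Real.log_natCast_nonneg _
        linarith
      refine mul_le_mul_of_nonneg_left ?_ hprod
      have hterm : ∀ x, (2 : ℝ) ^ (((c, l₃) :: F').map fun q => cr x (q.1 :: q.2)).sum =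
          ω x + if sideOf (Y x) (u a) ≠ sideOf (Y x) (u b) then ω x else 0 := by
        intro x
        have h1 : (F.map fun q => cr x (q.1 :: q.2)).sum =
            cr x (a :: l₁) + (cr x (b :: l₂) + (F'.map fun q => cr x (q.1 :: q.2)).sum) := by
          rw [(hperm.map _).sum_eq]; simp
        have h2 : cr x (c :: l₃) = (if sideOf (Y x) (u a) ≠ sideOf (Y x) (u b) then 1 else 0) +
            (cr x (a :: l₁) + cr x (b :: l₂)) := by
          rw [← hc]; exact crossings_reverseAux _ _ _ _ _
        simp only [hω, h1, List.map_cons, List.sum_cons, h2]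
        split_ifs
        · rw [show ∀ A B C : ℕ, 1 + (A + B) + C = (A + (B + C)) + 1 from fun A B C => by ring,
            pow_succ]
          ring
        · rw [zero_add, add_zero, add_assoc]
      calc ∑ x, (2 : ℝ) ^ (((c, l₃) :: F').map fun q => cr x (q.1 :: q.2)).sum
          = ∑ x, ω x + ∑ x, if sideOf (Y x) (u a) ≠ sideOf (Y x) (u b) then ω x else 0 := by
            rw [← Finset.sum_add_distrib]
            exact Finset.sum_congr rfl fun x _ => hterm x
        _ ≤ _ := by linarith

/-- Points have an ordering in which every given hyperplane separates few consecutive pairs. -/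
theorem exists_low_crossing_path {ι X : Type} [Fintype X] [Nonempty X] {d : ℕ} (hd : 2 ≤ d)
    (j₀ : Fin d) (u : ι → Fin d → ℝ) (hu : ∀ i, u i j₀ = 1) (Y : X → Fin d → ℝ) (P : Finset ι) :
    ∃ l : List ι, l.Perm P.toList ∧ ∀ x,
      (crossings (fun i => sideOf (Y x) (u i)) l : ℝ) ≤
        2 * (Real.log (Fintype.card X) +
          4 * (1 + Real.log P.card) ^ 2 * (P.card : ℝ) ^ (1 - 1 / ((d - 1 : ℕ) : ℝ))) := by
  set D := d - 1 with hD
  have hD1 : 1 ≤ D := by omega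
  set n := P.card with hn
  have hX1 : (1 : ℝ) ≤ Fintype.card X := by exact_mod_cast Fintype.card_pos
  rcases Nat.eq_zero_or_pos n with h0 | hpos
  · refine ⟨P.toList, List.Perm.refl _, fun x => ?_⟩
    have : P = ∅ := Finset.card_eq_zero.1 h0
    subst this
    simp only [Finset.toList_empty, crossings, Nat.cast_zero]
    have := Real.log_nonneg hX1
    positivity
  -- The process starts from single points, with all weights equal to one. At the end the weight `2
  -- ^ crossings` of one functional is at most the total, and logarithms give the bound.
  obtain ⟨l, hl, hsum⟩ := exists_merged_path hd j₀ u hu Y (n - 1) (P.toList.map fun i => (i, []))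
    (by simp; omega)
  have hflat : ((P.toList.map fun i => (i, ([] : List ι))).map fun q => q.1 :: q.2).flatten
      = P.toList := by
    rw [List.map_map]
    induction P.toList with
    | nil => rfl
    | cons a t ih => simpa using ih
  rw [hflat] at hl
  refine ⟨l, hl, fun x => ?_⟩
  have hz : ∀ x, ((P.toList.map fun i => (i, ([] : List ι))).map
      fun q => crossings (fun i => sideOf (Y x) (u i)) (q.1 :: q.2)).sum = 0 := by
    intro x
    rw [List.map_map]
    refine List.sum_eq_zero fun a ha => ?_
    rw [List.mem_map] at ha
    obtain ⟨i, _, rfl⟩ := ha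
    rfl
  simp only [hz, pow_zero, Finset.sum_const, nsmul_eq_mul, mul_one, Finset.card_univ] at hsum
  have hx : (2 : ℝ) ^ crossings (fun i => sideOf (Y x) (u i)) l ≤
      ∑ x, (2 : ℝ) ^ crossings (fun i => sideOf (Y x) (u i)) l :=
    Finset.single_le_sum (f := fun x => (2 : ℝ) ^ crossings (fun i => sideOf (Y x) (u i)) l)
      (fun _ _ => by positivity) (Finset.mem_univ x)
  have hn1 : (1 : ℝ) ≤ n := by exact_mod_cast hpos
  have hLn : 0 ≤ Real.log n := Real.log_nonneg hn1
  set A := (n : ℝ) ^ (1 - 1 / (D : ℝ)) with hA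
  -- Writing `m ^ (-1/D)` as `m ^ (1 - 1/D) / m` and bounding the numerator by its value at `n`
  -- turns the sum of the edge bounds into a harmonic sum.
  have hedge : ∀ k ∈ Finset.range (n - 1),
      edgeBound D (k + 2) ≤ 4 * (1 + Real.log n) * A * ((k + 2 : ℕ) : ℝ)⁻¹ := by
    intro k hk
    rw [Finset.mem_range] at hk
    have hk2 : (0 : ℝ) < ((k + 2 : ℕ) : ℝ) := by positivity
    have hkn : ((k + 2 : ℕ) : ℝ) ≤ n := by exact_mod_cast (by omega : k + 2 ≤ n)
    have h1 : Real.log ((k + 2 : ℕ) : ℝ) ≤ Real.log n := Real.log_le_log hk2 hkn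
    have h2 : (1 : ℝ) / ((k + 2 : ℕ) : ℝ) ^ (1 / (D : ℝ)) ≤ A * ((k + 2 : ℕ) : ℝ)⁻¹ := by
      have h3 : ((k + 2 : ℕ) : ℝ) ^ (1 - 1 / (D : ℝ)) ≤ A := by
        refine Real.rpow_le_rpow hk2.le hkn ?_
        have : (1 : ℝ) / D ≤ 1 := by
          rw [div_le_one (by positivity)]; exact_mod_cast hD1
        linarith
      have h4 : (1 : ℝ) / ((k + 2 : ℕ) : ℝ) ^ (1 / (D : ℝ)) =
          ((k + 2 : ℕ) : ℝ) ^ (1 - 1 / (D : ℝ)) * ((k + 2 : ℕ) : ℝ)⁻¹ := by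
        rw [Real.rpow_sub hk2, Real.rpow_one]
        field_simp
      rw [h4]
      exact mul_le_mul_of_nonneg_right h3 (by positivity)
    have h5 : 0 ≤ Real.log ((k + 2 : ℕ) : ℝ) := Real.log_natCast_nonneg _
    calc edgeBound D (k + 2) = (4 * Real.log ((k + 2 : ℕ) : ℝ) + 4) *
          (1 / ((k + 2 : ℕ) : ℝ) ^ (1 / (D : ℝ))) := by rw [edgeBound]; ring
      _ ≤ (4 * Real.log n + 4) * (A * ((k + 2 : ℕ) : ℝ)⁻¹) := by
          refine mul_le_mul (by linarith) h2 (by positivity) (by linarith)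
      _ = _ := by ring
  have hharm : ∑ k ∈ Finset.range (n - 1), ((k + 2 : ℕ) : ℝ)⁻¹ ≤ Real.log n := by
    have h1 := harmonic_le_one_add_log n
    have h2 : ((harmonic n : ℚ) : ℝ) = 1 + ∑ k ∈ Finset.range (n - 1), ((k + 2 : ℕ) : ℝ)⁻¹ := by
      rw [harmonic, show n = (n - 1) + 1 by omega, Finset.sum_range_succ']
      push_cast
      rw [add_comm]
      congr 1
      · simp
      · refine Finset.sum_congr (by simp) fun k _ => ?_
        ring_nf
    linarith
  have hprod : ∏ k ∈ Finset.range (n - 1), (1 + edgeBound D (k + 2)) ≤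
      Real.exp (4 * (1 + Real.log n) ^ 2 * A) := by
    have hA0 : 0 ≤ A := by positivity
    calc ∏ k ∈ Finset.range (n - 1), (1 + edgeBound D (k + 2))
        ≤ ∏ k ∈ Finset.range (n - 1), Real.exp (4 * (1 + Real.log n) * A * ((k + 2 : ℕ) : ℝ)⁻¹) := by
          refine Finset.prod_le_prod (fun k _ => ?_) (fun k hk => ?_)
          · have : 0 ≤ edgeBound D (k + 2) := by
              refine div_nonneg ?_ (by positivity)
              have : 0 ≤ Real.log ((k + 2 : ℕ) : ℝ) := Real.log_natCast_nonneg _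
              linarith
            linarith
          · have := hedge k hk
            have h2 := Real.add_one_le_exp (4 * (1 + Real.log n) * A * ((k + 2 : ℕ) : ℝ)⁻¹)
            linarith
      _ = Real.exp (4 * (1 + Real.log n) * A * ∑ k ∈ Finset.range (n - 1), ((k + 2 : ℕ) : ℝ)⁻¹) := by
          rw [← Real.exp_sum, Finset.mul_sum]
      _ ≤ _ := by
          refine Real.exp_le_exp.2 ?_
          have h3 : 0 ≤ 4 * (1 + Real.log n) * A := by positivity
          nlinarith [mul_le_mul_of_nonneg_left hharm h3]
  have hfinal : (2 : ℝ) ^ crossings (fun i => sideOf (Y x) (u i)) l ≤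
      Real.exp (4 * (1 + Real.log n) ^ 2 * A) * Fintype.card X :=
    hx.trans (hsum.trans (mul_le_mul_of_nonneg_right hprod (by linarith)))
  have hlog := Real.log_le_log (by positivity) hfinal
  rw [Real.log_pow, Real.log_mul (by positivity) (by linarith), Real.log_exp] at hlog
  have hl2 : (1 / 2 : ℝ) ≤ Real.log 2 := by linarith [Real.log_two_gt_d9]
  have hcr : (0 : ℝ) ≤ crossings (fun i => sideOf (Y x) (u i)) l := by positivity
  nlinarith

/-! ### Cutting a path into pieces -/

theorem crossings_append_le {ι : Type} (s : ι → Bool) (l₁ l₂ : List ι) :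
    crossings s l₁ + crossings s l₂ ≤ crossings s (l₁ ++ l₂) := by
  induction l₁ with
  | nil => simp [crossings]
  | cons a l ih =>
    cases l with
    | nil =>
      cases l₂ with
      | nil => simp [crossings]
      | cons b l₂ => simp [crossings]
    | cons b l =>
      simp only [List.cons_append, crossings] at ih ⊢
      omega

theorem sum_crossings_le_flatten {ι : Type} (s : ι → Bool) (gs : List (List ι)) :
    (gs.map (crossings s)).sum ≤ crossings s gs.flatten := by
  induction gs with
  | nil => simp [crossings]
  | cons g gs ih =>
    rw [List.map_cons, List.sum_cons, List.flatten_cons]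
    exact (Nat.add_le_add_left ih _).trans (crossings_append_le s _ _)

theorem eq_of_crossings_eq_zero {ι : Type} (s : ι → Bool) (a : ι) (l : List ι)
    (h : crossings s (a :: l) = 0) : ∀ b ∈ a :: l, s b = s a := by
  induction l generalizing a with
  | nil => simp
  | cons c l ih =>
    simp only [crossings, Nat.add_eq_zero_iff] at h
    have hac : s a = s c := by
      by_contra hne
      simp [hne] at h
    intro b hb
    rcases List.mem_cons.1 hb with rfl | hb
    · rfl
    · rw [hac]; exact ih c h.2 b hb

/-- A path is cut into pieces that no hyperplane of `X` crosses and that are light or singletons. -/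
theorem exists_path_pieces {ι X : Type} [Fintype X] (s : X → ι → Bool) (w : ι → ℝ)
    (hw : ∀ i, 0 ≤ w i) (θ : ℝ) (hθ : 0 < θ) (a : ι) (l : List ι) :
    ∃ (t : List ι) (gs : List (List ι)), ((a :: t) :: gs).flatten = a :: l ∧
      (∀ g ∈ (a :: t) :: gs, ∀ x, ∀ b ∈ g, ∀ c ∈ g, s x b = s x c) ∧
      (∀ g ∈ (a :: t) :: gs, (g.map w).sum ≤ θ ∨ ∃ b, g = [b]) ∧
      ((((a :: t) :: gs).length : ℝ) * θ ≤
        (1 + ∑ x, (crossings (s x) (a :: l) : ℝ)) * θ +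
          (2 * ((a :: l).map w).sum - ((a :: t).map w).sum)) := by
  -- The path is built from its end: `a` joins the first piece unless a functional separates it from
  -- `b` or the piece would become too heavy. In the count, minus the weight of the first piece
  -- serves as a credit. A cut made because of weight occurs only when `w a` plus that weight
  -- exceeds `θ`, and it raises the right-hand side by at least this sum.
  induction l generalizing a with
  | nil =>
    refine ⟨[], [], by simp, by simp, by simp, ?_⟩
    simp [crossings]
    linarith [hw a]
  | cons b l ih =>
    obtain ⟨t, gs, hfl, hs, hwt, hlen⟩ := ih b
    have hmono : ∀ x, (crossings (s x) (b :: l) : ℝ) ≤ crossings (s x) (a :: b :: l) := by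
      intro x
      exact_mod_cast (by simp only [crossings]; omega :
        crossings (s x) (b :: l) ≤ crossings (s x) (a :: b :: l))
    have hsum := Finset.sum_le_sum fun x (_ : x ∈ Finset.univ) => hmono x
    by_cases hcut : ∃ x, s x a ≠ s x b
    · refine ⟨[], (b :: t) :: gs, ?_, ?_, ?_, ?_⟩
      · rw [List.flatten_cons, hfl]; rfl
      · intro g hg
        rcases List.mem_cons.1 hg with rfl | hg
        · simp
        · exact hs g hg
      · intro g hg
        rcases List.mem_cons.1 hg with rfl | hg
        · exact Or.inr ⟨a, rfl⟩
        · exact hwt g hg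
      · classical
        obtain ⟨x₀, hx₀⟩ := hcut
        have hsum' : 1 + ∑ x, (crossings (s x) (b :: l) : ℝ) ≤
            ∑ x, (crossings (s x) (a :: b :: l) : ℝ) := by
          have h1 : ∀ x, (crossings (s x) (b :: l) : ℝ) + (if x = x₀ then 1 else 0) ≤
              crossings (s x) (a :: b :: l) := by
            intro x
            split_ifs with h
            · subst h
              simp [crossings, hx₀, add_comm]
            · simpa using hmono x
          have h2 := Finset.sum_le_sum fun x (_ : x ∈ Finset.univ) => h1 x
          rw [Finset.sum_add_distrib, Finset.sum_ite_eq'] at h2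
          simp at h2
          linarith
        have hbt : 0 ≤ ((b :: t).map w).sum := List.sum_nonneg (by simp; grind)
        simp only [List.map_cons, List.sum_cons, List.length_cons, List.map_nil, List.sum_nil] at *
        push_cast at *
        nlinarith [hw a]
    · push Not at hcut
      by_cases hheavy : w a + ((b :: t).map w).sum ≤ θ
      · refine ⟨b :: t, gs, ?_, ?_, ?_, ?_⟩
        · rw [List.flatten_cons, List.cons_append, ← List.flatten_cons, hfl]
        · intro g hg
          rcases List.mem_cons.1 hg with rfl | hg
          · have h1 : ∀ x, ∀ c ∈ a :: b :: t, s x c = s x b := by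
              intro x c hc
              rcases List.mem_cons.1 hc with rfl | hc
              · exact hcut x
              · exact hs _ (List.mem_cons_self ..) x c hc b (List.mem_cons_self ..)
            intro x c hc e he
            rw [h1 x c hc, h1 x e he]
          · exact hs g (List.mem_cons_of_mem _ hg)
        · intro g hg
          rcases List.mem_cons.1 hg with rfl | hg
          · left; simpa using hheavy
          · exact hwt g (List.mem_cons_of_mem _ hg)
        · simp only [List.map_cons, List.sum_cons, List.length_cons] at *
          push_cast at *
          nlinarith [hw a]
      · refine ⟨[], (b :: t) :: gs, ?_, ?_, ?_, ?_⟩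
        · rw [List.flatten_cons, hfl]; rfl
        · intro g hg
          rcases List.mem_cons.1 hg with rfl | hg
          · simp
          · exact hs g hg
        · intro g hg
          rcases List.mem_cons.1 hg with rfl | hg
          · exact Or.inr ⟨a, rfl⟩
          · exact hwt g hg
        · simp only [List.map_cons, List.sum_cons, List.length_cons, List.map_nil,
            List.sum_nil] at *
          push_cast at *
          nlinarith [hw a]

/-! ### Cancellation of errors between groups -/

/-- Sparsification of disjoint groups one after the other: if every change of the weights in a group
that keeps the moments changes the sum of `F y` by at most `b`, and not at all unless `y` crosses the
group, then the changes can be made to cancel. -/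
theorem exists_balanced_sparsification {ι κ Y : Type} [Fintype ι] [Fintype κ] [Fintype Y]
    [DecidableEq ι] [Nonempty Y] (φ : ι → κ → ℝ) (k₀ : κ) (hφ : ∀ i, φ i k₀ = 1)
    (F : Y → ι → ℝ) (w : ι → ℝ) (hw : ∀ i, 0 ≤ w i)
    (cr : Y → Finset ι → Prop) [∀ y g, Decidable (cr y g)] (b lam : ℝ) (hlam : 0 < lam)
    (hlb : lam * b ≤ 1) (gs : List (Finset ι)) (hdisj : gs.Pairwise Disjoint)
    (hgs : ∀ g ∈ gs, ∀ w' : ι → ℝ, (∀ i, 0 ≤ w' i) →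
      (∀ k, ∑ i ∈ g, w' i * φ i k = ∑ i ∈ g, w i * φ i k) → ∀ y,
      |∑ i ∈ g, w' i * F y i - ∑ i ∈ g, w i * F y i| ≤ if cr y g then b else 0) :
    ∃ w' : ι → ℝ, (∀ i, 0 ≤ w' i) ∧ (∀ i, w i = 0 → w' i = 0) ∧
      (∀ i, (∀ g ∈ gs, i ∉ g) → w' i = w i) ∧
      (∀ g ∈ gs, (g.filter fun i => w' i ≠ 0).card ≤ Fintype.card κ) ∧
      (∀ g ∈ gs, ∀ k, ∑ i ∈ g, w' i * φ i k = ∑ i ∈ g, w i * φ i k) ∧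
      ∑ y, (Real.exp (lam * ∑ i, (w' i - w i) * F y i) +
          Real.exp (-(lam * ∑ i, (w' i - w i) * F y i))) *
        Real.exp (-(lam ^ 2 * b ^ 2 * (gs.countP fun g => decide (cr y g)))) ≤
        2 * Fintype.card Y := by
  induction gs with
  | nil => exact ⟨w, hw, fun _ h => h, fun _ _ => rfl, by simp, by simp, by simp; ring_nf; rfl⟩
  | cons g gs ih =>
    rw [List.pairwise_cons] at hdisj
    obtain ⟨w₁, h0, hz, hout, hcard, hmom, hpot⟩ := ih hdisj.2
      fun g' hg' => hgs g' (List.mem_cons_of_mem _ hg')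
    have hw₁g : ∀ i ∈ g, w₁ i = w i := fun i hi =>
      hout i fun g' hg' hi' => Finset.disjoint_left.1 (hdisj.1 g' hg') hi hi'
    set S : Y → ℝ := fun y => ∑ i, (w₁ i - w i) * F y i with hS
    set e : Y → ℝ := fun y => Real.exp (-(lam ^ 2 * b ^ 2 * (if cr y g then 1 else 0))) with he
    set c : Y → ℝ := fun y =>
      Real.exp (-(lam ^ 2 * b ^ 2 * (gs.countP fun g => decide (cr y g)))) with hc
    -- The functional kept from growing is the derivative of the potential, up to the factor `lam`.
    -- Hence the first-order effect of this group is not positive, and the second-order effect, at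
    -- most `lam ^ 2 * b ^ 2` for the `y` that cross the group, is absorbed by the discount `e y`.
    obtain ⟨w₂, k0, kout, kz, kcard, kmom, kobj⟩ := exists_basic_solution g φ k₀ (fun i _ => hφ i)
      (fun i => ∑ y, e y * c y * (Real.exp (lam * S y) - Real.exp (-(lam * S y))) * F y i) w₁ h0
    have kmom' : ∀ k, ∑ i ∈ g, w₂ i * φ i k = ∑ i ∈ g, w i * φ i k := by
      intro k
      rw [kmom]
      exact Finset.sum_congr rfl fun i hi => by rw [hw₁g i hi]
    set T : Y → ℝ := fun y => ∑ i ∈ g, w₂ i * F y i - ∑ i ∈ g, w i * F y i with hT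
    have hTb : ∀ y, |T y| ≤ if cr y g then b else 0 := hgs g (List.mem_cons_self ..) w₂ k0 kmom'
    have hobj : ∑ y, e y * c y * (Real.exp (lam * S y) - Real.exp (-(lam * S y))) * T y ≤ 0 := by
      have h1 : ∀ v : ι → ℝ, ∑ i ∈ g, v i *
          ∑ y, e y * c y * (Real.exp (lam * S y) - Real.exp (-(lam * S y))) * F y i =
          ∑ y, e y * c y * (Real.exp (lam * S y) - Real.exp (-(lam * S y))) *
            ∑ i ∈ g, v i * F y i := by
        intro v
        simp_rw [Finset.mul_sum]
        rw [Finset.sum_comm]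
        exact Finset.sum_congr rfl fun y _ => Finset.sum_congr rfl fun i _ => by ring
      rw [h1, h1] at kobj
      have h2 : ∀ y, ∑ i ∈ g, w₁ i * F y i = ∑ i ∈ g, w i * F y i := fun y =>
        Finset.sum_congr rfl fun i hi => by rw [hw₁g i hi]
      simp_rw [h2] at kobj
      simp only [hT, mul_sub, Finset.sum_sub_distrib]
      simp only [mul_sub] at kobj
      linarith
    have hST : ∀ y, ∑ i, (w₂ i - w i) * F y i = S y + T y := by
      intro y
      have h1 : T y = ∑ i, (w₂ i - w₁ i) * F y i := by
        rw [← Finset.sum_subset (Finset.subset_univ g) (fun i _ hi => by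
          rw [kout i hi, sub_self, zero_mul])]
        rw [hT]
        simp only
        rw [← Finset.sum_sub_distrib]
        exact Finset.sum_congr rfl fun i hi => by rw [hw₁g i hi]; ring
      rw [h1, hS, ← Finset.sum_add_distrib]
      exact Finset.sum_congr rfl fun i _ => by ring
    refine ⟨w₂, k0, fun i hi => kz i (hz i hi), ?_, ?_, ?_, ?_⟩
    · intro i hi
      rw [kout i (hi g (List.mem_cons_self ..)),
        hout i fun g' hg' => hi g' (List.mem_cons_of_mem _ hg')]
    · intro g' hg'
      rcases List.mem_cons.1 hg' with rfl | hg'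
      · exact kcard
      · refine le_trans (le_of_eq ?_) (hcard g' hg')
        congr 1
        refine Finset.filter_congr fun i hi => ?_
        rw [kout i fun hi' => Finset.disjoint_left.1 (hdisj.1 g' hg') hi' hi]
    · intro g' hg' k
      rcases List.mem_cons.1 hg' with rfl | hg'
      · exact kmom' k
      · rw [← hmom g' hg' k]
        refine Finset.sum_congr rfl fun i hi => ?_
        rw [kout i fun hi' => Finset.disjoint_left.1 (hdisj.1 g' hg') hi' hi]
    · refine le_trans ?_ hpot
      have hterm : ∀ y, (Real.exp (lam * ∑ i, (w₂ i - w i) * F y i) +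
          Real.exp (-(lam * ∑ i, (w₂ i - w i) * F y i))) *
          Real.exp (-(lam ^ 2 * b ^ 2 * ((g :: gs).countP fun g => decide (cr y g)))) ≤
          (Real.exp (lam * S y) + Real.exp (-(lam * S y))) * c y +
          lam * (e y * c y * (Real.exp (lam * S y) - Real.exp (-(lam * S y))) * T y) := by
        intro y
        have h1 : Real.exp (-(lam ^ 2 * b ^ 2 * ((g :: gs).countP fun g => decide (cr y g)))) =
            e y * c y := by
          rw [he, hc, ← Real.exp_add, List.countP_cons]
          congr 1
          by_cases h : cr y g <;> simp [h]; ring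
        rw [h1, hST]
        have hA := Real.exp_pos (lam * S y)
        have hB := Real.exp_pos (-(lam * S y))
        have hcy : 0 < c y := Real.exp_pos _
        have hey : 0 < e y := Real.exp_pos _
        set β : ℝ := lam ^ 2 * b ^ 2 * (if cr y g then 1 else 0) with hβ
        have habs : |lam * T y| ≤ 1 := by
          rw [abs_mul, abs_of_pos hlam]
          refine le_trans (mul_le_mul_of_nonneg_left (hTb y) hlam.le) ?_
          split_ifs <;> linarith
        have hsq : (lam * T y) ^ 2 ≤ β := by
          have h3 := hTb y
          rw [mul_pow, hβ, mul_assoc]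
          refine mul_le_mul_of_nonneg_left ?_ (by positivity)
          rw [← sq_abs]
          split_ifs at h3 ⊢ with h
          · rw [mul_one]; exact pow_le_pow_left₀ (abs_nonneg _) h3 2
          · have : |T y| = 0 := le_antisymm h3 (abs_nonneg _)
            rw [this]; simp
        have heβ : e y * (1 + β) ≤ 1 := by
          have h4 : 1 + β ≤ Real.exp β := by linarith [Real.add_one_le_exp β]
          calc e y * (1 + β) ≤ e y * Real.exp β := mul_le_mul_of_nonneg_left h4 hey.le
            _ = 1 := by rw [he]; simp only; rw [← Real.exp_add]; simp [hβ]
        -- This is `exp x ≤ 1 + x + x ^ 2` for `|x| ≤ 1`; the assumption `lam * b ≤ 1` puts the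
        -- exponent in this range.
        have hx1 : Real.exp (lam * T y) ≤ 1 + lam * T y + β := by
          have := (abs_le.1 (Real.abs_exp_sub_one_sub_id_le habs)).2
          linarith
        have hx2 : Real.exp (-(lam * T y)) ≤ 1 - lam * T y + β := by
          have := (abs_le.1 (Real.abs_exp_sub_one_sub_id_le (x := -(lam * T y)) (by rwa [abs_neg]))).2
          have h5 : (-(lam * T y)) ^ 2 = (lam * T y) ^ 2 := by ring
          linarith
        rw [mul_add, neg_add, Real.exp_add, Real.exp_add]
        have h6 : Real.exp (lam * S y) * Real.exp (lam * T y) ≤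
            Real.exp (lam * S y) * (1 + lam * T y + β) := mul_le_mul_of_nonneg_left hx1 hA.le
        have h7 : Real.exp (-(lam * S y)) * Real.exp (-(lam * T y)) ≤
            Real.exp (-(lam * S y)) * (1 - lam * T y + β) := mul_le_mul_of_nonneg_left hx2 hB.le
        calc _ ≤ (Real.exp (lam * S y) * (1 + lam * T y + β) +
              Real.exp (-(lam * S y)) * (1 - lam * T y + β)) * (e y * c y) :=
              mul_le_mul_of_nonneg_right (add_le_add h6 h7) (by positivity)
          _ = (e y * (1 + β)) * ((Real.exp (lam * S y) + Real.exp (-(lam * S y))) * c y) +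
              lam * (e y * c y * (Real.exp (lam * S y) - Real.exp (-(lam * S y))) * T y) := by ring
          _ ≤ _ := by
              have h8 : 0 ≤ (Real.exp (lam * S y) + Real.exp (-(lam * S y))) * c y := by positivity
              nlinarith
      refine (Finset.sum_le_sum fun y _ => hterm y).trans ?_
      rw [Finset.sum_add_distrib, ← Finset.mul_sum]
      have := mul_nonpos_of_nonneg_of_nonpos hlam.le hobj
      linarith

/-! ### Moments and sides of a hyperplane -/

/-- The moments of order `p` of a vector. -/
def momentVec {d : ℕ} (p : ℕ) (u : Fin d → ℝ) (f : Fin p → Fin d) : ℝ := ∏ k, u (f k)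

theorem inner_pow_eq_moments {d : ℕ} (p : ℕ) (u y : Fin d → ℝ) :
    (∑ j, u j * y j) ^ p = ∑ f : Fin p → Fin d, momentVec p u f * momentVec p y f := by
  rw [Fintype.sum_pow]
  exact Finset.sum_congr rfl fun f _ => by rw [momentVec, momentVec, Finset.prod_mul_distrib]

/-- On one side of a hyperplane the moments determine the sum of `|⟨u, y⟩| ^ p`. -/
theorem sum_abs_inner_pow_eq_of_moments {ι : Type} {d : ℕ} (p : ℕ) (u : ι → Fin d → ℝ)
    (y : Fin d → ℝ) (g : Finset ι) (w w' : ι → ℝ)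
    (hmom : ∀ f, ∑ i ∈ g, w' i * momentVec p (u i) f = ∑ i ∈ g, w i * momentVec p (u i) f)
    (hside : ∀ a ∈ g, ∀ b ∈ g, sideOf y (u a) = sideOf y (u b)) :
    ∑ i ∈ g, w' i * |∑ j, u i j * y j| ^ p = ∑ i ∈ g, w i * |∑ j, u i j * y j| ^ p := by
  have hpoly : ∀ v : ι → ℝ, ∑ i ∈ g, v i * (∑ j, u i j * y j) ^ p =
      ∑ f, momentVec p y f * ∑ i ∈ g, v i * momentVec p (u i) f := by
    intro v
    simp_rw [inner_pow_eq_moments, Finset.mul_sum]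
    rw [Finset.sum_comm]
    exact Finset.sum_congr rfl fun f _ => Finset.sum_congr rfl fun i _ => by ring
  have heq : ∑ i ∈ g, w' i * (∑ j, u i j * y j) ^ p = ∑ i ∈ g, w i * (∑ j, u i j * y j) ^ p := by
    rw [hpoly, hpoly]
    exact Finset.sum_congr rfl fun f _ => by rw [hmom]
  -- Where the sign of `t = ⟨u, y⟩` is constant, `|t| ^ p` is `t ^ p` or `(-1) ^ p * t ^ p`, a form
  -- in `u` to which the moment equations apply.
  by_cases hpos : ∀ i ∈ g, 0 ≤ ∑ j, u i j * y j
  · have h1 : ∀ v : ι → ℝ, ∑ i ∈ g, v i * |∑ j, u i j * y j| ^ p =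
        ∑ i ∈ g, v i * (∑ j, u i j * y j) ^ p := fun v =>
      Finset.sum_congr rfl fun i hi => by rw [abs_of_nonneg (hpos i hi)]
    rw [h1, h1, heq]
  · push Not at hpos
    obtain ⟨a, ha, han⟩ := hpos
    have hneg : ∀ i ∈ g, ∑ j, u i j * y j < 0 := by
      intro i hi
      have := hside a ha i hi
      simp only [sideOf, decide_eq_decide] at this
      exact not_le.1 fun h => absurd (this.2 h) (not_le.2 han)
    have h1 : ∀ v : ι → ℝ, ∑ i ∈ g, v i * |∑ j, u i j * y j| ^ p =
        (-1) ^ p * ∑ i ∈ g, v i * (∑ j, u i j * y j) ^ p := by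
      intro v
      rw [Finset.mul_sum]
      refine Finset.sum_congr rfl fun i hi => ?_
      rw [abs_of_neg (hneg i hi), neg_pow]
      ring
    rw [h1, h1, heq]

/-- If `y` separates two points of a set of diameter `δ`, then the whole set is close to it. -/
theorem abs_inner_le_of_separated {ι : Type} {d : ℕ} (u : ι → Fin d → ℝ) (y : Fin d → ℝ)
    (hy : ∀ j, |y j| ≤ 1) (g : Finset ι) (δ : ℝ)
    (hdiam : ∀ a ∈ g, ∀ b ∈ g, ∀ j, |u a j - u b j| ≤ δ)
    (hside : ¬ ∀ a ∈ g, ∀ b ∈ g, sideOf y (u a) = sideOf y (u b)) :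
    ∀ i ∈ g, |∑ j, u i j * y j| ≤ d * δ := by
  have hdiff : ∀ a ∈ g, ∀ b ∈ g, ∑ j, u a j * y j - ∑ j, u b j * y j ≤ d * δ := by
    intro a ha b hb
    rw [← Finset.sum_sub_distrib]
    calc ∑ j, (u a j * y j - u b j * y j) ≤ ∑ _j : Fin d, δ := by
          refine Finset.sum_le_sum fun j _ => ?_
          rw [← sub_mul]
          refine (le_abs_self _).trans ?_
          rw [abs_mul]
          have h1 := hdiam a ha b hb j
          have h2 := hy j
          nlinarith [abs_nonneg (u a j - u b j), abs_nonneg (y j)]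
      _ = d * δ := by simp
  push Not at hside
  obtain ⟨a, ha, b, hb, hab⟩ := hside
  have key : ∃ a ∈ g, ∃ b ∈ g, 0 ≤ ∑ j, u a j * y j ∧ ∑ j, u b j * y j < 0 := by
    by_cases h1 : 0 ≤ ∑ j, u a j * y j <;> by_cases h2 : 0 ≤ ∑ j, u b j * y j
    · simp [sideOf, h1, h2] at hab
    · exact ⟨a, ha, b, hb, h1, not_le.1 h2⟩
    · exact ⟨b, hb, a, ha, h2, not_le.1 h1⟩
    · simp [sideOf, h1, h2] at hab
  obtain ⟨a, ha, b, hb, h1, h2⟩ := key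
  intro i hi
  rw [abs_le]
  constructor
  · have := hdiff a ha i hi
    linarith
  · have := hdiff i hi b hb
    linarith

/-! ### A grid of hyperplanes that controls diameters -/

/-- The functional `u ↦ u j - c` on the hyperplane `u j₀ = 1`. -/
noncomputable def gridFunctional {d : ℕ} (j₀ : Fin d) (g : ℕ) (q : Fin d × Fin g) : Fin d → ℝ := fun k =>
  (if k = q.1 then 1 else 0) - (if k = j₀ then (-1 + 2 * ((q.2 : ℝ) + 1) / g) else 0)

theorem sum_mul_gridFunctional {d : ℕ} (j₀ : Fin d) (g : ℕ) (q : Fin d × Fin g) (u : Fin d → ℝ)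
    (hu : u j₀ = 1) :
    ∑ j, u j * gridFunctional j₀ g q j = u q.1 - (-1 + 2 * ((q.2 : ℝ) + 1) / g) := by
  simp [gridFunctional, mul_sub, Finset.sum_sub_distrib, hu]

/-- Otherwise the largest grid value not exceeding `v j` is greater than `u j`, and its functional
puts the two points on different sides. -/
theorem sub_le_of_same_side_grid {d : ℕ} (j₀ : Fin d) (g : ℕ) (hg : 0 < g) (u v : Fin d → ℝ)
    (hu : u j₀ = 1) (hv : v j₀ = 1) (hub : ∀ j, |u j| ≤ 1) (hvb : ∀ j, |v j| ≤ 1)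
    (h : ∀ q, sideOf (gridFunctional j₀ g q) u = sideOf (gridFunctional j₀ g q) v) (j : Fin d) :
    v j - u j ≤ 2 / g := by
  by_contra hcon
  push Not at hcon
  have hg' : (0 : ℝ) < g := by exact_mod_cast hg
  have hu1 := abs_le.1 (hub j)
  have hv1 := abs_le.1 (hvb j)
  set z := (v j + 1) * g / 2 with hz
  have hz1 : 1 < z := by
    have : 2 / (g : ℝ) < v j + 1 := by linarith
    rw [div_lt_iff₀ hg'] at this
    rw [hz]; linarith
  have hzg : z ≤ g := by rw [hz]; nlinarith
  have hf1 : 1 ≤ ⌊z⌋₊ := Nat.le_floor (by exact_mod_cast hz1.le)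
  have hf2 : ⌊z⌋₊ ≤ g := by
    have := (Nat.floor_le (by linarith : 0 ≤ z)).trans hzg
    exact_mod_cast this
  -- The index `q` stands for the grid value number `q + 1`, hence the shift.
  have h1 := h (j, ⟨⌊z⌋₊ - 1, by omega⟩)
  simp only [sideOf, decide_eq_decide, sum_mul_gridFunctional j₀ g _ _ hu,
    sum_mul_gridFunctional j₀ g _ _ hv] at h1
  have hcast : ((⌊z⌋₊ - 1 : ℕ) : ℝ) + 1 = ⌊z⌋₊ := by
    rw [Nat.cast_sub hf1]; simp
  rw [hcast] at h1
  have hle : 2 * (⌊z⌋₊ : ℝ) / g ≤ v j + 1 := by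
    rw [div_le_iff₀ hg']
    have := Nat.floor_le (by linarith : 0 ≤ z)
    rw [hz] at this ⊢
    linarith
  have hlt : v j + 1 - 2 / g < 2 * (⌊z⌋₊ : ℝ) / g := by
    rw [← sub_pos]
    have : z < ⌊z⌋₊ + 1 := Nat.lt_floor_add_one z
    have h2 : v j + 1 = 2 * z / g := by rw [hz]; field_simp
    rw [h2, ← sub_div, ← sub_div]
    exact div_pos (by linarith) hg'
  have h2 := h1.2 (by linarith)
  linarith

/-! ### One halving step -/

/-- Bound for the number of edges of a path through `n` points that a hyperplane crosses,
when there are `N` test functionals. -/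
noncomputable def crossingBound (d N n : ℕ) : ℝ :=
  2 * (Real.log (N + d * n) + 4 * (1 + Real.log n) ^ 2 * (n : ℝ) ^ (1 - 1 / ((d - 1 : ℕ) : ℝ)))

/-- The error of one halving step from `n` points with `N` test functionals. -/
noncomputable def halvingError (d p N n : ℕ) : ℝ :=
  (Real.log (2 * N) + 1) * (√(crossingBound d N n) *
    (16 * d ^ p / n * (d * (32 * d ^ p * d * crossingBound d N n / n)) ^ p))

theorem pairwise_disjoint_toFinset_of_flatten {ι : Type} [DecidableEq ι] (gs : List (List ι))
    (h : gs.flatten.Nodup) : (gs.map List.toFinset).Pairwise Disjoint := by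
  rw [List.nodup_flatten] at h
  rw [List.pairwise_map]
  refine h.2.imp fun hab => ?_
  rw [Finset.disjoint_left]
  intro x hx hx'
  exact hab (List.mem_toFinset.1 hx) (List.mem_toFinset.1 hx')

theorem one_le_crossingBound {d N n : ℕ} (hd : 2 ≤ d) (hN : 1 ≤ N) (hn : 1 ≤ n) :
    1 ≤ crossingBound d N n := by
  have hN1 : (1 : ℝ) ≤ N := by exact_mod_cast hN
  have hn1 : (1 : ℝ) ≤ n := by exact_mod_cast hn
  have hLn : 0 ≤ Real.log n := Real.log_nonneg hn1
  have hD1 : (1 : ℝ) / ((d - 1 : ℕ) : ℝ) ≤ 1 := by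
    rw [div_le_one (by exact_mod_cast (by omega : 0 < d - 1))]
    exact_mod_cast (by omega : 1 ≤ d - 1)
  have h1 : 0 ≤ Real.log (N + d * n) := Real.log_nonneg (by
    have : (0 : ℝ) ≤ d * n := by positivity
    linarith)
  have h2 : (1 : ℝ) ≤ (n : ℝ) ^ (1 - 1 / ((d - 1 : ℕ) : ℝ)) :=
    Real.one_le_rpow hn1 (by linarith)
  have h3 : 1 ≤ (1 + Real.log n) ^ 2 := by nlinarith
  rw [crossingBound]
  nlinarith

/-- The number of groups with points on both sides is at most the number of crossings of the path. -/
theorem countP_separated_le_crossings {ι : Type} [DecidableEq ι] (s : ι → Bool)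
    (gs : List (List ι)) [DecidablePred fun G : Finset ι => ¬ ∀ a ∈ G, ∀ b ∈ G, s a = s b] :
    (gs.map List.toFinset).countP (fun G => decide (¬ ∀ a ∈ G, ∀ b ∈ G, s a = s b)) ≤
      crossings s gs.flatten := by
  refine le_trans ?_ (sum_crossings_le_flatten s gs)
  rw [List.countP_map]
  induction gs with
  | nil => simp
  | cons g' gs ih =>
    rw [List.countP_cons, List.map_cons, List.sum_cons, add_comm]
    refine Nat.add_le_add ?_ ih
    split_ifs with h
    · simp only [Function.comp, decide_eq_true_eq] at h
      by_contra hcon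
      refine h ?_
      cases g' with
      | nil => simp
      | cons a t =>
        have h2 := eq_of_crossings_eq_zero s a t (by omega)
        intro b hb c hc
        exact (h2 b (List.mem_toFinset.1 hb)).trans (h2 c (List.mem_toFinset.1 hc)).symm
    · exact Nat.zero_le _

/-- A path through the support of `w`, cut into few light pieces of small diameter. -/
theorem exists_light_pieces {ι Y : Type} [Fintype ι] [DecidableEq ι] [Fintype Y] [Nonempty Y] {d : ℕ}
    (hd : 2 ≤ d) (p : ℕ) (j₀ : Fin d) (u : ι → Fin d → ℝ) (hu : ∀ i, u i j₀ = 1)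
    (hub : ∀ i j, |u i j| ≤ 1) (y : Y → Fin d → ℝ) (w : ι → ℝ)
    (hw : ∀ i, 0 ≤ w i) (hW : ∑ i, w i ≤ 1) (n : ℕ)
    (hn : (Finset.univ.filter fun i => w i ≠ 0).card = n) (hnM : 8 * d ^ p ≤ n) :
    ∃ gs : List (List ι), gs.flatten.Nodup ∧ (∀ i, i ∈ gs.flatten ↔ w i ≠ 0) ∧
      (∀ g ∈ gs, ∀ a ∈ g, ∀ b ∈ g, ∀ j, |u a j - u b j| ≤
        32 * d ^ p * d * crossingBound d (Fintype.card Y) n / n) ∧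
      (∀ g ∈ gs, (g.map w).sum ≤ 16 * d ^ p / n ∨ ∃ b, g = [b]) ∧
      (d : ℝ) ^ p * gs.length ≤ n / 2 ∧
      ∀ x, (crossings (fun i => sideOf (y x) (u i)) gs.flatten : ℝ) ≤
        crossingBound d (Fintype.card Y) n := by
  classical
  set N := Fintype.card Y with hN
  have hN1 : (1 : ℝ) ≤ N := by exact_mod_cast Fintype.card_pos
  set kap := crossingBound d N n with hkap
  have hdp : 1 ≤ d ^ p := Nat.one_le_pow _ _ (by omega)
  have hd0 : (0 : ℝ) < d := by exact_mod_cast (by omega : 0 < d)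
  have hn0 : 0 < n := by omega
  have hn1 : (1 : ℝ) ≤ n := by exact_mod_cast hn0
  have hLn : 0 ≤ Real.log n := Real.log_nonneg hn1
  set M : ℝ := (d : ℝ) ^ p with hM
  have hM1 : 1 ≤ M := by rw [hM]; exact_mod_cast hdp
  have hkap1 : 1 ≤ kap := one_le_crossingBound hd Fintype.card_pos hn0
  -- With `g = ⌊q⌋` grid values in each direction, the `d * g` grid hyperplanes are crossed at most
  -- `n / (8 M)` times altogether, while two points on the same side of all of them differ by at
  -- most `2 / g ≤ δ` in each coordinate.
  set q : ℝ := n / (8 * M * d * kap) with hq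
  have hq0 : 0 < q := by positivity
  set g := ⌊q⌋₊ with hg
  set δ : ℝ := 32 * M * d * kap / n with hδ
  have hδq : δ * q = 4 := by rw [hδ, hq]; field_simp; norm_num
  have hδ0 : 0 < δ := by positivity
  have hgn : g ≤ n := by
    have h1 : q ≤ n := by
      rw [hq]
      refine div_le_self (by linarith) ?_
      have : (1 : ℝ) ≤ d := by exact_mod_cast (by omega : 1 ≤ d)
      have h2 : 1 ≤ M * d := by nlinarith
      nlinarith
    have h2 := (Nat.floor_le hq0.le).trans h1
    exact_mod_cast h2
  set θ : ℝ := 16 * M / n with hθ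
  have hθ0 : 0 < θ := by positivity
  -- the path
  set P := Finset.univ.filter fun i => w i ≠ 0 with hP
  obtain ⟨l, hl, hcross⟩ := exists_low_crossing_path (X := Y ⊕ (Fin d × Fin g)) hd j₀ u hu
    (Sum.elim y (gridFunctional j₀ g)) P
  have hcross' : ∀ x, (crossings (fun i => sideOf (Sum.elim y (gridFunctional j₀ g) x) (u i)) l : ℝ)
      ≤ kap := by
    intro x
    refine (hcross x).trans ?_
    rw [hn, hkap, crossingBound]
    have hcard : (Fintype.card (Y ⊕ (Fin d × Fin g)) : ℝ) ≤ N + d * n := by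
      rw [Fintype.card_sum, Fintype.card_prod, Fintype.card_fin, Fintype.card_fin]
      push_cast
      have : (g : ℝ) ≤ n := by exact_mod_cast hgn
      nlinarith
    have := Real.log_le_log (by exact_mod_cast Fintype.card_pos) hcard
    linarith
  have hlne : l ≠ [] := by
    rintro rfl
    have := hl.length_eq
    simp only [List.length_nil, Finset.length_toList] at this
    omega
  obtain ⟨a, t₀, rfl⟩ := List.exists_cons_of_ne_nil hlne
  obtain ⟨t, gs₀, hfl, hsame, hlight, hlen⟩ := exists_path_pieces
    (fun q i => sideOf (gridFunctional j₀ g q) (u i)) w hw θ hθ0 a t₀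
  set gs := (a :: t) :: gs₀ with hgs
  set l := a :: t₀ with hl'
  have hnodup : l.Nodup := hl.nodup_iff.2 P.nodup_toList
  have hmeml : ∀ i, i ∈ l ↔ w i ≠ 0 := by
    intro i
    rw [hl.mem_iff, Finset.mem_toList, hP]
    simp
  have hgsnodup : ∀ g ∈ gs, g.Nodup := by
    rw [← hfl, List.nodup_flatten] at hnodup
    exact hnodup.1
  have hlsum : (l.map w).sum ≤ 1 := by
    rw [(hl.map w).sum_eq, Finset.sum_map_toList]
    refine le_trans (Finset.sum_le_sum_of_subset_of_nonneg (Finset.subset_univ _)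
      fun i _ _ => hw i) hW
  -- Three contributions of at most `n / 8` each: the cuts at grid hyperplanes, the cuts because of
  -- weight (`2 / θ` of them), and the summand one, for which `8 * d ^ p ≤ n` is needed.
  have hcount : M * (gs.length : ℝ) ≤ n / 2 := by
    have h1 : ∑ q, (crossings ((fun q i => sideOf (gridFunctional j₀ g q) (u i)) q) l : ℝ) ≤
        d * g * kap := by
      calc _ ≤ ∑ _q : Fin d × Fin g, kap := Finset.sum_le_sum fun q _ => hcross' (Sum.inr q)
        _ = _ := by simp
    have h2 : (g : ℝ) ≤ q := Nat.floor_le hq0.le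
    have h3 : M * (d * g * kap) ≤ n / 8 := by
      calc M * (d * g * kap) = (M * d * kap) * g := by ring
        _ ≤ (M * d * kap) * q := mul_le_mul_of_nonneg_left h2 (by positivity)
        _ = n / 8 := by rw [hq]; field_simp
    have h4 : 0 ≤ ((a :: t).map w).sum := List.sum_nonneg (by
      intro x hx
      obtain ⟨i, _, rfl⟩ := List.mem_map.1 hx
      exact hw i)
    have h5 : (gs.length : ℝ) * θ ≤ (1 + d * g * kap) * θ + 2 := by nlinarith
    have h6 : (gs.length : ℝ) ≤ (1 + d * g * kap) + 2 / θ := by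
      rw [← sub_nonneg]
      have : ((1 + d * g * kap) + 2 / θ - gs.length) * θ ≥ 0 := by
        have : 2 / θ * θ = 2 := by field_simp
        nlinarith
      exact nonneg_of_mul_nonneg_left this hθ0
    have h7 : M * (2 / θ) = n / 8 := by rw [hθ]; field_simp; norm_num
    have h8 : M ≤ n / 8 := by
      have : (8 : ℝ) * M ≤ n := by rw [hM]; exact_mod_cast hnM
      linarith
    nlinarith
  have hdiam : ∀ g' ∈ gs, ∀ a ∈ g', ∀ b ∈ g', ∀ j, u a j - u b j ≤ δ := by
    intro g' hg' a ha b hb j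
    -- Without any grid value there is nothing to show: then `q < 1`, so `δ > 4` exceeds the side of
    -- the cube.
    rcases Nat.eq_zero_or_pos g with hg0 | hgpos
    · have hq1 : q < 1 := Nat.floor_eq_zero.1 hg0
      have h1 := abs_le.1 (hub a j)
      have h2 := abs_le.1 (hub b j)
      nlinarith
    · have h1 := sub_le_of_same_side_grid j₀ g hgpos (u b) (u a) (hu _) (hu _) (hub _)
        (hub _) (fun q => hsame g' hg' q b hb a ha) j
      refine h1.trans ?_
      have hg1 : (1 : ℝ) ≤ g := by exact_mod_cast hgpos
      have h2 : q < g + 1 := Nat.lt_floor_add_one q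
      rw [div_le_iff₀ (by linarith)]
      nlinarith
  refine ⟨gs, hfl ▸ hnodup, fun i => hfl ▸ hmeml i, fun g' hg' a ha b hb j => ?_, hlight, hcount,
    fun x => hfl ▸ hcross' (Sum.inl x)⟩
  exact abs_le.2 ⟨by linarith [hdiam g' hg' b hb a ha j], hdiam g' hg' a ha b hb j⟩

/-- The support can be halved at a small cost. -/
theorem exists_halving {ι Y : Type} [Fintype ι] [DecidableEq ι] [Fintype Y] [Nonempty Y] {d : ℕ}
    (hd : 2 ≤ d) (p : ℕ) (j₀ : Fin d) (u : ι → Fin d → ℝ) (hu : ∀ i, u i j₀ = 1)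
    (hub : ∀ i j, |u i j| ≤ 1) (y : Y → Fin d → ℝ) (hy : ∀ x j, |y x j| ≤ 1) (w : ι → ℝ)
    (hw : ∀ i, 0 ≤ w i) (hW : ∑ i, w i ≤ 1) (n : ℕ)
    (hn : (Finset.univ.filter fun i => w i ≠ 0).card = n) (hnM : 8 * d ^ p ≤ n) :
    ∃ w' : ι → ℝ, (∀ i, 0 ≤ w' i) ∧ (∀ i, w i = 0 → w' i = 0) ∧ ∑ i, w' i = ∑ i, w i ∧
      2 * (Finset.univ.filter fun i => w' i ≠ 0).card ≤ n ∧
      ∀ x, |∑ i, w' i * |∑ j, u i j * y x j| ^ p - ∑ i, w i * |∑ j, u i j * y x j| ^ p| ≤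
        halvingError d p (Fintype.card Y) n := by
  classical
  set N := Fintype.card Y with hN
  have hN1 : (1 : ℝ) ≤ N := by exact_mod_cast Fintype.card_pos
  have hd0 : (0 : ℝ) < d := by exact_mod_cast (by omega : 0 < d)
  have hn0 : 0 < n := by
    have := Nat.one_le_pow p d (by omega)
    omega
  have hn0' : (0 : ℝ) < n := by exact_mod_cast hn0
  obtain ⟨gs, hnodup, hmem, hdiamgs, hlight, hcount, hcross⟩ :=
    exists_light_pieces hd p j₀ u hu hub y w hw hW n hn hnM
  set kap := crossingBound d N n with hkap
  have hkap1 : 1 ≤ kap := one_le_crossingBound hd Fintype.card_pos hn0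
  set M : ℝ := (d : ℝ) ^ p with hM
  have hM0 : 0 < M := by positivity
  set δ : ℝ := 32 * M * d * kap / n with hδ
  have hδ0 : 0 < δ := by positivity
  set θ : ℝ := 16 * M / n with hθ
  have hθ0 : 0 < θ := by positivity
  have hgsnodup : ∀ g ∈ gs, g.Nodup := by
    rw [List.nodup_flatten] at hnodup
    exact hnodup.1
  -- A separated piece lies within `d * δ` of the hyperplane and has mass at most `θ` before and
  -- after the change. Both sums therefore lie between `0` and `b`.
  set b : ℝ := θ * (d * δ) ^ p with hb
  have hb0 : 0 < b := by positivity
  -- This makes `lam ^ 2 * b ^ 2 * kap = 1`. At most `kap` pieces are separated by a given test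
  -- vector, so its discount costs at most a factor `exp 1` and `lam * |S| ≤ log (2 * N) + 1`.
  set lam : ℝ := 1 / (b * √kap) with hlam
  have hsk : 1 ≤ √kap := Real.one_le_sqrt.2 hkap1
  have hlam0 : 0 < lam := by positivity
  have hlb : lam * b ≤ 1 := by
    rw [hlam, div_mul_eq_mul_div, one_mul, div_le_one (by positivity)]
    nlinarith
  -- The `p`-th power of the coordinate that equals one: preserving this moment preserves the mass
  -- of each piece.
  set k₀ : Fin p → Fin d := fun _ => j₀ with hk₀
  have hφ : ∀ i, momentVec p (u i) k₀ = 1 := fun i => by simp [momentVec, hk₀, hu]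
  obtain ⟨w', h0, hz, hout, hcard, hmom, hpot⟩ := exists_balanced_sparsification
    (fun i => momentVec p (u i)) k₀ hφ (fun x i => |∑ j, u i j * y x j| ^ p) w hw
    (fun x g => ¬ ∀ a ∈ g, ∀ b ∈ g, sideOf (y x) (u a) = sideOf (y x) (u b)) b lam hlam0 hlb
    (gs.map List.toFinset)
    (pairwise_disjoint_toFinset_of_flatten gs hnodup) (by
      intro G hG v hv hvm x
      obtain ⟨g', hg', rfl⟩ := List.mem_map.1 hG
      by_cases hcr : ¬ ∀ a ∈ g'.toFinset, ∀ b ∈ g'.toFinset, sideOf (y x) (u a) = sideOf (y x) (u b)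
      · rw [if_pos hcr]
        rcases hlight g' hg' with hlt | ⟨c, rfl⟩
        · have hdiam' : ∀ a ∈ g'.toFinset, ∀ b ∈ g'.toFinset, ∀ j, |u a j - u b j| ≤ δ :=
            fun a ha b hb j => hdiamgs g' hg' a (List.mem_toFinset.1 ha) b (List.mem_toFinset.1 hb) j
          have hclose := abs_inner_le_of_separated u (y x) (hy x) g'.toFinset δ hdiam' hcr
          have hmass : ∑ i ∈ g'.toFinset, w i ≤ θ := by
            rw [List.sum_toFinset w (hgsnodup g' hg')]; exact hlt
          have hmass' : ∑ i ∈ g'.toFinset, v i ≤ θ := by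
            have := hvm k₀
            simp only [hφ, mul_one] at this
            rw [this]; exact hmass
          have hbd : ∀ v : ι → ℝ, (∀ i, 0 ≤ v i) → ∑ i ∈ g'.toFinset, v i ≤ θ →
              0 ≤ ∑ i ∈ g'.toFinset, v i * |∑ j, u i j * y x j| ^ p ∧
              ∑ i ∈ g'.toFinset, v i * |∑ j, u i j * y x j| ^ p ≤ b := by
            intro v hv hvθ
            refine ⟨Finset.sum_nonneg fun i _ => mul_nonneg (hv i) (by positivity), ?_⟩
            calc _ ≤ ∑ i ∈ g'.toFinset, v i * (d * δ) ^ p :=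
                  Finset.sum_le_sum fun i hi => mul_le_mul_of_nonneg_left
                    (pow_le_pow_left₀ (abs_nonneg _) (hclose i hi) p) (hv i)
              _ = (∑ i ∈ g'.toFinset, v i) * (d * δ) ^ p := (Finset.sum_mul ..).symm
              _ ≤ _ := mul_le_mul_of_nonneg_right hvθ (by positivity)
          obtain ⟨h1, h2⟩ := hbd v hv hmass'
          obtain ⟨h3, h4⟩ := hbd w hw hmass
          exact abs_le.2 ⟨by linarith, by linarith⟩
        · exact absurd (by simp) hcr
      · rw [if_neg hcr]
        rw [not_not] at hcr
        rw [sum_abs_inner_pow_eq_of_moments p u (y x) g'.toFinset w v hvm hcr, sub_self, abs_zero])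
  have hout' : ∀ i, (∀ G ∈ gs.map List.toFinset, i ∉ G) → w i = 0 := by
    intro i hi
    by_contra hne
    have : i ∈ gs.flatten := (hmem i).2 hne
    obtain ⟨g', hg', hig⟩ := List.mem_flatten.1 this
    exact hi _ (List.mem_map_of_mem hg') (List.mem_toFinset.2 hig)
  refine ⟨w', h0, hz, ?_, ?_, fun x => ?_⟩
  · -- total mass
    have h1 : ∀ v : ι → ℝ, (∀ i, w i = 0 → v i = 0) →
        ∑ i, v i = ((gs.map List.toFinset).map fun G => ∑ i ∈ G, v i).sum := by
      intro v hv
      have h2 : ∑ i, v i = (gs.flatten.map v).sum := by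
        rw [← List.sum_toFinset v hnodup]
        refine (Finset.sum_subset (Finset.subset_univ _) fun i _ hi => hv i ?_).symm
        by_contra hne
        exact hi (List.mem_toFinset.2 ((hmem i).2 hne))
      rw [h2, List.map_flatten, List.sum_flatten, List.map_map, List.map_map]
      congr 1
      refine List.map_congr_left fun g' hg' => ?_
      simp only [Function.comp]
      exact (List.sum_toFinset v (hgsnodup g' hg')).symm
    rw [h1 w' hz, h1 w fun _ h => h]
    congr 1
    refine List.map_congr_left fun G hG => ?_
    have := hmom G hG k₀
    simpa only [hφ, mul_one] using this
  · have h1 : (Finset.univ.filter fun i => w' i ≠ 0) ⊆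
        (gs.map fun g' => g'.toFinset.filter fun i => w' i ≠ 0).toFinset.biUnion id := by
      intro i hi
      rw [Finset.mem_filter] at hi
      by_contra hcon
      refine hi.2 (hz i (hout' i fun G hG hiG => hcon ?_))
      obtain ⟨g', hg', rfl⟩ := List.mem_map.1 hG
      rw [Finset.mem_biUnion]
      exact ⟨_, List.mem_toFinset.2 (List.mem_map.2 ⟨g', hg', rfl⟩),
        Finset.mem_filter.2 ⟨hiG, hi.2⟩⟩
    have h2 : (Finset.univ.filter fun i => w' i ≠ 0).card ≤ gs.length * d ^ p := by
      refine (Finset.card_le_card h1).trans ?_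
      refine (Finset.card_biUnion_le_card_mul _ _ (d ^ p) ?_).trans ?_
      · intro G hG
        obtain ⟨g', hg', rfl⟩ := List.mem_map.1 (List.mem_toFinset.1 hG)
        simpa using hcard _ (List.mem_map_of_mem hg')
      · refine Nat.mul_le_mul_right _ ?_
        exact (List.toFinset_card_le _).trans (by simp)
    have h3 : (2 : ℝ) * (gs.length * d ^ p) ≤ n := by rw [hM] at hcount; linarith
    have h4 : 2 * (gs.length * d ^ p) ≤ n := by exact_mod_cast h3
    omega
  · set S := ∑ i, (w' i - w i) * |∑ j, u i j * y x j| ^ p with hS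
    have hSeq : ∑ i, w' i * |∑ j, u i j * y x j| ^ p - ∑ i, w i * |∑ j, u i j * y x j| ^ p = S := by
      rw [hS, ← Finset.sum_sub_distrib]
      exact Finset.sum_congr rfl fun i _ => by ring
    rw [hSeq]
    set c : ℕ := (gs.map List.toFinset).countP fun G =>
      decide (¬ ∀ a ∈ G, ∀ b ∈ G, sideOf (y x) (u a) = sideOf (y x) (u b)) with hc
    have hcle : (c : ℝ) ≤ kap := by
      refine le_trans ?_ (hcross x)
      exact_mod_cast countP_separated_le_crossings (fun i => sideOf (y x) (u i)) gs
    have hx := (Finset.single_le_sum (fun z _ => by positivity) (Finset.mem_univ x)).trans hpot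
    rw [← hS, ← hc] at hx
    have hexp : Real.exp (lam * |S| - lam ^ 2 * b ^ 2 * c) ≤ 2 * N := by
      refine le_trans ?_ hx
      rw [sub_eq_add_neg, Real.exp_add]
      refine mul_le_mul_of_nonneg_right ?_ (Real.exp_pos _).le
      rcases abs_cases S with ⟨h, _⟩ | ⟨h, _⟩ <;> rw [h]
      · linarith [Real.exp_pos (-(lam * S))]
      · rw [mul_neg]; linarith [Real.exp_pos (lam * S)]
    have hlog := Real.log_le_log (Real.exp_pos _) hexp
    rw [Real.log_exp] at hlog
    have hl1 : lam ^ 2 * b ^ 2 * c ≤ 1 := by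
      have h1 : lam ^ 2 * b ^ 2 * kap = 1 := by
        have : kap = √kap ^ 2 := (Real.sq_sqrt (by linarith)).symm
        rw [this, ← mul_pow, ← mul_pow, hlam]
        have : √kap ≠ 0 := by positivity
        field_simp
        
      have h2 := mul_le_mul_of_nonneg_left hcle (by positivity : 0 ≤ lam ^ 2 * b ^ 2)
      linarith
    have hlS : lam * |S| ≤ Real.log (2 * N) + 1 := by linarith
    have hfin : |S| ≤ (Real.log (2 * N) + 1) * (√kap * b) := by
      have : |S| = (lam * |S|) * (√kap * b) := by rw [hlam]; field_simp
      rw [this]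
      exact mul_le_mul_of_nonneg_right hlS (by positivity)
    refine hfin.trans (le_of_eq ?_)
    rw [halvingError, ← hkap, hb, hθ, hδ]

/-! ### Coarse reduction in grid cells -/

theorem abs_abs_pow_sub_abs_pow_le {a b B : ℝ} (ha : |a| ≤ B) (hb : |b| ≤ B) (p : ℕ) :
    |(|a| ^ p) - |b| ^ p| ≤ |a - b| * (p * B ^ (p - 1)) := by
  have hB : 0 ≤ B := (abs_nonneg a).trans ha
  refine (abs_pow_sub_pow_le |a| |b| p).trans ?_
  rw [mul_assoc]
  refine mul_le_mul (abs_abs_sub_abs_le a b) ?_ (by positivity) (abs_nonneg _)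
  refine mul_le_mul_of_nonneg_left (pow_le_pow_left₀ (by positivity) ?_ _) (by positivity)
  rw [abs_abs, abs_abs]
  exact max_le ha hb

theorem abs_inner_le {d : ℕ} (u y : Fin d → ℝ) {a b : ℝ} (ha : 0 ≤ a) (hu : ∀ j, |u j| ≤ a)
    (hy : ∀ j, |y j| ≤ b) : |∑ j, u j * y j| ≤ d * (a * b) := by
  refine (Finset.abs_sum_le_sum_abs _ _).trans ?_
  calc ∑ j, |u j * y j| ≤ ∑ _j : Fin d, a * b := by
        refine Finset.sum_le_sum fun j _ => ?_
        rw [abs_mul]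
        exact mul_le_mul (hu j) (hy j) (abs_nonneg _) ha
    _ = d * (a * b) := by simp

/-- Grid cells of side `2 / g` give an approximation with error `2 d / g`. -/
theorem exists_cell_sparsification {ι : Type} [Fintype ι] [DecidableEq ι] {d : ℕ}
    {p : ℕ} (hp : 1 ≤ p) (j₀ : Fin d) (u : ι → Fin d → ℝ) (hu : ∀ i, u i j₀ = 1)
    (hub : ∀ i j, |u i j| ≤ 1) (w : ι → ℝ)
    (hw : ∀ i, 0 ≤ w i) (hW : ∑ i, w i ≤ 1) (g : ℕ) (hg : 2 * d ≤ g) :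
    ∃ w' : ι → ℝ, (∀ i, 0 ≤ w' i) ∧ (∀ i, w i = 0 → w' i = 0) ∧ ∑ i, w' i = ∑ i, w i ∧
      (Finset.univ.filter fun i => w' i ≠ 0).card ≤ (g + 1) ^ d * d ^ p ∧
      ∀ y : Fin d → ℝ, (∀ j, |y j| ≤ 1) →
        |∑ i, w' i * |∑ j, u i j * y j| ^ p - ∑ i, w i * |∑ j, u i j * y j| ^ p| ≤ 2 * d / g := by
  have hd0 : 0 < d := j₀.pos
  have hg0 : (0 : ℝ) < g := by exact_mod_cast (by omega : 0 < g)
  have hcellb : ∀ i j, ⌊(u i j + 1) * g / 2⌋₊ < g + 1 := by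
    intro i j
    have h1 := abs_le.1 (hub i j)
    rw [Nat.lt_succ_iff]
    have h2 : (u i j + 1) * g / 2 ≤ g := by nlinarith
    have h3 := (Nat.floor_le (by nlinarith : 0 ≤ (u i j + 1) * g / 2)).trans h2
    exact_mod_cast h3
  set cell : ι → (Fin d → Fin (g + 1)) := fun i j => ⟨⌊(u i j + 1) * g / 2⌋₊, hcellb i j⟩ with hcell
  set G : (Fin d → Fin (g + 1)) → Finset ι := fun c => Finset.univ.filter fun i => cell i = c with hG
  have hdiam : ∀ c, ∀ a ∈ G c, ∀ b ∈ G c, ∀ j, |u a j - u b j| ≤ 2 / g := by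
    intro c a ha b hb j
    have h : cell a = cell b := by
      rw [(Finset.mem_filter.1 ha).2, (Finset.mem_filter.1 hb).2]
    have h1 : ⌊(u a j + 1) * g / 2⌋₊ = ⌊(u b j + 1) * g / 2⌋₊ := by
      have := congrFun h j
      simpa [hcell] using this
    have ha1 := abs_le.1 (hub a j)
    have hb1 := abs_le.1 (hub b j)
    have h2 := Nat.floor_le (by nlinarith : 0 ≤ (u a j + 1) * g / 2)
    have h3 := Nat.floor_le (by nlinarith : 0 ≤ (u b j + 1) * g / 2)
    have h4 := Nat.lt_floor_add_one ((u a j + 1) * g / 2)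
    have h5 := Nat.lt_floor_add_one ((u b j + 1) * g / 2)
    rw [h1] at h2 h4
    rw [abs_le, neg_le, le_div_iff₀ hg0, le_div_iff₀ hg0]
    constructor <;> nlinarith
  have hφ : ∀ i, momentVec p (u i) (fun _ => j₀) = 1 := fun i => by simp [momentVec, hu]
  set gs := (Finset.univ : Finset (Fin d → Fin (g + 1))).toList.map G with hgs
  have hdisj : gs.Pairwise Disjoint := by
    rw [hgs, List.pairwise_map]
    refine (Finset.nodup_toList _).imp fun {a b} hab => ?_
    rw [Finset.disjoint_left]
    intro i hi hi'
    exact hab ((Finset.mem_filter.1 hi).2.symm.trans (Finset.mem_filter.1 hi').2)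
  -- Only the matching of moments is used; with `F = 0` the potential says nothing. The purpose is a
  -- support bounded in terms of `g` alone, so that the number of halvings and all logarithms depend
  -- on `ε` and not on the number of points.
  obtain ⟨w', h0, hz, -, hcard, hmom, -⟩ := exists_balanced_sparsification (Y := Unit)
    (fun i => momentVec p (u i)) (fun _ => j₀) hφ (fun _ _ => 0) w hw (fun _ _ => False) 0 1
    one_pos (by simp) gs hdisj (by simp)
  have hGmem : ∀ c, G c ∈ gs := fun c => List.mem_map_of_mem (Finset.mem_toList.2 (Finset.mem_univ c))
  have hfib : ∀ f : ι → ℝ, ∑ i, f i = ∑ c, ∑ i ∈ G c, f i := fun f =>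
    (Finset.sum_fiberwise Finset.univ cell f).symm
  have hmass : ∀ c, ∑ i ∈ G c, w' i = ∑ i ∈ G c, w i := by
    intro c
    have := hmom _ (hGmem c) fun _ => j₀
    simpa only [hφ, mul_one] using this
  refine ⟨w', h0, hz, ?_, ?_, ?_⟩
  · rw [hfib, hfib]
    exact Finset.sum_congr rfl fun c _ => hmass c
  · have h1 : (Finset.univ.filter fun i => w' i ≠ 0) ⊆
        Finset.univ.biUnion fun c => (G c).filter fun i => w' i ≠ 0 := by
      intro i hi
      rw [Finset.mem_filter] at hi
      exact Finset.mem_biUnion.2 ⟨cell i, Finset.mem_univ _,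
        Finset.mem_filter.2 ⟨Finset.mem_filter.2 ⟨Finset.mem_univ _, rfl⟩, hi.2⟩⟩
    refine (Finset.card_le_card h1).trans ?_
    refine (Finset.card_biUnion_le_card_mul _ _ (d ^ p) fun c _ => ?_).trans (by simp)
    simpa using hcard _ (hGmem c)
  · intro y hy
    have hδ1 : 2 * (d : ℝ) / g ≤ 1 := by
      rw [div_le_one hg0]; exact_mod_cast hg
    have hδ0 : 0 ≤ 2 * (d : ℝ) / g := by positivity
    have hgroup : ∀ c, |∑ i ∈ G c, w' i * |∑ j, u i j * y j| ^ p -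
        ∑ i ∈ G c, w i * |∑ j, u i j * y j| ^ p| ≤ (∑ i ∈ G c, w i) * (2 * d / g) := by
      intro c
      have hm0 : 0 ≤ ∑ i ∈ G c, w i := Finset.sum_nonneg fun i _ => hw i
      by_cases hs : ∀ a ∈ G c, ∀ b ∈ G c, sideOf y (u a) = sideOf y (u b)
      · rw [sum_abs_inner_pow_eq_of_moments p u y (G c) w w' (hmom _ (hGmem c)) hs, sub_self,
          abs_zero]
        positivity
      · have hclose := abs_inner_le_of_separated u y hy (G c) (2 / g) (hdiam c) hs
        have hbd : ∀ v : ι → ℝ, (∀ i, 0 ≤ v i) → ∑ i ∈ G c, v i = ∑ i ∈ G c, w i →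
            0 ≤ ∑ i ∈ G c, v i * |∑ j, u i j * y j| ^ p ∧
            ∑ i ∈ G c, v i * |∑ j, u i j * y j| ^ p ≤ (∑ i ∈ G c, w i) * (2 * d / g) := by
          intro v hv hve
          refine ⟨Finset.sum_nonneg fun i _ => mul_nonneg (hv i) (by positivity), ?_⟩
          rw [← hve, Finset.sum_mul]
          refine Finset.sum_le_sum fun i hi => mul_le_mul_of_nonneg_left ?_ (hv i)
          have h1 : |∑ j, u i j * y j| ≤ 2 * d / g := (hclose i hi).trans (le_of_eq (by ring))
          exact (pow_le_of_le_one (abs_nonneg _) (h1.trans hδ1) (by omega)).trans h1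
        obtain ⟨h1, h2⟩ := hbd w' h0 (hmass c)
        obtain ⟨h3, h4⟩ := hbd w hw rfl
        exact abs_le.2 ⟨by linarith, by linarith⟩
    rw [hfib, hfib fun i => w i * |∑ j, u i j * y j| ^ p, ← Finset.sum_sub_distrib]
    refine (Finset.abs_sum_le_sum_abs _ _).trans ((Finset.sum_le_sum fun c _ => hgroup c).trans ?_)
    rw [← Finset.sum_mul, ← hfib]
    nlinarith

/-! ### Iterated halving and a net of test vectors -/

/-- Iterated halving. -/
theorem exists_iterated_halving {ι Y : Type} [Fintype ι] [DecidableEq ι] [Fintype Y] [Nonempty Y]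
    {d : ℕ}
    (hd : 2 ≤ d) (p : ℕ) (j₀ : Fin d) (u : ι → Fin d → ℝ) (hu : ∀ i, u i j₀ = 1)
    (hub : ∀ i j, |u i j| ≤ 1) (y : Y → Fin d → ℝ) (hy : ∀ x j, |y x j| ≤ 1) (nf : ℕ) (δ : ℝ)
    (hδ : 0 ≤ δ) (n₀ : ℕ)
    (hnf : ∀ n, nf < n → n ≤ n₀ → 8 * d ^ p ≤ n ∧ halvingError d p (Fintype.card Y) n ≤ δ) (r : ℕ)
    (w : ι → ℝ)
    (hw : ∀ i, 0 ≤ w i) (hW : ∑ i, w i ≤ 1)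
    (hn₀ : (Finset.univ.filter fun i => w i ≠ 0).card ≤ n₀)
    (hr : (Finset.univ.filter fun i => w i ≠ 0).card ≤ 2 ^ r * nf) :
    ∃ w' : ι → ℝ, (∀ i, 0 ≤ w' i) ∧ (∀ i, w i = 0 → w' i = 0) ∧ ∑ i, w' i = ∑ i, w i ∧
      (Finset.univ.filter fun i => w' i ≠ 0).card ≤ nf ∧
      ∀ x, |∑ i, w' i * |∑ j, u i j * y x j| ^ p - ∑ i, w i * |∑ j, u i j * y x j| ^ p| ≤ r * δ := by
  induction r generalizing w with
  | zero => exact ⟨w, hw, fun _ h => h, rfl, by simpa using hr, by simp⟩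
  | succ r ih =>
    by_cases hle : (Finset.univ.filter fun i => w i ≠ 0).card ≤ nf
    · exact ⟨w, hw, fun _ h => h, rfl, hle, fun x => by rw [sub_self, abs_zero]; positivity⟩
    obtain ⟨h8, hδn⟩ := hnf _ (not_le.1 hle) hn₀
    obtain ⟨w₁, h0, hz, hm, hc, he⟩ := exists_halving hd p j₀ u hu hub y hy w hw hW _ rfl h8
    obtain ⟨w₂, k0, kz, km, kc, ke⟩ := ih w₁ h0 (hm.trans_le hW) (by omega)
      (by rw [pow_succ] at hr; nlinarith)
    refine ⟨w₂, k0, fun i hi => kz i (hz i hi), km.trans hm, kc, fun x => ?_⟩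
    have h1 := (he x).trans hδn
    have h2 := ke x
    push_cast
    have h3 := abs_sub_le (∑ i, w₂ i * |∑ j, u i j * y x j| ^ p)
      (∑ i, w₁ i * |∑ j, u i j * y x j| ^ p) (∑ i, w i * |∑ j, u i j * y x j| ^ p)
    linarith

/-- The vector of the net with integer index `x`. -/
noncomputable def netPoint {d : ℕ} (G : ℕ) (x : Fin d → Fin (2 * G + 1)) (j : Fin d) : ℝ :=
  ((x j : ℝ) - G) / G

theorem abs_netPoint_le {d : ℕ} {G : ℕ} (hG : 0 < G) (x : Fin d → Fin (2 * G + 1)) (j : Fin d) :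
    |netPoint G x j| ≤ 1 := by
  have hG' : (0 : ℝ) < G := by exact_mod_cast hG
  rw [netPoint, abs_div, abs_of_pos hG', div_le_one hG', abs_le]
  have h1 : (x j : ℝ) ≤ 2 * G := by exact_mod_cast Nat.lt_succ_iff.1 (x j).2
  have h2 : (0 : ℝ) ≤ (x j : ℝ) := by positivity
  constructor <;> linarith

theorem exists_netPoint_near {d : ℕ} {G : ℕ} (hG : 0 < G) (y : Fin d → ℝ) (hy : ∀ j, |y j| ≤ 1) :
    ∃ x : Fin d → Fin (2 * G + 1), ∀ j, |y j - netPoint G x j| ≤ 1 / G := by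
  have hG' : (0 : ℝ) < G := by exact_mod_cast hG
  have h0 : ∀ j, 0 ≤ (y j + 1) * G := fun j => by nlinarith [(abs_le.1 (hy j)).1]
  have hb : ∀ j, ⌊(y j + 1) * G⌋₊ < 2 * G + 1 := by
    intro j
    rw [Nat.lt_succ_iff]
    have h2 : (y j + 1) * G ≤ 2 * G := by nlinarith [(abs_le.1 (hy j)).2]
    have h3 := (Nat.floor_le (h0 j)).trans h2
    exact_mod_cast h3
  refine ⟨fun j => ⟨⌊(y j + 1) * G⌋₊, hb j⟩, fun j => ?_⟩
  have h1 := Nat.floor_le (h0 j)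
  have h2 := Nat.lt_floor_add_one ((y j + 1) * G)
  have h3 : y j - netPoint G (fun j => ⟨⌊(y j + 1) * G⌋₊, hb j⟩) j =
      ((y j + 1) * G - ⌊(y j + 1) * G⌋₊) / G := by
    rw [netPoint]; field_simp; ring
  rw [h3, abs_div, abs_of_pos hG']
  refine div_le_div_of_nonneg_right ?_ hG'.le
  rw [abs_le]; constructor <;> linarith

/-- An estimate on the net extends to all vectors. -/
theorem abs_sum_sub_sum_le_of_net {ι : Type} [Fintype ι] {d p : ℕ} (u : ι → Fin d → ℝ)
    (hub : ∀ i j, |u i j| ≤ 1) (w w' : ι → ℝ) (hw : ∀ i, 0 ≤ w i) (hw' : ∀ i, 0 ≤ w' i)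
    (hW : ∑ i, w i ≤ 1) (hW' : ∑ i, w' i ≤ 1) {G : ℕ} (hG : 0 < G) (η : ℝ)
    (h : ∀ x, |∑ i, w' i * |∑ j, u i j * netPoint G x j| ^ p -
      ∑ i, w i * |∑ j, u i j * netPoint G x j| ^ p| ≤ η)
    (y : Fin d → ℝ) (hy : ∀ j, |y j| ≤ 1) :
    |∑ i, w' i * |∑ j, u i j * y j| ^ p - ∑ i, w i * |∑ j, u i j * y j| ^ p| ≤
      η + 2 * (d * p * d ^ (p - 1) / G) := by
  -- Passing to a net point moves every `⟨u i, y⟩` by at most `d / G`, and `|·| ^ p` has Lipschitz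
  -- constant `p * d ^ (p - 1)` on `[-d, d]`. The masses are at most one, so each of the two
  -- weighted sums moves by at most the product.
  obtain ⟨x, hx⟩ := exists_netPoint_near hG y hy
  have hpt : ∀ i, |(|∑ j, u i j * y j| ^ p) - |∑ j, u i j * netPoint G x j| ^ p| ≤
      d * p * d ^ (p - 1) / G := by
    intro i
    have h1 : |∑ j, u i j * y j| ≤ d := by simpa using abs_inner_le (u i) y zero_le_one (hub i) hy
    have h2 : |∑ j, u i j * netPoint G x j| ≤ d := by
      simpa using abs_inner_le (u i) (netPoint G x) zero_le_one (hub i) (abs_netPoint_le hG x)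
    have h3 : |∑ j, u i j * y j - ∑ j, u i j * netPoint G x j| ≤ d * (1 / G) := by
      have := abs_inner_le (u i) (fun j => y j - netPoint G x j) zero_le_one (hub i) hx
      simpa [mul_sub, Finset.sum_sub_distrib] using this
    refine (abs_abs_pow_sub_abs_pow_le h1 h2 p).trans ?_
    calc _ ≤ (d * (1 / G)) * (p * (d : ℝ) ^ (p - 1)) :=
          mul_le_mul_of_nonneg_right h3 (by positivity)
      _ = _ := by ring
  have hdiff : ∀ v : ι → ℝ, (∀ i, 0 ≤ v i) → ∑ i, v i ≤ 1 →
      |∑ i, v i * |∑ j, u i j * y j| ^ p - ∑ i, v i * |∑ j, u i j * netPoint G x j| ^ p| ≤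
        d * p * d ^ (p - 1) / G := by
    intro v hv hv1
    rw [← Finset.sum_sub_distrib]
    calc _ ≤ ∑ i, |v i * |∑ j, u i j * y j| ^ p - v i * |∑ j, u i j * netPoint G x j| ^ p| :=
          Finset.abs_sum_le_sum_abs _ _
      _ ≤ ∑ i, v i * (d * p * d ^ (p - 1) / G) := by
          refine Finset.sum_le_sum fun i _ => ?_
          rw [← mul_sub, abs_mul, abs_of_nonneg (hv i)]
          exact mul_le_mul_of_nonneg_left (hpt i) (hv i)
      _ = (∑ i, v i) * (d * p * d ^ (p - 1) / G) := (Finset.sum_mul ..).symm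
      _ ≤ _ := mul_le_of_le_one_left (by positivity) hv1
  have h1 := abs_le.1 (hdiff w hw hW)
  have h2 := abs_le.1 (hdiff w' hw' hW')
  have h3 := abs_le.1 (h x)
  exact abs_le.2 ⟨by linarith, by linarith⟩

/-! ### The exponent of the coreset size -/

/-- With `A = n ^ (1 - 1/(d-1))`, the powers of `n` are `√A` from the crossings, `1 / n` from the
mass of a piece and `(A / n) ^ p` from its diameter. Their product has the exponent `-1 /
sizeExponent d p`. The logarithms are collected in `L`: one factor from the union over test vectors,
one from `√A`, and two for each of the `p` factors. -/
theorem halvingError_le {d p N n : ℕ} (hd : 2 ≤ d) (hn : 1 ≤ n) (hN : 1 ≤ N)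
    {K L : ℝ} (hK : 0 ≤ K) (hL : 1 ≤ L) (h1 : Real.log (2 * N) + 1 ≤ K * L)
    (h2 : Real.log (N + d * n) ≤ K * L) (h3 : 1 + Real.log n ≤ K * L) :
    halvingError d p N n ≤ K * √(2 * K + 8 * K ^ 2) * (16 * d ^ p) *
      (32 * d ^ p * d ^ 2 * (2 * K + 8 * K ^ 2)) ^ p * L ^ (2 * p + 2) *
      (n : ℝ) ^ (-(((d : ℝ) + 2 * p) / (2 * ((d : ℝ) - 1)))) := by
  have hn1 : (1 : ℝ) ≤ n := by exact_mod_cast hn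
  have hn0 : (0 : ℝ) < n := by linarith
  have hN1 : (1 : ℝ) ≤ N := by exact_mod_cast hN
  have hD : ((d - 1 : ℕ) : ℝ) = (d : ℝ) - 1 := by rw [Nat.cast_sub (by omega)]; simp
  have hd1 : (1 : ℝ) ≤ (d : ℝ) - 1 := by
    have : (2 : ℝ) ≤ d := by exact_mod_cast hd
    linarith
  set D : ℝ := (d : ℝ) - 1 with hDdef
  set A := (n : ℝ) ^ (1 - 1 / D) with hA
  have hA1 : 1 ≤ A := Real.one_le_rpow hn1 (by
    have : 1 / D ≤ 1 := by rw [div_le_one (by linarith)]; exact hd1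
    linarith)
  set κ := 2 * K + 8 * K ^ 2 with hκ
  have hκ0 : 0 ≤ κ := by positivity
  have hcb : crossingBound d N n ≤ κ * L ^ 2 * A := by
    rw [crossingBound, hD, ← hA]
    have hln : 0 ≤ 1 + Real.log n := by linarith [Real.log_nonneg hn1]
    have h4 : (1 + Real.log n) ^ 2 ≤ (K * L) ^ 2 := pow_le_pow_left₀ hln h3 2
    have h5 : K * L ≤ K * (L ^ 2 * A) := by
      refine mul_le_mul_of_nonneg_left ?_ hK
      nlinarith
    have h6 : (1 + Real.log n) ^ 2 * A ≤ (K * L) ^ 2 * A :=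
      mul_le_mul_of_nonneg_right h4 (by linarith)
    rw [hκ]
    nlinarith
  have hcb0 : 0 ≤ crossingBound d N n := zero_le_one.trans (one_le_crossingBound hd hN hn)
  have hsq : √(crossingBound d N n) ≤ √κ * L * √A := by
    refine (Real.sqrt_le_sqrt hcb).trans (le_of_eq ?_)
    rw [Real.sqrt_mul (by positivity), Real.sqrt_mul hκ0, Real.sqrt_sq (by linarith)]
  have hlast : (16 * d ^ p / n * (d * (32 * d ^ p * d * crossingBound d N n / n)) ^ p : ℝ) ≤
      16 * d ^ p / n * (d * (32 * d ^ p * d * (κ * L ^ 2 * A) / n)) ^ p := by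
    gcongr
  have hexp : √A * (1 / n) * (A / n) ^ p = (n : ℝ) ^ (-(((d : ℝ) + 2 * p) / (2 * D))) := by
    have e1 : √A = (n : ℝ) ^ ((1 - 1 / D) * (1 / 2)) := by
      rw [Real.sqrt_eq_rpow, hA, ← Real.rpow_mul hn0.le]
    have e2 : (A / n) ^ p = (n : ℝ) ^ (-(1 / D) * p) := by
      have : A / n = (n : ℝ) ^ (-(1 / D)) := by
        rw [hA, Real.rpow_sub hn0, Real.rpow_one, Real.rpow_neg hn0.le]
        field_simp
      rw [this, ← Real.rpow_natCast, ← Real.rpow_mul hn0.le]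
    have e3 : (1 / (n : ℝ)) = (n : ℝ) ^ (-1 : ℝ) := by rw [Real.rpow_neg_one, one_div]
    rw [e1, e2, e3, ← Real.rpow_add hn0, ← Real.rpow_add hn0]
    congr 1
    have : (d : ℝ) = D + 1 := by rw [hDdef]; ring
    rw [this]
    have hD0 : D ≠ 0 := by linarith
    field_simp
    ring
  rw [halvingError]
  have hlog0 : 0 ≤ Real.log (2 * N) + 1 := by
    have := Real.log_nonneg (by linarith : (1 : ℝ) ≤ 2 * N)
    linarith
  calc _ ≤ (K * L) * ((√κ * L * √A) *
        (16 * d ^ p / n * (d * (32 * d ^ p * d * (κ * L ^ 2 * A) / n)) ^ p)) := by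
        refine mul_le_mul h1 (mul_le_mul hsq hlast ?_ ?_) ?_ ?_
        all_goals positivity
    _ = K * √κ * (16 * d ^ p) * (32 * d ^ p * d ^ 2 * κ) ^ p * L ^ (2 * p + 2) *
        (√A * (1 / n) * (A / n) ^ p) := by
        have : (d * (32 * d ^ p * d * (κ * L ^ 2 * A) / n) : ℝ) =
          (32 * d ^ p * d ^ 2 * κ) * (L ^ 2) * (A / n) := by ring
        rw [this, mul_pow, mul_pow, ← pow_mul]
        ring
    _ = _ := by rw [hexp]

/-- The exponent of the size of the coreset. -/
noncomputable def sizeExponent (d p : ℕ) : ℝ := (2 * ((d : ℝ) - 1)) / ((d : ℝ) + 2 * (p : ℝ))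

theorem sizeExponent_nonneg {d p : ℕ} (hd : 2 ≤ d) : 0 ≤ sizeExponent d p := by
  have : (2 : ℝ) ≤ d := by exact_mod_cast hd
  refine div_nonneg ?_ ?_ <;> linarith [(Nat.cast_nonneg p : (0 : ℝ) ≤ p)]

theorem sizeExponent_le_two {d p : ℕ} (hd : 2 ≤ d) : sizeExponent d p ≤ 2 := by
  have : (2 : ℝ) ≤ d := by exact_mod_cast hd
  have hp : (0 : ℝ) ≤ p := Nat.cast_nonneg p
  rw [sizeExponent, div_le_iff₀ (by linarith)]
  linarith

/-- Dividing by `log 2` gives a logarithmic unit that is at least one, so additive constants can be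
absorbed as multiples of it. -/
theorem log_le_of_le_mul_pow {x B ε : ℝ} {d : ℕ} (hx : 1 ≤ x) (hB : 1 ≤ B) (hε : 0 < ε)
    (hε1 : ε < 1) (h : x ≤ B * (2 / ε) ^ d) :
    Real.log x ≤ (Real.log B + d) * (Real.log (2 / ε) / Real.log 2) := by
  have hl2 : 0 < Real.log 2 := Real.log_pos one_lt_two
  have h2 : 2 ≤ 2 / ε := by rw [le_div_iff₀ hε]; linarith
  have hL : 1 ≤ Real.log (2 / ε) / Real.log 2 := by
    rw [le_div_iff₀ hl2, one_mul]; exact Real.log_le_log two_pos h2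
  set L := Real.log (2 / ε) / Real.log 2 with hLdef
  have h3 : Real.log (2 / ε) ≤ L := by
    have : Real.log (2 / ε) = L * Real.log 2 := by rw [hLdef]; field_simp
    rw [this]
    have := Real.log_two_lt_d9
    nlinarith
  have h4 := Real.log_le_log (by linarith) h
  rw [Real.log_mul (by linarith) (by positivity), Real.log_pow] at h4
  have h5 := Real.log_nonneg hB
  have h6 : (d : ℝ) * Real.log (2 / ε) ≤ d * L := mul_le_mul_of_nonneg_left h3 (by positivity)
  nlinarith

set_option maxHeartbeats 800000 in
/-- Coresets for points of the unit cube in the hyperplane `u j₀ = 1`, with absolute error. -/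
theorem exists_chart_coreset (d p : ℕ) (hd : 2 ≤ d) (hp : 1 ≤ p) :
    ∃ (C : ℝ) (k : ℕ), 0 < C ∧ ∀ ε : ℝ, 0 < ε → ε < 1 → ∀ (ι : Type) [Fintype ι] (j₀ : Fin d)
      (u : ι → Fin d → ℝ), (∀ i, u i j₀ = 1) → (∀ i j, |u i j| ≤ 1) → ∀ w : ι → ℝ,
      (∀ i, 0 ≤ w i) → ∑ i, w i ≤ 1 →
      ∃ w' : ι → ℝ, (∀ i, 0 ≤ w' i) ∧ (∀ i, w i = 0 → w' i = 0) ∧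
        ((Finset.univ.filter fun i => w' i ≠ 0).card : ℝ) ≤
          C * (1 / ε) ^ sizeExponent d p * Real.log (2 / ε) ^ k ∧
        ∀ y : Fin d → ℝ, (∀ j, |y j| ≤ 1) →
          |∑ i, w' i * |∑ j, u i j * y j| ^ p - ∑ i, w i * |∑ j, u i j * y j| ^ p| ≤ ε := by
  classical
  have hd0 : (0 : ℝ) < d := by exact_mod_cast (by omega : 0 < d)
  have hd1 : (1 : ℝ) ≤ d := by exact_mod_cast (by omega : 1 ≤ d)
  have hp1 : (1 : ℝ) ≤ p := by exact_mod_cast hp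
  have hl2 : 0 < Real.log 2 := Real.log_pos one_lt_two
  set a : ℝ := d * p * d ^ (p - 1) with ha
  have ha0 : 0 < a := by positivity
  clear_value a
  set B : ℝ := 2 * (8 * a + 2) ^ d + d * ((4 * d + 1) ^ d * d ^ p) with hB
  have hB1 : 1 ≤ B := by
    have : (1 : ℝ) ≤ (8 * a + 2) ^ d := one_le_pow₀ (by linarith)
    have h2 : (0 : ℝ) ≤ d * ((4 * d + 1) ^ d * d ^ p) := by positivity
    rw [hB]; linarith
  clear_value B
  set K : ℝ := Real.log B + d + 1 with hK
  have hK0 : 0 < K := by have := Real.log_nonneg hB1; positivity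
  clear_value K
  set c₆ : ℝ := K * √(2 * K + 8 * K ^ 2) * (16 * d ^ p) *
      (32 * d ^ p * d ^ 2 * (2 * K + 8 * K ^ 2)) ^ p with hc₆
  have hc₆0 : 0 < c₆ := by positivity
  clear_value c₆
  set c₇ : ℝ := c₆ * (2 * (2 * K + 1)) with hc₇
  have hc₇0 : 0 < c₇ := by positivity
  clear_value c₇
  set e := sizeExponent d p with he
  have he0 : 0 ≤ e := sizeExponent_nonneg hd
  have he2 : e ≤ 2 := sizeExponent_le_two hd
  clear_value e
  refine ⟨(c₇ ^ e + 1 + 8 * d ^ p) * (1 / Real.log 2) ^ ((2 * p + 3) * 2), (2 * p + 3) * 2,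
    by positivity, ?_⟩
  intro ε hε hε1 ι _ j₀ u hu hub w hw hW
  set L := Real.log (2 / ε) / Real.log 2 with hL
  have h2ε : 2 ≤ 2 / ε := by rw [le_div_iff₀ hε]; linarith
  have hL1 : 1 ≤ L := by
    rw [hL, le_div_iff₀ hl2, one_mul]; exact Real.log_le_log two_pos h2ε
  clear_value L
  set T := 2 / ε with hT
  have hεT : 1 / ε = T / 2 := by rw [hT]; ring
  have hT1 : 1 ≤ T ^ d := one_le_pow₀ (by linarith)
  -- The error budget: at most `ε / 4` for the cells (`2 * d / g`), `ε / 4` for the net (`2 * a /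
  -- G`), and `ε / 2` for all halvings, spread evenly over at most `(2 * K + 1) * L` rounds.
  set g := ⌈8 * d / ε⌉₊ with hg
  set G := ⌈8 * a / ε⌉₊ with hG
  have hg8 : 8 * d / ε ≤ g := Nat.le_ceil _
  have hG8 : 8 * a / ε ≤ G := Nat.le_ceil _
  have hG0 : 0 < G := Nat.ceil_pos.2 (by positivity)
  have hg0 : (0 : ℝ) < g := lt_of_lt_of_le (by positivity) hg8
  have hG0' : (0 : ℝ) < G := by exact_mod_cast hG0
  have hg2 : 2 * d ≤ g := by
    have h1 : (2 : ℝ) * d ≤ 8 * d / ε :=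
      (by linarith : (2 : ℝ) * d ≤ 8 * d).trans (le_div_self (by positivity) hε hε1.le)
    exact_mod_cast h1.trans hg8
  have hgT : (g : ℝ) + 1 ≤ (4 * d + 1) * T := by
    have h1 : (g : ℝ) < 8 * d / ε + 1 := Nat.ceil_lt_add_one (by positivity)
    have h3 : 8 * d / ε = 4 * d * T := by rw [hT]; ring
    linarith
  have hGT : 2 * (G : ℝ) + 1 ≤ (8 * a + 2) * T := by
    have h1 : (G : ℝ) < 8 * a / ε + 1 := Nat.ceil_lt_add_one (by positivity)
    have h3 : 8 * a / ε = 4 * a * T := by rw [hT]; ring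
    linarith
  set n₀ := (g + 1) ^ d * d ^ p with hn₀
  have hn₀T : (n₀ : ℝ) ≤ (4 * d + 1) ^ d * d ^ p * T ^ d := by
    have h1 : ((g : ℝ) + 1) ^ d ≤ ((4 * d + 1) * T) ^ d := pow_le_pow_left₀ (by positivity) hgT d
    rw [mul_pow] at h1
    rw [hn₀]
    push_cast
    have h2 := mul_le_mul_of_nonneg_right h1 (by positivity : (0 : ℝ) ≤ (d : ℝ) ^ p)
    linarith
  have hn₀1 : 1 ≤ n₀ := Nat.mul_pos (by positivity) (Nat.pow_pos (by omega))
  set N := Fintype.card (Fin d → Fin (2 * G + 1)) with hN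
  have hN' : (N : ℝ) = (2 * (G : ℝ) + 1) ^ d := by rw [hN]; simp
  have hNT : (N : ℝ) ≤ (8 * a + 2) ^ d * T ^ d := by
    rw [hN', ← mul_pow]; exact pow_le_pow_left₀ (by positivity) hGT d
  have hN1 : 1 ≤ N := Fintype.card_pos
  have hN1' : (1 : ℝ) ≤ N := by exact_mod_cast hN1
  have hlogB : ∀ x : ℝ, 1 ≤ x → x ≤ B * T ^ d → Real.log x + 1 ≤ K * L := by
    intro x hx hxB
    have := log_le_of_le_mul_pow hx hB1 hε hε1 hxB
    rw [← hL] at this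
    rw [hK]; linarith
  have hNB : 2 * (N : ℝ) ≤ B * T ^ d := by
    have h2 : (0 : ℝ) ≤ d * ((4 * d + 1) ^ d * d ^ p) * T ^ d := by positivity
    rw [hB]; linarith
  have hnB : ∀ n : ℕ, n ≤ n₀ → (N : ℝ) + d * n ≤ B * T ^ d := by
    intro n hn
    have h1 : (n : ℝ) ≤ n₀ := by exact_mod_cast hn
    have h2 : (d : ℝ) * n ≤ d * ((4 * d + 1) ^ d * d ^ p * T ^ d) :=
      mul_le_mul_of_nonneg_left (h1.trans hn₀T) hd0.le
    have h3 : 0 ≤ (8 * a + 2) ^ d * T ^ d := by positivity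
    rw [hB]; linarith
  have hlogn : ∀ n : ℕ, 1 ≤ n → n ≤ n₀ → Real.log n + 1 ≤ K * L := by
    intro n hn hn'
    have h1 : (1 : ℝ) ≤ n := by exact_mod_cast hn
    refine hlogB n h1 (le_trans ?_ (hnB n hn'))
    have := le_mul_of_one_le_left (by linarith : (0 : ℝ) ≤ n) hd1
    linarith
  obtain ⟨w₁, h0, hz, hm, hc, he₁⟩ := exists_cell_sparsification hp j₀ u hu hub w hw hW g hg2
  set r := Nat.clog 2 n₀ with hr
  have hrL : (r : ℝ) ≤ (2 * K + 1) * L := by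
    rcases Nat.lt_or_ge 1 n₀ with h | h
    · have h1 : (2 : ℝ) ^ (r - 1) ≤ n₀ := by
        have := (Nat.pow_pred_clog_lt_self one_lt_two h).le
        rw [← hr, Nat.pred_eq_sub_one] at this
        exact_mod_cast this
      have h2 := Real.log_le_log (by positivity) h1
      rw [Real.log_pow] at h2
      have h3 := hlogn n₀ hn₀1 le_rfl
      have h4 : (r : ℝ) - 1 ≤ ((r - 1 : ℕ) : ℝ) := by
        have : (r : ℝ) ≤ ((r - 1 : ℕ) : ℝ) + 1 := by exact_mod_cast (by omega : r ≤ r - 1 + 1)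
        linarith
      have h5 : (1 / 2 : ℝ) ≤ Real.log 2 := by linarith [Real.log_two_gt_d9]
      have h6 : (0 : ℝ) ≤ ((r - 1 : ℕ) : ℝ) := by positivity
      have h7 := mul_le_mul_of_nonneg_left h5 h6
      have h8 : (2 * K + 1) * L = 2 * (K * L) + L := by ring
      linarith
    · have : r = 0 := Nat.clog_of_right_le_one h 2
      rw [this, Nat.cast_zero]; positivity
  set δ := ε / (2 * ((2 * K + 1) * L)) with hδ
  have hδ0 : 0 < δ := by positivity
  clear_value δ
  set z : ℝ := c₇ * L ^ (2 * p + 3) / ε with hzdef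
  have hz0 : 0 < z := by positivity
  clear_value z
  -- At `n = z ^ e` the bound for one halving equals the permitted `δ`, since `1 / e` is the rate of
  -- decay; above it the bound is smaller. The second summand is the least support that
  -- `exists_halving` accepts.
  set nf := ⌈z ^ e⌉₊ + 8 * d ^ p with hnf
  have hstep : ∀ n, nf < n → n ≤ n₀ → 8 * d ^ p ≤ n ∧ halvingError d p N n ≤ δ := by
    intro n hn hn'
    refine ⟨by omega, ?_⟩
    have hn1 : 1 ≤ n := by omega
    have hn1' : (1 : ℝ) ≤ n := by exact_mod_cast hn1
    refine (halvingError_le hd hn1 hN1 hK0.le hL1 (hlogB _ (by linarith) hNB) ?_ ?_).trans ?_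
    · have h0 : (0 : ℝ) ≤ d * n := by positivity
      have := hlogB (N + d * n) (by linarith) (hnB n hn')
      linarith
    · have := hlogn n hn1 hn'
      linarith
    · rw [← hc₆]
      set β : ℝ := ((d : ℝ) + 2 * p) / (2 * ((d : ℝ) - 1)) with hβ
      have hd2 : (2 : ℝ) ≤ d := by exact_mod_cast hd
      have heβ : e * β = 1 := by
        rw [he, sizeExponent, hβ]
        have : (d : ℝ) - 1 ≠ 0 := by linarith
        field_simp
      have hβ0 : 0 < β := by
        rw [hβ]; exact div_pos (by linarith) (by linarith)
      have hzn : z ≤ (n : ℝ) ^ β := by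
        have h1 : z ^ e ≤ n := by
          have h2 : ⌈z ^ e⌉₊ ≤ n := by omega
          exact (Nat.le_ceil _).trans (by exact_mod_cast h2)
        calc z = (z ^ e) ^ β := by rw [← Real.rpow_mul hz0.le, heβ, Real.rpow_one]
          _ ≤ _ := Real.rpow_le_rpow (by positivity) h1 hβ0.le
      rw [Real.rpow_neg (by linarith)]
      have hnβ : 0 < (n : ℝ) ^ β := by positivity
      rw [← div_eq_mul_inv, div_le_iff₀ hnβ]
      calc c₆ * L ^ (2 * p + 2) = δ * z := by
            rw [hδ, hzdef, hc₇, pow_succ L (2 * p + 2)]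
            field_simp
        _ ≤ _ := mul_le_mul_of_nonneg_left hzn hδ0.le
  have hnf1 : 1 ≤ nf := by
    have := Nat.one_le_pow p d (by omega)
    omega
  obtain ⟨w₂, k0, kz, km, kc, ke⟩ := exists_iterated_halving hd p j₀ u hu hub (netPoint G)
    (abs_netPoint_le hG0) nf δ hδ0.le n₀ hstep r w₁ h0 (hm.trans_le hW) hc 
    (hc.trans ((Nat.le_pow_clog one_lt_two n₀).trans (Nat.le_mul_of_pos_right _ hnf1)))
  refine ⟨w₂, k0, fun i hi => kz i (hz i hi), ?_, ?_⟩
  · have h1 : (nf : ℝ) ≤ z ^ e + 1 + 8 * d ^ p := by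
      rw [hnf]
      push_cast
      have := Nat.ceil_lt_add_one (by positivity : 0 ≤ z ^ e)
      linarith
    have hLk : (1 : ℝ) ≤ L ^ ((2 * p + 3) * 2) := one_le_pow₀ hL1
    have hEe : (1 : ℝ) ≤ (1 / ε) ^ e := Real.one_le_rpow (by rw [le_div_iff₀ hε]; linarith) he0
    have h2 : z ^ e ≤ c₇ ^ e * (1 / ε) ^ e * L ^ ((2 * p + 3) * 2) := by
      have : z = c₇ * (1 / ε) * L ^ (2 * p + 3) := by rw [hzdef]; ring
      rw [this, Real.mul_rpow (by positivity) (by positivity),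
        Real.mul_rpow hc₇0.le (by positivity)]
      refine mul_le_mul_of_nonneg_left ?_ (by positivity)
      rw [pow_mul, ← Real.rpow_natCast (L ^ (2 * p + 3)) 2]
      exact Real.rpow_le_rpow_of_exponent_le (one_le_pow₀ hL1)
        (by exact_mod_cast he2)
    have hXX : (1 : ℝ) ≤ (1 / ε) ^ e * L ^ ((2 * p + 3) * 2) := one_le_mul_of_one_le_of_one_le hEe hLk
    have h3 : ((Finset.univ.filter fun i => w₂ i ≠ 0).card : ℝ) ≤ nf := by exact_mod_cast kc
    calc _ ≤ (c₇ ^ e + 1 + 8 * d ^ p) * ((1 / ε) ^ e * L ^ ((2 * p + 3) * 2)) := by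
          have h4 := mul_le_mul_of_nonneg_left hXX (by positivity : (0 : ℝ) ≤ 1 + 8 * d ^ p)
          linarith
      _ = _ := by rw [hL, div_pow, div_pow, one_pow]; ring
  · intro y hy
    have hη : ∀ x, |∑ i, w₂ i * |∑ j, u i j * netPoint G x j| ^ p -
        ∑ i, w i * |∑ j, u i j * netPoint G x j| ^ p| ≤ r * δ + 2 * d / g := by
      intro x
      have h1 := ke x
      have h2 := he₁ (netPoint G x) (abs_netPoint_le hG0 x)
      have h3 := abs_sub_le (∑ i, w₂ i * |∑ j, u i j * netPoint G x j| ^ p)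
        (∑ i, w₁ i * |∑ j, u i j * netPoint G x j| ^ p)
        (∑ i, w i * |∑ j, u i j * netPoint G x j| ^ p)
      linarith
    refine (abs_sum_sub_sum_le_of_net u hub w w₂ hw k0 hW ((km.trans hm).trans_le hW) hG0 _ hη y
      hy).trans ?_
    have h1 : r * δ ≤ ε / 2 := by
      have h2 : (2 * K + 1) * L * δ = ε / 2 := by rw [hδ]; field_simp
      have h3 := mul_le_mul_of_nonneg_right hrL hδ0.le
      linarith
    have h2 : 2 * (d : ℝ) / g ≤ ε / 4 := by
      rw [div_le_iff₀ hg0]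
      rw [div_le_iff₀ hε] at hg8
      linarith
    have h3 : a / G ≤ ε / 8 := by
      rw [div_le_iff₀ hG0']
      rw [div_le_iff₀ hε] at hG8
      linarith
    rw [← ha]
    linarith

/-! ### Well-conditioned coordinates -/

/-- **Auerbach's lemma**: a basis of unit vectors in which coordinates are bounded by the norm. -/
theorem exists_auerbach_basis (V : Type*) [NormedAddCommGroup V] [NormedSpace ℝ V]
    [FiniteDimensional ℝ V] :
    ∃ b : Module.Basis (Fin (Module.finrank ℝ V)) ℝ V,
      (∀ k, ‖b k‖ ≤ 1) ∧ ∀ v k, |b.repr v k| ≤ ‖v‖ := by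
  classical
  set e := Module.finBasis ℝ V with he
  have hcont : Continuous fun x : Fin (Module.finrank ℝ V) → V => |e.det x| := by
    refine continuous_abs.comp ?_
    refine Continuous.matrix_det (A := fun x => e.toMatrix x) (continuous_matrix fun i j => ?_)
    exact (LinearMap.continuous_of_finiteDimensional (e.coord i)).comp (continuous_apply j)
  have hcompact : IsCompact (Set.pi Set.univ
      fun _ : Fin (Module.finrank ℝ V) => Metric.closedBall (0 : V) 1) :=
    isCompact_univ_pi fun _ => isCompact_closedBall 0 1
  -- A tuple of unit vectors of maximal volume. Replacing its `k`-th vector by `v` multiplies the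
  -- determinant by the `k`-th coordinate of `v`, so this coordinate is at most one in absolute
  -- value if `‖v‖ ≤ 1`.
  obtain ⟨x, hx, hmax⟩ := hcompact.exists_isMaxOn
    ⟨fun _ => 0, fun _ _ => by simp⟩ hcont.continuousOn
  have hx1 : ∀ k, ‖x k‖ ≤ 1 := fun k => by simpa using hx k (Set.mem_univ k)
  have hdet : e.det x ≠ 0 := by
    intro h0
    have hy : (fun k => (‖e k‖⁻¹ : ℝ) • e k) ∈ Set.pi Set.univ
        fun _ : Fin (Module.finrank ℝ V) => Metric.closedBall (0 : V) 1 := by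
      intro k _
      simp [norm_smul, inv_mul_cancel₀ (norm_ne_zero_iff.2 (e.ne_zero k))]
    have h1 := hmax hy
    simp only [Set.mem_ofPred_eq, h0, abs_zero] at h1
    have h2 : e.det (fun k => (‖e k‖⁻¹ : ℝ) • e k) = ∏ k, ‖e k‖⁻¹ := by
      rw [AlternatingMap.map_smul_univ, Module.Basis.det_self, smul_eq_mul, mul_one]
    rw [h2] at h1
    have h3 : ∏ k, ‖e k‖⁻¹ ≠ 0 := Finset.prod_ne_zero_iff.2 fun k _ =>
      inv_ne_zero (norm_ne_zero_iff.2 (e.ne_zero k))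
    exact h3 (abs_eq_zero.1 (le_antisymm h1 (abs_nonneg _)))
  obtain ⟨hli, hsp⟩ := (e.is_basis_iff_det).2 (isUnit_iff_ne_zero.2 hdet)
  set b := Module.Basis.mk hli hsp.ge with hb
  have hbx : ∀ k, b k = x k := fun k => by rw [hb, Module.Basis.mk_apply]
  have hcoord : ∀ k v, e.det (Function.update x k v) = e.det x * b.repr v k := by
    intro k v
    have h : (e.det.toMultilinearMap.toLinearMap x k) = (e.det x) • b.coord k := by
      refine b.ext fun i => ?_
      rw [LinearMap.smul_apply, Module.Basis.coord_apply, Module.Basis.repr_self, hbx]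
      by_cases hik : i = k
      · subst hik
        simp
      · rw [Finsupp.single_eq_of_ne (Ne.symm hik), smul_zero]
        exact e.det.map_eq_zero_of_eq _ (by simp [hik] :
          Function.update x k (x i) i = Function.update x k (x i) k) hik
    have := LinearMap.congr_fun h v
    simpa using this
  have hunit : ∀ v k, ‖v‖ ≤ 1 → |b.repr v k| ≤ 1 := by
    intro v k hv
    have hmem : Function.update x k v ∈ Set.pi Set.univ
        fun _ : Fin (Module.finrank ℝ V) => Metric.closedBall (0 : V) 1 := by
      intro j _
      by_cases hj : j = k
      · subst hj; simpa using hv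
      · simpa [hj] using hx1 j
    have h1 := hmax hmem
    simp only [Set.mem_ofPred_eq, hcoord, abs_mul] at h1
    have h2 : 0 < |e.det x| := abs_pos.2 hdet
    by_contra hcon
    push Not at hcon
    nlinarith
  refine ⟨b, fun k => by rw [hbx]; exact hx1 k, fun v k => ?_⟩
  by_cases hv : v = 0
  · simp [hv]
  · have hn : 0 < ‖v‖ := norm_pos_iff.2 hv
    have h1 := hunit (‖v‖⁻¹ • v) k (by simp [norm_smul, inv_mul_cancel₀ hn.ne'])
    rw [map_smul, Finsupp.smul_apply, smul_eq_mul, abs_mul, abs_inv, abs_norm,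
      inv_mul_le_iff₀ hn, mul_one] at h1
    exact h1

/-- Coordinates in which a weighted family of functionals is well conditioned. -/
theorem exists_conditioned_coordinates {ι : Type} [Fintype ι] {d p : ℕ} (hp : 1 ≤ p)
    (a : ι → Fin d → ℝ) (w : ι → ℝ) (hw : ∀ i, 0 ≤ w i) :
    ∃ α : ι → Fin d → ℝ, (∀ k, ∑ i, |α i k| ^ p ≤ 1) ∧
      ∀ x : Fin d → ℝ, ∃ c : Fin d → ℝ,
        (∀ k, |c k| ^ p ≤ ∑ i, w i * |∑ j, a i j * x j| ^ p) ∧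
        ∀ i, w i * |∑ j, a i j * x j| ^ p = |∑ k, α i k * c k| ^ p := by
  classical
  have hp0 : p ≠ 0 := by omega
  have : Fact (1 ≤ (p : ENNReal)) := ⟨by exact_mod_cast hp⟩
  set s : ι → ℝ := fun i => w i ^ (1 / (p : ℝ)) with hs
  have hsp : ∀ i, s i ^ p = w i := fun i => by
    rw [hs]; simp only; rw [one_div]; exact Real.rpow_inv_natCast_pow (hw i) hp0
  have hs0 : ∀ i, 0 ≤ s i := fun i => Real.rpow_nonneg (hw i) _
  let B : (Fin d → ℝ) →ₗ[ℝ] (ι → ℝ) :=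
    { toFun := fun x i => s i * ∑ j, a i j * x j
      map_add' := fun x y => by
        funext i; simp [mul_add, Finset.sum_add_distrib]
      map_smul' := fun c x => by
        funext i
        simp only [Pi.smul_apply, smul_eq_mul, RingHom.id_apply, Finset.mul_sum]
        exact Finset.sum_congr rfl fun j _ => by ring }
  let A : (Fin d → ℝ) →ₗ[ℝ] PiLp (p : ENNReal) (fun _ : ι => ℝ) :=
    (WithLp.linearEquiv (p : ENNReal) ℝ (ι → ℝ)).symm.toLinearMap ∘ₗ B
  have hA : ∀ x i, A x i = s i * ∑ j, a i j * x j := fun x i => rfl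
  have hnorm : ∀ v : PiLp (p : ENNReal) (fun _ : ι => ℝ), ‖v‖ ^ p = ∑ i, |v i| ^ p := by
    intro v
    rw [PiLp.norm_eq_sum (by simp; omega)]
    simp only [ENNReal.toReal_natCast, Real.norm_eq_abs, Real.rpow_natCast, one_div]
    exact Real.rpow_inv_natCast_pow (by positivity) hp0
  -- Since `‖A x‖ ^ p` is the weighted sum, the coordinates `c` of `A x` are controlled by that sum,
  -- and the entries of the basis vectors form the new rows `α`. If the rank is below `d`, the
  -- missing coordinates are zero.
  obtain ⟨b, hb1, hb2⟩ := exists_auerbach_basis (LinearMap.range A)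
  have hr : Module.finrank ℝ (LinearMap.range A) ≤ d := by
    simpa using LinearMap.finrank_range_le A
  refine ⟨fun i k => if h : k.1 < Module.finrank ℝ (LinearMap.range A) then
    (b ⟨k, h⟩ : PiLp (p : ENNReal) (fun _ : ι => ℝ)) i else 0, fun k => ?_, fun x => ?_⟩
  · by_cases h : k.1 < Module.finrank ℝ (LinearMap.range A)
    · simp only [h, dif_pos]
      rw [← hnorm]
      exact pow_le_one₀ (norm_nonneg _) (hb1 ⟨k, h⟩)
    · simp [h, hp0]
  · have hAx : ∀ i, |A x i| ^ p = w i * |∑ j, a i j * x j| ^ p := by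
      intro i
      rw [hA, abs_mul, mul_pow, abs_of_nonneg (hs0 i), hsp]
    set v : LinearMap.range A := ⟨A x, x, rfl⟩ with hv
    refine ⟨fun k => if h : k.1 < Module.finrank ℝ (LinearMap.range A) then b.repr v ⟨k, h⟩ else 0,
      fun k => ?_, fun i => ?_⟩
    · have hsum : ∑ i, w i * |∑ j, a i j * x j| ^ p = ‖v‖ ^ p := by
        have : ‖v‖ = ‖A x‖ := rfl
        rw [this, hnorm]
        exact Finset.sum_congr rfl fun i _ => (hAx i).symm
      rw [hsum]
      refine pow_le_pow_left₀ (abs_nonneg _) ?_ p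
      by_cases h : k.1 < Module.finrank ℝ (LinearMap.range A)
      · simp only [h, dif_pos]; exact hb2 v _
      · simp only [h, dif_neg, not_false_iff, abs_zero]; exact norm_nonneg v
    · rw [← hAx]
      congr 2
      have h1 : A x i = ∑ k, b.repr v k * (b k : PiLp (p : ENNReal) (fun _ : ι => ℝ)) i := by
        have h2 := congrArg (fun z : LinearMap.range A =>
          (z : PiLp (p : ENNReal) (fun _ : ι => ℝ)) i) (b.sum_repr v)
        simp only [Submodule.coe_sum, Submodule.coe_smul, WithLp.ofLp_sum, WithLp.ofLp_smul,
          Finset.sum_apply, Pi.smul_apply, smul_eq_mul] at h2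
        exact h2.symm
      rw [h1]
      have h3 : ∀ k : Fin d, (if h : k.1 < Module.finrank ℝ (LinearMap.range A) then
          (b ⟨k, h⟩ : PiLp (p : ENNReal) (fun _ : ι => ℝ)) i else 0) *
          (if h : k.1 < Module.finrank ℝ (LinearMap.range A) then b.repr v ⟨k, h⟩ else 0) =
          (fun m : ℕ => if h : m < Module.finrank ℝ (LinearMap.range A) then
            b.repr v ⟨m, h⟩ * (b ⟨m, h⟩ : PiLp (p : ENNReal) (fun _ : ι => ℝ)) i else 0) k := by
        intro k
        by_cases h : k.1 < Module.finrank ℝ (LinearMap.range A)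
        · simp only [h, dif_pos]; ring
        · simp [h]
      rw [Finset.sum_congr rfl fun k _ => h3 k, Fin.sum_univ_eq_sum_range
        (fun m : ℕ => if h : m < Module.finrank ℝ (LinearMap.range A) then
            b.repr v ⟨m, h⟩ * (b ⟨m, h⟩ : PiLp (p : ENNReal) (fun _ : ι => ℝ)) i else 0) d,
        ← Finset.sum_subset (Finset.range_mono hr) (fun m _ hm => by
          rw [Finset.mem_range] at hm; simp [hm]), ← Fin.sum_univ_eq_sum_range]
      exact Finset.sum_congr rfl fun k _ => by simp

/-! ### Gluing the charts -/

/-- Upper bound for the size of a coreset in the form of a constant times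
`(1 / ε) ^ e * log (2 / ε) ^ k`. -/
noncomputable def sizeBound (d p k : ℕ) (C ε : ℝ) : ℝ :=
  C * (1 / ε) ^ sizeExponent d p * Real.log (2 / ε) ^ k

/-- A better accuracy by a constant factor costs a constant factor: the exponent is at most two, and
`log (2 / ε)` is at least `log 2`, so it absorbs `log m`. -/
theorem sizeBound_div_le {d p k : ℕ} (hd : 2 ≤ d) {C ε m : ℝ} (hC : 0 ≤ C) (hε : 0 < ε)
    (hε1 : ε < 1) (hm : 1 ≤ m) :
    sizeBound d p k C (ε / m) ≤ sizeBound d p k (C * m ^ 2 * (Real.log m / Real.log 2 + 1) ^ k) ε := by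
  have hl2 : 0 < Real.log 2 := Real.log_pos one_lt_two
  have he0 := sizeExponent_nonneg (p := p) hd
  have hm0 : 0 < m := by linarith
  have h2ε : 2 ≤ 2 / ε := by rw [le_div_iff₀ hε]; linarith
  have hL : Real.log 2 ≤ Real.log (2 / ε) := Real.log_le_log two_pos h2ε
  have hlm := Real.log_nonneg hm
  have h1 : (1 / (ε / m)) ^ sizeExponent d p ≤ m ^ 2 * (1 / ε) ^ sizeExponent d p := by
    have : 1 / (ε / m) = m * (1 / ε) := by field_simp
    rw [this, Real.mul_rpow hm0.le (by positivity)]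
    refine mul_le_mul_of_nonneg_right ?_ (by positivity)
    rw [← Real.rpow_natCast]
    exact Real.rpow_le_rpow_of_exponent_le hm (by exact_mod_cast sizeExponent_le_two hd)
  have h2 : Real.log (2 / (ε / m)) ≤ (Real.log m / Real.log 2 + 1) * Real.log (2 / ε) := by
    have h3 : 2 / (ε / m) = m * (2 / ε) := by field_simp
    rw [h3, Real.log_mul hm0.ne' (by positivity), add_mul, one_mul]
    have : Real.log m ≤ Real.log m / Real.log 2 * Real.log (2 / ε) := by
      rw [div_mul_eq_mul_div, le_div_iff₀ hl2]
      exact mul_le_mul_of_nonneg_left hL hlm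
    linarith
  have h3 : 0 ≤ Real.log (2 / (ε / m)) := by
    refine Real.log_nonneg ?_
    rw [le_div_iff₀ (by positivity), one_mul]
    have : ε / m ≤ ε := div_le_self hε.le hm
    linarith
  have h4 := pow_le_pow_left₀ h3 h2 k
  rw [mul_pow] at h4
  rw [sizeBound, sizeBound]
  calc C * (1 / (ε / m)) ^ sizeExponent d p * Real.log (2 / (ε / m)) ^ k
      ≤ C * (m ^ 2 * (1 / ε) ^ sizeExponent d p) *
        ((Real.log m / Real.log 2 + 1) ^ k * Real.log (2 / ε) ^ k) := by
        refine mul_le_mul (mul_le_mul_of_nonneg_left h1 hC) h4 (by positivity) (by positivity)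
    _ = _ := by ring

/-- Existence of coresets with relative error `ε`. -/
theorem exists_coreset (d p : ℕ) (hd : 2 ≤ d) (hp : 1 ≤ p) :
    ∃ (C : ℝ) (k : ℕ), 0 < C ∧ ∀ ε : ℝ, 0 < ε → ε < 1 → ∀ (ι : Type) [Fintype ι]
      (a : ι → Fin d → ℝ) (w : ι → ℝ), (∀ i, 0 ≤ w i) →
      ∃ w' : ι → ℝ, (∀ i, 0 ≤ w' i) ∧ (∀ i, w i = 0 → w' i = 0) ∧
        ((Finset.univ.filter fun i => w' i ≠ 0).card : ℝ) ≤ sizeBound d p k C ε ∧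
        ∀ x : Fin d → ℝ,
          |∑ i, w' i * |∑ j, a i j * x j| ^ p - ∑ i, w i * |∑ j, a i j * x j| ^ p| ≤
            ε * ∑ i, w i * |∑ j, a i j * x j| ^ p := by
  classical
  obtain ⟨C, k, hC, hchart⟩ := exists_chart_coreset d p hd hp
  have hd0 : (0 : ℝ) < d := by exact_mod_cast (by omega : 0 < d)
  have hd1 : (1 : ℝ) ≤ d := by exact_mod_cast (by omega : 1 ≤ d)
  have hdd : (1 : ℝ) ≤ (d : ℝ) ^ 2 := one_le_pow₀ hd1
  have hlogd : 0 ≤ Real.log ((d : ℝ) ^ 2) / Real.log 2 :=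
    div_nonneg (Real.log_nonneg hdd) (Real.log_nonneg one_le_two)
  refine ⟨d * (C * ((d : ℝ) ^ 2) ^ 2 * (Real.log ((d : ℝ) ^ 2) / Real.log 2 + 1) ^ k), k,
    by positivity, ?_⟩
  intro ε hε hε1 ι _ a w hw
  obtain ⟨α, hα, hcoord⟩ := exists_conditioned_coordinates hp a w hw
  have : Nonempty (Fin d) := ⟨⟨0, by omega⟩⟩
  have hargmax : ∀ i, ∃ j, ∀ k, |α i k| ≤ |α i j| := fun i => by
    obtain ⟨j, -, hj⟩ := Finset.exists_max_image Finset.univ (fun k => |α i k|) Finset.univ_nonempty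
    exact ⟨j, fun k => hj k (Finset.mem_univ k)⟩
  choose J hJ using hargmax
  -- Each row goes to the chart of its largest coordinate and is divided by it. The weight `|lam i|
  -- ^ p / d` undoes the scaling, and the conditioning keeps the mass of each chart at most one. In
  -- the other charts the row is represented by a unit vector of weight zero.
  set lam : ι → ℝ := fun i => α i (J i) with hlam
  set u : Fin d → ι → Fin d → ℝ := fun j i k =>
    if J i = j ∧ lam i ≠ 0 then α i k / lam i else if k = j then 1 else 0 with hu
  set W : Fin d → ι → ℝ := fun j i => if J i = j then |lam i| ^ p / d else 0 with hW
  have hu1 : ∀ j i, u j i j = 1 := by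
    intro j i
    simp only [hu]
    split_ifs with h
    · rw [← h.1]; exact div_self h.2
    · rfl
  have hub : ∀ j i k, |u j i k| ≤ 1 := by
    intro j i k
    simp only [hu]
    split_ifs with h h'
    · rw [abs_div]; exact div_le_one_of_le₀ (hJ i k) (abs_nonneg _)
    · simp
    · simp
  have hW0 : ∀ j i, 0 ≤ W j i := by
    intro j i
    simp only [hW]
    split_ifs
    · positivity
    · exact le_rfl
  have hW1 : ∀ j, ∑ i, W j i ≤ 1 := by
    intro j
    calc ∑ i, W j i ≤ ∑ i, (∑ k, |α i k| ^ p) / d := by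
          refine Finset.sum_le_sum fun i _ => ?_
          simp only [hW]
          split_ifs
          · refine div_le_div_of_nonneg_right ?_ hd0.le
            exact Finset.single_le_sum (f := fun k => |α i k| ^ p) (fun k _ => by positivity)
              (Finset.mem_univ (J i))
          · positivity
      _ = (∑ k, ∑ i, |α i k| ^ p) / d := by rw [← Finset.sum_div, Finset.sum_comm]
      _ ≤ (∑ _k : Fin d, (1 : ℝ)) / d :=
          div_le_div_of_nonneg_right (Finset.sum_le_sum fun k _ => hα k) hd0.le
      _ = 1 := by simp [hd0.ne']
  have hε' : ε / (d : ℝ) ^ 2 < 1 := (div_le_self hε.le hdd).trans_lt hε1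
  -- One factor `d` undoes the division by `d` in the weights, the other is the number of charts.
  have hch := fun j => hchart (ε / (d : ℝ) ^ 2) (by positivity) hε' ι j (u j) (hu1 j) (hub j) (W j)
    (hW0 j) (hW1 j)
  choose W' hW'0 hW'z hW'c hW'e using hch
  -- the sum over all charts
  have hsumW : ∀ (V : Fin d → ι → ℝ), (∀ j i, W j i = 0 → V j i = 0) → ∀ c : Fin d → ℝ,
      ∑ i, (V (J i) i / W (J i) i) * |∑ k, α i k * c k| ^ p =
        d * ∑ j, ∑ i, V j i * |∑ k, u j i k * c k| ^ p := by
    intro V hV c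
    rw [Finset.sum_comm, Finset.mul_sum]
    refine Finset.sum_congr rfl fun i _ => ?_
    have h1 : ∑ j, V j i * |∑ k, u j i k * c k| ^ p =
        V (J i) i * |∑ k, u (J i) i k * c k| ^ p := by
      refine Finset.sum_eq_single (J i) (fun j _ hj => ?_) (by simp)
      rw [hV j i (by simp [hW, Ne.symm hj]), zero_mul]
    rw [h1]
    by_cases hl : lam i = 0
    · have hWz : W (J i) i = 0 := by simp [hW, hl]; omega
      rw [hV _ _ hWz]; simp
    · have h2 : ∑ k, α i k * c k = lam i * ∑ k, u (J i) i k * c k := by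
        rw [Finset.mul_sum]
        refine Finset.sum_congr rfl fun k _ => ?_
        simp only [hu, hl, ne_eq, not_false_iff, and_self, if_true]
        field_simp
      have h3 : W (J i) i = |lam i| ^ p / d := by simp [hW]
      have h4 : |lam i| ^ p ≠ 0 := pow_ne_zero _ (abs_ne_zero.2 hl)
      rw [h2, h3, abs_mul, mul_pow]
      field_simp
  -- The quotient is the factor by which a chart changes the weight of a row. When `lam i = 0` the
  -- row contributes nothing, and division by zero gives it weight zero.
  refine ⟨fun i => w i * (W' (J i) i / W (J i) i), fun i => ?_, fun i hi => by simp [hi], ?_, ?_⟩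
  · exact mul_nonneg (hw i) (div_nonneg (hW'0 _ _) (hW0 _ _))
  · have h1 : (Finset.univ.filter fun i => w i * (W' (J i) i / W (J i) i) ≠ 0) ⊆
        Finset.univ.biUnion fun j => Finset.univ.filter fun i => W' j i ≠ 0 := by
      intro i hi
      rw [Finset.mem_filter] at hi
      refine Finset.mem_biUnion.2 ⟨J i, Finset.mem_univ _, Finset.mem_filter.2 ⟨Finset.mem_univ _, ?_⟩⟩
      intro h
      exact hi.2 (by rw [h]; simp)
    have h2 : ((Finset.univ.filter fun i => w i * (W' (J i) i / W (J i) i) ≠ 0).card : ℝ) ≤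
        ∑ j : Fin d, ((Finset.univ.filter fun i => W' j i ≠ 0).card : ℝ) := by
      exact_mod_cast (Finset.card_le_card h1).trans Finset.card_biUnion_le
    refine h2.trans ?_
    calc _ ≤ ∑ _j : Fin d, sizeBound d p k C (ε / (d : ℝ) ^ 2) :=
          Finset.sum_le_sum fun j _ => hW'c j
      _ = d * sizeBound d p k C (ε / (d : ℝ) ^ 2) := by simp
      _ ≤ d * sizeBound d p k _ ε :=
          mul_le_mul_of_nonneg_left (sizeBound_div_le hd hC.le hε hε1 hdd) hd0.le
      _ = _ := by rw [sizeBound, sizeBound]; ring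
  · intro x
    obtain ⟨c, hc, hcx⟩ := hcoord x
    set F := ∑ i, w i * |∑ j, a i j * x j| ^ p with hF
    have hF0 : 0 ≤ F := Finset.sum_nonneg fun i _ => mul_nonneg (hw i) (by positivity)
    have hG : ∑ i, w i * (W' (J i) i / W (J i) i) * |∑ j, a i j * x j| ^ p =
        d * ∑ j, ∑ i, W' j i * |∑ k, u j i k * c k| ^ p := by
      rw [← hsumW W' hW'z]
      refine Finset.sum_congr rfl fun i _ => ?_
      rw [← hcx]; ring
    have hF' : F = d * ∑ j, ∑ i, W j i * |∑ k, u j i k * c k| ^ p := by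
      rw [← hsumW W fun _ _ h => h, hF]
      refine Finset.sum_congr rfl fun i _ => ?_
      rw [hcx]
      by_cases hl : lam i = 0
      · have hα0 : ∀ k, α i k = 0 := fun k => by
          have h1 := hJ i k
          have h2 : α i (J i) = 0 := hl
          rw [h2, abs_zero] at h1
          exact abs_eq_zero.1 (le_antisymm h1 (abs_nonneg _))
        have hp0 : p ≠ 0 := by omega
        simp [hα0, hp0]
      · have h3 : W (J i) i ≠ 0 := by
          have : W (J i) i = |lam i| ^ p / d := by simp [hW]
          rw [this]
          exact div_ne_zero (pow_ne_zero _ (abs_ne_zero.2 hl)) hd0.ne'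
        rw [div_self h3, one_mul]
    -- scale `c`
    set ρ := F ^ (1 / (p : ℝ)) with hρ
    have hρp : ρ ^ p = F := by
      rw [hρ, one_div]; exact Real.rpow_inv_natCast_pow hF0 (by omega)
    have hρ0 : 0 ≤ ρ := Real.rpow_nonneg hF0 _
    have hcρ : ∀ k, |c k| ≤ ρ := fun k => by
      refine le_of_pow_le_pow_left₀ (by omega : p ≠ 0) hρ0 ?_
      rw [hρp]; exact hc k
    have hchartc : ∀ j, |∑ i, W' j i * |∑ k, u j i k * c k| ^ p -
        ∑ i, W j i * |∑ k, u j i k * c k| ^ p| ≤ ε / (d : ℝ) ^ 2 * F := by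
      intro j
      have hy : ∀ k, |c k / ρ| ≤ 1 := fun k => by
        rw [abs_div, abs_of_nonneg hρ0]; exact div_le_one_of_le₀ (hcρ k) hρ0
      have hsc : ∀ i, |∑ k, u j i k * c k| ^ p = F * |∑ k, u j i k * (c k / ρ)| ^ p := by
        intro i
        rw [← hρp, ← abs_of_nonneg hρ0, ← mul_pow, ← abs_mul, Finset.mul_sum, abs_of_nonneg hρ0]
        congr 2
        refine Finset.sum_congr rfl fun k _ => ?_
        by_cases h0 : ρ = 0
        · have := hcρ k
          rw [h0] at this
          have : c k = 0 := abs_eq_zero.1 (le_antisymm this (abs_nonneg _))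
          simp [this]
        · field_simp
      have h1 : ∀ V : ι → ℝ, ∑ i, V i * |∑ k, u j i k * c k| ^ p =
          F * ∑ i, V i * |∑ k, u j i k * (c k / ρ)| ^ p := by
        intro V
        rw [Finset.mul_sum]
        exact Finset.sum_congr rfl fun i _ => by rw [hsc]; ring
      rw [h1, h1, ← mul_sub, abs_mul, abs_of_nonneg hF0, mul_comm]
      exact mul_le_mul_of_nonneg_right (hW'e j _ hy) hF0
    rw [hG]
    nth_rewrite 1 [hF']
    rw [← mul_sub, ← Finset.sum_sub_distrib, abs_mul, abs_of_pos hd0]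
    calc _ ≤ (d : ℝ) * ∑ _j : Fin d, ε / (d : ℝ) ^ 2 * F :=
          mul_le_mul_of_nonneg_left ((Finset.abs_sum_le_sum_abs _ _).trans
            (Finset.sum_le_sum fun j _ => hchartc j)) hd0.le
      _ = ε * F := by
          simp only [Finset.sum_const, Finset.card_univ, Fintype.card_fin, nsmul_eq_mul]
          field_simp

namespace StreamRAM

/-! ### A small imperative language and its compilation -/

/-- Expressions over variables and a heap. -/
inductive Ex
  | lit (z : ℤ)
  | var (a : ℕ)
  | op (o : BinOp) (e f : Ex)
  | ld (e : Ex)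

/-- Commands: assignment, heap assignment, reading the stream, and control flow. -/
inductive Cm
  | skip
  | set (a : ℕ) (e : Ex)
  | put (e f : Ex)
  | nxt (a : ℕ)
  | seq (P Q : Cm)
  | ite (e : Ex) (P Q : Cm)
  | whl (e : Ex) (P : Cm)

/-- Values of the variables, heap contents and the unread input. -/
structure HState where
  v : ℕ → ℤ
  h : ℤ → ℤ
  inp : List ℤ

def Ex.eval (σ : HState) : Ex → ℤ
  | .lit z => z
  | .var a => σ.v a
  | .op o e f => o.eval (e.eval σ) (f.eval σ)
  | .ld e => σ.h (e.eval σ)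

/-- All heap accesses of the expression are below `cap`. -/
def Ex.Ok (cap : ℕ) (σ : HState) : Ex → Prop
  | .lit _ => True
  | .var _ => True
  | .op _ e f => e.Ok cap σ ∧ f.Ok cap σ
  | .ld e => e.Ok cap σ ∧ 0 ≤ e.eval σ ∧ e.eval σ < cap

/-- A strict bound for the variables of an expression. -/
def Ex.varBound : Ex → ℕ
  | .lit _ => 0
  | .var a => a + 1
  | .op _ e f => max e.varBound f.varBound
  | .ld e => e.varBound

/-- The number of temporary cells needed by an expression. -/
def Ex.depth : Ex → ℕ
  | .lit _ => 1
  | .var _ => 1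
  | .op _ e f => max e.depth (f.depth + 1)
  | .ld e => max e.depth 2

/-- If all inputs are at most `X`, then all intermediate values are at most `X ^ size`. -/
def Ex.size (HB : ℕ) : Ex → ℕ
  | .lit z => z.natAbs + 1
  | .var _ => 1
  | .op _ e f => e.size HB + f.size HB
  | .ld e => e.size HB + HB + 1

def Cm.varBound : Cm → ℕ
  | .skip => 0
  | .set a e => max (a + 1) e.varBound
  | .put e f => max e.varBound f.varBound
  | .nxt a => a + 1
  | .seq P Q => max P.varBound Q.varBound
  | .ite e P Q => max e.varBound (max P.varBound Q.varBound)
  | .whl e P => max e.varBound P.varBound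

def Cm.depth : Cm → ℕ
  | .skip => 0
  | .set _ e => e.depth + 1
  | .put e f => max e.depth (f.depth + 1) + 3
  | .nxt _ => 0
  | .seq P Q => max P.depth Q.depth
  | .ite e P Q => max e.depth (max P.depth Q.depth)
  | .whl e P => max e.depth P.depth

def Cm.size (HB : ℕ) : Cm → ℕ
  | .skip => 0
  | .set _ e => e.size HB
  | .put e f => e.size HB + f.size HB + HB + 1
  | .nxt _ => 1
  | .seq P Q => P.size HB + Q.size HB
  | .ite e P Q => e.size HB + P.size HB + Q.size HB
  | .whl e P => e.size HB + P.size HB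

/-- Code that leaves the value of the expression in cell `t`. -/
def Ex.comp (HB : ℕ) : Ex → ℕ → Prog
  | .lit z, t => .instr (.const t z)
  | .var a, t => .seq (.instr (.const t 0)) (.instr (.op .add t t a))
  | .op o e f, t => .seq (e.comp HB t) (.seq (f.comp HB (t + 1)) (.instr (.op o t t (t + 1))))
  | .ld e, t => .seq (e.comp HB t) (.seq (.instr (.const (t + 1) HB))
      (.seq (.instr (.op .add t t (t + 1))) (.instr (.load t t))))

/-- Compilation; variables are cells below `TB`, the heap starts at `HB`. -/
def Cm.comp (TB HB : ℕ) : Cm → Prog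
  | .skip => .skip
  | .set a e => .seq (e.comp HB TB) (.seq (.instr (.const (TB + 1) 0))
      (.instr (.op .add a TB (TB + 1))))
  | .put e f => .seq (e.comp HB TB) (.seq (f.comp HB (TB + 1))
      (.seq (.instr (.const (TB + 2) HB)) (.seq (.instr (.op .add TB TB (TB + 2)))
        (.instr (.store TB (TB + 1))))))
  | .nxt a => .instr (.next a)
  | .seq P Q => .seq (P.comp TB HB) (Q.comp TB HB)
  | .ite e P Q => .seq (e.comp HB TB) (.ite TB (P.comp TB HB) (Q.comp TB HB))
  | .whl e P => .seq (e.comp HB TB) (.while TB (.seq (P.comp TB HB) (e.comp HB TB)))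

/-- Runs of commands in which all heap accesses are below `cap` and all stored values at most `X`. -/
inductive HEx (X : ℤ) (cap : ℕ) : Cm → HState → HState → Prop
  | skip (σ : HState) : HEx X cap .skip σ σ
  | set {a : ℕ} {e : Ex} {σ : HState} (ho : e.Ok cap σ) (hb : |e.eval σ| ≤ X) :
      HEx X cap (.set a e) σ { σ with v := Function.update σ.v a (e.eval σ) }
  | put {e f : Ex} {σ : HState} (he : e.Ok cap σ) (hf : f.Ok cap σ) (h0 : 0 ≤ e.eval σ)
      (h1 : e.eval σ < cap) (hb : |f.eval σ| ≤ X) :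
      HEx X cap (.put e f) σ { σ with h := Function.update σ.h (e.eval σ) (f.eval σ) }
  | nxt {a : ℕ} {σ : HState} {z : ℤ} {rest : List ℤ} (hi : σ.inp = z :: rest) (hb : |z| ≤ X) :
      HEx X cap (.nxt a) σ { σ with v := Function.update σ.v a z, inp := rest }
  | seq {P Q : Cm} {σ τ ρ : HState} (h₁ : HEx X cap P σ τ) (h₂ : HEx X cap Q τ ρ) :
      HEx X cap (.seq P Q) σ ρ
  | ite_true {e : Ex} {P Q : Cm} {σ τ : HState} (ho : e.Ok cap σ) (h0 : e.eval σ ≠ 0)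
      (h : HEx X cap P σ τ) : HEx X cap (.ite e P Q) σ τ
  | ite_false {e : Ex} {P Q : Cm} {σ τ : HState} (ho : e.Ok cap σ) (h0 : e.eval σ = 0)
      (h : HEx X cap Q σ τ) : HEx X cap (.ite e P Q) σ τ
  | whl_true {e : Ex} {P : Cm} {σ τ ρ : HState} (ho : e.Ok cap σ) (h0 : e.eval σ ≠ 0)
      (h₁ : HEx X cap P σ τ) (h₂ : HEx X cap (.whl e P) τ ρ) : HEx X cap (.whl e P) σ ρ
  | whl_false {e : Ex} {P : Cm} {σ : HState} (ho : e.Ok cap σ) (h0 : e.eval σ = 0) :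
      HEx X cap (.whl e P) σ σ

/-- The machine state `s` represents `σ`. -/
structure Rep (TB HB : ℕ) (s : State) (σ : HState) : Prop where
  v : ∀ a, a < TB → s.mem a = σ.v a
  h : ∀ a : ℕ, s.mem (HB + a) = σ.h a
  inp : s.input = σ.inp

/-- All variables and heap cells in use are at most `X`. -/
structure Bounded (TB cap : ℕ) (X : ℤ) (σ : HState) : Prop where
  v : ∀ a, a < TB → |σ.v a| ≤ X
  h : ∀ a : ℤ, 0 ≤ a → a < cap → |σ.h a| ≤ X

/-- Exponents at most add up, since `X ^ a + X ^ b ≤ X ^ a * X ^ b` for powers that are at least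
two. -/
theorem BinOp.abs_eval_le {X : ℤ} (hX : 2 ≤ X) {a b : ℕ} (ha : 1 ≤ a) (hb : 1 ≤ b) {x y : ℤ}
    (hx : |x| ≤ X ^ a) (hy : |y| ≤ X ^ b) (o : BinOp) : |o.eval x y| ≤ X ^ (a + b) := by
  have h2a : 2 ≤ X ^ a := hX.trans (le_self_pow₀ (by omega) (by omega))
  have h2b : 2 ≤ X ^ b := hX.trans (le_self_pow₀ (by omega) (by omega))
  have hsum : X ^ a + X ^ b ≤ X ^ (a + b) := by rw [pow_add]; nlinarith
  cases o with
  | add => exact (abs_add_le x y).trans (by linarith)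
  | sub => exact (abs_sub x y).trans (by linarith)
  | mul =>
    rw [BinOp.eval, abs_mul, pow_add]
    exact mul_le_mul hx hy (abs_nonneg _) (by linarith)
  | div =>
    have h1 : |Int.fdiv x y| ≤ |x| := by
      rcases eq_or_ne y 0 with rfl | hy0
      · simp
      · have h2 := Int.fdiv_mul_add_fmod x y
        rcases lt_or_gt_of_ne hy0 with hneg | hpos
        · rw [← Int.neg_fdiv_neg, Int.fdiv_eq_ediv_of_nonneg _ (by omega)]
          have := Int.abs_ediv_le_abs (-x) (-y)
          rwa [abs_neg] at this
        · rw [Int.fdiv_eq_ediv_of_nonneg _ hpos.le]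
          exact Int.abs_ediv_le_abs x y
    exact h1.trans (by linarith)
  | lt =>
    rw [BinOp.eval]
    split_ifs <;> simp <;> linarith

theorem Ex.one_le_size (HB : ℕ) (e : Ex) : 1 ≤ e.size HB := by
  induction e with
  | lit z => simp [Ex.size]
  | var a => simp [Ex.size]
  | op o e f h₁ h₂ => simp only [Ex.size]; omega
  | ld e h => simp only [Ex.size]; omega

/-- The exponent depends only on the expression. A fixed program therefore needs words only a
constant factor longer than the stored numbers. -/
theorem Ex.abs_eval_le {HB TB cap : ℕ} {X : ℤ} (hX : 2 ≤ X) {σ : HState} (hσ : Bounded TB cap X σ)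
    (e : Ex) (ho : e.Ok cap σ) (hv : e.varBound ≤ TB) : |e.eval σ| ≤ X ^ e.size HB := by
  have hX1 : 1 ≤ X := by omega
  induction e with
  | lit z =>
    have h1 : (z.natAbs : ℤ) < 2 ^ z.natAbs := by exact_mod_cast Nat.lt_two_pow_self
    have h2 : (2 : ℤ) ^ z.natAbs ≤ X ^ z.natAbs := pow_le_pow_left₀ (by norm_num) hX _
    have h3 : X ^ z.natAbs ≤ X ^ (z.natAbs + 1) := pow_le_pow_right₀ hX1 (by omega)
    rw [Ex.eval, Ex.size, Int.abs_eq_natAbs]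
    omega
  | var a =>
    simp only [Ex.varBound] at hv
    simpa [Ex.eval, Ex.size] using hσ.v a (by omega)
  | op o e f h₁ h₂ =>
    simp only [Ex.varBound, max_le_iff] at hv
    exact BinOp.abs_eval_le hX (Ex.one_le_size HB e) (Ex.one_le_size HB f) (h₁ ho.1 hv.1)
      (h₂ ho.2 hv.2) o
  | ld e h =>
    refine (hσ.h _ ho.2.1 ho.2.2).trans ?_
    exact le_self_pow₀ hX1 (by simp [Ex.size])

theorem State.get_eq {S : ℕ} {s : State} {a : ℕ} (h : a < S) : s.get S a = some (s.mem a) := by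
  rw [State.get, if_pos ⟨by omega, by exact_mod_cast h⟩]; simp

theorem State.set_eq {S w : ℕ} {s : State} {a : ℕ} {x : ℤ} (h : a < S) (hx : |x| < 2 ^ w) :
    s.set S w a x = some { s with mem := Function.update s.mem a x } := by
  rw [State.set, if_pos ⟨by omega, by exact_mod_cast h, hx⟩]; simp

theorem exec_const {S w : ℕ} {s : State} {a : ℕ} {z : ℤ} (h : a < S) (hz : |z| < 2 ^ w) :
    Exec S w (.instr (.const a z)) s { s with mem := Function.update s.mem a z } :=
  .instr (State.set_eq h hz)

theorem exec_op {S w : ℕ} {s : State} {a b c : ℕ} {o : BinOp} (ha : a < S) (hb : b < S) (hc : c < S)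
    (hz : |o.eval (s.mem b) (s.mem c)| < 2 ^ w) :
    Exec S w (.instr (.op o a b c)) s
      { s with mem := Function.update s.mem a (o.eval (s.mem b) (s.mem c)) } := by
  refine .instr ?_
  rw [Instr.step, State.get_eq hb, State.get_eq hc]
  exact State.set_eq ha hz

theorem Rep.update_temp {TB HB : ℕ} {s : State} {σ : HState} (h : Rep TB HB s σ) {t : ℕ}
    (ht : TB ≤ t) (ht' : t < HB) (x : ℤ) :
    Rep TB HB { s with mem := Function.update s.mem t x } σ where
  v a ha := by simp only [Function.update_of_ne (by omega : a ≠ t)]; exact h.v a ha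
  h a := by simp only [Function.update_of_ne (by omega : HB + a ≠ t)]; exact h.h a
  inp := h.inp

/-- Code with target `t` leaves all cells below `t` alone. This keeps the variables intact and lets
a left operand in `t` survive the evaluation of the right operand in `t + 1`. -/
theorem Ex.exec_comp {S w TB HB cap : ℕ} {X : ℤ} (hX : 2 ≤ X) (hS : HB + cap ≤ S) {σ : HState}
    (hσ : Bounded TB cap X σ) (e : Ex) (ho : e.Ok cap σ) (hv : e.varBound ≤ TB) (t : ℕ) (ht : TB ≤ t)
    (hd : t + e.depth ≤ HB) (hw : X ^ e.size HB < 2 ^ w) (s : State) (hs : Rep TB HB s σ) :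
    ∃ s', Exec S w (e.comp HB t) s s' ∧ Rep TB HB s' σ ∧ s'.mem t = e.eval σ ∧
      ∀ a, a < t → s'.mem a = s.mem a := by
  have hX1 : 1 ≤ X := by omega
  induction e generalizing t s with
  | lit z =>
    have hz := (Ex.abs_eval_le (HB := HB) hX hσ (.lit z) ho hv).trans_lt hw
    simp only [Ex.depth] at hd
    exact ⟨_, exec_const (by omega) hz, hs.update_temp ht (by omega) z, by simp [Ex.eval],
      fun a ha => Function.update_of_ne (by omega) _ _⟩
  | var a =>
    have hz := (Ex.abs_eval_le (HB := HB) hX hσ (.var a) ho hv).trans_lt hw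
    simp only [Ex.depth] at hd
    simp only [Ex.varBound] at hv
    have h1 : s.mem a = σ.v a := hs.v a (by omega)
    have hpos : (0 : ℤ) < 2 ^ w := by positivity
    have he := exec_op (S := S) (w := w) (s := { s with mem := Function.update s.mem t 0 })
      (a := t) (b := t) (c := a) (o := .add) (by omega) (by omega) (by omega) (by
        simpa [Ex.eval, BinOp.eval, Function.update_of_ne (by omega : a ≠ t), h1] using hz)
    refine ⟨_, .seq (exec_const (by omega) (by simp)) he,
      (hs.update_temp ht (by omega) _).update_temp ht (by omega) _, ?_, fun b hb => ?_⟩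
    · simp [BinOp.eval, Function.update_of_ne (by omega : a ≠ t), h1, Ex.eval]
    · simp [Function.update_of_ne (by omega : b ≠ t)]
  | op o e f h₁ h₂ =>
    have hz := (Ex.abs_eval_le (HB := HB) hX hσ (.op o e f) ho hv).trans_lt hw
    simp only [Ex.depth] at hd
    simp only [Ex.varBound, max_le_iff] at hv
    simp only [Ex.size] at hw
    have hde := le_max_left e.depth (f.depth + 1)
    have hdf := le_max_right e.depth (f.depth + 1)
    obtain ⟨s₁, e₁, r₁, m₁, f₁⟩ := h₁ ho.1 hv.1 t ht (by omega)
      ((pow_le_pow_right₀ hX1 (by omega)).trans_lt hw) s hs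
    obtain ⟨s₂, e₂, r₂, m₂, f₂⟩ := h₂ ho.2 hv.2 (t + 1) (by omega) (by omega)
      ((pow_le_pow_right₀ hX1 (by omega)).trans_lt hw) s₁ r₁
    have hf0 : 1 ≤ f.depth := by cases f <;> simp [Ex.depth]
    have hev : o.eval (s₂.mem t) (s₂.mem (t + 1)) = (Ex.op o e f).eval σ := by
      rw [m₂, f₂ t (by omega), m₁]; rfl
    refine ⟨_, .seq e₁ (.seq e₂ (exec_op (by omega) (by omega) (by omega) (by rw [hev]; exact hz))),
      r₂.update_temp ht (by omega) _, by simp [hev], fun a ha => ?_⟩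
    simp only [Function.update_of_ne (by omega : a ≠ t)]
    rw [f₂ a (by omega), f₁ a ha]
  | ld e h =>
    have hz := (Ex.abs_eval_le (HB := HB) hX hσ (.ld e) ho hv).trans_lt hw
    have hze := Ex.abs_eval_le (HB := HB) hX hσ e ho.1 hv
    simp only [Ex.depth] at hd
    simp only [Ex.size] at hw
    have hde := le_max_left e.depth 2
    have hd2 := le_max_right e.depth 2
    obtain ⟨s₁, e₁, r₁, m₁, f₁⟩ := h ho.1 hv t ht (by omega)
      ((pow_le_pow_right₀ hX1 (by omega)).trans_lt hw) s hs
    -- The absolute address `HB + k` is formed in a cell and has to fit into a word; the summand `HB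
    -- + 1` in the size of a heap access provides for it.
    have hHB : (HB : ℤ) < X ^ HB := by
      have h1 : (HB : ℤ) < 2 ^ HB := by exact_mod_cast Nat.lt_two_pow_self
      exact h1.trans_le (pow_le_pow_left₀ (by norm_num) hX _)
    have hHB' : |(HB : ℤ)| < 2 ^ w := by
      rw [abs_of_nonneg (by omega)]
      exact (hHB.trans_le (pow_le_pow_right₀ hX1 (by omega))).trans hw
    obtain ⟨k, hk⟩ := Int.eq_ofNat_of_zero_le ho.2.1
    have hkcap : k < cap := by have := ho.2.2; rw [hk] at this; exact_mod_cast this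
    have hsum : |(k : ℤ) + HB| < 2 ^ w := by
      rw [abs_of_nonneg (by omega)]
      refine lt_of_le_of_lt ?_ hw
      rw [hk, abs_of_nonneg (by omega)] at hze
      have h1 : X ^ (e.size HB + HB + 1) = X ^ e.size HB * X ^ HB * X := by
        rw [pow_succ, pow_add]
      have h2 : 1 ≤ X ^ e.size HB := one_le_pow₀ hX1
      have h3 : 1 ≤ X ^ HB := one_le_pow₀ hX1
      rw [h1]
      nlinarith [mul_nonneg (sub_nonneg.2 h2) (sub_nonneg.2 h3), mul_pos (by omega : 0 < X ^ e.size HB)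
        (by omega : 0 < X ^ HB)]
    set s₂ : State := { s₁ with mem := Function.update s₁.mem (t + 1) HB } with hs₂
    have e₂ : Exec S w (.instr (.const (t + 1) HB)) s₁ s₂ := exec_const (by omega) hHB'
    have hadd : BinOp.eval .add (s₂.mem t) (s₂.mem (t + 1)) = (k : ℤ) + HB := by
      simp [hs₂, BinOp.eval, m₁, hk]
    have e₃ := exec_op (S := S) (w := w) (s := s₂) (a := t) (b := t) (c := t + 1) (o := .add)
      (by omega) (by omega) (by omega) (by rw [hadd]; exact hsum)
    rw [hadd] at e₃
    set s₃ : State := { s₂ with mem := Function.update s₂.mem t ((k : ℤ) + HB) } with hs₃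
    have r₃ : Rep TB HB s₃ σ :=
      (r₁.update_temp (by omega) (by omega) _).update_temp (by omega) (by omega) _
    have hget : s₃.mem (HB + k) = σ.h k := r₃.h k
    have hevk : (Ex.ld e).eval σ = σ.h k := by simp only [Ex.eval, hk]
    have e₄ : Exec S w (.instr (.load t t)) s₃
        { s₃ with mem := Function.update s₃.mem t (σ.h k) } := by
      refine .instr ?_
      rw [Instr.step, State.get_eq (by omega : t < S)]
      have : s₃.mem t = ((HB + k : ℕ) : ℤ) := by simp [hs₃, add_comm]
      rw [Option.bind_some, this, State.get_eq (by omega : HB + k < S), Option.bind_some, hget]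
      exact State.set_eq (by omega) (hevk ▸ hz)
    refine ⟨_, .seq e₁ (.seq e₂ (.seq e₃ e₄)), r₃.update_temp ht (by omega) _, by simp [hevk],
      fun a ha => ?_⟩
    simp only [hs₃, hs₂, Function.update_of_ne (by omega : a ≠ t),
      Function.update_of_ne (by omega : a ≠ t + 1)]
    exact f₁ a ha

/-- Compiled commands simulate the runs of the language. -/
theorem HEx.exec_comp {S w TB HB cap : ℕ} {X : ℤ} (hX : 2 ≤ X) (hS : HB + cap ≤ S) {c : Cm}
    {σ τ : HState} (h : HEx X cap c σ τ) (hσ : Bounded TB cap X σ) (hv : c.varBound ≤ TB)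
    (hd : TB + c.depth + 3 ≤ HB) (hw : X ^ c.size HB < 2 ^ w) (s : State) (hs : Rep TB HB s σ) :
    ∃ t, Exec S w (c.comp TB HB) s t ∧ Rep TB HB t τ ∧ Bounded TB cap X τ := by
  have hX1 : 1 ≤ X := by omega
  have hpos : (0 : ℤ) < 2 ^ w := by positivity
  induction h generalizing s with
  | skip σ => exact ⟨s, .skip s, hs, hσ⟩
  | @set a e σ ho hb =>
    simp only [Cm.varBound, max_le_iff] at hv
    simp only [Cm.depth] at hd
    simp only [Cm.size] at hw
    obtain ⟨s₁, e₁, r₁, m₁, -⟩ := e.exec_comp hX hS hσ ho hv.2 TB le_rfl (by omega) hw s hs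
    have hz := (Ex.abs_eval_le (HB := HB) hX hσ e ho hv.2).trans_lt hw
    set s₂ : State := { s₁ with mem := Function.update s₁.mem (TB + 1) 0 } with hs₂
    have e₂ : Exec S w (.instr (.const (TB + 1) 0)) s₁ s₂ := exec_const (by omega) (by simp)
    have hadd : BinOp.eval .add (s₂.mem TB) (s₂.mem (TB + 1)) = e.eval σ := by
      simp [hs₂, BinOp.eval, m₁]
    have e₃ := exec_op (S := S) (w := w) (s := s₂) (a := a) (b := TB) (c := TB + 1) (o := .add)
      (by omega) (by omega) (by omega) (by rw [hadd]; exact hz)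
    rw [hadd] at e₃
    have r₂ : Rep TB HB s₂ σ := r₁.update_temp (by omega) (by omega) _
    refine ⟨_, .seq e₁ (.seq e₂ e₃), ⟨fun b hb' => ?_, fun b => ?_, r₂.inp⟩, ⟨fun b hb' => ?_, hσ.h⟩⟩
    · by_cases hba : b = a
      · subst hba; simp
      · simp only [Function.update_of_ne hba]; exact r₂.v b hb'
    · simp only [Function.update_of_ne (by omega : HB + b ≠ a)]; exact r₂.h b
    · by_cases hba : b = a
      · subst hba; simpa using hb
      · simp only [Function.update_of_ne hba]; exact hσ.v b hb'
  | @put e f σ he hf h0 h1 hb =>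
    simp only [Cm.varBound, max_le_iff] at hv
    simp only [Cm.depth] at hd
    simp only [Cm.size] at hw
    have hde := le_max_left e.depth (f.depth + 1)
    have hdf := le_max_right e.depth (f.depth + 1)
    obtain ⟨s₁, e₁, r₁, m₁, -⟩ := e.exec_comp hX hS hσ he hv.1 TB le_rfl (by omega)
      ((pow_le_pow_right₀ hX1 (by omega)).trans_lt hw) s hs
    obtain ⟨s₂, e₂, r₂, m₂, f₂⟩ := f.exec_comp hX hS hσ hf hv.2 (TB + 1) (by omega) (by omega)
      ((pow_le_pow_right₀ hX1 (by omega)).trans_lt hw) s₁ r₁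
    have hze := Ex.abs_eval_le (HB := HB) hX hσ e he hv.1
    have hHB : (HB : ℤ) < X ^ HB := by
      have h1 : (HB : ℤ) < 2 ^ HB := by exact_mod_cast Nat.lt_two_pow_self
      exact h1.trans_le (pow_le_pow_left₀ (by norm_num) hX _)
    have hHB' : |(HB : ℤ)| < 2 ^ w := by
      rw [abs_of_nonneg (by omega)]
      exact (hHB.trans_le (pow_le_pow_right₀ hX1 (by omega))).trans hw
    obtain ⟨k, hk⟩ := Int.eq_ofNat_of_zero_le h0
    have hkcap : k < cap := by rw [hk] at h1; exact_mod_cast h1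
    have hsum : |(k : ℤ) + HB| < 2 ^ w := by
      rw [abs_of_nonneg (by omega)]
      refine lt_of_le_of_lt ?_ hw
      rw [hk, abs_of_nonneg (by omega)] at hze
      have h1 : X ^ e.size HB * X ^ HB * X ≤ X ^ (e.size HB + f.size HB + HB + 1) := by
        rw [← pow_add, ← pow_succ]
        exact pow_le_pow_right₀ hX1 (by omega)
      have h2 : 1 ≤ X ^ e.size HB := one_le_pow₀ hX1
      have h3 : 1 ≤ X ^ HB := one_le_pow₀ hX1
      refine le_trans ?_ h1
      nlinarith [mul_nonneg (sub_nonneg.2 h2) (sub_nonneg.2 h3), mul_pos (by omega : 0 < X ^ e.size HB)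
        (by omega : 0 < X ^ HB)]
    have hzf : |f.eval σ| < 2 ^ w := (Ex.abs_eval_le (HB := HB) hX hσ f hf hv.2).trans_lt
      ((pow_le_pow_right₀ hX1 (by omega)).trans_lt hw)
    set s₃ : State := { s₂ with mem := Function.update s₂.mem (TB + 2) HB } with hs₃
    have e₃ : Exec S w (.instr (.const (TB + 2) HB)) s₂ s₃ := exec_const (by omega) hHB'
    have hadd : BinOp.eval .add (s₃.mem TB) (s₃.mem (TB + 2)) = (k : ℤ) + HB := by
      simp [hs₃, BinOp.eval, f₂ TB (by omega), m₁, hk]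
    have e₄ := exec_op (S := S) (w := w) (s := s₃) (a := TB) (b := TB) (c := TB + 2) (o := .add)
      (by omega) (by omega) (by omega) (by rw [hadd]; exact hsum)
    rw [hadd] at e₄
    set s₄ : State := { s₃ with mem := Function.update s₃.mem TB ((k : ℤ) + HB) } with hs₄
    have r₄ : Rep TB HB s₄ σ :=
      (r₂.update_temp (by omega) (by omega) _).update_temp (by omega) (by omega) _
    have e₅ : Exec S w (.instr (.store TB (TB + 1))) s₄
        { s₄ with mem := Function.update s₄.mem (HB + k) (f.eval σ) } := by
      refine .instr ?_
      rw [Instr.step, State.get_eq (by omega : TB < S)]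
      have h5 : s₄.mem TB = ((HB + k : ℕ) : ℤ) := by simp [hs₄, add_comm]
      have h6 : s₄.mem (TB + 1) = f.eval σ := by simp [hs₄, hs₃, m₂]
      rw [Option.bind_some, State.get_eq (by omega : TB + 1 < S), Option.bind_some, h5, h6]
      exact State.set_eq (by omega) hzf
    refine ⟨_, .seq e₁ (.seq e₂ (.seq e₃ (.seq e₄ e₅))), ⟨fun b hb' => ?_, fun b => ?_, r₄.inp⟩,
      ⟨hσ.v, fun b hb0 hbc => ?_⟩⟩
    · simp only [Function.update_of_ne (by omega : b ≠ HB + k)]; exact r₄.v b hb'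
    · rw [hk]
      by_cases hbk : b = k
      · subst hbk; simp
      · simp only [Function.update_of_ne (by omega : HB + b ≠ HB + k)]
        rw [Function.update_of_ne (by simpa using hbk)]
        exact r₄.h b
    · by_cases hbk : b = e.eval σ
      · subst hbk; simpa using hb
      · simp only [Function.update_of_ne hbk]; exact hσ.h b hb0 hbc
  | @nxt a σ z rest hi hb =>
    simp only [Cm.varBound] at hv
    simp only [Cm.size, pow_one] at hw
    refine ⟨{ s with mem := Function.update s.mem a z, input := rest }, .instr ?_,
      ⟨fun b hb' => ?_, fun b => ?_, rfl⟩, ⟨fun b hb' => ?_, hσ.h⟩⟩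
    · rw [Instr.step, hs.inp, hi]
      exact State.set_eq (s := { s with input := rest }) (by omega) (hb.trans_lt hw)
    · by_cases hba : b = a
      · subst hba; simp
      · simp only [Function.update_of_ne hba]; exact hs.v b hb'
    · simp only [Function.update_of_ne (by omega : HB + b ≠ a)]; exact hs.h b
    · by_cases hba : b = a
      · subst hba; simpa using hb
      · simp only [Function.update_of_ne hba]; exact hσ.v b hb'
  | seq h₁ h₂ ih₁ ih₂ =>
    simp only [Cm.varBound, max_le_iff] at hv
    simp only [Cm.depth] at hd
    simp only [Cm.size] at hw
    rename_i P Q _ _ _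
    have hdP := le_max_left P.depth Q.depth
    have hdQ := le_max_right P.depth Q.depth
    obtain ⟨t₁, e₁, r₁, b₁⟩ := ih₁ hσ hv.1 (by omega)
      ((pow_le_pow_right₀ hX1 (by omega)).trans_lt hw) s hs
    obtain ⟨t₂, e₂, r₂, b₂⟩ := ih₂ b₁ hv.2 (by omega)
      ((pow_le_pow_right₀ hX1 (by omega)).trans_lt hw) t₁ r₁
    exact ⟨t₂, .seq e₁ e₂, r₂, b₂⟩
  | ite_true ho h0 h ih =>
    simp only [Cm.varBound, max_le_iff] at hv
    simp only [Cm.depth] at hd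
    simp only [Cm.size] at hw
    rename_i e P Q _ _
    have hde := le_max_left e.depth (max P.depth Q.depth)
    have hdP := (le_max_left P.depth Q.depth).trans (le_max_right e.depth (max P.depth Q.depth))
    obtain ⟨t₁, e₁, r₁, m₁, -⟩ := e.exec_comp hX hS hσ ho hv.1 TB le_rfl (by omega)
      ((pow_le_pow_right₀ hX1 (by omega)).trans_lt hw) s hs
    obtain ⟨t₂, e₂, r₂, b₂⟩ := ih hσ hv.2.1 (by omega)
      ((pow_le_pow_right₀ hX1 (by omega)).trans_lt hw) t₁ r₁
    exact ⟨t₂, .seq e₁ (.ite_true (State.get_eq (by omega)) (by rw [m₁]; exact h0) e₂), r₂, b₂⟩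
  | ite_false ho h0 h ih =>
    simp only [Cm.varBound, max_le_iff] at hv
    simp only [Cm.depth] at hd
    simp only [Cm.size] at hw
    rename_i e P Q _ _
    have hde := le_max_left e.depth (max P.depth Q.depth)
    have hdQ := (le_max_right P.depth Q.depth).trans (le_max_right e.depth (max P.depth Q.depth))
    obtain ⟨t₁, e₁, r₁, m₁, -⟩ := e.exec_comp hX hS hσ ho hv.1 TB le_rfl (by omega)
      ((pow_le_pow_right₀ hX1 (by omega)).trans_lt hw) s hs
    obtain ⟨t₂, e₂, r₂, b₂⟩ := ih hσ hv.2.2 (by omega)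
      ((pow_le_pow_right₀ hX1 (by omega)).trans_lt hw) t₁ r₁
    refine ⟨t₂, .seq e₁ (.ite_false ?_ e₂), r₂, b₂⟩
    rw [State.get_eq (by omega), m₁, h0]
  | whl_true ho h0 h₁ h₂ ih₁ ih₂ =>
    have hv' := hv
    have hd' := hd
    have hw' := hw
    simp only [Cm.varBound, max_le_iff] at hv
    simp only [Cm.depth] at hd
    simp only [Cm.size] at hw
    rename_i e P _ _ _
    have hde := le_max_left e.depth P.depth
    have hdP := le_max_right e.depth P.depth
    obtain ⟨t₁, e₁, r₁, m₁, -⟩ := e.exec_comp hX hS hσ ho hv.1 TB le_rfl (by omega)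
      ((pow_le_pow_right₀ hX1 (by omega)).trans_lt hw) s hs
    obtain ⟨t₂, e₂, r₂, b₂⟩ := ih₁ hσ hv.2 (by omega)
      ((pow_le_pow_right₀ hX1 (by omega)).trans_lt hw) t₁ r₁
    obtain ⟨t₃, e₃, r₃, b₃⟩ := ih₂ b₂ hv' hd' hw' t₂ r₂
    -- The compiled loop evaluates its condition once in front and again at the end of each pass.
    -- The evaluation in front of the remaining loop thus becomes the end of the current pass.
    cases e₃ with
    | seq e₃ e₄ =>
      exact ⟨t₃, .seq e₁ (.while_true (State.get_eq (by omega)) (by rw [m₁]; exact h0)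
        (.seq e₂ e₃) e₄), r₃, b₃⟩
  | whl_false ho h0 =>
    simp only [Cm.varBound, max_le_iff] at hv
    simp only [Cm.depth] at hd
    simp only [Cm.size] at hw
    rename_i e P _
    have hde := le_max_left e.depth P.depth
    obtain ⟨t₁, e₁, r₁, m₁, -⟩ := e.exec_comp hX hS hσ ho hv.1 TB le_rfl (by omega)
      ((pow_le_pow_right₀ hX1 (by omega)).trans_lt hw) s hs
    refine ⟨t₁, .seq e₁ (.while_false ?_), r₁, hσ⟩
    rw [State.get_eq (by omega), m₁, h0]

/-! ### Total correctness -/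

/-- The command halts without fault in a state that satisfies `Q`. -/
def Wp (X : ℤ) (cap : ℕ) (c : Cm) (Q : HState → Prop) (σ : HState) : Prop :=
  ∃ τ, HEx X cap c σ τ ∧ Q τ

section Rules

variable {X : ℤ} {cap : ℕ} {Q : HState → Prop} {σ : HState}

theorem Wp.mono {c : Cm} {Q' : HState → Prop} (h : Wp X cap c Q σ) (hQ : ∀ τ, Q τ → Q' τ) :
    Wp X cap c Q' σ :=
  let ⟨τ, hτ, hq⟩ := h
  ⟨τ, hτ, hQ τ hq⟩

theorem wp_skip (h : Q σ) : Wp X cap .skip Q σ := ⟨σ, .skip σ, h⟩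

theorem wp_set {a : ℕ} {e : Ex} (ho : e.Ok cap σ) (hb : |e.eval σ| ≤ X)
    (h : Q { σ with v := Function.update σ.v a (e.eval σ) }) : Wp X cap (.set a e) Q σ :=
  ⟨_, .set ho hb, h⟩

theorem wp_put {e f : Ex} (he : e.Ok cap σ) (hf : f.Ok cap σ) (h0 : 0 ≤ e.eval σ)
    (h1 : e.eval σ < cap) (hb : |f.eval σ| ≤ X)
    (h : Q { σ with h := Function.update σ.h (e.eval σ) (f.eval σ) }) : Wp X cap (.put e f) Q σ :=
  ⟨_, .put he hf h0 h1 hb, h⟩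

theorem wp_nxt {a : ℕ} {z : ℤ} {rest : List ℤ} (hi : σ.inp = z :: rest) (hb : |z| ≤ X)
    (h : Q { σ with v := Function.update σ.v a z, inp := rest }) : Wp X cap (.nxt a) Q σ :=
  ⟨_, .nxt hi hb, h⟩

theorem wp_seq {c c' : Cm} (h : Wp X cap c (Wp X cap c' Q) σ) : Wp X cap (.seq c c') Q σ :=
  let ⟨_, hτ, ρ, hρ, hq⟩ := h
  ⟨ρ, .seq hτ hρ, hq⟩

theorem wp_ite {e : Ex} {c c' : Cm} (ho : e.Ok cap σ) (h1 : e.eval σ ≠ 0 → Wp X cap c Q σ)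
    (h2 : e.eval σ = 0 → Wp X cap c' Q σ) : Wp X cap (.ite e c c') Q σ := by
  by_cases h0 : e.eval σ = 0
  · obtain ⟨τ, hτ, hq⟩ := h2 h0
    exact ⟨τ, .ite_false ho h0 hτ, hq⟩
  · obtain ⟨τ, hτ, hq⟩ := h1 h0
    exact ⟨τ, .ite_true ho h0 hτ, hq⟩

/-- Loop rule with an invariant and a natural number that decreases. -/
theorem wp_whl {e : Ex} {c : Cm} (I : ℕ → HState → Prop)
    (hstep : ∀ n τ, I n τ → e.Ok cap τ ∧ (e.eval τ = 0 → Q τ) ∧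
      (e.eval τ ≠ 0 → Wp X cap c (fun ρ => ∃ m < n, I m ρ) τ))
    (n : ℕ) (h : I n σ) : Wp X cap (.whl e c) Q σ := by
  induction n using Nat.strong_induction_on generalizing σ with
  | _ n ih =>
    obtain ⟨ho, hq, hc⟩ := hstep n σ h
    by_cases h0 : e.eval σ = 0
    · exact ⟨σ, .whl_false ho h0, hq h0⟩
    · obtain ⟨ρ, hρ, m, hm, hI⟩ := hc h0
      obtain ⟨τ, hτ, hqτ⟩ := ih m hm hI
      exact ⟨τ, .whl_true ho h0 hρ hτ, hqτ⟩

/-- Rule for loops that run `n` times. -/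
theorem wp_for {e : Ex} {c : Cm} (n : ℕ) (I : ℕ → HState → Prop)
    (hok : ∀ j τ, j ≤ n → I j τ → e.Ok cap τ ∧ (e.eval τ ≠ 0 ↔ j < n))
    (hstep : ∀ j τ, j < n → I j τ → Wp X cap c (I (j + 1)) τ)
    (h0 : I 0 σ) (hn : ∀ τ, I n τ → Q τ) : Wp X cap (.whl e c) Q σ := by
  refine wp_whl (fun m τ => m ≤ n ∧ I (n - m) τ) (fun m τ hI => ?_) n ⟨le_rfl, by simpa using h0⟩
  obtain ⟨ho, hiff⟩ := hok (n - m) τ (by omega) hI.2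
  refine ⟨ho, fun hz => ?_, fun hz => ?_⟩
  · have hnot : ¬ (n - m < n) := fun h => (hiff.2 h) hz
    have hm : n - m = n := by omega
    exact hn τ (by rw [← hm]; exact hI.2)
  · have hlt := hiff.1 hz
    refine (hstep _ τ hlt hI.2).mono fun ρ hρ => ⟨m - 1, by omega, by omega, ?_⟩
    rwa [show n - (m - 1) = n - m + 1 by omega]

end Rules

end StreamRAM

namespace StreamRAM

/-! ### Expressions used by the program -/

instance : Add Ex := ⟨.op .add⟩
instance : Sub Ex := ⟨.op .sub⟩
instance : Mul Ex := ⟨.op .mul⟩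
instance : Div Ex := ⟨.op .div⟩

def Ex.less (e f : Ex) : Ex := .op .lt e f

def Ex.npow (e : Ex) : ℕ → Ex
  | 0 => .lit 1
  | k + 1 => e.npow k * e

def Ex.abs (e : Ex) : Ex := e * (.lit 1 - .lit 2 * e.less (.lit 0))

section EvalLemmas

variable (σ : HState) (cap : ℕ) (e f : Ex)

@[simp] theorem eval_lit (z : ℤ) : (Ex.lit z).eval σ = z := rfl
@[simp] theorem eval_var (a : ℕ) : (Ex.var a).eval σ = σ.v a := rfl
@[simp] theorem eval_ld : (Ex.ld e).eval σ = σ.h (e.eval σ) := rfl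
@[simp] theorem eval_add : (e + f).eval σ = e.eval σ + f.eval σ := rfl
@[simp] theorem eval_sub : (e - f).eval σ = e.eval σ - f.eval σ := rfl
@[simp] theorem eval_mul : (e * f).eval σ = e.eval σ * f.eval σ := rfl
@[simp] theorem eval_div : (e / f).eval σ = Int.fdiv (e.eval σ) (f.eval σ) := rfl
@[simp] theorem eval_less : (e.less f).eval σ = if e.eval σ < f.eval σ then 1 else 0 := rfl
@[simp] theorem ok_lit (z : ℤ) : (Ex.lit z).Ok cap σ ↔ True := Iff.rfl
@[simp] theorem ok_var (a : ℕ) : (Ex.var a).Ok cap σ ↔ True := Iff.rfl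
@[simp] theorem ok_ld : (Ex.ld e).Ok cap σ ↔ e.Ok cap σ ∧ 0 ≤ e.eval σ ∧ e.eval σ < cap := Iff.rfl
@[simp] theorem ok_add : (e + f).Ok cap σ ↔ e.Ok cap σ ∧ f.Ok cap σ := Iff.rfl
@[simp] theorem ok_sub : (e - f).Ok cap σ ↔ e.Ok cap σ ∧ f.Ok cap σ := Iff.rfl
@[simp] theorem ok_mul : (e * f).Ok cap σ ↔ e.Ok cap σ ∧ f.Ok cap σ := Iff.rfl
@[simp] theorem ok_div : (e / f).Ok cap σ ↔ e.Ok cap σ ∧ f.Ok cap σ := Iff.rfl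
@[simp] theorem ok_less : (e.less f).Ok cap σ ↔ e.Ok cap σ ∧ f.Ok cap σ := Iff.rfl

@[simp] theorem eval_npow (k : ℕ) : (e.npow k).eval σ = e.eval σ ^ k := by
  induction k with
  | zero => rw [Ex.npow, eval_lit, pow_zero]
  | succ k ih => rw [Ex.npow, eval_mul, ih, pow_succ]

@[simp] theorem ok_npow (k : ℕ) : e.Ok cap σ → (e.npow k).Ok cap σ := by
  intro h
  induction k with
  | zero => trivial
  | succ k ih => exact ⟨ih, h⟩

@[simp] theorem eval_abs : e.abs.eval σ = |e.eval σ| := by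
  rw [Ex.abs, eval_mul, eval_sub, eval_mul, eval_lit, eval_lit]
  by_cases h : e.eval σ < 0
  · rw [show (e.less (.lit 0)).eval σ = 1 from if_pos h, abs_of_neg h]; ring
  · rw [show (e.less (.lit 0)).eval σ = 0 from if_neg h, abs_of_nonneg (not_lt.1 h)]; ring

theorem eval_less_ne_zero : (e.less f).eval σ ≠ 0 ↔ e.eval σ < f.eval σ := by
  rw [eval_less]
  split_ifs with h <;> simp [h]

theorem eval_less_eq_zero : (e.less f).eval σ = 0 ↔ f.eval σ ≤ e.eval σ := by
  rw [← not_lt, ← eval_less_ne_zero, not_not]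

@[simp] theorem ok_abs : e.abs.Ok cap σ ↔ e.Ok cap σ := by
  simp [Ex.abs]

end EvalLemmas

/-- `(n + 1) * N`, in terms of which all sizes are measured. -/
def Ex.scale : Ex := (.var 0 + .lit 1) * .var 1

/-- Exponents that fix the range of the weights, of the test vectors, and the denominator. -/
structure Exponents where
  d : ℕ
  p : ℕ
  eU : ℕ
  eR : ℕ
  eK : ℕ

namespace Exponents

variable (E : Exponents)

/-- Coordinate `c` of test vector number `M[12]`. -/
def coordEx (c : ℕ) : Ex :=
  (Ex.var 12 / ((Ex.lit 2 * Ex.scale.npow E.eR + .lit 1).npow c)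
    - (Ex.var 12 / ((Ex.lit 2 * Ex.scale.npow E.eR + .lit 1).npow c)) /
      (Ex.lit 2 * Ex.scale.npow E.eR + .lit 1) * (Ex.lit 2 * Ex.scale.npow E.eR + .lit 1))
    - Ex.scale.npow E.eR

/-- The inner product of the record at address `a` with the test vector, first `c` coordinates. -/
def dotEx (a : Ex) : ℕ → Ex
  | 0 => .lit 0
  | c + 1 => dotEx a c + .ld (a + .lit c) * E.coordEx c

/-- Address of record `M[4] + M[13]`. -/
def recEx : Ex := (.var 4 + .var 13) * .lit (E.d + 2)

/-- Address of digit `M[13]`. -/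
def digitEx : Ex := .var 3 * .lit (E.d + 2) + .var 13

def valueEx : Ex := (E.dotEx E.recEx E.d).abs.npow E.p

/-- Test whether the digits define a reweighting of the records from `M[4]` on with at most `M[8]`
nonzero weights that passes all integer test vectors; the result is `M[10]`. -/
def countLoop : Cm :=
  .seq (.set 13 (.lit 0)) (.whl ((Ex.var 13).less (.var 3 - .var 4))
    (.seq (.set 11 (.var 11 + (Ex.lit 0).less (.ld E.digitEx))) (.set 13 (.var 13 + .lit 1))))

/-- Use of the variables: `0` and `1` hold `n` and `N`, `2` the number of rows read, `3` the number
of records, `4` the first record to be reduced, `5` the tag to be written, `6` the inverse accuracy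
of the test, `7` whether the search goes on, `8` the admissible support size, `10` the verdict of
the test, `11` the support size of the candidate, `12` the test vector, `13` a position in the
block, `14` and `15` the sums with old and new weights. -/
def sumLoop : Cm :=
  .seq (.set 14 (.lit 0)) (.seq (.set 15 (.lit 0)) (.seq (.set 13 (.lit 0))
    (.whl ((Ex.var 13).less (.var 3 - .var 4))
      (.seq (.set 14 (.var 14 + .ld (E.recEx + .lit E.d) * E.valueEx))
        (.seq (.set 15 (.var 15 + .ld E.digitEx * E.valueEx)) (.set 13 (.var 13 + .lit 1)))))))

def testLoop : Cm :=
  .seq (.set 12 (.lit 0)) (.whl ((Ex.var 12).less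
      ((Ex.lit 2 * Ex.scale.npow E.eR + .lit 1).npow E.d))
    (.seq E.sumLoop (.seq (.ite ((Ex.var 14).less (.var 6 * (Ex.var 15 - .var 14).abs))
      (.set 10 (.lit 0)) .skip) (.set 12 (.var 12 + .lit 1)))))

def check : Cm :=
  .seq (.set 10 (.lit 1)) (.seq (.set 11 (.lit 0)) (.seq E.countLoop
    (.seq (.ite ((Ex.var 8).less (.var 11)) (.set 10 (.lit 0)) .skip) E.testLoop)))

/-! ### Specification of the test -/

/-- The scale as a number. -/
def Z (n N : ℕ) : ℕ := (n + 1) * N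

def R (n N : ℕ) : ℕ := Z n N ^ E.eR
def U (n N : ℕ) : ℕ := Z n N ^ E.eU
def K (n N : ℕ) : ℕ := Z n N ^ E.eK

end Exponents

/-- Coordinate `c` of the test vector number `t` in `[-R, R] ^ d`. -/
def testVec (R t c : ℕ) : ℤ := ((t / (2 * R + 1) ^ c % (2 * R + 1) : ℕ) : ℤ) - R

theorem abs_testVec_le (R t c : ℕ) : |testVec R t c| ≤ R := by
  have : t / (2 * R + 1) ^ c % (2 * R + 1) < 2 * R + 1 := Nat.mod_lt _ (by omega)
  rw [testVec, abs_le]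
  omega

/-- The value `|⟨b, x⟩| ^ p` for the record at address `a` and test vector number `t`. -/
def recValue (d p R : ℕ) (h : ℤ → ℤ) (a : ℤ) (t : ℕ) : ℤ :=
  |∑ c ∈ Finset.range d, h (a + c) * testVec R t c| ^ p

theorem abs_recValue_le {d p R : ℕ} {h : ℤ → ℤ} {a : ℤ} {Q : ℤ} (hQ : ∀ c : ℕ, c < d → |h (a + c)| ≤ Q)
    (t : ℕ) : |recValue d p R h a t| ≤ (d * (Q * R)) ^ p := by
  rw [recValue, abs_pow, abs_abs]
  refine pow_le_pow_left₀ (abs_nonneg _) ((Finset.abs_sum_le_sum_abs _ _).trans ?_) p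
  calc _ ≤ ∑ _c ∈ Finset.range d, Q * (R : ℤ) := by
        refine Finset.sum_le_sum fun c hc => ?_
        rw [abs_mul]
        have h1 := hQ c (Finset.mem_range.1 hc)
        exact mul_le_mul h1 (abs_testVec_le R t c) (abs_nonneg _) ((abs_nonneg _).trans h1)
    _ = _ := by simp

/-- The weighted sum of the values of the first `j` records from number `s` on. -/
def blockSum (d p R : ℕ) (h : ℤ → ℤ) (s : ℕ) (f : ℕ → ℤ) (j t : ℕ) : ℤ :=
  ∑ i ∈ Finset.range j, f i * recValue d p R h ((s + i) * (d + 2)) t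

/-- The numbers `f` form a reweighting of the records from `s` to `len` that passes the test. -/
def Passes (d p R : ℕ) (h : ℤ → ℤ) (s len : ℕ) (f : ℕ → ℤ) (m T : ℤ) : Prop :=
  (∑ j ∈ Finset.range (len - s), (if 0 < f j then 1 else 0 : ℤ)) ≤ m ∧
  ∀ t < (2 * R + 1) ^ d,
    T * |blockSum d p R h s f (len - s) t -
      blockSum d p R h s (fun i => h ((s + i) * (d + 2) + d)) (len - s) t| ≤
    blockSum d p R h s (fun i => h ((s + i) * (d + 2) + d)) (len - s) t

/-! ### Correctness of the test program -/

/-- Two states that agree except for variables from `k` on. -/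
def FrameFrom (k : ℕ) (σ τ : HState) : Prop :=
  (∀ a < k, τ.v a = σ.v a) ∧ τ.h = σ.h ∧ τ.inp = σ.inp

theorem FrameFrom.refl (k : ℕ) (σ : HState) : FrameFrom k σ σ := ⟨fun _ _ => rfl, rfl, rfl⟩

theorem FrameFrom.trans {k : ℕ} {σ τ ρ : HState} (h₁ : FrameFrom k σ τ) (h₂ : FrameFrom k τ ρ) :
    FrameFrom k σ ρ :=
  ⟨fun a ha => (h₂.1 a ha).trans (h₁.1 a ha), h₂.2.1.trans h₁.2.1, h₂.2.2.trans h₁.2.2⟩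

theorem FrameFrom.mono {k l : ℕ} (hkl : k ≤ l) {σ τ : HState} (h : FrameFrom l σ τ) :
    FrameFrom k σ τ := ⟨fun a ha => h.1 a (by omega), h.2.1, h.2.2⟩

theorem FrameFrom.update {k : ℕ} {σ τ : HState} (h : FrameFrom k σ τ) {a : ℕ} (ha : k ≤ a) (x : ℤ) :
    FrameFrom k σ { τ with v := Function.update τ.v a x } :=
  ⟨fun b hb => by
    simp only [Function.update_of_ne (by omega : b ≠ a)]; exact h.1 b hb, h.2.1, h.2.2⟩

namespace Exponents

variable (E : Exponents)

/-- The bounds under which the test runs: numbers of records, sizes of entries and weights. -/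
structure Env (n N : ℕ) (X : ℤ) (cap : ℕ) (Q : ℤ) : Prop where
  sum_le : n * (E.U n N * (E.d * (Q * E.R n N)) ^ E.p) ≤ X
  net_le : ((2 * E.R n N + 1) ^ E.d : ℤ) ≤ X
  n_le : (n : ℤ) + 1 ≤ X

/-- State of the program: `len` records, of which those from number `s` on are to be reduced. -/
structure Block (n N cap : ℕ) (Q : ℤ) (s len : ℕ) (σ : HState) : Prop where
  v0 : σ.v 0 = n
  v1 : σ.v 1 = N
  v3 : σ.v 3 = len
  v4 : σ.v 4 = s
  hs : s ≤ len
  hlen : len ≤ n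
  hcap : len * (E.d + 2) + len < cap
  entry : ∀ j : ℕ, j < len - s → ∀ c : ℕ, c < E.d → |σ.h ((s + j) * (E.d + 2) + c)| ≤ Q
  weight : ∀ j : ℕ, j < len - s → |σ.h ((s + j) * (E.d + 2) + E.d)| ≤ E.U n N

/-- The same with digits, one for each record, after the records. -/
structure Ready (n N cap : ℕ) (Q : ℤ) (s len : ℕ) (σ : HState) : Prop
    extends E.Block n N cap Q s len σ where
  digit : ∀ j : ℕ, j < len - s → |σ.h (len * (E.d + 2) + j)| ≤ E.U n N

variable {E}

theorem Block.frame {n N cap : ℕ} {Q : ℤ} {s len : ℕ} {σ τ : HState}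
    (h : E.Block n N cap Q s len σ) {k : ℕ} (hk : 5 ≤ k) (hf : FrameFrom k σ τ) :
    E.Block n N cap Q s len τ where
  v0 := (hf.1 0 (by omega)).trans h.v0
  v1 := (hf.1 1 (by omega)).trans h.v1
  v3 := (hf.1 3 (by omega)).trans h.v3
  v4 := (hf.1 4 (by omega)).trans h.v4
  hs := h.hs
  hlen := h.hlen
  hcap := h.hcap
  entry := by rw [hf.2.1]; exact h.entry
  weight := by rw [hf.2.1]; exact h.weight

theorem Ready.frame {n N cap : ℕ} {Q : ℤ} {s len : ℕ} {σ τ : HState}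
    (h : E.Ready n N cap Q s len σ) {k : ℕ} (hk : 5 ≤ k) (hf : FrameFrom k σ τ) :
    E.Ready n N cap Q s len τ where
  toBlock := h.toBlock.frame hk hf
  digit := by rw [hf.2.1]; exact h.digit

theorem eval_scale {n N : ℕ} {σ : HState} (h0 : σ.v 0 = n) (h1 : σ.v 1 = N) :
    Ex.scale.eval σ = (Z n N : ℤ) := by
  simp [Ex.scale, h0, h1, Z]

theorem ok_scale (σ : HState) (cap : ℕ) : Ex.scale.Ok cap σ := by simp [Ex.scale]

/-- The coordinate is a digit of `t` in base `2 * R + 1`, shifted by `R`. The machine has no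
remainder operation, so the remainder is formed as the dividend minus quotient times divisor. -/
theorem eval_coordEx {n N : ℕ} {σ : HState} (h0 : σ.v 0 = n) (h1 : σ.v 1 = N) {t : ℕ}
    (ht : σ.v 12 = t) (c : ℕ) : (E.coordEx c).eval σ = testVec (E.R n N) t c := by
  simp only [coordEx, eval_sub, eval_mul, eval_div, eval_npow, eval_add, eval_lit, eval_var,
    eval_scale h0 h1, ht]
  have hR : ((Z n N : ℤ)) ^ E.eR = (E.R n N : ℤ) := by simp [R]
  rw [hR]
  have hM : (2 * (E.R n N : ℤ) + 1) = ((2 * E.R n N + 1 : ℕ) : ℤ) := by push_cast; ring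
  rw [hM, Int.fdiv_eq_ediv_of_nonneg _ (by positivity), Int.fdiv_eq_ediv_of_nonneg _ (by positivity),
    testVec]
  congr 1
  rw [Int.natCast_mod, Int.emod_def]
  push_cast
  ring

theorem ok_coordEx (σ : HState) (cap c : ℕ) : (E.coordEx c).Ok cap σ := by
  have h : (Ex.lit 2 * Ex.scale.npow E.eR + .lit 1).Ok cap σ := by
    simp [ok_scale]
  simp [coordEx, ok_scale]

theorem eval_dotEx {n N : ℕ} {σ : HState} (h0 : σ.v 0 = n) (h1 : σ.v 1 = N) {t : ℕ}
    (ht : σ.v 12 = t) (a : Ex) (c : ℕ) :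
    (E.dotEx a c).eval σ = ∑ c ∈ Finset.range c, σ.h (a.eval σ + c) * testVec (E.R n N) t c := by
  induction c with
  | zero => simp [dotEx]
  | succ c ih =>
    rw [Finset.sum_range_succ, dotEx, eval_add, ih, eval_mul, eval_coordEx h0 h1 ht]
    simp

theorem ok_dotEx {σ : HState} {cap : ℕ} (a : Ex) (c : ℕ) (ha : a.Ok cap σ) (h0 : 0 ≤ a.eval σ)
    (h1 : a.eval σ + c ≤ cap) : (E.dotEx a c).Ok cap σ := by
  induction c with
  | zero => simp [dotEx]
  | succ c ih =>
    push_cast at h1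
    simp only [dotEx, ok_add, ok_mul, ok_ld, ok_lit, eval_add, eval_lit, ok_coordEx, and_true]
    exact ⟨ih (by omega), ha, by omega, by omega⟩

theorem Block.eval_recEx {n N cap : ℕ} {Q : ℤ} {s len : ℕ} {σ : HState}
    (h : E.Block n N cap Q s len σ) {j : ℕ} (hj : σ.v 13 = j) :
    E.recEx.eval σ = (s + j) * (E.d + 2) := by
  simp [recEx, h.v4, hj]

theorem Block.eval_digitEx {n N cap : ℕ} {Q : ℤ} {s len : ℕ} {σ : HState}
    (h : E.Block n N cap Q s len σ) {j : ℕ} (hj : σ.v 13 = j) :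
    E.digitEx.eval σ = len * (E.d + 2) + j := by
  simp [digitEx, h.v3, hj]

theorem Block.rec_lt {n N cap : ℕ} {Q : ℤ} {s len : ℕ} {σ : HState}
    (h : E.Block n N cap Q s len σ) {j : ℕ} (hj : j < len - s) :
    ((s : ℤ) + j) * (E.d + 2) + (E.d + 2) ≤ cap := by
  have h1 : (s + j + 1) * (E.d + 2) ≤ len * (E.d + 2) := Nat.mul_le_mul_right _ (by omega)
  have h2 : (s + j + 1) * (E.d + 2) ≤ cap := h1.trans ((Nat.le_add_right _ _).trans h.hcap.le)
  have h3 : (((s + j + 1) * (E.d + 2) : ℕ) : ℤ) ≤ cap := by exact_mod_cast h2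
  push_cast at h3
  linarith

/-- The position just after the last digit is included, because `increment` evaluates both factors
of its loop condition, also when the first one is already zero. -/
theorem Block.digit_lt {n N cap : ℕ} {Q : ℤ} {s len : ℕ} {σ : HState}
    (h : E.Block n N cap Q s len σ) {j : ℕ} (hj : j ≤ len - s) :
    (len : ℤ) * (E.d + 2) + j < cap := by
  have h1 : len * (E.d + 2) + j < cap := lt_of_le_of_lt (by omega) h.hcap
  exact_mod_cast h1

theorem Block.ok_digitEx {n N cap : ℕ} {Q : ℤ} {s len : ℕ} {σ : HState}
    (h : E.Block n N cap Q s len σ) {j : ℕ} (hj : σ.v 13 = j) (hlt : j ≤ len - s) :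
    (Ex.ld E.digitEx).Ok cap σ := by
  rw [ok_ld, h.eval_digitEx hj]
  exact ⟨by simp [digitEx], by positivity, h.digit_lt hlt⟩

theorem Block.ok_valueEx {n N cap : ℕ} {Q : ℤ} {s len : ℕ} {σ : HState}
    (h : E.Block n N cap Q s len σ) {j : ℕ} (hj : σ.v 13 = j) (hlt : j < len - s) :
    E.valueEx.Ok cap σ := by
  refine ok_npow _ _ _ _ ((ok_abs _ _ _).2 (ok_dotEx _ _ (by simp [recEx]) ?_ ?_))
  · rw [h.eval_recEx hj]; positivity
  · rw [h.eval_recEx hj]; have := h.rec_lt hlt; omega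

theorem Block.eval_valueEx {n N cap : ℕ} {Q : ℤ} {s len : ℕ} {σ : HState}
    (h : E.Block n N cap Q s len σ) {j t : ℕ} (hj : σ.v 13 = j) (ht : σ.v 12 = t) :
    E.valueEx.eval σ = recValue E.d E.p (E.R n N) σ.h ((s + j) * (E.d + 2)) t := by
  rw [valueEx, eval_npow, eval_abs, eval_dotEx h.v0 h.v1 ht, h.eval_recEx hj, recValue]

theorem Block.eval_loopCond {n N cap : ℕ} {Q : ℤ} {s len : ℕ} {σ : HState}
    (h : E.Block n N cap Q s len σ) {j : ℕ} (hj : σ.v 13 = j) :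
    (((Ex.var 13).less (.var 3 - .var 4)).eval σ ≠ 0 ↔ j < len - s) := by
  have := h.hs
  simp only [eval_less, eval_var, eval_sub, hj, h.v3, h.v4]
  split_ifs with h1 <;> simp <;> omega

theorem wp_countLoop {n N cap : ℕ} {X Q : ℤ} {s len : ℕ} {σ : HState} (hE : E.Env n N X cap Q)
    (h : E.Ready n N cap Q s len σ) (h11 : σ.v 11 = 0) :
    Wp X cap E.countLoop (fun τ => FrameFrom 11 σ τ ∧ τ.v 11 =
      ∑ j ∈ Finset.range (len - s), (if 0 < σ.h (len * (E.d + 2) + j) then 1 else 0 : ℤ)) σ := by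
  have hX := hE.n_le
  have hlen := h.hlen
  refine wp_seq (wp_set (by simp) (by simp; omega) ?_)
  refine wp_for (len - s) (fun j τ => FrameFrom 11 σ τ ∧ τ.v 13 = j ∧ τ.v 11 =
      ∑ j ∈ Finset.range j, (if 0 < σ.h (len * (E.d + 2) + j) then 1 else 0 : ℤ)) ?_ ?_ ?_ ?_
  · intro j τ hj hI
    exact ⟨by simp, (h.frame (by omega) hI.1).eval_loopCond hI.2.1⟩
  · intro j τ hj ⟨hf, h13, hc⟩
    have hr := h.frame (by omega) hf
    have hcount : ∀ j : ℕ, 0 ≤ ∑ j ∈ Finset.range j, (if 0 < σ.h (len * (E.d + 2) + j) then 1 else 0 : ℤ) ∧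
        ∑ j ∈ Finset.range j, (if 0 < σ.h (len * (E.d + 2) + j) then 1 else 0 : ℤ) ≤ j := by
      intro j
      refine ⟨Finset.sum_nonneg fun i _ => by split_ifs <;> simp, ?_⟩
      calc _ ≤ ∑ _i ∈ Finset.range j, (1 : ℤ) :=
            Finset.sum_le_sum fun i _ => by split_ifs <;> simp
        _ = _ := by simp
    have hev : (Ex.var 11 + (Ex.lit 0).less (.ld E.digitEx)).eval τ =
        ∑ j ∈ Finset.range (j + 1), (if 0 < σ.h (len * (E.d + 2) + j) then 1 else 0 : ℤ) := by
      rw [Finset.sum_range_succ, ← hc, eval_add, eval_var, eval_less, eval_lit, eval_ld,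
        hr.eval_digitEx h13, hf.2.1]
    refine wp_seq (wp_set ?_ ?_ (wp_set (by simp) ?_ ?_))
    · exact ⟨trivial, trivial, hr.ok_digitEx h13 hj.le⟩
    · rw [hev, abs_of_nonneg (hcount _).1]
      have := (hcount (j + 1)).2
      push_cast at this
      omega
    · simp only [eval_add, eval_var, eval_lit, Function.update_of_ne (by omega : (13 : ℕ) ≠ 11), h13]
      rw [abs_of_nonneg (by omega)]; omega
    · refine ⟨(hf.update (by omega) _).update (by omega) _, ?_, ?_⟩
      · simp [h13]
      · simp only [Function.update_of_ne (by omega : (11 : ℕ) ≠ 13), Function.update_self]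
        exact hev
  · exact ⟨(FrameFrom.refl 11 σ).update (by omega) _, by simp, by simp [h11]⟩
  · intro τ hτ
    exact ⟨hτ.1, hτ.2.2⟩

/-- Every partial sum is bounded, not only the final one, since each of them is stored in a cell. -/
theorem Ready.abs_blockSum_le {n N cap : ℕ} {X Q : ℤ} {s len : ℕ} {σ : HState}
    (hE : E.Env n N X cap Q) (h : E.Ready n N cap Q s len σ) (f : ℕ → ℤ)
    (hf : ∀ j, j < len - s → |f j| ≤ E.U n N) (t j : ℕ) (hj : j ≤ len - s) :
    |blockSum E.d E.p (E.R n N) σ.h s f j t| ≤ X := by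
  have hQ : ∀ i ∈ Finset.range j,
      |f i * recValue E.d E.p (E.R n N) σ.h ((s + i) * (E.d + 2)) t| ≤
        E.U n N * (E.d * (Q * E.R n N)) ^ E.p := by
    intro i hi
    have hi' := Finset.mem_range.1 hi
    rw [abs_mul]
    exact mul_le_mul (hf i (by omega)) (abs_recValue_le (h.entry i (by omega)) t) (abs_nonneg _)
      (by positivity)
  rw [blockSum]
  rcases Nat.eq_zero_or_pos j with rfl | hj0
  · have hX := hE.n_le
    rw [Finset.range_zero, Finset.sum_empty, abs_zero]
    omega
  · refine le_trans ((Finset.abs_sum_le_sum_abs _ _).trans ?_) hE.sum_le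
    have h0 : 0 ≤ E.U n N * (E.d * (Q * E.R n N)) ^ E.p :=
      (abs_nonneg _).trans (hQ 0 (Finset.mem_range.2 hj0))
    refine (Finset.sum_le_sum hQ).trans ?_
    rw [Finset.sum_const, Finset.card_range, nsmul_eq_mul]
    refine mul_le_mul_of_nonneg_right ?_ h0
    have := h.hlen
    exact_mod_cast (by omega : j ≤ n)

theorem wp_sumLoop {n N cap : ℕ} {X Q : ℤ} {s len t : ℕ} {σ : HState} (hE : E.Env n N X cap Q)
    (h : E.Ready n N cap Q s len σ) (h12 : σ.v 12 = t) :
    Wp X cap E.sumLoop (fun τ => FrameFrom 13 σ τ ∧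
      τ.v 14 = blockSum E.d E.p (E.R n N) σ.h s (fun i => σ.h ((s + i) * (E.d + 2) + E.d))
        (len - s) t ∧
      τ.v 15 = blockSum E.d E.p (E.R n N) σ.h s (fun i => σ.h (len * (E.d + 2) + i))
        (len - s) t) σ := by
  have hX := hE.n_le
  have hlen := h.hlen
  refine wp_seq (wp_set (by simp) (by simp; omega) (wp_seq (wp_set (by simp) (by simp; omega)
    (wp_seq (wp_set (by simp) (by simp; omega) ?_)))))
  refine wp_for (len - s) (fun j τ => FrameFrom 13 σ τ ∧ τ.v 13 = j ∧
      τ.v 14 = blockSum E.d E.p (E.R n N) σ.h s (fun i => σ.h ((s + i) * (E.d + 2) + E.d)) j t ∧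
      τ.v 15 = blockSum E.d E.p (E.R n N) σ.h s (fun i => σ.h (len * (E.d + 2) + i)) j t) ?_ ?_ ?_ ?_
  · intro j τ hj hI
    exact ⟨by simp, (h.frame (by omega) hI.1).eval_loopCond hI.2.1⟩
  · intro j τ hj ⟨hf, h13, h14, h15⟩
    have hr := h.frame (by omega) hf
    have ht : τ.v 12 = t := (hf.1 12 (by omega)).trans h12
    have e1 : (Ex.var 14 + .ld (E.recEx + .lit E.d) * E.valueEx).eval τ =
        blockSum E.d E.p (E.R n N) σ.h s (fun i => σ.h ((s + i) * (E.d + 2) + E.d)) (j + 1) t := by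
      rw [blockSum, Finset.sum_range_succ, ← blockSum, ← h14, eval_add, eval_mul, eval_ld, eval_add,
        hr.eval_recEx h13, hr.eval_valueEx h13 ht, hf.2.1]
      rfl
    refine wp_seq (wp_set ?_ ?_ ?_)
    · refine ⟨trivial, ?_, hr.ok_valueEx h13 hj⟩
      have := hr.rec_lt hj
      simp only [ok_ld, ok_add, ok_lit, eval_add, eval_lit, hr.eval_recEx h13]
      exact ⟨by simp [recEx], by positivity, by linarith⟩
    · rw [e1]
      exact h.abs_blockSum_le hE _ h.weight t _ hj
    have hf' : FrameFrom 13 σ { τ with v := Function.update τ.v 14 ((Ex.var 14 +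
        .ld (E.recEx + .lit E.d) * E.valueEx).eval τ) } := hf.update (by omega) _
    have hr' := h.frame (by omega) hf'
    have h13' : ({ τ with v := Function.update τ.v 14 ((Ex.var 14 +
        .ld (E.recEx + .lit E.d) * E.valueEx).eval τ) } : HState).v 13 = j := by simp [h13]
    have ht' := (hf'.1 12 (by omega)).trans h12
    have e14 : ({ τ with v := Function.update τ.v 14 ((Ex.var 14 +
        .ld (E.recEx + .lit E.d) * E.valueEx).eval τ) } : HState).v 14 =
          blockSum E.d E.p (E.R n N) σ.h s (fun i => σ.h ((s + i) * (E.d + 2) + E.d)) (j + 1) t := by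
      rw [← e1]
      exact Function.update_self (f := τ.v) 14 _
    have e15 : ({ τ with v := Function.update τ.v 14 ((Ex.var 14 +
        .ld (E.recEx + .lit E.d) * E.valueEx).eval τ) } : HState).v 15 =
          blockSum E.d E.p (E.R n N) σ.h s (fun i => σ.h (len * (E.d + 2) + i)) j t := by
      simp [h15]
    generalize ({ τ with v := Function.update τ.v 14 ((Ex.var 14 +
        .ld (E.recEx + .lit E.d) * E.valueEx).eval τ) } : HState) = ρ at *
    have e2 : (Ex.var 15 + .ld E.digitEx * E.valueEx).eval ρ =
        blockSum E.d E.p (E.R n N) σ.h s (fun i => σ.h (len * (E.d + 2) + i)) (j + 1) t := by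
      rw [blockSum, Finset.sum_range_succ, ← blockSum, ← e15, eval_add, eval_mul, eval_ld,
        hr'.eval_digitEx h13', hr'.eval_valueEx h13' ht', hf'.2.1]
      rfl
    refine wp_seq (wp_set ?_ ?_ (wp_set (by simp) ?_ ?_))
    · exact ⟨trivial, hr'.ok_digitEx h13' hj.le, hr'.ok_valueEx h13' hj⟩
    · rw [e2]
      exact h.abs_blockSum_le hE _ h.digit t _ hj
    · simp only [eval_add, eval_var, eval_lit, Function.update_of_ne (by omega : (13 : ℕ) ≠ 15), h13']
      rw [abs_of_nonneg (by omega)]; omega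
    · refine ⟨(hf'.update (by omega) _).update (by omega) _, ?_, ?_, ?_⟩
      · simp [h13']
      · simp [e14]
      · simp only [Function.update_of_ne (by omega : (15 : ℕ) ≠ 13), Function.update_self]
        exact e2
  · refine ⟨(((FrameFrom.refl 13 σ).update (by omega) _).update (by omega) _).update (by omega) _,
      by simp, by simp [blockSum], by simp [blockSum]⟩
  · intro τ hτ
    exact ⟨hτ.1, hτ.2.2⟩

theorem wp_testLoop {n N cap : ℕ} {X Q : ℤ} {s len : ℕ} {σ : HState} (hE : E.Env n N X cap Q)
    (h : E.Ready n N cap Q s len σ) (b : Prop) [Decidable b] (h10 : σ.v 10 = if b then 1 else 0) :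
    Wp X cap E.testLoop (fun τ => FrameFrom 10 σ τ ∧ (τ.v 10 = 0 ∨ τ.v 10 = 1) ∧
      (τ.v 10 = 1 ↔ b ∧ ∀ t < (2 * E.R n N + 1) ^ E.d,
    σ.v 6 * |blockSum E.d E.p (E.R n N) σ.h s (fun i => σ.h (len * (E.d + 2) + i)) (len - s) t -
      blockSum E.d E.p (E.R n N) σ.h s (fun i => σ.h ((s + i) * (E.d + 2) + E.d)) (len - s) t| ≤
    blockSum E.d E.p (E.R n N) σ.h s (fun i => σ.h ((s + i) * (E.d + 2) + E.d)) (len - s) t)) σ := by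
  have hX := hE.n_le
  have hnet := hE.net_le
  refine wp_seq (wp_set (by simp) (by simp; omega) ?_)
  refine wp_for ((2 * E.R n N + 1) ^ E.d) (fun T τ => FrameFrom 10 σ τ ∧ τ.v 12 = T ∧
    (τ.v 10 = 0 ∨ τ.v 10 = 1) ∧ (τ.v 10 = 1 ↔ b ∧ ∀ t < T,
    σ.v 6 * |blockSum E.d E.p (E.R n N) σ.h s (fun i => σ.h (len * (E.d + 2) + i)) (len - s) t -
      blockSum E.d E.p (E.R n N) σ.h s (fun i => σ.h ((s + i) * (E.d + 2) + E.d)) (len - s) t| ≤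
    blockSum E.d E.p (E.R n N) σ.h s (fun i => σ.h ((s + i) * (E.d + 2) + E.d)) (len - s) t)) ?_ ?_ ?_ ?_
  · intro t τ ht ⟨hf, h12, _⟩
    have hr := h.frame (by omega) hf
    refine ⟨by simp [ok_scale], ?_⟩
    rw [eval_less_ne_zero]
    simp only [eval_var, eval_npow, eval_add, eval_mul, eval_lit, h12, eval_scale hr.v0 hr.v1]
    have hR : ((Z n N : ℤ)) ^ E.eR = (E.R n N : ℤ) := by simp [R]
    rw [hR]
    have hM : (2 * (E.R n N : ℤ) + 1) ^ E.d = (((2 * E.R n N + 1) ^ E.d : ℕ) : ℤ) := by push_cast; ring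
    rw [hM, Nat.cast_lt]
  · intro t τ ht ⟨hf, h12, h01, hiff⟩
    have hr := h.frame (by omega) hf
    refine wp_seq ((wp_sumLoop hE hr h12).mono fun ρ ⟨hfρ, h14, h15⟩ => ?_)
    have hfr : FrameFrom 10 σ ρ := hf.trans (hfρ.mono (by omega))
    have h6 : ρ.v 6 = σ.v 6 := hfr.1 6 (by omega)
    have h12ρ : ρ.v 12 = t := (hfρ.1 12 (by omega)).trans h12
    have h10ρ : ρ.v 10 = τ.v 10 := hfρ.1 10 (by omega)
    rw [hf.2.1] at h14 h15
    have htX : |(t : ℤ) + 1| ≤ X := by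
      rw [abs_of_nonneg (by positivity)]
      refine le_trans ?_ hnet
      exact_mod_cast ht
    refine wp_seq (wp_ite (by simp) ?_ ?_)
    · intro hne
      have hlt : blockSum E.d E.p (E.R n N) σ.h s (fun i => σ.h ((s + i) * (E.d + 2) + E.d)) (len - s) t
          < σ.v 6 * |blockSum E.d E.p (E.R n N) σ.h s (fun i => σ.h (len * (E.d + 2) + i)) (len - s) t -
      blockSum E.d E.p (E.R n N) σ.h s (fun i => σ.h ((s + i) * (E.d + 2) + E.d)) (len - s) t| := by
        by_contra hc
        apply hne
        simp only [eval_less, eval_var, eval_mul, eval_abs, eval_sub, h14, h15, h6]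
        exact if_neg hc
      refine wp_set (by simp) (by simp; omega) (wp_set (by simp) (by simpa [h12ρ] using htX) ?_)
      refine ⟨(hfr.update (by omega) _).update (by omega) _, by simp [h12ρ], by simp, ?_⟩
      simp only [Function.update_of_ne (by omega : (10 : ℕ) ≠ 12), Function.update_self, eval_lit]
      refine ⟨fun h => absurd h (by norm_num), fun h => absurd (h.2 t (by omega)) (not_le.2 hlt)⟩
    · intro heq
      have hle : ¬ blockSum E.d E.p (E.R n N) σ.h s (fun i => σ.h ((s + i) * (E.d + 2) + E.d)) (len - s) t
          < σ.v 6 * |blockSum E.d E.p (E.R n N) σ.h s (fun i => σ.h (len * (E.d + 2) + i)) (len - s) t -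
      blockSum E.d E.p (E.R n N) σ.h s (fun i => σ.h ((s + i) * (E.d + 2) + E.d)) (len - s) t| := by
        intro hc
        simp only [eval_less, eval_var, eval_mul, eval_abs, eval_sub, h14, h15, h6] at heq
        rw [if_pos hc] at heq
        exact absurd heq (by norm_num)
      refine wp_skip (wp_set (by simp) (by simpa [h12ρ] using htX) ?_)
      refine ⟨hfr.update (by omega) _, by simp [h12ρ], ?_, ?_⟩
      · simpa [h10ρ] using h01
      · simp only [Function.update_of_ne (by omega : (10 : ℕ) ≠ 12), h10ρ, hiff]
        refine and_congr_right fun _ => ⟨fun h t' ht' => ?_, fun h t' ht' => h t' (by omega)⟩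
        rcases Nat.lt_succ_iff_lt_or_eq.1 ht' with h' | rfl
        · exact h t' h'
        · exact not_lt.1 hle
  · refine ⟨(FrameFrom.refl 10 σ).update (by omega) _, by simp, ?_, ?_⟩
    · by_cases hb : b <;> simp [h10, hb]
    · by_cases hb : b <;> simp [h10, hb]
  · intro τ hτ
    exact ⟨hτ.1, hτ.2.2⟩

theorem wp_check {n N cap : ℕ} {X Q : ℤ} {s len : ℕ} {σ : HState} (hE : E.Env n N X cap Q)
    (h : E.Ready n N cap Q s len σ) :
    Wp X cap E.check (fun τ => FrameFrom 10 σ τ ∧ (τ.v 10 = 0 ∨ τ.v 10 = 1) ∧ (τ.v 10 = 1 ↔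
      Passes E.d E.p (E.R n N) σ.h s len (fun i => σ.h (len * (E.d + 2) + i)) (σ.v 8) (σ.v 6))) σ := by
  have hX := hE.n_le
  have hf0 : FrameFrom 10 σ
      { σ with v := Function.update (Function.update σ.v 10 1) 11 0 } :=
    ((FrameFrom.refl 10 σ).update (by omega) 1).update (by omega) 0
  refine wp_seq (wp_set (by simp) (by simp; omega) (wp_seq (wp_set (by simp) (by simp; omega)
    (wp_seq ((wp_countLoop hE (h.frame (by omega) hf0) (by simp)).mono fun τ ⟨hf, h11⟩ => ?_)))))
  have hfτ : FrameFrom 10 σ τ := hf0.trans (hf.mono (by omega))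
  have h10 : τ.v 10 = 1 := (hf.1 10 (by omega)).trans (by simp)
  have h8 : τ.v 8 = σ.v 8 := hfτ.1 8 (by omega)
  dsimp only at h11
  refine wp_seq ((?_ : Wp X cap (.ite ((Ex.var 8).less (.var 11)) (.set 10 (.lit 0)) .skip)
    (fun ρ => FrameFrom 10 σ ρ ∧ ρ.v 10 = if (∑ j ∈ Finset.range (len - s),
      (if 0 < σ.h (len * (E.d + 2) + j) then 1 else 0 : ℤ)) ≤ σ.v 8 then 1 else 0) τ).mono ?_)
  · refine wp_ite (by simp) (fun hne => wp_set (by simp) (by simp; omega) ?_) fun heq => wp_skip ?_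
    · refine ⟨hfτ.update (by omega) _, ?_⟩
      rw [if_neg]
      · simp
      · intro hc
        apply hne
        simp only [eval_less, eval_var, h8, h11]
        exact if_neg (not_lt.2 hc)
    · refine ⟨hfτ, ?_⟩
      rw [if_pos, h10]
      by_contra hc
      simp only [eval_less, eval_var, h8, h11, if_pos (not_le.1 hc)] at heq
      exact absurd heq (by norm_num)
  · intro ρ ⟨hfρ, h10ρ⟩
    refine (wp_testLoop hE (h.frame (by omega) hfρ) _ h10ρ).mono fun υ ⟨hfυ, h01, hiff⟩ => ?_
    refine ⟨hfρ.trans hfυ, h01, ?_⟩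
    rw [hiff, hfρ.2.1, hfρ.1 6 (by omega)]
    rfl

end Exponents

end StreamRAM

namespace StreamRAM

/-! ### Numerals -/

/-- Gives the counter value at which the odometer shows prescribed weights and a prescribed support
size; the part above the `k` digits is not bounded. -/
theorem exists_numeral (B k : ℕ) (f : ℕ → ℕ) (hf : ∀ j < k, f j < B) (m : ℕ) :
    ∃ V : ℕ, (∀ j < k, V / B ^ j % B = f j) ∧ V / B ^ k = m := by
  induction k generalizing f with
  | zero => exact ⟨m, by simp, by simp⟩
  | succ k ih =>
    obtain ⟨V, hV, hm⟩ := ih (fun j => f (j + 1)) fun j hj => hf _ (by omega)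
    have h0 := hf 0 (by omega)
    have hB : 0 < B := by omega
    have hdiv : ∀ j, (f 0 + B * V) / B ^ (j + 1) = V / B ^ j := fun j => by
      rw [pow_succ', ← Nat.div_div_eq_div_mul, Nat.add_mul_div_left _ _ hB, Nat.div_eq_of_lt h0,
        zero_add]
    refine ⟨f 0 + B * V, fun j hj => ?_, by rw [hdiv, hm]⟩
    rcases j with _ | j
    · simp [Nat.mod_eq_of_lt h0]
    · rw [hdiv]
      exact hV j (by omega)

section Increment

variable {B V j : ℕ}

/-- The hypothesis says that the `j` lowest digits are maximal, so that adding one carries into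
digit `j`. -/
theorem succ_eq_of_mod_eq (hB : 0 < B) (h : V % B ^ j = B ^ j - 1) : V + 1 = B ^ j * (V / B ^ j + 1) := by
  have h1 := Nat.div_add_mod V (B ^ j)
  have h2 : 0 < B ^ j := by positivity
  rw [mul_add, mul_one]
  omega

theorem succ_digit_of_lt (hB : 0 < B) (h : V % B ^ j = B ^ j - 1) {i : ℕ} (hi : i < j) :
    (V + 1) / B ^ i % B = 0 := by
  rw [succ_eq_of_mod_eq hB h, show j = i + (j - i - 1 + 1) by omega, pow_add, mul_assoc,
    Nat.mul_div_cancel_left _ (by positivity), pow_succ', mul_assoc]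
  exact Nat.mul_mod_right _ _

theorem succ_div_of_le (hB : 0 < B) (h : V % B ^ j = B ^ j - 1) {i : ℕ} (hi : j ≤ i) :
    (V + 1) / B ^ i = (V / B ^ j + 1) / B ^ (i - j) := by
  obtain ⟨l, rfl⟩ := Nat.exists_eq_add_of_le hi
  rw [succ_eq_of_mod_eq hB h, pow_add, ← Nat.div_div_eq_div_mul,
    Nat.mul_div_cancel_left _ (by positivity), Nat.add_sub_cancel_left]

theorem succ_div_of_gt (hB : 0 < B) (h : V % B ^ j = B ^ j - 1) (hd : V / B ^ j % B + 1 < B) {i : ℕ}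
    (hi : j < i) : (V + 1) / B ^ i = V / B ^ i := by
  obtain ⟨l, rfl⟩ := Nat.exists_eq_add_of_le (Nat.succ_le_of_lt hi)
  rw [succ_div_of_le hB h (by omega), show j.succ + l - j = l + 1 by omega, pow_succ',
    ← Nat.div_div_eq_div_mul, show j.succ + l = j + (l + 1) by omega, pow_add, pow_succ',
    ← Nat.div_div_eq_div_mul, ← Nat.div_div_eq_div_mul]
  congr 1
  rw [Nat.succ_div, if_neg, add_zero]
  intro hdvd
  have := Nat.mod_add_div (V / B ^ j) B
  rw [Nat.dvd_iff_mod_eq_zero, Nat.add_mod, Nat.mod_eq_of_lt (show 1 < B by omega),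
    Nat.mod_eq_of_lt hd] at hdvd
  omega

theorem succ_digit_self (hB : 0 < B) (h : V % B ^ j = B ^ j - 1) (hd : V / B ^ j % B + 1 < B) :
    (V + 1) / B ^ j % B = V / B ^ j % B + 1 := by
  rw [succ_div_of_le hB h le_rfl, Nat.sub_self, pow_zero, Nat.div_one, Nat.add_mod,
    Nat.mod_eq_of_lt (show 1 < B by omega), Nat.mod_eq_of_lt hd]

theorem mod_pow_succ_eq (hB : 0 < B) (h : V % B ^ j = B ^ j - 1) (hd : V / B ^ j % B + 1 = B) :
    V % B ^ (j + 1) = B ^ (j + 1) - 1 := by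
  rw [Nat.mod_pow_succ, h, show V / B ^ j % B = B - 1 by omega, pow_succ, Nat.mul_sub, mul_one]
  have h1 : B ^ j ≤ B ^ j * B := Nat.le_mul_of_pos_right _ hB
  have h2 : 0 < B ^ j := by positivity
  omega

end Increment

namespace Exponents

/-! ### The search -/

variable (E : Exponents)

def blockLen : Ex := .var 3 - .var 4

def maxWeight : Ex := Ex.scale.npow E.eU

/-- Pass to the next sequence of digits; `M[8]` is the most significant one. -/
def increment : Cm :=
  .seq (.set 13 (.lit 0)) (.seq
    (.whl ((Ex.var 13).less blockLen * (E.maxWeight - .lit 1).less (.ld E.digitEx))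
      (.seq (.put E.digitEx (.lit 0)) (.set 13 (.var 13 + .lit 1))))
    (.ite ((Ex.var 13).less blockLen) (.put E.digitEx (.ld E.digitEx + .lit 1))
      (.set 8 (.var 8 + .lit 1))))

/-- The admissible support size is the most significant digit of the odometer and so varies slowest.
At the first success it is at most the size for which a solution is known to exist. The program thus
needs no knowledge of the constants in the coreset bound. -/
def search : Cm :=
  .seq (.set 13 (.lit 0)) (.seq (.whl ((Ex.var 13).less blockLen)
      (.seq (.put E.digitEx (.lit 0)) (.set 13 (.var 13 + .lit 1))))
    (.seq (.set 8 (.lit 0)) (.seq (.set 7 (.lit 1))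
      (.whl (.var 7) (.seq E.check (.ite (.var 10) (.set 7 (.lit 0)) E.increment))))))

/-- The digits and `M[8]` represent `V`; nothing else has changed. -/
structure Odometer (n N s len : ℕ) (σ : HState) (V : ℕ) (τ : HState) : Prop where
  v : ∀ a < 7, τ.v a = σ.v a
  inp : τ.inp = σ.inp
  h : ∀ a : ℤ, a < len * (E.d + 2) → τ.h a = σ.h a
  digit : ∀ j < len - s, τ.h (len * (E.d + 2) + j) = (V / (E.U n N + 1) ^ j % (E.U n N + 1) : ℕ)
  top : τ.v 8 = (V / (E.U n N + 1) ^ (len - s) : ℕ)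

variable {E} {n N cap s len : ℕ} {X Q : ℤ} {σ τ : HState}

theorem rec_add_lt {d s j len : ℕ} (hj : j < len - s) {c : ℕ} (hc : c < d + 2) :
    ((s : ℤ) + j) * (d + 2) + c < len * (d + 2) := by
  have h1 : (s + j + 1) * (d + 2) ≤ len * (d + 2) := Nat.mul_le_mul_right _ (by omega)
  have h2 : (((s + j + 1) * (d + 2) : ℕ) : ℤ) ≤ ((len * (d + 2) : ℕ) : ℤ) := by exact_mod_cast h1
  push_cast at h2
  have h3 : (c : ℤ) < d + 2 := by exact_mod_cast hc
  linarith

theorem Block.of_eq (h : E.Block n N cap Q s len σ) (hv : ∀ a < 5, τ.v a = σ.v a)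
    (hh : ∀ a : ℤ, a < len * (E.d + 2) → τ.h a = σ.h a) : E.Block n N cap Q s len τ where
  v0 := (hv 0 (by omega)).trans h.v0
  v1 := (hv 1 (by omega)).trans h.v1
  v3 := (hv 3 (by omega)).trans h.v3
  v4 := (hv 4 (by omega)).trans h.v4
  hs := h.hs
  hlen := h.hlen
  hcap := h.hcap
  entry j hj c hc := by
    rw [hh _ (rec_add_lt hj (by omega))]
    exact h.entry j hj c hc
  weight j hj := by
    rw [hh _ (rec_add_lt hj (by omega))]
    exact h.weight j hj

theorem Odometer.ready {V : ℕ} (h : E.Block n N cap Q s len σ) (ho : E.Odometer n N s len σ V τ) :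
    E.Ready n N cap Q s len τ where
  toBlock := h.of_eq (fun a ha => ho.v a (by omega)) ho.h
  digit j hj := by
    rw [ho.digit j hj, Nat.abs_cast]
    exact_mod_cast Nat.lt_succ_iff.1 (Nat.mod_lt _ (by omega))

theorem Odometer.frame {V : ℕ} (ho : E.Odometer n N s len σ V τ) {k : ℕ} (hk : 9 ≤ k) {ρ : HState}
    (hf : FrameFrom k τ ρ) : E.Odometer n N s len σ V ρ where
  v a ha := (hf.1 a (by omega)).trans (ho.v a ha)
  inp := hf.2.2.trans ho.inp
  h a ha := by rw [hf.2.1]; exact ho.h a ha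
  digit := by rw [hf.2.1]; exact ho.digit
  top := (hf.1 8 (by omega)).trans ho.top

theorem eval_maxWeight (h0 : σ.v 0 = n) (h1 : σ.v 1 = N) : E.maxWeight.eval σ = (E.U n N : ℤ) := by
  simp [maxWeight, eval_scale h0 h1, U]

theorem ok_maxWeight : E.maxWeight.Ok cap σ := by simp [maxWeight, ok_scale]

theorem wp_increment (hE : E.Env n N X cap Q) (hU : (E.U n N : ℤ) ≤ X) (h : E.Block n N cap Q s len σ)
    {V : ℕ} (ho : E.Odometer n N s len σ V τ)
    (htop : (((V + 1) / (E.U n N + 1) ^ (len - s) : ℕ) : ℤ) ≤ X) :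
    Wp X cap E.increment (fun ρ => E.Odometer n N s len σ (V + 1) ρ ∧ ρ.v 7 = τ.v 7) τ := by
  have hX := hE.n_le
  have hlen := h.hlen
  have hs := h.hs
  set B := E.U n N + 1 with hB
  have hB0 : 0 < B := by omega
  refine wp_seq (wp_set (by simp) (by simp; omega) (wp_seq ?_))
  -- Invariant of the carry loop: the `j` lowest digits of `V` are maximal and have been set to
  -- zero, and everything above still shows `V`.
  refine wp_whl (fun m ρ => ∃ j ≤ len - s, m = len - s - j ∧ (∀ a < 7, ρ.v a = σ.v a) ∧
    ρ.inp = σ.inp ∧ (∀ a : ℤ, a < len * (E.d + 2) → ρ.h a = σ.h a) ∧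
    (∀ i < len - s, ρ.h (len * (E.d + 2) + i) = if i < j then 0 else ((V / B ^ i % B : ℕ) : ℤ)) ∧
    ρ.v 8 = (V / B ^ (len - s) : ℕ) ∧ ρ.v 7 = τ.v 7 ∧ ρ.v 13 = j ∧ V % B ^ j = B ^ j - 1) ?_ (len - s)
    ⟨0, by omega, by omega, ?_, ho.inp, ho.h, fun i hi => by
      rw [if_neg (Nat.not_lt_zero i)]; exact ho.digit i hi, ?_, by simp, by simp, ?_⟩
  · rintro m ρ ⟨j, hj, rfl, hv, hinp, hh, hdig, htop', h7, h13, hmod⟩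
    have hb : E.Block n N cap Q s len ρ := h.of_eq (fun a ha => hv a (by omega)) hh
    have hda : E.digitEx.eval ρ = len * (E.d + 2) + j := hb.eval_digitEx h13
    have hlt : (len : ℤ) * (E.d + 2) + j < cap := hb.digit_lt hj
    have hnn : 0 ≤ (len : ℤ) * (E.d + 2) + j := by positivity
    have hokd : E.digitEx.Ok cap ρ := by simp [digitEx]
    have hdlt : V / B ^ j % B < B := Nat.mod_lt _ hB0
    refine ⟨⟨by simp [blockLen], ⟨ok_maxWeight, trivial⟩, hb.ok_digitEx h13 hj⟩, fun hz => ?_,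
      fun hz => ?_⟩
    · rw [eval_mul, mul_eq_zero, eval_less_eq_zero, eval_less_eq_zero, eval_ld, hda, eval_sub,
        eval_maxWeight hb.v0 hb.v1, eval_lit] at hz
      refine wp_ite (by simp [blockLen]) (fun hc => ?_) fun hc => ?_
      · have hj' : j < len - s := (hb.eval_loopCond h13).1 hc
        have hz' : ρ.h (len * (E.d + 2) + j) ≤ E.U n N - 1 := by
          rcases hz with hz | hz
          · exact absurd ((eval_less_eq_zero _ _ _).2 hz) hc
          · exact hz
        rw [hdig j hj', if_neg (lt_irrefl j)] at hz'
        have hd : V / B ^ j % B + 1 < B := by omega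
        refine wp_put hokd ⟨hb.ok_digitEx h13 hj, trivial⟩ (by rw [hda]; exact hnn)
          (by rw [hda]; exact hlt) ?_ ⟨⟨hv, hinp, ?_, ?_, ?_⟩, h7⟩
        · rw [eval_add, eval_ld, eval_lit, hda, hdig j hj', if_neg (lt_irrefl j),
            abs_of_nonneg (by positivity)]
          omega
        · intro a ha
          simp only [hda]
          rw [Function.update_of_ne (by omega)]
          exact hh a ha
        · intro i hi
          simp only [hda, eval_add, eval_ld, eval_lit]
          rcases lt_trichotomy i j with hij | rfl | hij
          · rw [Function.update_of_ne (by omega), hdig i hi, if_pos hij, succ_digit_of_lt hB0 hmod hij]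
            rfl
          · rw [Function.update_self, hdig i hi, if_neg (lt_irrefl i), succ_digit_self hB0 hmod hd]
            push_cast
            rfl
          · rw [Function.update_of_ne (by omega), hdig i hi, if_neg (by omega),
              succ_div_of_gt hB0 hmod hd hij]
        · rw [succ_div_of_gt hB0 hmod hd hj']
          exact htop'
      · have hj' : j = len - s := by
          by_contra hne
          exact ((hb.eval_loopCond h13).2 (by omega)) hc
        have hsd : (V + 1) / B ^ (len - s) = V / B ^ (len - s) + 1 := by
          rw [← hj', succ_div_of_le hB0 hmod le_rfl, Nat.sub_self, pow_zero, Nat.div_one]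
        refine wp_set (by simp) ?_ ⟨⟨?_, hinp, hh, ?_, ?_⟩, ?_⟩
        · rw [hsd] at htop
          push_cast at htop
          rw [eval_add, eval_var, eval_lit, htop', abs_of_nonneg (by positivity)]
          push_cast
          exact htop
        · intro a ha
          simp only [Function.update_of_ne (by omega : a ≠ 8)]
          exact hv a ha
        · intro i hi
          simp only
          rw [hdig i hi, if_pos (by omega), succ_digit_of_lt hB0 hmod (by omega)]
          rfl
        · rw [hsd]
          simp [htop']
        · simp [h7]
    · rw [eval_mul, mul_ne_zero_iff, blockLen, hb.eval_loopCond h13, eval_less_ne_zero, eval_ld, hda, eval_sub,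
        eval_maxWeight hb.v0 hb.v1, eval_lit] at hz
      obtain ⟨hj', hz⟩ := hz
      rw [hdig j hj', if_neg (lt_irrefl j)] at hz
      refine wp_seq (wp_put hokd trivial (by rw [hda]; exact hnn) (by rw [hda]; exact hlt)
        (by simp; omega) (wp_set (by simp) ?_ ⟨len - s - (j + 1), by omega, j + 1, by omega, rfl, ?_,
          hinp, ?_, ?_, ?_, ?_, ?_, mod_pow_succ_eq hB0 hmod (by omega)⟩))
      · simp only [eval_add, eval_var, eval_lit, h13]
        rw [abs_of_nonneg (by positivity)]
        omega
      · intro a ha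
        simp only [Function.update_of_ne (by omega : a ≠ 13)]
        exact hv a ha
      · intro a ha
        simp only [hda]
        rw [Function.update_of_ne (by omega)]
        exact hh a ha
      · intro i hi
        simp only [hda, eval_lit]
        by_cases hij : i = j
        · rw [hij, Function.update_self, if_pos (by omega)]
        · rw [Function.update_of_ne (by omega), hdig i hi]
          by_cases hlt' : i < j
          · rw [if_pos hlt', if_pos (by omega)]
          · rw [if_neg hlt', if_neg (by omega)]
      · simpa using htop'
      · simpa using h7
      · simp [h13]
  · intro a ha
    simp only [Function.update_of_ne (by omega : a ≠ 13)]
    exact ho.v a ha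
  · rw [← ho.top]
    simp
  · simp [Nat.mod_one]

theorem _root_.StreamRAM.Passes.congr {d p R s len : ℕ} {h h' : ℤ → ℤ} {f f' : ℕ → ℤ} {m T : ℤ}
    (hh : ∀ a : ℤ, a < len * (d + 2) → h' a = h a) (hf : ∀ j < len - s, f' j = f j)
    (H : Passes d p R h s len f m T) : Passes d p R h' s len f' m T := by
  have hrec : ∀ t, ∀ j < len - s, recValue d p R h' ((s + j) * (d + 2)) t =
      recValue d p R h ((s + j) * (d + 2)) t := by
    intro t j hj
    rw [recValue, recValue]
    congr 2
    refine Finset.sum_congr rfl fun c hc => ?_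
    rw [hh _ (rec_add_lt hj (by have := Finset.mem_range.1 hc; omega))]
  have hb : ∀ g g' : ℕ → ℤ, (∀ j < len - s, g' j = g j) → ∀ t,
      blockSum d p R h' s g' (len - s) t = blockSum d p R h s g (len - s) t := by
    intro g g' hg t
    refine Finset.sum_congr rfl fun j hj => ?_
    rw [hg j (Finset.mem_range.1 hj), hrec t j (Finset.mem_range.1 hj)]
  refine ⟨le_of_eq_of_le (Finset.sum_congr rfl fun j hj => ?_) H.1, fun t ht => ?_⟩
  · rw [hf j (Finset.mem_range.1 hj)]
  · have h1 := hb (fun i => h ((s + i) * (d + 2) + d)) (fun i => h' ((s + i) * (d + 2) + d))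
      (fun j hj => hh _ (rec_add_lt hj (by omega))) t
    rw [hb f f' hf t, h1]
    exact H.2 t ht

theorem _root_.StreamRAM.Passes.mono {d p R s len : ℕ} {h : ℤ → ℤ} {f : ℕ → ℤ} {m m' T : ℤ} (hm : m ≤ m')
    (H : Passes d p R h s len f m T) : Passes d p R h s len f m' T := ⟨H.1.trans hm, H.2⟩

theorem wp_search (hE : E.Env n N X cap Q) (hU : (E.U n N : ℤ) ≤ X) (h : E.Block n N cap Q s len σ)
    {f : ℕ → ℕ} {m : ℕ} (hm : (m : ℤ) ≤ X) (hf : ∀ j < len - s, f j ≤ E.U n N)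
    (hpass : Passes E.d E.p (E.R n N) σ.h s len (fun j => f j) m (σ.v 6)) :
    Wp X cap E.search (fun τ => (∀ a < 7, τ.v a = σ.v a) ∧ τ.inp = σ.inp ∧
      (∀ a : ℤ, a < len * (E.d + 2) → τ.h a = σ.h a) ∧ ∃ g : ℕ → ℕ, (∀ j < len - s, g j ≤ E.U n N ∧
        τ.h (len * (E.d + 2) + j) = g j) ∧
      Passes E.d E.p (E.R n N) σ.h s len (fun j => g j) m (σ.v 6)) σ := by
  have hX := hE.n_le
  have hlen := h.hlen
  -- The odometer shows the given solution at `V₀`. The search therefore stops at some `V ≤ V₀`, and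
  -- there the top digit is at most that of `V₀`, which is `m`.
  obtain ⟨V₀, hV₀, hV₀m⟩ := exists_numeral (E.U n N + 1) (len - s) f
    (fun j hj => Nat.lt_succ_of_le (hf j hj)) m
  refine wp_seq (wp_set (by simp) (by simp; omega) (wp_seq ?_))
  refine wp_for (len - s) (fun j τ => (∀ a < 7, τ.v a = σ.v a) ∧ τ.inp = σ.inp ∧
      (∀ a : ℤ, a < len * (E.d + 2) → τ.h a = σ.h a) ∧ τ.v 13 = j ∧
      ∀ i < j, τ.h (len * (E.d + 2) + i) = 0) ?_ ?_ ?_ ?_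
  · rintro j τ hj ⟨hv, hinp, hh, h13, h0⟩
    have hb : E.Block n N cap Q s len τ := h.of_eq (fun a ha => hv a (by omega)) hh
    exact ⟨by simp [blockLen], hb.eval_loopCond h13⟩
  · rintro j τ hj ⟨hv, hinp, hh, h13, h0⟩
    have hb : E.Block n N cap Q s len τ := h.of_eq (fun a ha => hv a (by omega)) hh
    have hda : E.digitEx.eval τ = len * (E.d + 2) + j := hb.eval_digitEx h13
    have hlt : (len : ℤ) * (E.d + 2) + j < cap := hb.digit_lt hj.le
    refine wp_seq (wp_put (by simp [digitEx]) trivial (by rw [hda]; positivity) (by rw [hda]; exact hlt)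
      (by simp; omega) (wp_set (by simp) ?_ ⟨?_, hinp, ?_, ?_, ?_⟩))
    · simp only [eval_add, eval_var, eval_lit, h13]
      rw [abs_of_nonneg (by positivity)]
      omega
    · intro a ha
      simp only [Function.update_of_ne (by omega : a ≠ 13)]
      exact hv a ha
    · intro a ha
      simp only [hda]
      rw [Function.update_of_ne (by omega)]
      exact hh a ha
    · simp [h13]
    · intro i hi
      simp only [hda, eval_lit]
      by_cases hij : i = j
      · rw [hij, Function.update_self]
      · rw [Function.update_of_ne (by omega), h0 i (by omega)]
  · refine ⟨fun a ha => ?_, rfl, fun a _ => rfl, by simp, by simp⟩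
    simp only [Function.update_of_ne (by omega : a ≠ 13)]
  rintro τ ⟨hv, hinp, hh, h13, h0⟩
  refine wp_seq (wp_set (by simp) (by simp; omega) (wp_seq (wp_set (by simp) (by simp; omega) ?_)))
  refine wp_whl (fun k ρ => ∃ V ≤ V₀, E.Odometer n N s len σ V ρ ∧
    ((ρ.v 7 = 1 ∧ k = V₀ - V + 1) ∨ (ρ.v 7 = 0 ∧ k = 0 ∧ Passes E.d E.p (E.R n N) ρ.h s len
      (fun j => ρ.h (len * (E.d + 2) + j)) (ρ.v 8) (ρ.v 6)))) ?_ (V₀ + 1)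
    ⟨0, by omega, ⟨?_, hinp, hh, ?_, by simp⟩, Or.inl ⟨by simp, by omega⟩⟩
  · rintro k ρ ⟨V, hV, ho, hcase⟩
    have hr := ho.ready h
    refine ⟨trivial, fun hz => ?_, fun hz => ?_⟩
    · rcases hcase with ⟨h7, _⟩ | ⟨h7, _, hp⟩
      · rw [eval_var, h7] at hz
        exact absurd hz one_ne_zero
      · refine ⟨ho.v, ho.inp, ho.h, fun j => V / (E.U n N + 1) ^ j % (E.U n N + 1), fun j hj =>
          ⟨Nat.lt_succ_iff.1 (Nat.mod_lt _ (by omega)), ho.digit j hj⟩, ?_⟩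
        rw [ho.v 6 (by omega)] at hp
        refine (hp.congr (fun a ha => (ho.h a ha).symm) fun j hj => (ho.digit j hj).symm).mono ?_
        rw [ho.top, ← hV₀m]
        exact_mod_cast Nat.div_le_div_right hV
    · rcases hcase with ⟨h7, rfl⟩ | ⟨h7, _⟩
      swap
      · exact absurd h7 hz
      refine wp_seq ((wp_check hE hr).mono fun υ ⟨hfυ, h01, hiff⟩ => ?_)
      have hou := ho.frame (by omega) hfυ
      have h7υ : υ.v 7 = 1 := (hfυ.1 7 (by omega)).trans h7
      refine wp_ite trivial (fun hne => wp_set trivial (by simp; omega) ?_) fun heq => ?_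
      · refine ⟨0, by omega, V, hV, ⟨?_, hou.inp, hou.h, hou.digit, by simpa using hou.top⟩,
          Or.inr ⟨by simp, rfl, ?_⟩⟩
        · intro a ha
          simp only [Function.update_of_ne (by omega : a ≠ 7)]
          exact hou.v a ha
        · have hp := hiff.1 (h01.resolve_left hne)
          simp only [Function.update_of_ne (by omega : (8 : ℕ) ≠ 7),
            Function.update_of_ne (by omega : (6 : ℕ) ≠ 7)]
          rw [hfυ.2.1, hfυ.1 8 (by omega), hfυ.1 6 (by omega)]
          exact hp
      · have hVlt : V < V₀ := by
          refine lt_of_le_of_ne hV fun hEq => ?_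
          have h10 : υ.v 10 ≠ 1 := by
            rw [eval_var] at heq
            rw [heq]
            norm_num
          refine h10 (hiff.2 ?_)
          rw [ho.v 6 (by omega), ho.top, hEq, hV₀m]
          refine hpass.congr ho.h fun j hj => ?_
          rw [ho.digit j hj, hEq, hV₀ j hj]
        refine (wp_increment hE hU h hou ?_).mono fun ξ ⟨hoξ, h7ξ⟩ => ?_
        · refine le_trans ?_ hm
          rw [← hV₀m]
          exact_mod_cast Nat.div_le_div_right hVlt
        · exact ⟨V₀ - (V + 1) + 1, by omega, V + 1, hVlt, hoξ, Or.inl ⟨h7ξ.trans h7υ, rfl⟩⟩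
  · intro a ha
    simp only [Function.update_of_ne (by omega : a ≠ 7), Function.update_of_ne (by omega : a ≠ 8)]
    exact hv a ha
  · intro j hj
    simp only
    rw [h0 j hj]
    simp

end Exponents

end StreamRAM

namespace StreamRAM

/-! ### Lists of records -/

/-- The position of a row in the stream, the numerator of its weight, and a tag. -/
structure Rec where
  pos : ℕ
  u : ℕ
  tag : ℕ

/-- The heap begins with the records of `L`; entry `c` of the row at position `i` is `row i c`. -/
def Stored (d : ℕ) (row : ℕ → ℕ → ℤ) (h : ℤ → ℤ) (L : List Rec) : Prop :=
  ∀ (i : ℕ) (r : Rec), L[i]? = some r → (∀ c : ℕ, c < d → h (i * (d + 2) + c) = row r.pos c) ∧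
    h (i * (d + 2) + d) = r.u ∧ h (i * (d + 2) + (d + 1)) = r.tag

section Stored

variable {d : ℕ} {row : ℕ → ℕ → ℤ} {h h' : ℤ → ℤ} {L : List Rec}

theorem Stored.nil : Stored d row h [] := by
  intro i r hr
  simp at hr

theorem Stored.congr (hL : Stored d row h L)
    (hh : ∀ a : ℤ, a < L.length * (d + 2) → h' a = h a) : Stored d row h' L := by
  intro i r hr
  obtain ⟨hi, -⟩ := List.getElem?_eq_some_iff.1 hr
  have hlt : ∀ c : ℕ, c < d + 2 → (i : ℤ) * (d + 2) + c < L.length * (d + 2) := by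
    intro c hc
    have h1 : ((i : ℤ) + 1) * (d + 2) ≤ L.length * (d + 2) :=
      mul_le_mul_of_nonneg_right (by exact_mod_cast hi) (by positivity)
    have h2 : (c : ℤ) < d + 2 := by exact_mod_cast hc
    linarith
  obtain ⟨h1, h2, h3⟩ := hL i r hr
  refine ⟨fun c hc => by rw [hh _ (hlt c (by omega)), h1 c hc], by rw [hh _ (hlt d (by omega)), h2], ?_⟩
  rw [hh _ (by exact_mod_cast hlt (d + 1) (by omega)), h3]

theorem Stored.take (hL : Stored d row h L) (s : ℕ) : Stored d row h (L.take s) := by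
  intro i r hr
  rw [List.getElem?_take] at hr
  split_ifs at hr
  exact hL i r hr

theorem Stored.append_singleton (hL : Stored d row h L)
    (hh : ∀ a : ℤ, a < L.length * (d + 2) → h' a = h a) {r : Rec}
    (hrow : ∀ c : ℕ, c < d → h' (L.length * (d + 2) + c) = row r.pos c)
    (hu : h' (L.length * (d + 2) + d) = r.u) (ht : h' (L.length * (d + 2) + (d + 1)) = r.tag) :
    Stored d row h' (L ++ [r]) := by
  intro i q hq
  rcases lt_trichotomy i L.length with hi | rfl | hi
  · rw [List.getElem?_append_left hi] at hq
    exact hL.congr hh i q hq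
  · rw [List.getElem?_concat_length] at hq
    obtain rfl := Option.some.inj hq
    exact ⟨hrow, hu, ht⟩
  · rw [List.getElem?_eq_none (by simp; omega)] at hq
    cases hq

end Stored

/-- The records `g 0, …, g (j - 1)` with new weights `f` and tag `l`, without those of weight `0`. -/
def reweigh (g : ℕ → Rec) (f : ℕ → ℕ) (l : ℕ) : ℕ → List Rec
  | 0 => []
  | j + 1 => reweigh g f l j ++ if f j = 0 then [] else [⟨(g j).pos, f j, l⟩]

theorem length_reweigh_le (g : ℕ → Rec) (f : ℕ → ℕ) (l j : ℕ) : (reweigh g f l j).length ≤ j := by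
  induction j with
  | zero => simp [reweigh]
  | succ j ih =>
    rw [reweigh, List.length_append]
    split_ifs <;> simp <;> omega

namespace Exponents

variable (E : Exponents)

/-! ### Moving the surviving records -/

/-- Copy the first `c` entries of record `M[4] + M[13]` to record `M[16]`. -/
def copyEntries : ℕ → Cm
  | 0 => .skip
  | c + 1 => .seq (copyEntries c) (.put (.var 16 * .lit (E.d + 2) + .lit c) (.ld (E.recEx + .lit c)))

/-- Keep the records with a nonzero digit, which becomes the weight; the new tag is `M[5]`. -/
def compress : Cm :=
  .seq (.set 16 (.var 4)) (.seq (.set 13 (.lit 0)) (.seq (.whl ((Ex.var 13).less blockLen)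
    (.seq (.set 17 (.ld E.digitEx)) (.seq (.ite (.var 17)
        (.seq (E.copyEntries E.d) (.seq (.put (.var 16 * .lit (E.d + 2) + .lit E.d) (.var 17))
          (.seq (.put (.var 16 * .lit (E.d + 2) + .lit (E.d + 1)) (.var 5))
            (.set 16 (.var 16 + .lit 1))))) .skip)
      (.set 13 (.var 13 + .lit 1)))))
    (.set 3 (.var 16))))

/-- Replace the records from `M[4]` on by fewer ones; the error is governed by `M[6]`. -/
def reduce : Cm := .seq E.search E.compress

variable {E} {n N cap s len : ℕ} {X Q : ℤ} {σ τ : HState} {row : ℕ → ℕ → ℤ}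

/-- The target coincides with the source or lies entirely before it, so no cell is overwritten
before it has been read. -/
theorem wp_copyEntries {a b : ℤ} (ha : 0 ≤ a) (hab : b = a ∨ a + (E.d + 2) ≤ b)
    (hsrc : E.recEx.eval σ = b) (hdst : σ.v 16 * (E.d + 2) = a) (hcap : b + (E.d + 2) ≤ cap) (c : ℕ)
    (hc : c ≤ E.d) (hX : ∀ i : ℕ, i < c → |σ.h (b + i)| ≤ X) :
    Wp X cap (E.copyEntries c) (fun τ => τ.v = σ.v ∧ τ.inp = σ.inp ∧
      (∀ i : ℕ, i < c → τ.h (a + i) = σ.h (b + i)) ∧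
      ∀ z, (z < a ∨ a + c ≤ z) → τ.h z = σ.h z) σ := by
  induction c with
  | zero => exact wp_skip ⟨rfl, rfl, by simp, by simp⟩
  | succ c ih =>
    refine wp_seq ((ih (by omega) fun i hi => hX i (by omega)).mono ?_)
    rintro τ ⟨hv, hinp, h1, h2⟩
    have hd : (Ex.var 16 * .lit (E.d + 2) + .lit c).eval τ = a + c := by
      simp [hv, hdst]
    have hs : (E.recEx + .lit c).eval τ = b + c := by
      rw [eval_add, eval_lit, ← hsrc]
      simp [recEx, hv]
    have hb : τ.h (b + c) = σ.h (b + c) := h2 _ (by omega)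
    refine wp_put (by simp) ?_ (by rw [hd]; omega) (by rw [hd]; omega) ?_ ⟨hv, hinp, ?_, ?_⟩
    · refine ⟨by simp [recEx], by rw [hs]; omega, by rw [hs]; omega⟩
    · rw [eval_ld, hs, hb]
      exact hX c (by omega)
    · intro i hi
      simp only [hd, eval_ld, hs]
      by_cases hic : i = c
      · rw [hic, Function.update_self, hb]
      · rw [Function.update_of_ne (by omega), h1 i (by omega)]
    · intro z hz
      push_cast at hz
      simp only [hd]
      rw [Function.update_of_ne (by omega), h2 z (by omega)]

theorem wp_compress {L : List Rec} {g : ℕ → Rec} {f : ℕ → ℕ} {l : ℕ} (hX : (n : ℤ) + 1 ≤ X)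
    (hU : (E.U n N : ℤ) ≤ X) (hQ : Q ≤ X) (hl : (l : ℤ) ≤ X)
    (h : E.Block n N cap Q s L.length σ) (hL : Stored E.d row σ.h L)
    (hg : ∀ j < L.length - s, L[s + j]? = some (g j)) (h5 : σ.v 5 = l)
    (hf : ∀ j < L.length - s, f j ≤ E.U n N ∧ σ.h (L.length * (E.d + 2) + j) = f j) :
    Wp X cap E.compress (fun τ => (∀ a < 7, a ≠ 3 → τ.v a = σ.v a) ∧ τ.inp = σ.inp ∧
      τ.v 3 = (L.take s ++ reweigh g f l (L.length - s)).length ∧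
      Stored E.d row τ.h (L.take s ++ reweigh g f l (L.length - s))) σ := by
  have hlen := h.hlen
  have hs := h.hs
  have hsl : (L.take s).length = s := by rw [List.length_take]; omega
  have hlenle : ∀ j ≤ L.length - s, (L.take s ++ reweigh g f l j).length ≤ s + j := fun j _ => by
    rw [List.length_append, hsl]
    have := length_reweigh_le g f l j
    omega
  refine wp_seq (wp_set (by simp) (by rw [eval_var, h.v4, Nat.abs_cast]; omega) (wp_seq
    (wp_set (by simp) (by simp; omega) (wp_seq ?_))))
  -- The survivors are moved forward in place. At most `s + j` records are in the output before
  -- record `s + j` is processed, so that record, the later ones and the digits behind them are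
  -- still the original ones.
  refine wp_for (L.length - s) (fun j τ => (∀ a < 7, τ.v a = σ.v a) ∧ τ.inp = σ.inp ∧
    τ.v 13 = j ∧ τ.v 16 = (L.take s ++ reweigh g f l j).length ∧
    Stored E.d row τ.h (L.take s ++ reweigh g f l j) ∧
    ∀ z : ℤ, (s + j) * (E.d + 2) ≤ z → τ.h z = σ.h z) ?_ ?_ ?_ ?_
  · rintro j τ hj ⟨hv, hinp, h13, h16, hst, hh⟩
    refine ⟨by simp [blockLen], ?_⟩
    rw [eval_less_ne_zero]
    simp only [eval_var, blockLen, eval_sub, h13, hv 3 (by omega), hv 4 (by omega), h.v3, h.v4]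
    omega
  · rintro j τ hj ⟨hv, hinp, h13, h16, hst, hh⟩
    have hda : E.digitEx.eval τ = L.length * (E.d + 2) + j := by
      simp [digitEx, hv 3 (by omega), h.v3, h13]
    have hlt : (L.length : ℤ) * (E.d + 2) + j < cap := h.digit_lt hj.le
    have hge : ((s : ℤ) + j) * (E.d + 2) ≤ L.length * (E.d + 2) + j := by
      have := rec_add_lt (d := E.d) hj (c := 0) (by omega)
      push_cast at this
      omega
    have hdig : τ.h (L.length * (E.d + 2) + j) = f j := by rw [hh _ hge, (hf j hj).2]
    have hfX : |(f j : ℤ)| ≤ X := by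
      rw [Nat.abs_cast]
      exact le_trans (by exact_mod_cast (hf j hj).1) hU
    have hjX : |(j : ℤ) + 1| ≤ X := by
      rw [abs_of_nonneg (by positivity)]
      omega
    refine wp_seq (wp_set ⟨by simp [digitEx], by rw [hda]; positivity, by rw [hda]; exact hlt⟩
      (by rw [eval_ld, hda, hdig]; exact hfX) (wp_seq (wp_ite trivial (fun hne => ?_) fun heq => ?_)))
    · have hfj : f j ≠ 0 := by
        rw [eval_var] at hne
        simp only [Function.update_self, eval_ld, hda, hdig] at hne
        exact_mod_cast hne
      have hm := hlenle j hj.le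
      set m := (L.take s ++ reweigh g f l j).length with hmdef
      have hrec : ((s : ℤ) + j) * (E.d + 2) + (E.d + 2) ≤ cap := h.rec_lt hj
      have hab : ((s : ℤ) + j) * (E.d + 2) = m * (E.d + 2) ∨
          (m : ℤ) * (E.d + 2) + (E.d + 2) ≤ (s + j) * (E.d + 2) := by
        rcases hm.lt_or_eq with hm | hm
        · right
          have h1 : ((m : ℤ) + 1) * (E.d + 2) ≤ (s + j) * (E.d + 2) :=
            mul_le_mul_of_nonneg_right (by exact_mod_cast hm) (by positivity)
          linarith
        · left
          rw [hm]
          push_cast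
          rfl
      have hmnn : 0 ≤ (m : ℤ) * (E.d + 2) := by positivity
      refine wp_seq ((wp_copyEntries (X := X) (a := m * (E.d + 2)) (b := (s + j) * (E.d + 2)) hmnn hab ?_ ?_ hrec
        E.d le_rfl ?_).mono ?_)
      · simp [recEx, hv 4 (by omega), h.v4, h13]
      · simp [h16]
      · intro i hi
        simp only
        rw [hh _ (by omega)]
        exact (h.entry j hj i hi).trans hQ
      rintro ρ ⟨hρv, hρi, hρ1, hρ2⟩
      simp only at hρ1 hρ2
      have h16ρ : ρ.v 16 = m := by simp [hρv, h16]
      have h17ρ : ρ.v 17 = f j := by simp [hρv, hda, hdig]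
      have h5ρ : ρ.v 5 = l := by simp [hρv, hv 5 (by omega), h5]
      have h13ρ : ρ.v 13 = j := by simp [hρv, h13]
      have hvρ : ∀ a < 7, ρ.v a = σ.v a := fun a ha => by
        rw [hρv]
        simp only [Function.update_of_ne (by omega : a ≠ 17)]
        exact hv a ha
      have hmX : |(m : ℤ) + 1| ≤ X := by
        rw [abs_of_nonneg (by positivity)]
        omega
      have e1 : (Ex.var 16 * .lit (E.d + 2) + .lit E.d).eval ρ = m * (E.d + 2) + E.d := by
        simp [h16ρ]
      refine wp_seq (wp_put (by simp) trivial (by rw [e1]; positivity) (by rw [e1]; omega)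
        (by rw [eval_var, h17ρ]; exact hfX) (wp_seq ?_))
      have e2 : ∀ k : ℤ → ℤ, (Ex.var 16 * .lit (E.d + 2) + .lit (E.d + 1)).eval { ρ with h := k } =
          m * (E.d + 2) + (E.d + 1) := fun k => by simp [h16ρ]
      refine wp_put (by simp) trivial (by rw [e2]; positivity) (by rw [e2]; omega)
        (by rw [eval_var]; simp only [h5ρ]; rw [Nat.abs_cast]; exact hl) ?_
      refine wp_set (by simp) (by simp [h16ρ]; exact hmX) (wp_set (by simp) (by simp [h13ρ]; exact hjX) ?_)
      refine ⟨?_, ?_, ?_, ?_, ?_, ?_⟩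
      · intro a ha
        simp only [Function.update_of_ne (by omega : a ≠ 13), Function.update_of_ne (by omega : a ≠ 16)]
        exact hvρ a ha
      · simp only
        rw [hρi]
        exact hinp
      · simp [h13ρ]
      · rw [reweigh, if_neg hfj, ← List.append_assoc, List.length_append, ← hmdef]
        simp [h16ρ]
      · rw [reweigh, if_neg hfj, ← List.append_assoc]
        simp only [e1, e2]
        obtain ⟨hL1, -, -⟩ := hL _ _ (hg j hj)
        refine hst.append_singleton ?_ ?_ ?_ ?_
        · intro z hz
          rw [← hmdef] at hz
          rw [Function.update_of_ne (by omega), Function.update_of_ne (by omega), hρ2 z (by omega)]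
        · intro c hc
          rw [← hmdef, Function.update_of_ne (by omega), Function.update_of_ne (by omega), hρ1 c hc,
            hh _ (by omega), ← hL1 c hc]
          push_cast
          rfl
        · rw [← hmdef, Function.update_of_ne (by omega), Function.update_self, eval_var, h17ρ]
        · rw [← hmdef, Function.update_self, eval_var]
          exact h5ρ
      · intro z hz
        push_cast at hz
        have hz' : ((s : ℤ) + j) * (E.d + 2) + (E.d + 2) ≤ z := by linarith
        simp only [e1, e2]
        rw [Function.update_of_ne (by omega), Function.update_of_ne (by omega), hρ2 z (by omega),
          hh z (by omega)]
    · have hfj : f j = 0 := by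
        rw [eval_var] at heq
        simp only [Function.update_self, eval_ld, hda, hdig] at heq
        exact_mod_cast heq
      have hrw : reweigh g f l (j + 1) = reweigh g f l j := by rw [reweigh, if_pos hfj, List.append_nil]
      refine wp_skip (wp_set (by simp) (by simpa [h13] using hjX) ⟨?_, hinp, by simp [h13], ?_, ?_, ?_⟩)
      · intro a ha
        simp only [Function.update_of_ne (by omega : a ≠ 13), Function.update_of_ne (by omega : a ≠ 17)]
        exact hv a ha
      · rw [hrw]
        simp [h16]
      · rw [hrw]
        exact hst
      · intro z hz
        push_cast at hz
        refine hh z (le_trans ?_ hz)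
        exact mul_le_mul_of_nonneg_right (by omega) (by positivity)
  · refine ⟨?_, rfl, by simp, ?_, ?_, fun z _ => rfl⟩
    · intro a ha
      simp only [Function.update_of_ne (by omega : a ≠ 13), Function.update_of_ne (by omega : a ≠ 16)]
    · simp [reweigh, h.v4, hs]
    · rw [reweigh, List.append_nil]
      exact hL.take s
  · rintro τ ⟨hv, hinp, h13, h16, hst, hh⟩
    refine wp_set trivial ?_ ⟨?_, hinp, ?_, hst⟩
    · rw [eval_var, h16, Nat.abs_cast]
      have := hlenle _ le_rfl
      omega
    · intro a ha ha3
      simp only [Function.update_of_ne ha3]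
      exact hv a ha
    · simp [h16]

theorem wp_reduce {L : List Rec} {g : ℕ → Rec} {f : ℕ → ℕ} {l m : ℕ} (hE : E.Env n N X cap Q)
    (hU : (E.U n N : ℤ) ≤ X) (hQ : Q ≤ X) (hl : (l : ℤ) ≤ X) (hm : (m : ℤ) ≤ X)
    (h : E.Block n N cap Q s L.length σ) (hL : Stored E.d row σ.h L)
    (hg : ∀ j < L.length - s, L[s + j]? = some (g j)) (h5 : σ.v 5 = l)
    (hf : ∀ j < L.length - s, f j ≤ E.U n N)
    (hpass : Passes E.d E.p (E.R n N) σ.h s L.length (fun j => f j) m (σ.v 6)) :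
    Wp X cap E.reduce (fun τ => ∃ f' : ℕ → ℕ, (∀ j < L.length - s, f' j ≤ E.U n N) ∧
      Passes E.d E.p (E.R n N) σ.h s L.length (fun j => f' j) m (σ.v 6) ∧
      (∀ a < 7, a ≠ 3 → τ.v a = σ.v a) ∧ τ.inp = σ.inp ∧
      τ.v 3 = (L.take s ++ reweigh g f' l (L.length - s)).length ∧
      Stored E.d row τ.h (L.take s ++ reweigh g f' l (L.length - s))) σ := by
  refine wp_seq ((wp_search hE hU h hm hf hpass).mono ?_)
  rintro τ ⟨hv, hinp, hh, f', hf', hp'⟩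
  refine (wp_compress hE.n_le hU hQ hl (h.of_eq (fun a ha => hv a (by omega)) hh) (hL.congr hh) hg
    ((hv 5 (by omega)).trans h5) hf').mono ?_
  rintro ρ ⟨hv', hinp', h3, hst⟩
  exact ⟨f', fun j hj => (hf' j hj).1, hp', fun a ha ha3 => (hv' a ha ha3).trans (hv a ha),
    hinp'.trans hinp, h3, hst⟩

/-! ### Reading a row and choosing the block to reduce -/

variable (E) in
/-- Read `c` numbers into record `M[3]`. -/
def readEntries : ℕ → Cm
  | 0 => .skip
  | c + 1 => .seq (readEntries c) (.seq (.nxt 16) (.put (.var 3 * .lit (E.d + 2) + .lit c) (.var 16)))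

theorem wp_readEntries {l rest : List ℤ} (hin : σ.inp = l ++ rest) (hl : ∀ z ∈ l, |z| ≤ X)
    (hlen : σ.v 3 = len) (hcap : (len : ℤ) * (E.d + 2) + (E.d + 2) ≤ cap) (c : ℕ) (hcd : c ≤ E.d)
    (hc : c ≤ l.length) :
    Wp X cap (E.readEntries c) (fun τ => (∀ a < 7, τ.v a = σ.v a) ∧ τ.inp = l.drop c ++ rest ∧
      (∀ z, z < (len : ℤ) * (E.d + 2) → τ.h z = σ.h z) ∧
      ∀ i : ℕ, i < c → τ.h (len * (E.d + 2) + i) = l.getD i 0) σ := by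
  induction c with
  | zero => exact wp_skip ⟨fun _ _ => rfl, by simpa using hin, by simp, by simp⟩
  | succ c ih =>
    refine wp_seq ((ih (by omega) (by omega)).mono ?_)
    rintro τ ⟨hv, hinp, h1, h2⟩
    have hcl : c < l.length := by omega
    rw [List.drop_eq_getElem_cons hcl, List.cons_append] at hinp
    have hb := hl _ (List.getElem_mem hcl)
    have e1 : (Ex.var 3 * .lit (E.d + 2) + .lit c).eval
        { τ with v := Function.update τ.v 16 l[c], inp := l.drop (c + 1) ++ rest } =
        len * (E.d + 2) + c := by
      simp [hv 3 (by omega), hlen]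
    have hnn : 0 ≤ (len : ℤ) * (E.d + 2) := by positivity
    refine wp_seq (wp_nxt hinp hb (wp_put (by simp) trivial (by rw [e1]; omega) (by rw [e1]; omega)
      (by simpa using hb) ⟨?_, rfl, ?_, ?_⟩))
    · intro a ha
      simp only [Function.update_of_ne (by omega : a ≠ 16)]
      exact hv a ha
    · intro z hz
      simp only [e1]
      rw [Function.update_of_ne (by omega), h1 z hz]
    · intro i hi
      simp only [e1]
      by_cases hic : i = c
      · rw [hic, Function.update_self, List.getD_eq_getElem _ _ hcl]
        simp
      · rw [Function.update_of_ne (by omega), h2 i (by omega)]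

variable (E) in
/-- The tag of record `M[4] - 1`. -/
def prevTag : Ex :=
  .ld ((Ex.var 4 - (Ex.lit 0).less (.var 4)) * .lit (E.d + 2) + .lit (E.d + 1))

variable (E) in
/-- Lower `M[4]` and raise `M[5]` until the tags before `M[4]` are above `M[5]`. -/
def scan : Cm :=
  .whl ((Ex.lit 0).less (.var 4) * E.prevTag.less (.var 5 + .lit 1))
    (.seq (.set 5 (.var 5 + (Ex.var 5 - .lit 1).less E.prevTag)) (.set 4 (.var 4 - .lit 1)))

theorem wp_scan {tag : ℕ → ℕ} (hX : (len : ℤ) + 1 ≤ X) (h4 : σ.v 4 = len) (h5 : σ.v 5 = 0)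
    (hcap : (len : ℤ) * (E.d + 2) + (E.d + 2) ≤ cap)
    (ht : ∀ j : ℕ, j < len → σ.h (j * (E.d + 2) + (E.d + 1)) = tag j) :
    Wp X cap E.scan (fun τ => (∀ a, a ≠ 4 → a ≠ 5 → τ.v a = σ.v a) ∧ τ.h = σ.h ∧ τ.inp = σ.inp ∧
      ∃ s l : ℕ, τ.v 4 = s ∧ τ.v 5 = l ∧ s ≤ len ∧ l ≤ len ∧ (∀ j, s ≤ j → j < len → tag j < l) ∧
        (∀ t < l, ∃ j, s ≤ j ∧ j < len ∧ tag j = t) ∧ (s = 0 ∨ l < tag (s - 1))) σ := by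
  refine wp_whl (fun s τ => s ≤ len ∧ (∀ a, a ≠ 4 → a ≠ 5 → τ.v a = σ.v a) ∧ τ.h = σ.h ∧
    τ.inp = σ.inp ∧ τ.v 4 = s ∧ ∃ l : ℕ, τ.v 5 = l ∧ l ≤ len - s ∧
      (∀ j, s ≤ j → j < len → tag j < l) ∧ (∀ t < l, ∃ j, s ≤ j ∧ j < len ∧ tag j = t)) ?_ len
    ⟨le_rfl, fun _ _ _ => rfl, rfl, rfl, h4, 0, by simpa using h5, by omega, by omega, by omega⟩
  rintro s τ ⟨hs, hv, hh, hinp, h4, l, h5, hl, htag, hex⟩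
  -- The loop condition is a product and reads the tag even if `M[4] = 0`. Subtracting the truth
  -- value of `0 < M[4]` keeps the address legal.
  have haddr : ((Ex.var 4 - (Ex.lit 0).less (.var 4)) * .lit (E.d + 2) + .lit (E.d + 1)).eval τ =
      ((s - 1 : ℕ) : ℤ) * (E.d + 2) + (E.d + 1) := by
    simp only [eval_add, eval_mul, eval_sub, eval_var, eval_lit, eval_less, h4]
    rcases Nat.eq_zero_or_pos s with rfl | h0
    · simp
    · rw [if_pos (by exact_mod_cast h0), Nat.cast_sub h0]
      simp
  have hle : ((s - 1 : ℕ) : ℤ) * (E.d + 2) ≤ len * (E.d + 2) :=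
    mul_le_mul_of_nonneg_right (by omega) (by positivity)
  have hok : E.prevTag.Ok cap τ := by
    refine ⟨by simp, ?_, ?_⟩
    · rw [haddr]; positivity
    · rw [haddr]; omega
  have hval : 0 < s → E.prevTag.eval τ = tag (s - 1) := fun h0 => by
    rw [prevTag, eval_ld, haddr, hh, ht (s - 1) (by omega)]
  refine ⟨⟨by simp, hok, by simp⟩, fun hz => ?_, fun hz => ?_⟩
  · refine ⟨hv, hh, hinp, s, l, h4, h5, hs, by omega, htag, hex, ?_⟩
    rw [eval_mul, mul_eq_zero, eval_less_eq_zero, eval_less_eq_zero, eval_lit, eval_var, h4] at hz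
    rcases Nat.eq_zero_or_pos s with h0 | h0
    · exact Or.inl h0
    · right
      rcases hz with hz | hz
      · omega
      · rw [hval h0, eval_add, eval_var, eval_lit, h5] at hz
        omega
  · rw [eval_mul, mul_ne_zero_iff, eval_less_ne_zero, eval_less_ne_zero, eval_lit, eval_var, h4] at hz
    have h0 : 0 < s := by exact_mod_cast hz.1
    have hz2 := hz.2
    rw [hval h0, eval_add, eval_var, eval_lit, h5] at hz2
    -- Here the tag is at most `l`, so the comparison adds one exactly if the tag equals `l`, as in
    -- the carry of a binary counter.
    have hnew : (Ex.var 5 + (Ex.var 5 - .lit 1).less E.prevTag).eval τ =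
        ((max l (tag (s - 1) + 1) : ℕ) : ℤ) := by
      rw [eval_add, eval_less, eval_sub, eval_var, eval_lit, hval h0, h5]
      split_ifs with h1 <;> omega
    refine wp_seq (wp_set ⟨trivial, ⟨trivial, trivial⟩, hok⟩ ?_ (wp_set (by simp) ?_
      ⟨s - 1, by omega, by omega, ?_, hh, hinp, ?_, max l (tag (s - 1) + 1), ?_, by omega, ?_, ?_⟩))
    · rw [hnew, Nat.abs_cast]
      omega
    · simp only [eval_sub, eval_var, eval_lit, Function.update_of_ne (by omega : (4 : ℕ) ≠ 5), h4]
      rw [abs_of_nonneg (by omega)]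
      omega
    · intro a ha4 ha5
      simp only [Function.update_of_ne ha4, Function.update_of_ne ha5]
      exact hv a ha4 ha5
    · simp only [Function.update_self, eval_sub, eval_var, eval_lit,
        Function.update_of_ne (by omega : (4 : ℕ) ≠ 5), h4]
      omega
    · simp only [Function.update_of_ne (by omega : (5 : ℕ) ≠ 4), Function.update_self]
      exact hnew
    · intro j hj hjl
      rcases hj.lt_or_eq with hj | rfl
      · have := htag j (by omega) hjl
        omega
      · omega
    · intro t htl
      by_cases htl' : t < l
      · obtain ⟨j, hj, hjl, hjt⟩ := hex t htl'
        exact ⟨j, by omega, hjl, hjt⟩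
      · exact ⟨s - 1, le_rfl, by omega, by omega⟩

end Exponents

end StreamRAM

namespace StreamRAM

/-! ### Testing on integer points -/

/-- A vector can be replaced by one whose size is controlled by its inner products with given
integer vectors. -/
theorem exists_conditioned {d k : ℕ} {Q : ℝ} (hQ : 1 ≤ Q) (b : Fin k → Fin d → ℤ)
    (hb : ∀ j c, |(b j c : ℝ)| ≤ Q) (x : Fin d → ℝ) {M : ℝ} (hM0 : 0 ≤ M)
    (hM : ∀ j, |∑ c, (b j c : ℝ) * x c| ≤ M) :
    ∃ y : Fin d → ℝ, (∀ j, ∑ c, (b j c : ℝ) * y c = ∑ c, (b j c : ℝ) * x c) ∧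
      ∀ c, |y c| ≤ d * (d.factorial * Q ^ d) * M := by
  set row : Fin k → Fin d → ℝ := fun j c => b j c with hrow
  -- A basis `s` of the span of the rows is taken among the rows and completed to a basis `t` of the
  -- space by unit vectors, so all its vectors are integral with entries at most `Q`. The new vector
  -- has the prescribed inner products with `s` and the inner product zero with the added vectors.
  obtain ⟨s, hs, -, hspan, hind⟩ := exists_linearIndepOn_id_extension (K := ℝ)
    (linearIndepOn_empty ℝ (id : (Fin d → ℝ) → Fin d → ℝ)) (Set.empty_subset (Set.range row))
  obtain ⟨t, ht, hst, hspan', hind'⟩ := exists_linearIndepOn_id_extension (K := ℝ) hind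
    (Set.subset_union_left (t := Set.range fun c : Fin d => (Pi.single c 1 : Fin d → ℝ)))
  have htop : ⊤ ≤ Submodule.span ℝ t := by
    intro v _
    rw [← (Pi.basisFun ℝ (Fin d)).sum_repr v]
    refine Submodule.sum_mem _ fun c _ => Submodule.smul_mem _ _ (hspan' (Or.inr ⟨c, ?_⟩))
    simp
  have hint : ∀ v ∈ t, ∃ z : Fin d → ℤ, (∀ c, v c = z c) ∧ ∀ c, |(z c : ℝ)| ≤ Q := by
    intro v hv
    rcases ht hv with hv | ⟨c, rfl⟩
    · obtain ⟨j, rfl⟩ := hs hv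
      exact ⟨b j, fun _ => rfl, hb j⟩
    · refine ⟨Pi.single c 1, fun c' => ?_, fun c' => ?_⟩
      · by_cases h : c' = c
        · subst h; simp
        · simp [h]
      · by_cases h : c' = c
        · subst h; simpa using hQ
        · simp [h]; linarith
  set B := Module.Basis.mk (v := ((↑) : t → Fin d → ℝ)) hind' (by simpa using htop) with hB
  set e : Fin d ≃ t := (Pi.basisFun ℝ (Fin d)).indexEquiv B with he
  choose z hz hzQ using fun i : Fin d => hint (e i) (e i).2
  set A : Matrix (Fin d) (Fin d) ℤ := Matrix.of z with hA
  set A' : Matrix (Fin d) (Fin d) ℝ := A.map (Int.cast : ℤ → ℝ) with hA'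
  have hA'e : ∀ i, A' i = (e i : Fin d → ℝ) := fun i => by
    funext c
    simp [hA', hA, hz]
  have hunit : IsUnit A' := by
    rw [← Matrix.linearIndependent_rows_iff_isUnit]
    have h1 : A'.row = fun i => ((e i : t) : Fin d → ℝ) := funext hA'e
    rw [h1]
    exact LinearIndependent.comp hind' e e.injective
  have hdet' : A'.det = (A.det : ℝ) := by
    rw [hA']
    exact (Int.cast_det A).symm
  have hdetu : IsUnit A'.det := (Matrix.isUnit_iff_isUnit_det A').1 hunit
  -- A nonzero integer is at least one in absolute value. By Cramer's rule the solution is then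
  -- bounded by cofactors, however badly conditioned the rows are.
  have hdet1 : 1 ≤ |A'.det| := by
    have h1 : A.det ≠ 0 := fun h0 => by
      rw [hdet', h0] at hdetu
      simp at hdetu
    rw [hdet', ← Int.cast_abs]
    exact_mod_cast Int.one_le_abs h1
  classical
  set val : Fin d → ℝ := fun i => if (e i : Fin d → ℝ) ∈ s then ∑ c, A' i c * x c else 0 with hval
  have hvalM : ∀ i, |val i| ≤ M := by
    intro i
    simp only [hval]
    split_ifs with h
    · obtain ⟨j, hj⟩ := hs h
      have h2 := hM j
      have h3 : ∀ c, A' i c = (b j c : ℝ) := fun c => by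
        rw [hA'e, ← hj]
      simpa only [h3] using h2
    · simpa using hM0
  refine ⟨A'⁻¹.mulVec val, fun j => ?_, fun c => ?_⟩
  · have hmul : A'.mulVec (A'⁻¹.mulVec val) = val := by
      rw [Matrix.mulVec_mulVec, Matrix.mul_nonsing_inv _ hdetu, Matrix.one_mulVec]
    have hmem : row j ∈ Submodule.span ℝ s := hspan ⟨j, rfl⟩
    have key : ∀ v ∈ Submodule.span ℝ s, ∑ c, v c * (A'⁻¹.mulVec val) c = ∑ c, v c * x c := by
      intro v hv
      induction hv using Submodule.span_induction with
      | mem v hv =>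
        obtain ⟨i, hi⟩ := e.surjective ⟨v, hst hv⟩
        have h1 : A' i = v := by rw [hA'e, hi]
        have h2 := congrFun hmul i
        simp only [hval, hi, hv, if_true] at h2
        rw [← h1]
        exact h2
      | zero => simp
      | add v w _ _ h1 h2 =>
        simp only [Pi.add_apply, add_mul, Finset.sum_add_distrib, h1, h2]
      | smul a v _ h1 =>
        simp only [Pi.smul_apply, smul_eq_mul, mul_assoc, ← Finset.mul_sum, h1]
    exact key _ hmem
  · have hadj : ∀ i, |A'.adjugate c i| ≤ d.factorial * Q ^ d := by
      intro i
      rw [Matrix.adjugate_apply]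
      have h1 := Matrix.det_le (A := A'.updateRow i (Pi.single c 1)) (abv := AbsoluteValue.abs) (x := Q)
        (fun i' j' => by
          by_cases h : i' = i
          · subst h
            rw [Matrix.updateRow_self]
            by_cases hc : j' = c
            · subst hc; simpa using hQ
            · simp [hc]; linarith
          · rw [Matrix.updateRow_ne h]
            simpa [hA', hA] using hzQ i' j')
      simpa using h1
    rw [Matrix.inv_def, Matrix.smul_mulVec, Pi.smul_apply, smul_eq_mul, abs_mul, Ring.inverse_eq_inv',
      abs_inv]
    have h1 : |A'.det|⁻¹ ≤ 1 := inv_le_one_of_one_le₀ hdet1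
    refine (mul_le_of_le_one_left (abs_nonneg _) h1).trans ?_
    rw [Matrix.mulVec, dotProduct]
    refine (Finset.abs_sum_le_sum_abs _ _).trans ?_
    calc _ ≤ ∑ _i : Fin d, (d.factorial * Q ^ d) * M := by
          refine Finset.sum_le_sum fun i _ => ?_
          rw [abs_mul]
          exact mul_le_mul (hadj i) (hvalM i) (abs_nonneg _) (by positivity)
      _ = _ := by simp [mul_assoc]

/-- An inequality between weighted sums that holds at all integer points of a large box holds, up to
a factor of two, at all real points. -/
theorem le_two_mul_of_integer_test {d p k : ℕ} {Q U T : ℝ} (hd : 1 ≤ d) (hp : 1 ≤ p) (hQ : 1 ≤ Q)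
    (hT : 0 ≤ T) {b : Fin k → Fin d → ℤ} (hb : ∀ j c, |(b j c : ℝ)| ≤ Q) {u f : Fin k → ℝ}
    (hu : ∀ j, 1 ≤ u j ∧ u j ≤ U) (hf : ∀ j, 0 ≤ f j ∧ f j ≤ U) {R : ℝ}
    (hR : d * (d.factorial * Q ^ d) * ((T + 1) * (k * U) * (d * Q * p * 2 ^ p)) + 1 ≤ R)
    (H : ∀ z : Fin d → ℤ, (∀ c, |(z c : ℝ)| ≤ R) →
      T * |∑ j, f j * |∑ c, (b j c : ℝ) * z c| ^ p - ∑ j, u j * |∑ c, (b j c : ℝ) * z c| ^ p| ≤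
        ∑ j, u j * |∑ c, (b j c : ℝ) * z c| ^ p) (x : Fin d → ℝ) :
    T * |∑ j, f j * |∑ c, (b j c : ℝ) * x c| ^ p - ∑ j, u j * |∑ c, (b j c : ℝ) * x c| ^ p| ≤
      2 * ∑ j, u j * |∑ c, (b j c : ℝ) * x c| ^ p := by
  rcases Nat.eq_zero_or_pos k with rfl | hk
  · simp
  have : Nonempty (Fin k) := ⟨⟨0, hk⟩⟩
  obtain ⟨j₀, hj₀⟩ := Finite.exists_max fun j => |∑ c, (b j c : ℝ) * x c|
  set μ := |∑ c, (b j₀ c : ℝ) * x c| with hμ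
  have hμ0 : 0 ≤ μ := abs_nonneg _
  rcases hμ0.eq_or_lt with h0 | hμpos
  · have hz : ∀ j, |∑ c, (b j c : ℝ) * x c| = 0 := fun j =>
      le_antisymm ((hj₀ j).trans h0.symm.le) (abs_nonneg _)
    simp [hz, show p ≠ 0 by omega]
  have hU1 : 1 ≤ U := (hu j₀).1.trans (hu j₀).2
  have hd' : (1 : ℝ) ≤ d := by exact_mod_cast hd
  have hp' : (1 : ℝ) ≤ p := by exact_mod_cast hp
  have hk' : (1 : ℝ) ≤ k := by exact_mod_cast hk
  have h2p : (1 : ℝ) ≤ 2 ^ p := one_le_pow₀ (by norm_num)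
  -- The vector is scaled until its largest inner product is `M` and then rounded to an integer
  -- point. Since the weights are at least one, the weighted sum is at least `M ^ p`. `M` is so
  -- large that the total effect `(T + 1) * (k * U * Δ)` of the rounding does not exceed this.
  set M := (T + 1) * (k * U) * (d * Q * p * 2 ^ p) with hMdef
  have hdQ : 1 ≤ d * Q := one_le_mul_of_one_le_of_one_le hd' hQ
  have hMdQ : d * Q ≤ M := by
    have h1 : (1 : ℝ) ≤ (T + 1) * (k * U) :=
      one_le_mul_of_one_le_of_one_le (by linarith) (one_le_mul_of_one_le_of_one_le hk' hU1)
    have h2 : (1 : ℝ) ≤ p * 2 ^ p := one_le_mul_of_one_le_of_one_le hp' h2p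
    calc d * Q = 1 * (d * Q * 1) := by ring
      _ ≤ (T + 1) * (k * U) * (d * Q * (p * 2 ^ p)) := by gcongr
      _ = M := by rw [hMdef]; ring
  have hMpos : 0 < M := by linarith
  -- pass to the scaled vector
  obtain ⟨y, hy, hyM⟩ := exists_conditioned hQ b hb (fun c => M / μ * x c) hMpos.le (fun j => by
    have h1 : ∑ c, (b j c : ℝ) * (M / μ * x c) = M / μ * ∑ c, (b j c : ℝ) * x c := by
      rw [Finset.mul_sum]
      exact Finset.sum_congr rfl fun c _ => by ring
    rw [h1, abs_mul, abs_of_nonneg (by positivity)]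
    calc M / μ * |∑ c, (b j c : ℝ) * x c| ≤ M / μ * μ := by gcongr; exact hj₀ j
      _ = M := by field_simp)
  have hys : ∀ j, |∑ c, (b j c : ℝ) * y c| = M / μ * |∑ c, (b j c : ℝ) * x c| := fun j => by
    have h1 : ∑ c, (b j c : ℝ) * (M / μ * x c) = M / μ * ∑ c, (b j c : ℝ) * x c := by
      rw [Finset.mul_sum]
      exact Finset.sum_congr rfl fun c _ => by ring
    rw [hy, h1, abs_mul, abs_of_nonneg (by positivity)]
  have hyle : ∀ j, |∑ c, (b j c : ℝ) * y c| ≤ M := fun j => by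
    rw [hys]
    calc M / μ * |∑ c, (b j c : ℝ) * x c| ≤ M / μ * μ := by gcongr; exact hj₀ j
      _ = M := by field_simp
  have hscale : ∀ w : Fin k → ℝ, ∑ j, w j * |∑ c, (b j c : ℝ) * y c| ^ p =
      (M / μ) ^ p * ∑ j, w j * |∑ c, (b j c : ℝ) * x c| ^ p := fun w => by
    rw [Finset.mul_sum]
    refine Finset.sum_congr rfl fun j _ => ?_
    rw [hys, mul_pow]
    ring
  set z : Fin d → ℤ := fun c => ⌊y c⌋ with hz
  have hzy : ∀ c, |(z c : ℝ) - y c| ≤ 1 := fun c => by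
    rw [abs_sub_comm, abs_of_nonneg (by linarith [Int.floor_le (y c)])]
    linarith [Int.lt_floor_add_one (y c)]
  have hzR : ∀ c, |(z c : ℝ)| ≤ R := fun c => by
    have h1 : |(z c : ℝ)| ≤ |(z c : ℝ) - y c| + |y c| := by
      have := abs_add_le ((z c : ℝ) - y c) (y c)
      simpa using this
    linarith [hzy c, hyM c]
  have hclose : ∀ j, |(∑ c, (b j c : ℝ) * z c) - ∑ c, (b j c : ℝ) * y c| ≤ d * Q := fun j => by
    rw [← Finset.sum_sub_distrib]
    refine (Finset.abs_sum_le_sum_abs _ _).trans ?_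
    calc _ ≤ ∑ _c : Fin d, Q * 1 := by
          refine Finset.sum_le_sum fun c _ => ?_
          rw [← mul_sub, abs_mul]
          exact mul_le_mul (hb j c) (hzy c) (abs_nonneg _) (by linarith)
      _ = _ := by simp
  have hzle : ∀ j, |∑ c, (b j c : ℝ) * z c| ≤ 2 * M := fun j => by
    have h1 := abs_add_le ((∑ c, (b j c : ℝ) * z c) - ∑ c, (b j c : ℝ) * y c) (∑ c, (b j c : ℝ) * y c)
    rw [sub_add_cancel] at h1
    linarith [hclose j, hyle j]
  set Δ := d * Q * (p * (2 * M) ^ (p - 1)) with hΔ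
  have hdiff : ∀ w : Fin k → ℝ, (∀ j, |w j| ≤ U) →
      |∑ j, w j * |∑ c, (b j c : ℝ) * z c| ^ p - ∑ j, w j * |∑ c, (b j c : ℝ) * y c| ^ p| ≤ k * U * Δ := by
    intro w hw
    rw [← Finset.sum_sub_distrib]
    refine (Finset.abs_sum_le_sum_abs _ _).trans ?_
    calc _ ≤ ∑ _j : Fin k, U * Δ := by
          refine Finset.sum_le_sum fun j _ => ?_
          rw [← mul_sub, abs_mul]
          refine mul_le_mul (hw j) ?_ (abs_nonneg _) (by linarith)
          refine (abs_abs_pow_sub_abs_pow_le (hzle j) ((hyle j).trans (by linarith)) p).trans ?_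
          exact mul_le_mul_of_nonneg_right (hclose j) (by positivity)
      _ = _ := by simp [mul_assoc]
  have hsmall : (T + 1) * (k * U * Δ) ≤ M ^ p := by
    have h1 : M ^ p = M ^ (p - 1) * M := by rw [← pow_succ, Nat.sub_add_cancel hp]
    have h2 : (2 : ℝ) ^ p = 2 ^ (p - 1) * 2 := by rw [← pow_succ, Nat.sub_add_cancel hp]
    have h3 : (T + 1) * (k * U * Δ) * 2 = M ^ (p - 1) * M := by
      rw [hΔ, mul_pow]
      nth_rewrite 3 [hMdef]
      rw [h2]
      ring
    have h4 : 0 ≤ (T + 1) * (k * U * Δ) := by positivity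
    rw [h1]
    linarith
  have hFy : M ^ p ≤ ∑ j, u j * |∑ c, (b j c : ℝ) * y c| ^ p := by
    have h1 : |∑ c, (b j₀ c : ℝ) * y c| = M := by
      rw [hys, ← hμ]
      field_simp
    calc M ^ p = 1 * |∑ c, (b j₀ c : ℝ) * y c| ^ p := by rw [h1, one_mul]
      _ ≤ u j₀ * |∑ c, (b j₀ c : ℝ) * y c| ^ p := by gcongr; exact (hu j₀).1
      _ ≤ _ := Finset.single_le_sum (f := fun j => u j * |∑ c, (b j c : ℝ) * y c| ^ p)
          (fun j _ => mul_nonneg (by linarith [(hu j).1]) (by positivity)) (Finset.mem_univ j₀)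
  have hd1 := hdiff u fun j => by rw [abs_of_nonneg (by linarith [(hu j).1])]; exact (hu j).2
  have hd2 := hdiff (fun j => f j - u j) fun j => by
    rw [abs_le]
    constructor <;> linarith [(hu j).1, (hu j).2, (hf j).1, (hf j).2]
  have hHz := H z hzR
  simp only [sub_mul, Finset.sum_sub_distrib] at hd2
  set Gz := ∑ j, f j * |∑ c, (b j c : ℝ) * z c| ^ p
  set Fz := ∑ j, u j * |∑ c, (b j c : ℝ) * z c| ^ p
  have hy2 : T * |∑ j, f j * |∑ c, (b j c : ℝ) * y c| ^ p - ∑ j, u j * |∑ c, (b j c : ℝ) * y c| ^ p| ≤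
      2 * ∑ j, u j * |∑ c, (b j c : ℝ) * y c| ^ p := by
    set Gy := ∑ j, f j * |∑ c, (b j c : ℝ) * y c| ^ p
    set Fy := ∑ j, u j * |∑ c, (b j c : ℝ) * y c| ^ p
    have h1 : |Gy - Fy| ≤ |Gz - Fz| + k * U * Δ := by
      have h2 := abs_sub_abs_le_abs_sub (Gy - Fy) (Gz - Fz)
      rw [abs_sub_comm (Gy - Fy) (Gz - Fz)] at h2
      linarith
    have h2 : Fz ≤ Fy + k * U * Δ := by linarith [(abs_le.1 hd1).2]
    calc T * |Gy - Fy| ≤ T * (|Gz - Fz| + k * U * Δ) := by gcongr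
      _ = T * |Gz - Fz| + T * (k * U * Δ) := by ring
      _ ≤ Fy + (T + 1) * (k * U * Δ) := by linarith
      _ ≤ 2 * Fy := by linarith
  rw [hscale, hscale, ← mul_sub, abs_mul, abs_of_nonneg (by positivity)] at hy2
  have hpos : 0 < (M / μ) ^ p := by positivity
  refine le_of_mul_le_mul_left ?_ hpos
  calc _ = _ := by ring
    _ ≤ _ := hy2
    _ = _ := by ring

end StreamRAM

namespace StreamRAM

/-! ### Blocks of records and the rows they stand for -/

/-- `|⟨a, x⟩| ^ p` for the row at position `a`. -/
noncomputable def rowValue (d p : ℕ) (row : ℕ → ℕ → ℤ) (a : ℕ) (x : Fin d → ℝ) : ℝ :=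
  |∑ c : Fin d, (row a c : ℝ) * x c| ^ p

theorem rowValue_nonneg {d p : ℕ} {row : ℕ → ℕ → ℤ} {a : ℕ} {x : Fin d → ℝ} :
    0 ≤ rowValue d p row a x := by
  rw [rowValue]
  positivity

theorem rowValue_le {d p : ℕ} {row : ℕ → ℕ → ℤ} {a : ℕ} {x : Fin d → ℝ} {Q : ℝ}
    (hrow : ∀ c : Fin d, |(row a c : ℝ)| ≤ Q) (hx : ∀ c, |x c| ≤ Q) :
    rowValue d p row a x ≤ (d * (Q * Q)) ^ p := by
  rw [rowValue]
  refine pow_le_pow_left₀ (abs_nonneg _) ((Finset.abs_sum_le_sum_abs _ _).trans ?_) p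
  calc _ ≤ ∑ _c : Fin d, Q * Q := by
        refine Finset.sum_le_sum fun c _ => ?_
        rw [abs_mul]
        exact mul_le_mul (hrow c) (hx c) (abs_nonneg _) ((abs_nonneg _).trans (hrow c))
    _ = _ := by simp

theorem exists_testVec {d R : ℕ} (z : Fin d → ℤ) (hz : ∀ c, |z c| ≤ R) :
    ∃ t < (2 * R + 1) ^ d, ∀ c : Fin d, testVec R t c = z c := by
  obtain ⟨t, ht, h0⟩ := exists_numeral (2 * R + 1) d
    (fun c => if h : c < d then (z ⟨c, h⟩ + R).toNat else 0)
    (fun c hc => by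
      have := abs_le.1 (hz ⟨c, hc⟩)
      rw [dif_pos hc]
      omega) 0
  refine ⟨t, ?_, fun c => ?_⟩
  · exact (Nat.div_eq_zero_iff.1 h0).resolve_left (by positivity)
  · have h1 := ht c c.2
    rw [dif_pos c.2] at h1
    have := abs_le.1 (hz c)
    rw [testVec, h1]
    simp only [Fin.eta]
    omega

section Translate

variable {d p R s : ℕ} {row : ℕ → ℕ → ℤ} {h : ℤ → ℤ} {L : List Rec} {g : ℕ → Rec}

theorem blockSum_cast (hL : Stored d row h L) (hg : ∀ j < L.length - s, L[s + j]? = some (g j))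
    (f : ℕ → ℤ) (t : ℕ) :
    ((blockSum d p R h s f (L.length - s) t : ℤ) : ℝ) = ∑ j ∈ Finset.range (L.length - s),
      (f j : ℝ) * rowValue d p row (g j).pos fun c => (testVec R t c : ℝ) := by
  rw [blockSum]
  push_cast
  refine Finset.sum_congr rfl fun j hj => ?_
  obtain ⟨h1, -, -⟩ := hL _ _ (hg j (Finset.mem_range.1 hj))
  rw [recValue, rowValue, Finset.sum_range]
  push_cast
  congr 3
  refine Finset.sum_congr rfl fun c _ => ?_
  rw [← h1 c c.2]
  push_cast
  rfl

theorem passes_iff (hL : Stored d row h L) (hg : ∀ j < L.length - s, L[s + j]? = some (g j))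
    (f : ℕ → ℕ) (m T : ℕ) :
    Passes d p R h s L.length (fun j => f j) m T ↔
      ((Finset.range (L.length - s)).filter fun j => f j ≠ 0).card ≤ m ∧
      ∀ t < (2 * R + 1) ^ d, (T : ℝ) * |∑ j ∈ Finset.range (L.length - s),
            (f j : ℝ) * rowValue d p row (g j).pos (fun c => (testVec R t c : ℝ)) -
          ∑ j ∈ Finset.range (L.length - s),
            ((g j).u : ℝ) * rowValue d p row (g j).pos (fun c => (testVec R t c : ℝ))| ≤
          ∑ j ∈ Finset.range (L.length - s),
            ((g j).u : ℝ) * rowValue d p row (g j).pos (fun c => (testVec R t c : ℝ)) := by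
  have hu : ∀ t, blockSum d p R h s (fun i => h ((s + i) * (d + 2) + d)) (L.length - s) t =
      blockSum d p R h s (fun i => ((g i).u : ℤ)) (L.length - s) t := by
    intro t
    refine Finset.sum_congr rfl fun j hj => ?_
    obtain ⟨-, h2, -⟩ := hL _ _ (hg j (Finset.mem_range.1 hj))
    have h3 : h (((s : ℤ) + j) * (d + 2) + d) = (g j).u := by
      rw [← h2]
      push_cast
      rfl
    simp only [h3]
  refine and_congr ?_ (forall_congr' fun t => imp_congr_right fun _ => ?_)
  · rw [Finset.card_filter]
    have h1 : (∑ j ∈ Finset.range (L.length - s), (if 0 < (f j : ℤ) then 1 else 0 : ℤ)) =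
        ((∑ j ∈ Finset.range (L.length - s), (if f j ≠ 0 then 1 else 0 : ℕ) : ℕ) : ℤ) := by
      push_cast
      refine Finset.sum_congr rfl fun j _ => if_congr ?_ rfl rfl
      omega
    rw [h1]
    exact Nat.cast_le
  · rw [hu t, ← Int.cast_le (R := ℝ)]
    push_cast
    rw [blockSum_cast hL hg, blockSum_cast hL hg]
    simp only [Int.cast_natCast]

end Translate

/-- The first `k` records of `g` stand for the rows at the positions `P`, each with weight `K`, up to
a relative error `ρ`. -/
structure Merged (d p K U : ℕ) (row : ℕ → ℕ → ℤ) (k : ℕ) (g : ℕ → Rec) (P : Finset ℕ) (ρ : ℝ) :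
    Prop where
  inj : ∀ i < k, ∀ j < k, (g i).pos = (g j).pos → i = j
  mem : ∀ j < k, (g j).pos ∈ P
  weight : ∀ j < k, 1 ≤ (g j).u ∧ (g j).u ≤ U
  err : ∀ x, |∑ j ∈ Finset.range k, ((g j).u : ℝ) * rowValue d p row (g j).pos x -
    K * ∑ a ∈ P, rowValue d p row a x| ≤ ρ * (K * ∑ a ∈ P, rowValue d p row a x)
  nonneg : 0 ≤ ρ
  le_half : ρ ≤ 1 / 2

namespace Merged

variable {d p K U k : ℕ} {row : ℕ → ℕ → ℤ} {g : ℕ → Rec} {P : Finset ℕ} {ρ : ℝ}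

theorem sum_le (h : Merged d p K U row k g P ρ) (x : Fin d → ℝ) :
    ∑ j ∈ Finset.range k, ((g j).u : ℝ) * rowValue d p row (g j).pos x ≤
      2 * (K * ∑ a ∈ P, rowValue d p row a x) := by
  have h1 := (abs_le.1 (h.err x)).2
  have h2 : 0 ≤ (K : ℝ) * ∑ a ∈ P, rowValue d p row a x :=
    mul_nonneg (by positivity) (Finset.sum_nonneg fun _ _ => rowValue_nonneg)
  nlinarith [h.le_half]

/-- This pays for rounding weights down to integers: one unit for each row is at most the fraction
`2 / K` of the weighted sum. -/
theorem le_sum (h : Merged d p K U row k g P ρ) (x : Fin d → ℝ) :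
    K * ∑ j ∈ Finset.range k, rowValue d p row (g j).pos x ≤
      2 * ∑ j ∈ Finset.range k, ((g j).u : ℝ) * rowValue d p row (g j).pos x := by
  have h1 := (abs_le.1 (h.err x)).1
  have h2 : 0 ≤ (K : ℝ) * ∑ a ∈ P, rowValue d p row a x :=
    mul_nonneg (by positivity) (Finset.sum_nonneg fun _ _ => rowValue_nonneg)
  have h3 : ∑ j ∈ Finset.range k, rowValue d p row (g j).pos x ≤ ∑ a ∈ P, rowValue d p row a x := by
    rw [← Finset.sum_image (f := fun a => rowValue d p row a x) (g := fun j => (g j).pos)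
      (fun i hi j hj hij => h.inj i (Finset.mem_range.1 hi) j (Finset.mem_range.1 hj) hij)]
    refine Finset.sum_le_sum_of_subset_of_nonneg ?_ fun _ _ _ => rowValue_nonneg
    intro a ha
    obtain ⟨j, hj, rfl⟩ := Finset.mem_image.1 ha
    exact h.mem j (Finset.mem_range.1 hj)
  have h4 : (K : ℝ) * ∑ j ∈ Finset.range k, rowValue d p row (g j).pos x ≤
      K * ∑ a ∈ P, rowValue d p row a x := by gcongr
  nlinarith [h.le_half]

/-- A coreset with few rows exists, with integer weights. -/
theorem exists_weights (h : Merged d p K U row k g P ρ) (hp : 1 ≤ p) {C : ℝ} {e : ℕ}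
    (hC : ∀ ε : ℝ, 0 < ε → ε < 1 → ∀ (ι : Type) [Fintype ι] (a : ι → Fin d → ℝ) (w : ι → ℝ),
      (∀ i, 0 ≤ w i) → ∃ w' : ι → ℝ, (∀ i, 0 ≤ w' i) ∧ (∀ i, w i = 0 → w' i = 0) ∧
        ((Finset.univ.filter (w' · ≠ 0)).card : ℝ) ≤ sizeBound d p e C ε ∧
        ∀ x : Fin d → ℝ, |∑ i, w' i * |∑ j, a i j * x j| ^ p - ∑ i, w i * |∑ j, a i j * x j| ^ p| ≤
          ε * ∑ i, w i * |∑ j, a i j * x j| ^ p)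
    {Q T m : ℕ} (hQ : ∀ a ∈ P, ∀ c : Fin d, |row a c| ≤ Q) (hT : 1 ≤ T) (hTK : 4 * T ≤ K)
    (hU : 4 * K * (P.card * (d * (Q * Q)) ^ p) ≤ U) (hm : sizeBound d p e C (1 / (2 * T)) < m + 1) :
    ∃ f : ℕ → ℕ, (∀ j < k, f j ≤ U) ∧ ((Finset.range k).filter fun j => f j ≠ 0).card ≤ m ∧
      ∀ x : Fin d → ℝ, (T : ℝ) * |∑ j ∈ Finset.range k, (f j : ℝ) * rowValue d p row (g j).pos x -
        ∑ j ∈ Finset.range k, ((g j).u : ℝ) * rowValue d p row (g j).pos x| ≤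
        ∑ j ∈ Finset.range k, ((g j).u : ℝ) * rowValue d p row (g j).pos x := by
  have hT' : (1 : ℝ) ≤ T := by exact_mod_cast hT
  -- Half of the permitted error is for the real weights, the other half for the rounding.
  obtain ⟨w, hw0, -, hcard, hw⟩ := hC (1 / (2 * T)) (by positivity)
    (by rw [div_lt_one (by positivity)]; linarith) (Fin k)
    (fun j c => (row (g j).pos c : ℝ)) (fun j => ((g j).u : ℝ)) (fun j => by positivity)
  have hsum : ∀ (v : ℕ → ℝ) (x : Fin d → ℝ), ∑ j : Fin k, v j * |∑ c : Fin d, (row (g j).pos c : ℝ) * x c| ^ p =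
      ∑ j ∈ Finset.range k, v j * rowValue d p row (g j).pos x := fun v x => by
    rw [Finset.sum_range]
    rfl
  have hF0 : ∀ x, 0 ≤ ∑ j ∈ Finset.range k, ((g j).u : ℝ) * rowValue d p row (g j).pos x := fun x =>
    Finset.sum_nonneg fun j _ => mul_nonneg (by positivity) rowValue_nonneg
  classical
  set f : Fin k → ℕ := fun j => if ∀ c : Fin d, row (g j).pos c = 0 then 0 else ⌊w j⌋₊ with hf
  have hfw : ∀ j, (f j : ℝ) ≤ w j := fun j => by
    simp only [hf]
    split_ifs with h0
    · simpa using hw0 j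
    · exact Nat.floor_le (hw0 j)
  -- The approximation is evaluated at the row itself. Its inner product with itself is a positive
  -- integer, so its weight is at most the whole sum. Nothing bounds the weight of a zero row, which
  -- is why `f` drops such rows.
  have hwU : ∀ j : Fin k, (¬ ∀ c : Fin d, row (g j).pos c = 0) → w j ≤ U := by
    intro j hj
    set b : Fin d → ℝ := fun c => (row (g j).pos c : ℝ) with hb
    have hbQ : ∀ c, |b c| ≤ Q := fun c => by
      have := hQ _ (h.mem j j.2) c
      simp only [hb]
      exact_mod_cast this
    have hbb : (1 : ℝ) ≤ ∑ c : Fin d, (row (g j).pos c : ℝ) * b c := by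
      push Not at hj
      obtain ⟨c, hc⟩ := hj
      have h1 : (1 : ℤ) ≤ ∑ c : Fin d, row (g j).pos c * row (g j).pos c := by
        have h2 : 0 < row (g j).pos c * row (g j).pos c := mul_self_pos.2 hc
        refine le_trans h2 (Finset.single_le_sum (f := fun c : Fin d => row (g j).pos c * row (g j).pos c)
          (fun c _ => mul_self_nonneg _) (Finset.mem_univ c))
      simp only [hb]
      exact_mod_cast h1
    have h1 := (abs_le.1 (hw b)).2
    have h2 : w j ≤ ∑ i, w i * |∑ c : Fin d, (row (g i).pos c : ℝ) * b c| ^ p := by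
      refine le_trans ?_ (Finset.single_le_sum (f := fun i => w i * |∑ c : Fin d, (row (g i).pos c : ℝ) * b c| ^ p)
        (fun i _ => mul_nonneg (hw0 i) (by positivity)) (Finset.mem_univ j))
      exact le_mul_of_one_le_right (hw0 j) (one_le_pow₀ (hbb.trans (le_abs_self _)))
    have h3 := hsum (fun j => ((g j).u : ℝ)) b
    rw [h3] at h1
    have h4 : (1 : ℝ) / (2 * T) ≤ 1 := by
      rw [div_le_one (by positivity)]; linarith
    have h5 : ∑ a ∈ P, rowValue d p row a b ≤ P.card * (d * (Q * Q)) ^ p := by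
      refine (Finset.sum_le_sum (g := fun _ => ((d : ℝ) * (Q * Q)) ^ p) fun a ha =>
        rowValue_le (fun c => by exact_mod_cast hQ a ha c) hbQ).trans ?_
      simp
    have h6 : (4 * K * (P.card * (d * (Q * Q)) ^ p) : ℝ) ≤ U := by exact_mod_cast hU
    have h7 : (K : ℝ) * ∑ a ∈ P, rowValue d p row a b ≤ K * (P.card * (d * (Q * Q)) ^ p) := by gcongr
    have h8 := h.sum_le b
    have h9 := mul_le_mul_of_nonneg_right h4 (hF0 b)
    linarith
  refine ⟨fun j => if hj : j < k then f ⟨j, hj⟩ else 0, fun j hj => ?_, ?_, fun x => ?_⟩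
  · simp only [dif_pos hj, hf]
    split_ifs with h0
    · exact Nat.zero_le _
    · have h1 := (Nat.floor_le (hw0 ⟨j, hj⟩)).trans (hwU ⟨j, hj⟩ h0)
      exact_mod_cast h1
  · have h1 : ((Finset.range k).filter fun j => (if hj : j < k then f ⟨j, hj⟩ else 0) ≠ 0).card ≤
        (Finset.univ.filter (w · ≠ 0)).card := by
      rw [← Finset.card_map Fin.valEmbedding]
      refine Finset.card_le_card fun j hj => ?_
      rw [Finset.mem_filter, Finset.mem_range] at hj
      obtain ⟨hjk, hj⟩ := hj
      rw [dif_pos hjk] at hj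
      rw [Finset.mem_map]
      refine ⟨⟨j, hjk⟩, Finset.mem_filter.2 ⟨Finset.mem_univ _, fun hw' => hj ?_⟩, rfl⟩
      have := hfw ⟨j, hjk⟩
      rw [hw'] at this
      exact_mod_cast le_antisymm this (by positivity)
    have h2 : ((Finset.univ.filter (w · ≠ 0)).card : ℝ) < m + 1 := hcard.trans_lt hm
    have h3 : (Finset.univ.filter (w · ≠ 0)).card < m + 1 := by exact_mod_cast h2
    exact h1.trans (by omega)
  · have hfsum : ∑ j ∈ Finset.range k, (((if hj : j < k then f ⟨j, hj⟩ else 0 : ℕ)) : ℝ) *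
        rowValue d p row (g j).pos x = ∑ j : Fin k, (f j : ℝ) * rowValue d p row (g j).pos x := by
      rw [Finset.sum_range]
      refine Finset.sum_congr rfl fun j _ => ?_
      rw [dif_pos j.2]
    have hround : |∑ j : Fin k, (f j : ℝ) * rowValue d p row (g j).pos x -
        ∑ j : Fin k, w j * rowValue d p row (g j).pos x| ≤
        ∑ j ∈ Finset.range k, rowValue d p row (g j).pos x := by
      rw [← Finset.sum_sub_distrib, Finset.sum_range]
      refine (Finset.abs_sum_le_sum_abs _ _).trans (Finset.sum_le_sum fun j _ => ?_)
      rw [← sub_mul, abs_mul, abs_of_nonneg (rowValue_nonneg (x := x))]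
      by_cases h0 : ∀ c : Fin d, row (g j).pos c = 0
      · have : rowValue d p row (g j).pos x = 0 := by
          rw [rowValue]
          simp [h0, show p ≠ 0 by omega]
        rw [this]
        simp
      · refine mul_le_of_le_one_left rowValue_nonneg ?_
        simp only [hf, if_neg h0]
        rw [abs_sub_comm, abs_of_nonneg (by linarith [Nat.floor_le (hw0 j)])]
        linarith [Nat.lt_floor_add_one (w j)]
    have hwx := hw x
    have h3 := hsum (fun j => ((g j).u : ℝ)) x
    rw [h3] at hwx
    rw [hfsum]
    have hwx' : |∑ j : Fin k, w j * rowValue d p row (g j).pos x -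
        ∑ j ∈ Finset.range k, ((g j).u : ℝ) * rowValue d p row (g j).pos x| ≤
        1 / (2 * T) * ∑ j ∈ Finset.range k, ((g j).u : ℝ) * rowValue d p row (g j).pos x := hwx
    have hle := h.le_sum x
    set S := ∑ j ∈ Finset.range k, rowValue d p row (g j).pos x with hS
    set F := ∑ j ∈ Finset.range k, ((g j).u : ℝ) * rowValue d p row (g j).pos x with hFdef
    have hS0 : 0 ≤ S := Finset.sum_nonneg fun _ _ => rowValue_nonneg
    have hTK' : (4 * T : ℝ) ≤ K := by exact_mod_cast hTK
    have h5 : 4 * T * S ≤ 2 * F := (mul_le_mul_of_nonneg_right hTK' hS0).trans hle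
    have h6 := abs_sub_le (∑ j : Fin k, (f j : ℝ) * rowValue d p row (g j).pos x)
      (∑ j : Fin k, w j * rowValue d p row (g j).pos x) F
    calc (T : ℝ) * |∑ j : Fin k, (f j : ℝ) * rowValue d p row (g j).pos x - F|
        ≤ T * (S + 1 / (2 * T) * F) := by
          refine mul_le_mul_of_nonneg_left ?_ (by positivity)
          linarith
      _ = T * S + F / 2 := by field_simp
      _ ≤ F := by linarith

/-- Weights that pass the test approximate at all real points. -/
theorem of_test (h : Merged d p K U row k g P ρ) (hd : 1 ≤ d) (hp : 1 ≤ p) {Q T R : ℕ} (hQ1 : 1 ≤ Q)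
    (hQ : ∀ a ∈ P, ∀ c : Fin d, |row a c| ≤ Q) (hT : 1 ≤ T) {f : ℕ → ℕ} (hf : ∀ j < k, f j ≤ U)
    (hR : d * (d.factorial * Q ^ d) * ((T + 1) * (k * U) * (d * Q * p * 2 ^ p)) + 1 ≤ R)
    (H : ∀ t < (2 * R + 1) ^ d, (T : ℝ) * |∑ j ∈ Finset.range k,
            (f j : ℝ) * rowValue d p row (g j).pos (fun c => (testVec R t c : ℝ)) -
          ∑ j ∈ Finset.range k,
            ((g j).u : ℝ) * rowValue d p row (g j).pos (fun c => (testVec R t c : ℝ))| ≤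
          ∑ j ∈ Finset.range k,
            ((g j).u : ℝ) * rowValue d p row (g j).pos (fun c => (testVec R t c : ℝ)))
    (x : Fin d → ℝ) :
    |∑ j ∈ Finset.range k, (f j : ℝ) * rowValue d p row (g j).pos x -
      K * ∑ a ∈ P, rowValue d p row a x| ≤ (ρ + 4 / T) * (K * ∑ a ∈ P, rowValue d p row a x) := by
  have hT' : (0 : ℝ) < T := by exact_mod_cast hT
  have key := le_two_mul_of_integer_test (Q := Q) (U := U) (T := T) (R := R) hd hp (by exact_mod_cast hQ1)
    hT'.le (b := fun (j : Fin k) c => row (g j).pos c)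
    (fun j c => by exact_mod_cast hQ _ (h.mem j j.2) c) (u := fun j => ((g j).u : ℝ))
    (f := fun j => (f j : ℝ)) (fun j => by exact_mod_cast h.weight j j.2)
    (fun j => ⟨by positivity, by exact_mod_cast hf j j.2⟩) (by exact_mod_cast hR)
    (fun z hz => by
      obtain ⟨t, ht, htz⟩ := exists_testVec (R := R) z (fun c => by exact_mod_cast hz c)
      have := H t ht
      simp only [Finset.sum_range, rowValue, htz] at this
      exact this) x
  simp only [← Finset.sum_range (fun j => (f j : ℝ) * |∑ c : Fin d, (row (g j).pos c : ℝ) * x c| ^ p),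
    ← Finset.sum_range (fun j => ((g j).u : ℝ) * |∑ c : Fin d, (row (g j).pos c : ℝ) * x c| ^ p)] at key
  change (T : ℝ) * |∑ j ∈ Finset.range k, (f j : ℝ) * rowValue d p row (g j).pos x -
    ∑ j ∈ Finset.range k, ((g j).u : ℝ) * rowValue d p row (g j).pos x| ≤
    2 * ∑ j ∈ Finset.range k, ((g j).u : ℝ) * rowValue d p row (g j).pos x at key
  -- The `4` in `4 / T` consists of a factor two for passing from integer to real points and a
  -- factor two for comparing the sum over the records with that over the rows.
  have h1 := h.sum_le x
  have h2 := h.err x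
  have h3 := abs_sub_le (∑ j ∈ Finset.range k, (f j : ℝ) * rowValue d p row (g j).pos x)
    (∑ j ∈ Finset.range k, ((g j).u : ℝ) * rowValue d p row (g j).pos x)
    (K * ∑ a ∈ P, rowValue d p row a x)
  have h4 : |∑ j ∈ Finset.range k, (f j : ℝ) * rowValue d p row (g j).pos x -
      ∑ j ∈ Finset.range k, ((g j).u : ℝ) * rowValue d p row (g j).pos x| ≤
      4 / T * (K * ∑ a ∈ P, rowValue d p row a x) := by
    rw [div_mul_eq_mul_div, le_div_iff₀ hT', mul_comm]
    linarith
  rw [add_mul]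
  linarith

end Merged

end StreamRAM

namespace StreamRAM

/-! ### The invariant of the streaming algorithm -/

/-- The relative error allowed for a block that is built from levels below `l`. -/
noncomputable def levelError (N l : ℕ) : ℝ := (1 - 1 / ((l : ℝ) + 1)) / (2 * N)

theorem levelError_nonneg (N l : ℕ) : 0 ≤ levelError N l := by
  have h : 1 / ((l : ℝ) + 1) ≤ 1 := by
    rw [div_le_one (by positivity)]
    linarith [Nat.cast_nonneg (α := ℝ) l]
  exact div_nonneg (by linarith) (by positivity)

theorem levelError_le (N l : ℕ) : levelError N l ≤ 1 / (2 * N) := by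
  have h : 0 ≤ 1 / ((l : ℝ) + 1) := by positivity
  exact div_le_div_of_nonneg_right (by linarith) (by positivity)

theorem levelError_le_half {N : ℕ} (hN : 1 ≤ N) (l : ℕ) : levelError N l ≤ 1 / 2 := by
  have h : (1 : ℝ) ≤ N := by exact_mod_cast hN
  exact (levelError_le N l).trans (one_div_le_one_div_of_le (by norm_num) (by linarith))

theorem levelError_mono (N : ℕ) {l l' : ℕ} (h : l ≤ l') : levelError N l ≤ levelError N l' := by
  have h1 : (l : ℝ) ≤ l' := by exact_mod_cast h
  have h2 : 1 / ((l' : ℝ) + 1) ≤ 1 / ((l : ℝ) + 1) :=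
    one_div_le_one_div_of_le (by positivity) (by linarith)
  exact div_le_div_of_nonneg_right (by linarith) (by positivity)

/-- The test parameter is chosen so that the errors telescope: `1 / ((l+1) * (l+2))` is `1 / (l+1) -
1 / (l+2)`. The total stays below `1 / (2 * N)` for any number of levels, with a parameter only
quadratic in `l`. -/
theorem levelError_add {N : ℕ} (hN : 1 ≤ N) (l : ℕ) :
    levelError N l + 4 / ((8 * N * (l + 1) * (l + 2) : ℕ) : ℝ) = levelError N (l + 1) := by
  have h : (0 : ℝ) < N := by exact_mod_cast hN
  rw [levelError, levelError]
  push_cast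
  field_simp
  ring

section Lists

theorem sum_map_eq_sum_filter {M : Type*} [AddCommMonoid M] (φ : Rec → M) (B : List Rec) {m : ℕ}
    (hm : ∀ r ∈ B, r.tag < m) :
    (B.map φ).sum = ∑ t ∈ Finset.range m, ((B.filter (·.tag = t)).map φ).sum := by
  induction B with
  | nil => simp
  | cons r B ih =>
    rw [List.map_cons, List.sum_cons, ih fun q hq => hm q (List.mem_cons_of_mem _ hq)]
    have h : ∀ t, (((r :: B).filter (·.tag = t)).map φ).sum =
        (if r.tag = t then φ r else 0) + ((B.filter (·.tag = t)).map φ).sum := fun t => by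
      by_cases ht : r.tag = t <;> simp [ht]
    rw [Finset.sum_congr rfl fun t _ => h t, Finset.sum_add_distrib, Finset.sum_ite_eq,
      if_pos (Finset.mem_range.2 (hm r List.mem_cons_self))]

theorem eq_map_range {B : List Rec} {g : ℕ → Rec} (hg : ∀ j < B.length, B[j]? = some (g j)) :
    B = (List.range B.length).map g := by
  refine List.ext_getElem? fun j => ?_
  by_cases hj : j < B.length
  · rw [hg j hj]
    simp [hj]
  · simp [hj]

theorem sum_map_range {M : Type*} [AddCommMonoid M] (φ : ℕ → M) (k : ℕ) :
    ((List.range k).map φ).sum = ∑ j ∈ Finset.range k, φ j := by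
  induction k with
  | zero => simp
  | succ k ih => simp [List.range_succ, Finset.sum_range_succ, ih]

variable {g : ℕ → Rec} {f : ℕ → ℕ} {l : ℕ}

theorem mem_reweigh {k : ℕ} {r : Rec} (hr : r ∈ reweigh g f l k) :
    r.tag = l ∧ ∃ j < k, r.pos = (g j).pos ∧ r.u = f j ∧ f j ≠ 0 := by
  induction k with
  | zero => simp [reweigh] at hr
  | succ k ih =>
    rw [reweigh, List.mem_append] at hr
    rcases hr with hr | hr
    · obtain ⟨h1, j, hj, h2⟩ := ih hr
      exact ⟨h1, j, by omega, h2⟩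
    · split_ifs at hr with h0
      · simp at hr
      · rw [List.mem_singleton] at hr
        subst hr
        exact ⟨rfl, k, by omega, rfl, rfl, h0⟩

theorem sum_reweigh (φ : ℕ → ℝ) (k : ℕ) :
    ((reweigh g f l k).map fun r => (r.u : ℝ) * φ r.pos).sum =
      ∑ j ∈ Finset.range k, (f j : ℝ) * φ (g j).pos := by
  induction k with
  | zero => simp [reweigh]
  | succ k ih =>
    rw [reweigh, List.map_append, List.sum_append, ih, Finset.sum_range_succ]
    split_ifs with h0 <;> simp [h0]

theorem length_reweigh (k : ℕ) :
    (reweigh g f l k).length = ((Finset.range k).filter fun j => f j ≠ 0).card := by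
  induction k with
  | zero => simp [reweigh]
  | succ k ih =>
    rw [reweigh, List.length_append, ih, Finset.range_add_one, Finset.filter_insert]
    by_cases h0 : f k = 0
    · simp [h0]
    · rw [if_neg h0, if_pos h0, Finset.card_insert_of_notMem (by simp)]
      simp

theorem pairwise_reweigh {k : ℕ} (h : ∀ i j, i < j → j < k → (g i).pos < (g j).pos) :
    (reweigh g f l k).Pairwise fun a b => a.pos < b.pos := by
  induction k with
  | zero => simp [reweigh]
  | succ k ih =>
    rw [reweigh, List.pairwise_append]
    refine ⟨ih fun i j hij hj => h i j hij (by omega), ?_, fun a ha b hb => ?_⟩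
    · split_ifs <;> simp
    · split_ifs at hb with h0
      · simp at hb
      · rw [List.mem_singleton] at hb
        subst hb
        obtain ⟨-, j, hj, hpos, -⟩ := mem_reweigh ha
        rw [hpos]
        exact h j k hj (by omega)

end Lists

/-- The records `L` after `i` rows; `lv` tells the level of the block to which a row belongs. -/
structure Tracked (d p K U N M : ℕ) (row : ℕ → ℕ → ℤ) (i : ℕ) (L : List Rec) (lv : ℕ → ℕ) : Prop where
  pos_lt : ∀ r ∈ L, r.pos < i
  sorted : L.Pairwise fun a b => a.pos < b.pos
  anti : L.Pairwise fun a b => b.tag ≤ a.tag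
  weight : ∀ r ∈ L, 1 ≤ r.u ∧ r.u ≤ U
  level : ∀ r ∈ L, lv r.pos = r.tag
  err : ∀ t (x : Fin d → ℝ),
    |((L.filter (·.tag = t)).map fun r => (r.u : ℝ) * rowValue d p row r.pos x).sum -
      K * ∑ a ∈ (Finset.range i).filter (fun a => lv a = t), rowValue d p row a x| ≤
    levelError N (t + 1) *
      (K * ∑ a ∈ (Finset.range i).filter (fun a => lv a = t), rowValue d p row a x)
  -- The value of the binary counter, which makes the levels in use at most `log₂ i`. It is an
  -- inequality because a reduction can leave no record at all when its rows contribute nothing.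
  pot : ∑ t ∈ (L.map (·.tag)).toFinset, 2 ^ t ≤ i
  count : ∀ t, (L.filter (·.tag = t)).length ≤ M

theorem Tracked.nil (d p K U N M : ℕ) (row : ℕ → ℕ → ℤ) :
    Tracked d p K U N M row 0 [] fun _ => 0 where
  pos_lt := by simp
  sorted := by simp
  anti := by simp
  weight := by simp
  level := by simp
  err t x := by simp
  pot := by simp
  count := by simp

/-- Combine the errors of all levels below `m`. -/
theorem abs_sum_levels_le {d p K i m : ℕ} {row : ℕ → ℕ → ℤ} {B : List Rec} {lv : ℕ → ℕ} {ρ : ℝ}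
    (hm : ∀ r ∈ B, r.tag < m) (x : Fin d → ℝ)
    (herr : ∀ t < m, |((B.filter (·.tag = t)).map fun r => (r.u : ℝ) * rowValue d p row r.pos x).sum -
      K * ∑ a ∈ (Finset.range i).filter (fun a => lv a = t), rowValue d p row a x| ≤
      ρ * (K * ∑ a ∈ (Finset.range i).filter (fun a => lv a = t), rowValue d p row a x)) :
    |(B.map fun r => (r.u : ℝ) * rowValue d p row r.pos x).sum -
      K * ∑ a ∈ (Finset.range i).filter (fun a => lv a < m), rowValue d p row a x| ≤
      ρ * (K * ∑ a ∈ (Finset.range i).filter (fun a => lv a < m), rowValue d p row a x) := by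
  have hS : ∑ a ∈ (Finset.range i).filter (fun a => lv a < m), rowValue d p row a x =
      ∑ t ∈ Finset.range m, ∑ a ∈ (Finset.range i).filter (fun a => lv a = t), rowValue d p row a x := by
    rw [← Finset.sum_fiberwise_of_maps_to (s := (Finset.range i).filter (fun a => lv a < m))
      (t := Finset.range m) (g := lv)
      (fun a ha => Finset.mem_range.2 (Finset.mem_filter.1 ha).2)]
    refine Finset.sum_congr rfl fun t ht => Finset.sum_congr ?_ fun _ _ => rfl
    rw [Finset.filter_filter]
    refine Finset.filter_congr fun a _ => ⟨fun h => h.2, fun h => ⟨?_, h⟩⟩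
    rw [h]
    exact Finset.mem_range.1 ht
  rw [sum_map_eq_sum_filter _ B hm, hS, Finset.mul_sum, ← Finset.sum_sub_distrib, Finset.mul_sum]
  exact (Finset.abs_sum_le_sum_abs _ _).trans
    (Finset.sum_le_sum fun t ht => herr t (Finset.mem_range.1 ht))

namespace Tracked

variable {d p K U N M i s l : ℕ} {row : ℕ → ℕ → ℤ} {L : List Rec} {lv : ℕ → ℕ} {g : ℕ → Rec} {f : ℕ → ℕ}

theorem two_pow_tag_le (h : Tracked d p K U N M row i L lv) {r : Rec} (hr : r ∈ L) : 2 ^ r.tag ≤ i := by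
  refine le_trans ?_ h.pot
  exact Finset.single_le_sum (f := fun t => 2 ^ t) (fun _ _ => Nat.zero_le _)
    (List.mem_toFinset.2 (List.mem_map.2 ⟨r, hr, rfl⟩))

theorem length_le (h : Tracked d p K U N M row i L lv) : L.length ≤ (Nat.log 2 i + 1) * M := by
  have h1 := sum_map_eq_sum_filter (fun _ => 1) L (m := Nat.log 2 i + 1) fun r hr => by
    have h2 := h.two_pow_tag_le hr
    have h3 : 0 < 2 ^ r.tag := by positivity
    exact Nat.lt_succ_iff.2 ((Nat.le_log_iff_pow_le (by omega) (by omega)).2 h2)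
  simp only [List.map_const', List.sum_replicate, smul_eq_mul, mul_one] at h1
  rw [h1]
  refine (Finset.sum_le_sum fun t _ => h.count t).trans ?_
  simp

theorem length_le_self (h : Tracked d p K U N M row i L lv) : L.length ≤ i := by
  have h1 : (L.map (·.pos)).Nodup := by
    rw [List.Nodup, List.pairwise_map]
    exact h.sorted.imp fun h => h.ne
  have h2 : (L.map (·.pos)).toFinset ⊆ Finset.range i := fun a ha => by
    obtain ⟨r, hr, rfl⟩ := List.mem_map.1 (List.mem_toFinset.1 ha)
    exact Finset.mem_range.2 (h.pos_lt r hr)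
  have h3 := Finset.card_le_card h2
  rw [List.toFinset_card_of_nodup h1] at h3
  simpa using h3

theorem pos_lt_pos {B : List Rec} (h : B.Pairwise fun a b => a.pos < b.pos)
    (hg : ∀ j < B.length, B[j]? = some (g j)) : ∀ i j, i < j → j < B.length → (g i).pos < (g j).pos := by
  intro i j hij hj
  have h1 := (List.pairwise_iff_getElem.1 h) i j (by omega) hj hij
  have hi := hg i (by omega)
  have hj' := hg j hj
  rw [List.getElem?_eq_getElem (by omega)] at hi hj'
  rwa [Option.some.inj hi, Option.some.inj hj'] at h1

/-- The records with the new row appended. -/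
def snoc (L : List Rec) (i K : ℕ) : List Rec := L ++ [⟨i, K, 0⟩]

theorem sorted_snoc (h : Tracked d p K U N M row i L lv) :
    (snoc L i K).Pairwise fun a b => a.pos < b.pos := by
  rw [snoc, List.pairwise_append]
  refine ⟨h.sorted, by simp, fun a ha b hb => ?_⟩
  rw [List.mem_singleton] at hb
  subst hb
  exact h.pos_lt a ha

theorem drop_snoc (hs : s ≤ L.length) : (snoc L i K).drop s = L.drop s ++ [⟨i, K, 0⟩] := by
  rw [snoc, List.drop_append_of_le_length hs]

theorem take_snoc (hs : s ≤ L.length) : (snoc L i K).take s = L.take s := by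
  rw [snoc, List.take_append_of_le_length hs]

theorem length_drop_snoc : ((snoc L i K).drop s).length = (snoc L i K).length - s :=
  List.length_drop

/-- The rows of the levels up to `l`, and the new one. -/
def newBlock (lv : ℕ → ℕ) (i l : ℕ) : Finset ℕ :=
  insert i ((Finset.range i).filter fun a => lv a < l + 1)

/-- A level `t < l` has error at most `levelError N (t + 1) ≤ levelError N l`, and the new row is
exact. So the union of these levels and the new row has error `levelError N l`. -/
theorem merged (h : Tracked d p K U N M row i L lv) (hN : 1 ≤ N) (hK : 1 ≤ K) (hKU : K ≤ U)
    (hs : s ≤ L.length) (hlt : ∀ r ∈ L.drop s, r.tag < l) (hgt : ∀ r ∈ L.take s, l < r.tag)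
    (hg : ∀ j < (snoc L i K).length - s, (snoc L i K)[s + j]? = some (g j)) :
    Merged d p K U row ((snoc L i K).length - s) g (newBlock lv i l) (levelError N l) := by
  have hg' : ∀ j < ((snoc L i K).drop s).length, ((snoc L i K).drop s)[j]? = some (g j) := fun j hj => by
    rw [List.getElem?_drop]
    exact hg j (by rwa [length_drop_snoc] at hj)
  have hmem : ∀ j < (snoc L i K).length - s, g j ∈ (snoc L i K).drop s := fun j hj =>
    List.mem_of_getElem? (hg' j (by rwa [length_drop_snoc]))
  have hlL : ∀ r ∈ L.drop s, r ∈ L := fun r hr => List.mem_of_mem_drop hr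
  have hpos := pos_lt_pos (h.sorted_snoc.sublist (List.drop_sublist s _)) hg'
  rw [length_drop_snoc] at hpos
  refine ⟨fun a ha b hb hab => ?_, fun j hj => ?_, fun j hj => ?_, fun x => ?_, levelError_nonneg N l,
    levelError_le_half hN l⟩
  · rcases lt_trichotomy a b with hlt | heq | hlt
    · exact absurd hab (hpos a b hlt hb).ne
    · exact heq
    · exact absurd hab (hpos b a hlt ha).ne'
  · have hj' := hmem j hj
    rw [drop_snoc hs, List.mem_append, List.mem_singleton] at hj'
    rw [newBlock, Finset.mem_insert, Finset.mem_filter, Finset.mem_range]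
    rcases hj' with hj' | hj'
    · right
      exact ⟨h.pos_lt _ (hlL _ hj'), by rw [h.level _ (hlL _ hj')]; have := hlt _ hj'; omega⟩
    · left
      rw [hj']
  · have hj' := hmem j hj
    rw [drop_snoc hs, List.mem_append, List.mem_singleton] at hj'
    rcases hj' with hj' | hj'
    · exact h.weight _ (hlL _ hj')
    · rw [hj']
      exact ⟨hK, hKU⟩
  · have hsum : ∑ j ∈ Finset.range ((snoc L i K).length - s),
        ((g j).u : ℝ) * rowValue d p row (g j).pos x =
        ((L.drop s).map fun r => (r.u : ℝ) * rowValue d p row r.pos x).sum + K * rowValue d p row i x := by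
      rw [← sum_map_range (fun j => ((g j).u : ℝ) * rowValue d p row (g j).pos x)]
      have h1 := congrArg (fun B : List Rec => (B.map fun r => (r.u : ℝ) * rowValue d p row r.pos x).sum)
        (eq_map_range hg')
      simp only [List.map_map, length_drop_snoc] at h1
      rw [drop_snoc hs, List.map_append, List.sum_append] at h1
      simpa [Function.comp_def] using h1.symm
    have hfil : ∀ t < l + 1, L.filter (·.tag = t) = (L.drop s).filter (·.tag = t) := fun t ht => by
      conv_lhs => rw [← List.take_append_drop s L, List.filter_append]
      rw [List.filter_eq_nil_iff.2, List.nil_append]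
      intro r hr
      have := hgt r hr
      simp only [decide_eq_true_eq]
      omega
    have hlev : ∀ t < l + 1, |(((L.drop s).filter (·.tag = t)).map
        fun r => (r.u : ℝ) * rowValue d p row r.pos x).sum -
        K * ∑ a ∈ (Finset.range i).filter (fun a => lv a = t), rowValue d p row a x| ≤
        levelError N l * (K * ∑ a ∈ (Finset.range i).filter (fun a => lv a = t), rowValue d p row a x) := by
      intro t ht
      have he := h.err t x
      rw [hfil t ht] at he
      have hS0 : 0 ≤ (K : ℝ) * ∑ a ∈ (Finset.range i).filter (fun a => lv a = t), rowValue d p row a x :=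
        mul_nonneg (by positivity) (Finset.sum_nonneg fun _ _ => rowValue_nonneg)
      rcases Nat.lt_succ_iff_lt_or_eq.1 ht with ht | rfl
      · exact he.trans (mul_le_mul_of_nonneg_right (levelError_mono N ht) hS0)
      -- Level `l` has no record. Its relative error is below one, so its rows contribute zero
      -- everywhere and may be assigned to the new block.
      · have hnil : (L.drop s).filter (·.tag = t) = [] := by
          rw [List.filter_eq_nil_iff]
          intro r hr
          have := hlt r hr
          simp only [decide_eq_true_eq]
          omega
        rw [hnil] at he ⊢
        have hz : (K : ℝ) * ∑ a ∈ (Finset.range i).filter (fun a => lv a = t), rowValue d p row a x = 0 := by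
          simp only [List.map_nil, List.sum_nil, zero_sub, abs_neg, abs_of_nonneg hS0] at he
          have := levelError_le_half hN (t + 1)
          nlinarith
        rw [hz]
        simp
    have hmain := abs_sum_levels_le (fun r hr => (hlt r hr).trans (Nat.lt_succ_self l)) x hlev
    rw [hsum, newBlock, Finset.sum_insert (by simp)]
    have h1 : 0 ≤ levelError N l * (K * rowValue d p row i x) :=
      mul_nonneg (levelError_nonneg N l) (mul_nonneg (by positivity) rowValue_nonneg)
    rw [mul_add, mul_add, add_sub_add_comm]
    have h2 : ∀ a b : ℝ, a - b + (K * rowValue d p row i x) - (K * rowValue d p row i x) = a - b :=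
      fun a b => by ring
    have h3 := hmain
    rw [abs_le] at h3 ⊢
    constructor <;> linarith [h3.1, h3.2]

/-- One step of the algorithm. -/
theorem step (h : Tracked d p K U N M row i L lv) (hN : 1 ≤ N)
    (hs : s ≤ L.length) (hlt : ∀ r ∈ L.drop s, r.tag < l) (hgt : ∀ r ∈ L.take s, l < r.tag)
    (hall : ∀ t < l, ∃ r ∈ L.drop s, r.tag = t)
    (hg : ∀ j < (snoc L i K).length - s, (snoc L i K)[s + j]? = some (g j))
    (hf : ∀ j < (snoc L i K).length - s, f j ≤ U)
    (hcard : ((Finset.range ((snoc L i K).length - s)).filter fun j => f j ≠ 0).card ≤ M)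
    (herr : ∀ x : Fin d → ℝ, |∑ j ∈ Finset.range ((snoc L i K).length - s),
        (f j : ℝ) * rowValue d p row (g j).pos x - K * ∑ a ∈ newBlock lv i l, rowValue d p row a x| ≤
      (levelError N l + 4 / ((8 * N * (l + 1) * (l + 2) : ℕ) : ℝ)) *
        (K * ∑ a ∈ newBlock lv i l, rowValue d p row a x)) :
    Tracked d p K U N M row (i + 1) (L.take s ++ reweigh g f l ((snoc L i K).length - s))
      fun a => if a = i ∨ lv a < l + 1 then l else lv a := by
  have hg' : ∀ j < ((snoc L i K).drop s).length, ((snoc L i K).drop s)[j]? = some (g j) := fun j hj => by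
    rw [List.getElem?_drop]
    exact hg j (by rwa [length_drop_snoc] at hj)
  have hmem : ∀ j < (snoc L i K).length - s, g j ∈ L.drop s ∨ g j = ⟨i, K, 0⟩ := fun j hj => by
    have := List.mem_of_getElem? (hg' j (by rwa [length_drop_snoc]))
    rwa [drop_snoc hs, List.mem_append, List.mem_singleton] at this
  have hdL : ∀ r ∈ L.drop s, r ∈ L := fun r hr => List.mem_of_mem_drop hr
  have htL : ∀ r ∈ L.take s, r ∈ L := fun r hr => List.mem_of_mem_take hr
  have hpos := pos_lt_pos (h.sorted_snoc.sublist (List.drop_sublist s _)) hg'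
  rw [length_drop_snoc] at hpos
  have hsplit : (snoc L i K).take s ++ (snoc L i K).drop s = snoc L i K := List.take_append_drop s _
  have hcross := h.sorted_snoc
  rw [← hsplit, List.pairwise_append, take_snoc hs] at hcross
  have hfilR : ∀ t, t ≠ l → (reweigh g f l ((snoc L i K).length - s)).filter (·.tag = t) = [] :=
    fun t ht => by
      rw [List.filter_eq_nil_iff]
      intro r hr
      simp only [decide_eq_true_eq, (mem_reweigh hr).1]
      exact fun h => ht h.symm
  have hfilRl : (reweigh g f l ((snoc L i K).length - s)).filter (·.tag = l) =
      reweigh g f l ((snoc L i K).length - s) := by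
    rw [List.filter_eq_self]
    intro r hr
    simp only [decide_eq_true_eq, (mem_reweigh hr).1]
  have hfilT : ∀ t, t ≤ l → (L.take s).filter (·.tag = t) = [] := fun t ht => by
    rw [List.filter_eq_nil_iff]
    intro r hr
    have := hgt r hr
    simp only [decide_eq_true_eq]
    omega
  have hfilL : ∀ t, l < t → (L.take s).filter (·.tag = t) = L.filter (·.tag = t) := fun t ht => by
    conv_rhs => rw [← List.take_append_drop s L, List.filter_append]
    rw [(List.filter_eq_nil_iff (l := L.drop s)).2, List.append_nil]
    intro r hr
    have := hlt r hr
    simp only [decide_eq_true_eq]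
    omega
  refine ⟨?_, ?_, ?_, ?_, ?_, ?_, ?_, ?_⟩
  · intro r hr
    rcases List.mem_append.1 hr with hr | hr
    · have := h.pos_lt r (htL r hr)
      omega
    · obtain ⟨-, j, hj, hpj, -⟩ := mem_reweigh hr
      rcases hmem j hj with hm | hm
      · have := h.pos_lt _ (hdL _ hm)
        omega
      · rw [hpj, hm]
        exact Nat.lt_succ_self i
  · rw [List.pairwise_append]
    refine ⟨h.sorted.sublist (List.take_sublist s L), pairwise_reweigh hpos, fun a ha b hb => ?_⟩
    obtain ⟨-, j, hj, hpj, -⟩ := mem_reweigh hb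
    rw [hpj]
    exact hcross.2.2 a ha _ (List.mem_of_getElem? (hg' j (by rwa [length_drop_snoc])))
  · rw [List.pairwise_append]
    refine ⟨h.anti.sublist (List.take_sublist s L), ?_, fun a ha b hb => ?_⟩
    · refine List.pairwise_of_forall_mem_list fun a ha b hb => ?_
      rw [(mem_reweigh ha).1, (mem_reweigh hb).1]
    · rw [(mem_reweigh hb).1]
      exact (hgt a ha).le
  · intro r hr
    rcases List.mem_append.1 hr with hr | hr
    · exact h.weight r (htL r hr)
    · obtain ⟨-, j, hj, -, hu, h0⟩ := mem_reweigh hr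
      rw [hu]
      exact ⟨by omega, hf j hj⟩
  · intro r hr
    rcases List.mem_append.1 hr with hr | hr
    · have h1 := h.pos_lt r (htL r hr)
      have h2 := h.level r (htL r hr)
      have h3 := hgt r hr
      rw [if_neg (by omega), h2]
    · obtain ⟨ht, j, hj, hpj, -⟩ := mem_reweigh hr
      rw [if_pos, ht]
      rw [hpj]
      rcases hmem j hj with hm | hm
      · right
        have := hlt _ hm
        rw [h.level _ (hdL _ hm)]
        omega
      · left
        rw [hm]
  · intro t x
    rw [List.filter_append]
    rcases lt_trichotomy t l with ht | rfl | ht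
    · rw [hfilT t ht.le, hfilR t ht.ne, Finset.filter_eq_empty_iff.2]
      · simp
      · intro a _ hc
        split_ifs at hc with h1 <;> omega
    · rw [hfilT t le_rfl, hfilRl, List.nil_append, sum_reweigh fun a => rowValue d p row a x,
        ← levelError_add hN]
      have hset : (Finset.range (i + 1)).filter (fun a => (if a = i ∨ lv a < t + 1 then t else lv a) = t) =
          newBlock lv i t := by
        ext a
        rw [newBlock, Finset.mem_filter, Finset.mem_insert, Finset.mem_filter, Finset.mem_range,
          Finset.mem_range]
        split_ifs with h1 <;> omega
      rw [hset]
      exact herr x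
    · rw [hfilR t ht.ne', hfilL t ht, List.append_nil]
      have hset : (Finset.range (i + 1)).filter (fun a => (if a = i ∨ lv a < l + 1 then l else lv a) = t) =
          (Finset.range i).filter fun a => lv a = t := by
        ext a
        rw [Finset.mem_filter, Finset.mem_filter, Finset.mem_range, Finset.mem_range]
        split_ifs with h1 <;> omega
      rw [hset]
      exact h.err t x
  · have hsub : ((L.take s ++ reweigh g f l ((snoc L i K).length - s)).map (·.tag)).toFinset ⊆
        insert l ((L.take s).map (·.tag)).toFinset := by
      intro t ht
      obtain ⟨r, hr, rfl⟩ := List.mem_map.1 (List.mem_toFinset.1 ht)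
      rw [Finset.mem_insert, List.mem_toFinset]
      rcases List.mem_append.1 hr with hr | hr
      · exact Or.inr (List.mem_map.2 ⟨r, hr, rfl⟩)
      · exact Or.inl (mem_reweigh hr).1
    have hsup : Finset.range l ∪ ((L.take s).map (·.tag)).toFinset ⊆ (L.map (·.tag)).toFinset := by
      intro t ht
      rw [List.mem_toFinset, List.mem_map]
      rcases Finset.mem_union.1 ht with ht | ht
      · obtain ⟨r, hr, hrt⟩ := hall t (Finset.mem_range.1 ht)
        exact ⟨r, hdL r hr, hrt⟩
      · obtain ⟨r, hr, hrt⟩ := List.mem_map.1 (List.mem_toFinset.1 ht)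
        exact ⟨r, htL r hr, hrt⟩
    have hdisj : Disjoint (Finset.range l) ((L.take s).map (·.tag)).toFinset := by
      rw [Finset.disjoint_left]
      intro t ht ht'
      obtain ⟨r, hr, rfl⟩ := List.mem_map.1 (List.mem_toFinset.1 ht')
      have h1 := hgt r hr
      have h2 := Finset.mem_range.1 ht
      omega
    have hnot : l ∉ ((L.take s).map (·.tag)).toFinset := by
      intro ht'
      obtain ⟨r, hr, hrl⟩ := List.mem_map.1 (List.mem_toFinset.1 ht')
      have h1 := hgt r hr
      omega
    have h1 := Finset.sum_le_sum_of_subset (f := fun t => 2 ^ t) hsub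
    have h2 := (Finset.sum_le_sum_of_subset (f := fun t => 2 ^ t) hsup).trans h.pot
    rw [Finset.sum_insert hnot] at h1
    rw [Finset.sum_union hdisj] at h2
    -- The levels below `l` were all in use; together with the new row they account for the `2 ^ l`
    -- that level `l` adds.
    have h3 : ∑ t ∈ Finset.range l, 2 ^ t + 1 = 2 ^ l := by
      have := Nat.geomSum_eq (m := 2) le_rfl l
      have h4 : 1 ≤ 2 ^ l := Nat.one_le_two_pow
      omega
    omega
  · intro t
    rw [List.filter_append]
    rcases lt_trichotomy t l with ht | rfl | ht
    · rw [hfilT t ht.le, hfilR t ht.ne]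
      simp
    · rw [hfilT t le_rfl, hfilRl, List.nil_append, length_reweigh]
      exact hcard
    · rw [hfilR t ht.ne', hfilL t ht, List.append_nil]
      exact h.count t

/-- All records together stand for all rows. -/
theorem merged_all (h : Tracked d p K U N M row i L lv) (hN : 1 ≤ N)
    (hg : ∀ j < L.length, L[j]? = some (g j)) :
    Merged d p K U row L.length g (Finset.range i) (1 / (2 * N)) := by
  have hmem : ∀ j < L.length, g j ∈ L := fun j hj => List.mem_of_getElem? (hg j hj)
  have hpos := pos_lt_pos h.sorted hg
  have hN' : (1 : ℝ) ≤ N := by exact_mod_cast hN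
  refine ⟨fun a ha b hb hab => ?_, fun j hj => ?_, fun j hj => h.weight _ (hmem j hj), fun x => ?_,
    by positivity, one_div_le_one_div_of_le (by norm_num) (by linarith)⟩
  · rcases lt_trichotomy a b with hlt | heq | hlt
    · exact absurd hab (hpos a b hlt hb).ne
    · exact heq
    · exact absurd hab (hpos b a hlt ha).ne'
  · exact Finset.mem_range.2 (h.pos_lt _ (hmem j hj))
  · have hsum : ∑ j ∈ Finset.range L.length, ((g j).u : ℝ) * rowValue d p row (g j).pos x =
        (L.map fun r => (r.u : ℝ) * rowValue d p row r.pos x).sum := by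
      rw [← sum_map_range (fun j => ((g j).u : ℝ) * rowValue d p row (g j).pos x)]
      have h1 := congrArg (fun B : List Rec => (B.map fun r => (r.u : ℝ) * rowValue d p row r.pos x).sum)
        (eq_map_range hg)
      simp only [List.map_map] at h1
      exact h1.symm
    obtain ⟨m, hm⟩ : ∃ m, ∀ a < i, lv a < m :=
      ⟨(Finset.range i).sup lv + 1, fun a ha => Nat.lt_succ_of_le (Finset.le_sup (Finset.mem_range.2 ha))⟩
    have hfil : (Finset.range i).filter (fun a => lv a < m) = Finset.range i :=
      Finset.filter_true_of_mem fun a ha => hm a (Finset.mem_range.1 ha)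
    have hmain := abs_sum_levels_le (d := d) (p := p) (K := K) (i := i) (row := row) (B := L) (lv := lv)
      (m := m) (ρ := 1 / (2 * N)) (fun r hr => by rw [← h.level r hr]; exact hm _ (h.pos_lt r hr)) x
      (fun t _ => (h.err t x).trans (mul_le_mul_of_nonneg_right (levelError_le N _)
        (mul_nonneg (by positivity) (Finset.sum_nonneg fun _ _ => rowValue_nonneg))))
    rw [hfil] at hmain
    rw [hsum]
    exact hmain

end Tracked

end StreamRAM

namespace StreamRAM

namespace Exponents

/-! ### The program -/

variable (E : Exponents)

def denominator : Ex := Ex.scale.npow E.eK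

/-- Read one row and merge it with the blocks of low levels. -/
def readRow : Cm :=
  .seq (E.readEntries E.d)
    (.seq (.put (.var 3 * .lit (E.d + 2) + .lit E.d) E.denominator)
    (.seq (.put (.var 3 * .lit (E.d + 2) + .lit (E.d + 1)) (.lit 0))
    (.seq (.set 4 (.var 3)) (.seq (.set 3 (.var 3 + .lit 1)) (.seq (.set 5 (.lit 0))
    (.seq E.scan (.seq (.set 6 (.lit 8 * .var 1 * (.var 5 + .lit 1) * (.var 5 + .lit 2)))
    (.seq E.reduce (.set 2 (.var 2 + .lit 1))))))))))

/-- Merge all blocks. -/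
def finish : Cm :=
  .seq (.set 4 (.lit 0)) (.seq (.set 5 E.denominator) (.seq (.set 6 (.lit 8 * .var 1))
    (.seq E.reduce (.set 0 (.var 3)))))

def main : Cm :=
  .seq (.set 2 (.lit 0)) (.seq (.set 3 (.lit 0))
    (.seq (.whl ((Ex.var 2).less (.var 0)) E.readRow) E.finish))

/-- The largest value of `M[6]`. -/
def maxTest (n N : ℕ) : ℕ := 8 * N * (n + 1) * (n + 2)

/-- The relations between the parameters under which the program is correct. -/
structure Good (n N : ℕ) (X : ℤ) (cap Q M Mf : ℕ) (C : ℝ) (e : ℕ) : Prop where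
  env : E.Env n N X cap Q
  one_le_d : 1 ≤ E.d
  one_le_p : 1 ≤ E.p
  one_le_N : 1 ≤ N
  one_le_Q : 1 ≤ Q
  U_le : (E.U n N : ℤ) ≤ X
  K_le : E.K n N ≤ E.U n N
  Q_le : (Q : ℤ) ≤ X
  test_le : (maxTest n N : ℤ) ≤ X
  test_le_K : 4 * maxTest n N ≤ E.K n N
  U_ge : 4 * E.K n N * (n * (E.d * (Q * Q)) ^ E.p) ≤ E.U n N
  R_ge : E.d * (E.d.factorial * Q ^ E.d) * ((maxTest n N + 1) * (n * E.U n N) *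
    (E.d * Q * E.p * 2 ^ E.p)) + 1 ≤ E.R n N
  M_le : (M : ℤ) ≤ X
  Mf_le : (Mf : ℤ) ≤ X
  M_ge : ∀ l ≤ Nat.log 2 n, sizeBound E.d E.p e C (1 / (2 * (8 * N * (l + 1) * (l + 2) : ℕ))) < M + 1
  Mf_ge : sizeBound E.d E.p e C (1 / (2 * (8 * N : ℕ))) < Mf + 1
  cap_ge : ((Nat.log 2 n + 1) * M + 1) * (E.d + 2) + ((Nat.log 2 n + 1) * M + 1) < cap
  coreset : ∀ ε : ℝ, 0 < ε → ε < 1 → ∀ (ι : Type) [Fintype ι] (a : ι → Fin E.d → ℝ) (w : ι → ℝ),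
    (∀ i, 0 ≤ w i) → ∃ w' : ι → ℝ, (∀ i, 0 ≤ w' i) ∧ (∀ i, w i = 0 → w' i = 0) ∧
      ((Finset.univ.filter (w' · ≠ 0)).card : ℝ) ≤ sizeBound E.d E.p e C ε ∧
      ∀ x : Fin E.d → ℝ,
        |∑ i, w' i * |∑ j, a i j * x j| ^ E.p - ∑ i, w i * |∑ j, a i j * x j| ^ E.p| ≤
          ε * ∑ i, w i * |∑ j, a i j * x j| ^ E.p

variable {E} {n N cap Q M Mf e s : ℕ} {X : ℤ} {C : ℝ} {σ : HState} {row : ℕ → ℕ → ℤ} {L : List Rec}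

theorem eval_denominator (h0 : σ.v 0 = n) (h1 : σ.v 1 = N) :
    E.denominator.eval σ = (E.K n N : ℤ) := by
  simp [denominator, eval_scale h0 h1, K]

theorem ok_denominator : E.denominator.Ok cap σ := by simp [denominator, ok_scale]

theorem Block.of_stored (h0 : σ.v 0 = n) (h1 : σ.v 1 = N) (h3 : σ.v 3 = L.length) (h4 : σ.v 4 = s)
    (hs : s ≤ L.length) (hlen : L.length ≤ n) (hcap : L.length * (E.d + 2) + L.length < cap)
    (hL : Stored E.d row σ.h L) (hrow : ∀ a c, |row a c| ≤ Q) (hu : ∀ r ∈ L, r.u ≤ E.U n N) :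
    E.Block n N cap Q s L.length σ := by
  refine ⟨h0, h1, h3, h4, hs, hlen, hcap, fun j hj c hc => ?_, fun j hj => ?_⟩
  · obtain ⟨h, -, -⟩ := hL (s + j) _ (List.getElem?_eq_getElem (by omega))
    have h' := h c hc
    push_cast at h'
    rw [h']
    exact hrow _ c
  · have hlt : s + j < L.length := by omega
    obtain ⟨-, h, -⟩ := hL (s + j) _ (List.getElem?_eq_getElem hlt)
    push_cast at h
    rw [h, Nat.abs_cast]
    exact_mod_cast hu _ (List.getElem_mem hlt)

theorem exists_getElem?_eq (L : List Rec) : ∃ g : ℕ → Rec, ∀ j < L.length, L[j]? = some (g j) :=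
  ⟨fun j => L.getD j ⟨0, 0, 0⟩, fun j hj => by simp [hj]⟩

/-- Reducing a block of records that stands for given rows. -/
theorem wp_reduce_merged (hG : E.Good n N X cap Q M Mf C e) {g : ℕ → Rec} {l m T : ℕ} {P : Finset ℕ}
    {ρ : ℝ} (hrow : ∀ a c, |row a c| ≤ Q) (hl : (l : ℤ) ≤ X) (hm : (m : ℤ) ≤ X)
    (hblock : E.Block n N cap Q s L.length σ) (hL : Stored E.d row σ.h L)
    (hg : ∀ j < L.length - s, L[s + j]? = some (g j)) (h5 : σ.v 5 = l) (h6 : σ.v 6 = T)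
    (hmerged : Merged E.d E.p (E.K n N) (E.U n N) row (L.length - s) g P ρ) (hP : P.card ≤ n)
    (hT : 1 ≤ T) (hTmax : T ≤ maxTest n N) (hsize : sizeBound E.d E.p e C (1 / (2 * T)) < m + 1) :
    Wp X cap E.reduce (fun τ => ∃ f : ℕ → ℕ, (∀ j < L.length - s, f j ≤ E.U n N) ∧
      ((Finset.range (L.length - s)).filter fun j => f j ≠ 0).card ≤ m ∧
      (∀ x : Fin E.d → ℝ, |∑ j ∈ Finset.range (L.length - s),
          (f j : ℝ) * rowValue E.d E.p row (g j).pos x -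
          E.K n N * ∑ a ∈ P, rowValue E.d E.p row a x| ≤
        (ρ + 4 / T) * (E.K n N * ∑ a ∈ P, rowValue E.d E.p row a x)) ∧
      (∀ a < 7, a ≠ 3 → τ.v a = σ.v a) ∧ τ.inp = σ.inp ∧
      τ.v 3 = (L.take s ++ reweigh g f l (L.length - s)).length ∧
      Stored E.d row τ.h (L.take s ++ reweigh g f l (L.length - s))) σ := by
  obtain ⟨f, hfU, hfcard, hferr⟩ := hmerged.exists_weights hG.one_le_p hG.coreset
    (fun a _ c => hrow a c) hT ((Nat.mul_le_mul_left 4 hTmax).trans hG.test_le_K)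
    (le_trans (Nat.mul_le_mul_left _ (Nat.mul_le_mul_right _ hP)) hG.U_ge) hsize
  refine (wp_reduce hG.env hG.U_le hG.Q_le hl hm hblock hL hg h5 hfU ?_).mono ?_
  · rw [h6, passes_iff hL hg]
    exact ⟨hfcard, fun t _ => hferr _⟩
  · rintro τ ⟨f', hf'U, hpass, hv, hinp, h3, hst⟩
    rw [h6, passes_iff hL hg] at hpass
    refine ⟨f', hf'U, hpass.1, ?_, hv, hinp, h3, hst⟩
    refine hmerged.of_test hG.one_le_d hG.one_le_p hG.one_le_Q (fun a _ c => hrow a c) hT hf'U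
      (le_trans ?_ hG.R_ge) hpass.2
    have := hblock.hlen
    gcongr
    omega

theorem le_maxTest {l : ℕ} (hl : l ≤ n) : 8 * N * (l + 1) * (l + 2) ≤ maxTest n N := by
  rw [maxTest]
  gcongr

theorem wp_readRow (hG : E.Good n N X cap Q M Mf C e) (hrow : ∀ a c, |row a c| ≤ Q) {i : ℕ} (hi : i < n)
    {l rest : List ℤ} (hl : l.length = E.d) (hlrow : ∀ c, l.getD c 0 = row i c) (h0 : σ.v 0 = n)
    (h1 : σ.v 1 = N) (h2 : σ.v 2 = i) (h3 : σ.v 3 = L.length) (hinp : σ.inp = l ++ rest)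
    (hst : Stored E.d row σ.h L) {lv : ℕ → ℕ}
    (htr : Tracked E.d E.p (E.K n N) (E.U n N) N M row i L lv) :
    Wp X cap E.readRow (fun τ => τ.v 0 = n ∧ τ.v 1 = N ∧ τ.v 2 = (i + 1 : ℕ) ∧ τ.inp = rest ∧
      ∃ L' lv', τ.v 3 = List.length L' ∧ Stored E.d row τ.h L' ∧
        Tracked E.d E.p (E.K n N) (E.U n N) N M row (i + 1) L' lv') σ := by
  have hX := hG.env.n_le
  have hNX := hG.test_le
  have hlen := htr.length_le_self
  have hlenM : L.length ≤ (Nat.log 2 n + 1) * M := htr.length_le.trans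
    (Nat.mul_le_mul_right _ (Nat.succ_le_succ (Nat.log_mono_right hi.le)))
  have hcap : (L.length + 1) * (E.d + 2) + (L.length + 1) < cap := by
    refine lt_of_le_of_lt ?_ hG.cap_ge
    gcongr
  have hcap1 : (L.length : ℤ) * (E.d + 2) + (E.d + 2) ≤ cap := by
    have h : (L.length + 1) * (E.d + 2) ≤ cap := by omega
    have h' : (((L.length + 1) * (E.d + 2) : ℕ) : ℤ) ≤ cap := by exact_mod_cast h
    push_cast at h'
    linarith
  have hK1 : 1 ≤ E.K n N := by
    have h := hG.test_le_K
    have hN := hG.one_le_N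
    have h' : 0 < maxTest n N := by rw [maxTest]; positivity
    omega
  have hKX : |(E.K n N : ℤ)| ≤ X := by
    rw [Nat.abs_cast]
    exact le_trans (by exact_mod_cast hG.K_le) hG.U_le
  have hnn : 0 ≤ (L.length : ℤ) * (E.d + 2) := by positivity
  have hlX : ∀ z ∈ l, |z| ≤ X := by
    intro z hz
    obtain ⟨c, hc, rfl⟩ := List.mem_iff_getElem.1 hz
    have h := hlrow c
    rw [List.getD_eq_getElem _ _ hc] at h
    rw [h]
    exact (hrow i c).trans hG.Q_le
  refine wp_seq ((wp_readEntries hinp hlX h3 hcap1 E.d le_rfl hl.ge).mono ?_)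
  rintro τ ⟨hv, hinpτ, hh, hent⟩
  rw [← hl, List.drop_length, List.nil_append] at hinpτ
  have a1 : (Ex.var 3 * .lit (E.d + 2) + .lit E.d).eval τ = L.length * (E.d + 2) + E.d := by
    simp [hv 3 (by omega), h3]
  have a2 : ∀ k : ℤ → ℤ, (Ex.var 3 * .lit (E.d + 2) + .lit (E.d + 1)).eval { τ with h := k } =
      L.length * (E.d + 2) + (E.d + 1) := fun k => by simp [hv 3 (by omega), h3]
  have hden := eval_denominator (E := E) ((hv 0 (by omega)).trans h0) ((hv 1 (by omega)).trans h1)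
  refine wp_seq (wp_put (by simp) ok_denominator (by rw [a1]; positivity) (by rw [a1]; omega)
    (by rw [hden]; exact hKX) (wp_seq ?_))
  refine wp_put (by simp) trivial (by rw [a2]; positivity) (by rw [a2]; omega)
    (by simp; omega) ?_
  rw [a1, a2, hden, eval_lit]
  refine wp_seq (wp_set trivial ?_ (wp_seq (wp_set (by simp) ?_ (wp_seq (wp_set trivial ?_ ?_)))))
  · simp only [eval_var, hv 3 (by omega), h3]
    rw [Nat.abs_cast]
    omega
  · simp only [eval_add, eval_var, eval_lit, Function.update_of_ne (by omega : (3 : ℕ) ≠ 4),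
      hv 3 (by omega), h3]
    rw [abs_of_nonneg (by positivity)]
    omega
  · simp
    omega
  -- the state in which the tags are scanned
  set ρ : HState := _ with hρ
  change Wp X cap _ _ ρ
  have hρ4 : ρ.v 4 = L.length := by
    simp [hρ, hv 3 (by omega), h3]
  have hρ3 : ρ.v 3 = (Tracked.snoc L i (E.K n N)).length := by
    simp [hρ, hv 3 (by omega), h3, Tracked.snoc]
  have hρ5 : ρ.v 5 = 0 := by simp [hρ]
  have hρa : ∀ a < 3, ρ.v a = σ.v a := fun a ha => by
    simp only [hρ, Function.update_of_ne (by omega : a ≠ 5), Function.update_of_ne (by omega : a ≠ 3),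
      Function.update_of_ne (by omega : a ≠ 4)]
    exact hv a (by omega)
  have hρi : ρ.inp = rest := hinpτ
  have hρst : Stored E.d row ρ.h (Tracked.snoc L i (E.K n N)) := by
    simp only [hρ]
    refine hst.append_singleton ?_ ?_ ?_ ?_
    · intro z hz
      rw [Function.update_of_ne (by omega), Function.update_of_ne (by omega), hh z hz]
    · intro c hc
      rw [Function.update_of_ne (by omega), Function.update_of_ne (by omega), hent c hc, hlrow]
    · rw [Function.update_of_ne (by omega), Function.update_self]
    · rw [Function.update_self]
      rfl
  clear_value ρ
  obtain ⟨gL, hgL⟩ := exists_getElem?_eq L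
  have hsnoc : (Tracked.snoc L i (E.K n N)).length = L.length + 1 := by simp [Tracked.snoc]
  refine wp_seq ((wp_scan (E := E) (tag := fun j => (gL j).tag) (by omega) hρ4 hρ5 hcap1 fun j hj => ?_).mono ?_)
  · have hj' : (Tracked.snoc L i (E.K n N))[j]? = some (gL j) := by
      rw [Tracked.snoc, List.getElem?_append_left hj, hgL j hj]
    exact (hρst j _ hj').2.2
  rintro υ ⟨hυv, hυh, hυi, s, t, h4, h5, hs, ht, htag, hall, hfirst⟩
  have hidx : ∀ r ∈ L.drop s, ∃ j, s ≤ j ∧ j < L.length ∧ gL j = r := by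
    intro r hr
    obtain ⟨j, hj, rfl⟩ := List.mem_iff_getElem.1 hr
    rw [List.length_drop] at hj
    refine ⟨s + j, by omega, by omega, ?_⟩
    have h := hgL (s + j) (by omega)
    rw [List.getElem?_eq_getElem (by omega)] at h
    rw [List.getElem_drop]
    exact (Option.some.inj h).symm
  have hdrop : ∀ r ∈ L.drop s, r.tag < t := by
    intro r hr
    obtain ⟨j, hj, hjl, rfl⟩ := hidx r hr
    exact htag j hj hjl
  have htake : ∀ r ∈ L.take s, t < r.tag := by
    intro r hr
    obtain ⟨j, hj, rfl⟩ := List.mem_iff_getElem.1 hr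
    rw [List.length_take] at hj
    rw [List.getElem_take]
    rcases hfirst with rfl | hfirst
    · omega
    · have hlast := hgL (s - 1) (by omega)
      rw [List.getElem?_eq_getElem (by omega)] at hlast
      rw [← Option.some.inj hlast] at hfirst
      rcases (by omega : j < s - 1 ∨ j = s - 1) with hlt | rfl
      · exact hfirst.trans_le ((List.pairwise_iff_getElem.1 htr.anti) j (s - 1) (by omega) (by omega) hlt)
      · exact hfirst
  have hall' : ∀ t' < t, ∃ r ∈ L.drop s, r.tag = t' := by
    intro t' ht'
    obtain ⟨j, hj, hjl, hjt⟩ := hall t' ht'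
    refine ⟨gL j, ?_, hjt⟩
    have h := hgL j hjl
    rw [show j = s + (j - s) by omega, ← List.getElem?_drop] at h
    rw [show j = s + (j - s) by omega]
    exact List.mem_of_getElem? h
  -- All levels below `t` are in use, so the potential gives `2 ^ t - 1 ≤ i < n`.
  have htlog : t ≤ Nat.log 2 n := by
    refine Nat.le_log_of_pow_le (by omega) ?_
    have hsub : Finset.range t ⊆ (L.map (·.tag)).toFinset := by
      intro t' ht'
      obtain ⟨r, hr, hrt⟩ := hall' t' (Finset.mem_range.1 ht')
      exact List.mem_toFinset.2 (List.mem_map.2 ⟨r, List.mem_of_mem_drop hr, hrt⟩)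
    have h := (Finset.sum_le_sum_of_subset (f := fun t => 2 ^ t) hsub).trans htr.pot
    have h' := Nat.geomSum_eq (m := 2) le_rfl t
    have h'' : 1 ≤ 2 ^ t := Nat.one_le_two_pow
    omega
  have htn : t ≤ n := by omega
  have hTmax := le_maxTest (N := N) htn
  have hT1 : 1 ≤ 8 * N * (t + 1) * (t + 2) := by
    have := hG.one_le_N
    have : 0 < 8 * N * (t + 1) * (t + 2) := by positivity
    omega
  have heval : (Ex.lit 8 * .var 1 * (.var 5 + .lit 1) * (.var 5 + .lit 2)).eval υ =
      ((8 * N * (t + 1) * (t + 2) : ℕ) : ℤ) := by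
    simp [hυv 1 (by omega) (by omega), hρa 1 (by omega), h1, h5]
  refine wp_seq (wp_set (by simp) (by
    rw [heval, Nat.abs_cast]
    exact le_trans (by exact_mod_cast hTmax) hNX) (wp_seq ?_))
  rw [heval]
  obtain ⟨g, hg⟩ : ∃ g : ℕ → Rec, ∀ j < (Tracked.snoc L i (E.K n N)).length - s,
      (Tracked.snoc L i (E.K n N))[s + j]? = some (g j) := by
    obtain ⟨g, hg⟩ := exists_getElem?_eq (Tracked.snoc L i (E.K n N))
    exact ⟨fun j => g (s + j), fun j hj => hg _ (by omega)⟩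
  have hmerged := htr.merged hG.one_le_N hK1 hG.K_le hs hdrop htake hg
  have hPcard : (Tracked.newBlock lv i t).card ≤ n := by
    refine (Finset.card_insert_le _ _).trans ?_
    have h := Finset.card_filter_le (Finset.range i) fun a => lv a < t + 1
    rw [Finset.card_range] at h
    omega
  have hblock : E.Block n N cap Q s (Tracked.snoc L i (E.K n N)).length
      { υ with v := Function.update υ.v 6 ((8 * N * (t + 1) * (t + 2) : ℕ) : ℤ) } := by
    refine Block.of_stored (row := row) ?_ ?_ ?_ ?_ (by omega) (by omega) ?_ ?_ hrow ?_
    · simp only [Function.update_of_ne (by omega : (0 : ℕ) ≠ 6)]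
      rw [hυv 0 (by omega) (by omega), hρa 0 (by omega), h0]
    · simp only [Function.update_of_ne (by omega : (1 : ℕ) ≠ 6)]
      rw [hυv 1 (by omega) (by omega), hρa 1 (by omega), h1]
    · simp only [Function.update_of_ne (by omega : (3 : ℕ) ≠ 6)]
      rw [hυv 3 (by omega) (by omega), hρ3]
    · simp only [Function.update_of_ne (by omega : (4 : ℕ) ≠ 6)]
      exact h4
    · rw [hsnoc]
      exact hcap
    · simp only [hυh]
      exact hρst
    · intro r hr
      rcases List.mem_append.1 hr with hr | hr
      · exact (htr.weight r hr).2
      · rw [List.mem_singleton] at hr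
        rw [hr]
        exact hG.K_le
  refine (wp_reduce_merged hG (l := t) (T := 8 * N * (t + 1) * (t + 2)) hrow (by omega) hG.M_le hblock
    (by simp only [hυh]; exact hρst) hg (by simp [h5]) (by simp) hmerged hPcard hT1 hTmax
    (by exact_mod_cast hG.M_ge t htlog)).mono ?_
  rintro ξ ⟨f, hfU, hfcard, hferr, hξv, hξi, hξ3, hξst⟩
  rw [Tracked.take_snoc hs] at hξ3 hξst
  have hξa : ∀ a < 3, ξ.v a = σ.v a := fun a ha => by
    rw [hξv a (by omega) (by omega)]
    simp only [Function.update_of_ne (by omega : a ≠ 6)]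
    rw [hυv a (by omega) (by omega), hρa a ha]
  have e2 : (Ex.var 2 + .lit 1).eval ξ = ((i + 1 : ℕ) : ℤ) := by
    simp [hξa 2 (by omega), h2]
  refine wp_set (by simp) (by rw [e2, Nat.abs_cast]; omega) ⟨?_, ?_, ?_, ?_, _, _, ?_, hξst,
    htr.step hG.one_le_N hs hdrop htake hall' hg hfU hfcard hferr⟩
  · simp only [Function.update_of_ne (by omega : (0 : ℕ) ≠ 2)]
    rw [hξa 0 (by omega), h0]
  · simp only [Function.update_of_ne (by omega : (1 : ℕ) ≠ 2)]
    rw [hξa 1 (by omega), h1]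
  · simp only [Function.update_self]
    exact e2
  · exact hξi.trans (hυi.trans hρi)
  · simp only [Function.update_of_ne (by omega : (3 : ℕ) ≠ 2)]
    exact hξ3

/-- The tag written here is the denominator `K`. The last two cells of each record thus become
numerator and denominator of its weight, as the output format demands. The error is `1 / (2 * N)`
from the levels plus `4 / (8 * N)` from this reduction. -/
theorem wp_finish (hG : E.Good n N X cap Q M Mf C e) (hrow : ∀ a c, |row a c| ≤ Q) (h0 : σ.v 0 = n)
    (h1 : σ.v 1 = N) (h3 : σ.v 3 = L.length) (hst : Stored E.d row σ.h L) {lv : ℕ → ℕ}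
    (htr : Tracked E.d E.p (E.K n N) (E.U n N) N M row n L lv) :
    Wp X cap E.finish (fun τ => ∃ L' : List Rec, τ.v 0 = List.length L' ∧ Stored E.d row τ.h L' ∧
      L'.length ≤ Mf ∧ L'.length ≤ (Nat.log 2 n + 1) * M ∧ (∀ r ∈ L', r.pos < n ∧ r.tag = E.K n N) ∧
      (L'.Pairwise fun a b => a.pos < b.pos) ∧ ∀ x : Fin E.d → ℝ,
        |(L'.map fun r => (r.u : ℝ) * rowValue E.d E.p row r.pos x).sum -
          E.K n N * ∑ a ∈ Finset.range n, rowValue E.d E.p row a x| ≤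
          1 / N * (E.K n N * ∑ a ∈ Finset.range n, rowValue E.d E.p row a x)) σ := by
  have hX := hG.env.n_le
  have hlen := htr.length_le_self
  have hlenM : L.length ≤ (Nat.log 2 n + 1) * M := htr.length_le
  have hcap : L.length * (E.d + 2) + L.length < cap := by
    refine lt_of_le_of_lt ?_ hG.cap_ge
    gcongr <;> omega
  have hKX : (E.K n N : ℤ) ≤ X := le_trans (by exact_mod_cast hG.K_le) hG.U_le
  have hN : (0 : ℝ) < N := by exact_mod_cast hG.one_le_N
  have hTmax : 8 * N ≤ maxTest n N := by
    rw [maxTest, mul_assoc]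
    exact Nat.le_mul_of_pos_right _ (by positivity)
  refine wp_seq (wp_set trivial (by simp; omega) ?_)
  have hden : E.denominator.eval { σ with v := Function.update σ.v 4 ((Ex.lit 0).eval σ) } = E.K n N :=
    eval_denominator (by simpa using h0) (by simpa using h1)
  refine wp_seq (wp_set ok_denominator (by rw [hden, Nat.abs_cast]; exact hKX) (wp_seq ?_))
  rw [hden]
  have heval : (Ex.lit 8 * .var 1).eval { σ with
      v := Function.update (Function.update σ.v 4 ((Ex.lit 0).eval σ)) 5 (E.K n N : ℤ) } =
      ((8 * N : ℕ) : ℤ) := by simp [h1]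
  refine wp_set (by simp) (by
    rw [heval, Nat.abs_cast]
    exact le_trans (by exact_mod_cast hTmax) hG.test_le) ?_
  rw [heval]
  obtain ⟨g, hg⟩ := exists_getElem?_eq L
  have hmerged := htr.merged_all hG.one_le_N hg
  have hblock : E.Block n N cap Q 0 L.length { σ with v := Function.update (Function.update
      (Function.update σ.v 4 ((Ex.lit 0).eval σ)) 5 (E.K n N : ℤ)) 6 ((8 * N : ℕ) : ℤ) } :=
    Block.of_stored (row := row) (by simpa using h0) (by simpa using h1) (by simpa using h3) (by simp)
      (Nat.zero_le _) hlen hcap hst hrow fun r hr => (htr.weight r hr).2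
  refine wp_seq ((wp_reduce_merged (s := 0) hG (l := E.K n N) (T := 8 * N) hrow hKX hG.Mf_le hblock hst
    (by simpa using hg) (by simp) (by simp) hmerged (by simp)
    (by have := hG.one_le_N; omega) hTmax (by exact_mod_cast hG.Mf_ge)).mono ?_)
  rintro τ ⟨f, hfU, hfcard, hferr, hv, hinp, hτ3, hτst⟩
  simp only [List.take_zero, List.nil_append, Nat.sub_zero] at hτ3 hτst hfcard hferr
  have hle := length_reweigh_le g f (E.K n N) L.length
  refine wp_set trivial (by rw [eval_var, hτ3, Nat.abs_cast]; omega) ⟨_, ?_, hτst, ?_, by omega, ?_, ?_, ?_⟩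
  · simp [hτ3]
  · rw [length_reweigh]
    exact hfcard
  · intro r hr
    obtain ⟨ht, j, hj, hpj, -⟩ := mem_reweigh hr
    exact ⟨by rw [hpj]; exact htr.pos_lt _ (List.mem_of_getElem? (hg j hj)), ht⟩
  · exact pairwise_reweigh (Tracked.pos_lt_pos htr.sorted hg)
  · intro x
    rw [sum_reweigh fun a => rowValue E.d E.p row a x]
    refine (hferr x).trans (le_of_eq ?_)
    congr 1
    push_cast
    field_simp
    norm_num

/-- Total correctness of the program. -/
theorem wp_main (hG : E.Good n N X cap Q M Mf C e) {rows : List (List ℤ)} (hn : rows.length = n)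
    (hd : ∀ l ∈ rows, l.length = E.d) (hrow : ∀ a c, |(rows.getD a []).getD c 0| ≤ Q) (h0 : σ.v 0 = n)
    (h1 : σ.v 1 = N) (hinp : σ.inp = rows.flatten) :
    Wp X cap E.main (fun τ => ∃ L' : List Rec, τ.v 0 = List.length L' ∧
      Stored E.d (fun a c => (rows.getD a []).getD c 0) τ.h L' ∧
      L'.length ≤ Mf ∧ L'.length ≤ (Nat.log 2 n + 1) * M ∧ (∀ r ∈ L', r.pos < n ∧ r.tag = E.K n N) ∧
      (L'.Pairwise fun a b => a.pos < b.pos) ∧ ∀ x : Fin E.d → ℝ,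
        |(L'.map fun r => (r.u : ℝ) *
            rowValue E.d E.p (fun a c => (rows.getD a []).getD c 0) r.pos x).sum -
          E.K n N * ∑ a ∈ Finset.range n, rowValue E.d E.p (fun a c => (rows.getD a []).getD c 0) a x| ≤
          1 / N * (E.K n N * ∑ a ∈ Finset.range n,
            rowValue E.d E.p (fun a c => (rows.getD a []).getD c 0) a x)) σ := by
  have hX := hG.env.n_le
  refine wp_seq (wp_set trivial (by simp; omega) (wp_seq (wp_set trivial (by simp; omega) (wp_seq ?_))))
  refine wp_for n (fun i τ => τ.v 0 = n ∧ τ.v 1 = N ∧ τ.v 2 = (i : ℕ) ∧ τ.inp = (rows.drop i).flatten ∧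
    ∃ L lv, τ.v 3 = List.length L ∧ Stored E.d (fun a c => (rows.getD a []).getD c 0) τ.h L ∧
      Tracked E.d E.p (E.K n N) (E.U n N) N M (fun a c => (rows.getD a []).getD c 0) i L lv) ?_ ?_ ?_ ?_
  · rintro i τ hi ⟨h0, h1, h2, -⟩
    refine ⟨by simp, ?_⟩
    rw [eval_less_ne_zero, eval_var, eval_var, h0, h2, Nat.cast_lt]
  · rintro i τ hi ⟨h0, h1, h2, hin, L, lv, h3, hst, htr⟩
    have hi' : i < rows.length := by omega
    rw [List.drop_eq_getElem_cons hi', List.flatten_cons] at hin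
    refine wp_readRow hG hrow hi (hd _ (List.getElem_mem hi')) (fun c => ?_) h0 h1 h2 h3 hin hst htr
    rw [List.getD_eq_getElem rows [] hi']
  · refine ⟨by simpa using h0, by simpa using h1, by simp, by simpa using hinp, [], _, by simp,
      Stored.nil, Tracked.nil _ _ _ _ _ _ _⟩
  · rintro τ ⟨h0, h1, -, -, L, lv, h3, hst, htr⟩
    exact wp_finish hG hrow h0 h1 h3 hst htr

end Exponents

end StreamRAM

/-! ### Choice of the parameters -/

theorem sizeBound_anti {d p k : ℕ} (hd : 2 ≤ d) {C ε ε' : ℝ} (hC : 0 ≤ C) (hε : 0 < ε) (hεε' : ε ≤ ε')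
    (hε' : ε' ≤ 1) : sizeBound d p k C ε' ≤ sizeBound d p k C ε := by
  have h0 := sizeExponent_nonneg (p := p) hd
  have hε'0 : 0 < ε' := hε.trans_le hεε'
  have h1 : 1 ≤ 2 / ε' := by rw [le_div_iff₀ hε'0]; linarith
  rw [sizeBound, sizeBound]
  have h2 : Real.log (2 / ε') ≤ Real.log (2 / ε) :=
    Real.log_le_log (by linarith) (div_le_div_of_nonneg_left (by norm_num) hε hεε')
  have h3 : 0 ≤ Real.log (2 / ε') := Real.log_nonneg h1
  gcongr

/-- A crude polynomial bound, which serves only to show that the numbers of records fit into words.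
-/
theorem sizeBound_le_pow {d p k : ℕ} (hd : 2 ≤ d) {C : ℝ} (hC : 0 ≤ C) {T : ℕ} (hT : 1 ≤ T) :
    sizeBound d p k C (1 / (2 * T)) ≤ C * (2 * T) ^ 2 * (4 * T) ^ k := by
  have hT' : (1 : ℝ) ≤ T := by exact_mod_cast hT
  rw [sizeBound, one_div_one_div, div_div_eq_mul_div, div_one]
  have h1 : ((2 : ℝ) * T) ^ sizeExponent d p ≤ (2 * T) ^ 2 := by
    rw [← Real.rpow_natCast]
    exact Real.rpow_le_rpow_of_exponent_le (by linarith) (by exact_mod_cast sizeExponent_le_two hd)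
  have h2 : Real.log (2 * (2 * T)) ≤ 4 * T := by
    have := Real.log_le_sub_one_of_pos (show (0 : ℝ) < 2 * (2 * T) by positivity)
    linarith
  have h3 : 0 ≤ Real.log (2 * (2 * T)) := Real.log_nonneg (by linarith)
  gcongr

namespace StreamRAM

namespace Exponents

/-- Exponents for entries of size at most `(n + 1) ^ c`. -/
def choose (d p c : ℕ) : Exponents where
  d := d
  p := p
  -- Each exponent adds up the exponents of the factors in the requirement on it. A constant factor
  -- `a` is counted with exponent `a`, which is enough because the scale is at least two.
  eU := 10 + (d + 2 * c) * p
  eR := d + d.factorial + c * d + 6 + (1 + (10 + (d + 2 * c) * p)) + (d + c + p + p) + 1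
  eK := 7

/-- The exponent of the bound for all stored numbers. -/
def wordExponent (d p c k b : ℕ) : ℕ :=
  1 + (choose d p c).eU + (d + c + (choose d p c).eR) * p + ((choose d p c).eR + 2) * d + b + 12 + 7 * k
    + c + 5

variable {d p c n N k : ℕ} {C : ℝ}

theorem two_le_Z (hN : 2 ≤ N) : 2 ≤ Z n N := by
  rw [Z]
  nlinarith

theorem le_Z (hN : 2 ≤ N) : n + 1 ≤ Z n N := Nat.le_mul_of_pos_right _ (by omega)

theorem self_le_pow {Z : ℕ} (hZ : 2 ≤ Z) (a : ℕ) : a ≤ Z ^ a := (Nat.lt_pow_self hZ).le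

theorem maxTest_le (hn : 1 ≤ n) (hN : 2 ≤ N) : maxTest n N ≤ Z n N ^ 5 := by
  have hZ := two_le_Z (n := n) hN
  have h1 : n + 2 ≤ Z n N := by
    rw [Z]
    nlinarith
  calc maxTest n N = 2 ^ 3 * Z n N * (n + 2) := by rw [maxTest, Z]; ring
    _ ≤ Z n N ^ 3 * Z n N * Z n N := by
        gcongr
    _ = Z n N ^ 5 := by ring

theorem sizeBound_le_Z_pow (hd : 2 ≤ d) (hn : 1 ≤ n) (hN : 2 ≤ N) (hC : 0 ≤ C) {T : ℕ} (hT : 1 ≤ T)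
    (hTmax : T ≤ maxTest n N) :
    sizeBound d p k C (1 / (2 * T)) ≤ ((Z n N ^ (⌈C⌉₊ + 12 + 7 * k) : ℕ) : ℝ) := by
  have hZ := two_le_Z (n := n) hN
  have hT5 := hTmax.trans (maxTest_le hn hN)
  have h1 : ⌈C⌉₊ * (2 * T) ^ 2 * (4 * T) ^ k ≤ Z n N ^ (⌈C⌉₊ + 12 + 7 * k) := by
    calc ⌈C⌉₊ * (2 * T) ^ 2 * (4 * T) ^ k = ⌈C⌉₊ * (2 * T) ^ 2 * (2 ^ 2 * T) ^ k := by norm_num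
      _ ≤ Z n N ^ ⌈C⌉₊ * (Z n N * Z n N ^ 5) ^ 2 * (Z n N ^ 2 * Z n N ^ 5) ^ k := by
          gcongr
          exact self_le_pow hZ _
      _ = Z n N ^ (⌈C⌉₊ + 12 + 7 * k) := by
          rw [← pow_add, ← pow_succ', ← pow_mul, ← pow_mul, ← pow_add, ← pow_add]
  refine (sizeBound_le_pow hd hC hT).trans (le_trans ?_ (Nat.cast_le.2 h1))
  push_cast
  gcongr
  exact Nat.le_ceil C

/-- The parameter of the test for the highest level. -/
def topTest (n N : ℕ) : ℕ := 8 * N * (Nat.log 2 n + 1) * (Nat.log 2 n + 2)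

/-- The number of records kept in each level. -/
noncomputable def levelSize (d p k : ℕ) (C : ℝ) (n N : ℕ) : ℕ :=
  ⌊sizeBound d p k C (1 / (2 * topTest n N))⌋₊

/-- The number of records returned. -/
noncomputable def outputSize (d p k : ℕ) (C : ℝ) (N : ℕ) : ℕ :=
  ⌊sizeBound d p k C (1 / (2 * (8 * N : ℕ)))⌋₊

/-- The number of records in memory. -/
noncomputable def maxRecords (d p k : ℕ) (C : ℝ) (n N : ℕ) : ℕ :=
  (Nat.log 2 n + 1) * levelSize d p k C n N + 1

/-- The numerical bounds compare powers of the scale `Z n N`. There is no circularity: the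
denominator `K` determines the range `U` of the weights, this the range `R` of the test vectors, and
all of them the bound `X` for stored numbers. -/
theorem good_choose (hd : 2 ≤ d) (hp : 1 ≤ p) (hn : 1 ≤ n) (hN : 2 ≤ N) (hC : 0 < C)
    (hcore : ∀ ε : ℝ, 0 < ε → ε < 1 → ∀ (ι : Type) [Fintype ι] (a : ι → Fin d → ℝ) (w : ι → ℝ),
      (∀ i, 0 ≤ w i) → ∃ w' : ι → ℝ, (∀ i, 0 ≤ w' i) ∧ (∀ i, w i = 0 → w' i = 0) ∧
        ((Finset.univ.filter (w' · ≠ 0)).card : ℝ) ≤ sizeBound d p k C ε ∧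
        ∀ x : Fin d → ℝ, |∑ i, w' i * |∑ j, a i j * x j| ^ p - ∑ i, w i * |∑ j, a i j * x j| ^ p| ≤
          ε * ∑ i, w i * |∑ j, a i j * x j| ^ p) :
    (choose d p c).Good n N ((Z n N ^ wordExponent d p c k ⌈C⌉₊ : ℕ) : ℤ)
      (maxRecords d p k C n N * (d + 2) + maxRecords d p k C n N + 1) ((n + 1) ^ c)
      (levelSize d p k C n N) (outputSize d p k C N) C k := by
  have hZ := two_le_Z (n := n) hN
  have hnZ := le_Z (n := n) hN
  have hT5 := maxTest_le hn hN
  have hQ : (n + 1) ^ c ≤ Z n N ^ c := Nat.pow_le_pow_left hnZ c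
  have hQ1 : 1 ≤ (n + 1) ^ c := Nat.one_le_pow _ _ (by omega)
  have hmono : ∀ a, a ≤ wordExponent d p c k ⌈C⌉₊ →
      Z n N ^ a ≤ Z n N ^ wordExponent d p c k ⌈C⌉₊ := fun a ha => Nat.pow_le_pow_right (by omega) ha
  have hlog : Nat.log 2 n ≤ n := Nat.log_le_self 2 n
  have htop : topTest n N ≤ maxTest n N := le_maxTest hlog
  have htop1 : 1 ≤ topTest n N := by
    have : 0 < topTest n N := by rw [topTest]; positivity
    omega
  have h8 : 8 * N ≤ maxTest n N := by
    rw [maxTest, mul_assoc]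
    exact Nat.le_mul_of_pos_right _ (by positivity)
  have hU : (choose d p c).U n N = Z n N ^ (choose d p c).eU := rfl
  have hK : (choose d p c).K n N = Z n N ^ 7 := rfl
  have hR : (choose d p c).R n N = Z n N ^ (choose d p c).eR := rfl
  have heU : (choose d p c).eU = 10 + (d + 2 * c) * p := rfl
  have heR : (choose d p c).eR =
    d + d.factorial + c * d + 6 + (1 + (choose d p c).eU) + (d + c + p + p) + 1 := rfl
  have hd' : (choose d p c).d = d := rfl
  have hp' : (choose d p c).p = p := rfl
  refine ⟨⟨?_, ?_, ?_⟩, by rw [hd']; omega, hp, by omega, hQ1, ?_, ?_, ?_, ?_, ?_, ?_, ?_, ?_, ?_, ?_, ?_,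
    ?_, hcore⟩
  · rw [hU, hR, hd', hp']
    have h : n * (Z n N ^ (choose d p c).eU * (d * ((n + 1) ^ c * Z n N ^ (choose d p c).eR)) ^ p) ≤
        Z n N ^ wordExponent d p c k ⌈C⌉₊ := by
      calc _ ≤ Z n N * (Z n N ^ (choose d p c).eU * (Z n N ^ d * (Z n N ^ c *
            Z n N ^ (choose d p c).eR)) ^ p) := by
            gcongr
            · omega
            · exact self_le_pow hZ d
        _ = Z n N ^ (1 + (choose d p c).eU + (d + c + (choose d p c).eR) * p) := by ring
        _ ≤ _ := hmono _ (by rw [wordExponent]; omega)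
    exact_mod_cast h
  · rw [hR, hd']
    have h : (2 * Z n N ^ (choose d p c).eR + 1) ^ d ≤ Z n N ^ wordExponent d p c k ⌈C⌉₊ := by
      have h1 : 1 ≤ Z n N ^ (choose d p c).eR := Nat.one_le_pow _ _ (by omega)
      calc (2 * Z n N ^ (choose d p c).eR + 1) ^ d ≤ (Z n N ^ 2 * Z n N ^ (choose d p c).eR) ^ d := by
            gcongr
            have h2 : 4 ≤ Z n N ^ 2 := by nlinarith
            have h3 := Nat.mul_le_mul_right (Z n N ^ (choose d p c).eR) h2
            linarith
        _ = Z n N ^ (((choose d p c).eR + 2) * d) := by ring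
        _ ≤ _ := hmono _ (by rw [wordExponent]; omega)
    exact_mod_cast h
  · have h : n + 1 ≤ Z n N ^ wordExponent d p c k ⌈C⌉₊ :=
      hnZ.trans (le_of_eq_of_le (pow_one _).symm (hmono 1 (by rw [wordExponent]; omega)))
    exact_mod_cast h
  · rw [hU]
    exact_mod_cast hmono _ (by rw [wordExponent]; omega)
  · rw [hU, hK]
    exact Nat.pow_le_pow_right (by omega) (by omega)
  · exact_mod_cast hQ.trans (hmono c (by rw [wordExponent]; omega))
  · exact_mod_cast hT5.trans (hmono 5 (by rw [wordExponent]; omega))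
  · rw [hK]
    calc 4 * maxTest n N = 2 ^ 2 * maxTest n N := by norm_num
      _ ≤ Z n N ^ 2 * Z n N ^ 5 := by gcongr
      _ = Z n N ^ 7 := by ring
  · rw [hU, hK, hd', hp', heU]
    calc 4 * Z n N ^ 7 * (n * (d * ((n + 1) ^ c * (n + 1) ^ c)) ^ p) =
          2 ^ 2 * Z n N ^ 7 * (n * (d * ((n + 1) ^ c * (n + 1) ^ c)) ^ p) := by norm_num
      _ ≤ Z n N ^ 2 * Z n N ^ 7 * (Z n N * (Z n N ^ d * (Z n N ^ c * Z n N ^ c)) ^ p) := by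
          gcongr
          · omega
          · exact self_le_pow hZ d
      _ = Z n N ^ (10 + (d + 2 * c) * p) := by ring
  · rw [hU, hR, hd', hp', heR]
    have h1 : maxTest n N + 1 ≤ Z n N ^ 6 := by
      have : 1 ≤ Z n N ^ 5 := Nat.one_le_pow _ _ (by omega)
      rw [pow_succ]
      nlinarith
    have h2 : d * (d.factorial * ((n + 1) ^ c) ^ d) * ((maxTest n N + 1) *
        (n * Z n N ^ (choose d p c).eU) * (d * (n + 1) ^ c * p * 2 ^ p)) ≤
        Z n N ^ (d + d.factorial + c * d + 6 + (1 + (choose d p c).eU) + (d + c + p + p)) := by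
      calc _ ≤ Z n N ^ d * (Z n N ^ d.factorial * (Z n N ^ c) ^ d) * (Z n N ^ 6 *
            (Z n N * Z n N ^ (choose d p c).eU) * (Z n N ^ d * Z n N ^ c * Z n N ^ p * Z n N ^ p)) := by
            gcongr
            · exact self_le_pow hZ d
            · exact self_le_pow hZ _
            · omega
            · exact self_le_pow hZ d
            · exact self_le_pow hZ p
        _ = _ := by ring
    have h3 : 1 ≤ Z n N ^ (d + d.factorial + c * d + 6 + (1 + (choose d p c).eU) + (d + c + p + p)) :=
      Nat.one_le_pow _ _ (by omega)
    rw [pow_succ _ (d + d.factorial + c * d + 6 + (1 + (choose d p c).eU) + (d + c + p + p))]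
    nlinarith
  · have h := sizeBound_le_Z_pow (p := p) (k := k) hd hn hN hC.le htop1 htop
    have h1 : levelSize d p k C n N ≤ Z n N ^ (⌈C⌉₊ + 12 + 7 * k) :=
      Nat.floor_le_of_le h
    exact_mod_cast h1.trans (hmono _ (by rw [wordExponent]; omega))
  · have h := sizeBound_le_Z_pow (p := p) (k := k) hd hn hN hC.le (by omega : 1 ≤ 8 * N) h8
    have h1 : outputSize d p k C N ≤ Z n N ^ (⌈C⌉₊ + 12 + 7 * k) :=
      Nat.floor_le_of_le h
    exact_mod_cast h1.trans (hmono _ (by rw [wordExponent]; omega))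
  · intro l hl
    refine lt_of_le_of_lt ?_ (Nat.lt_floor_add_one _)
    have hT : 8 * N * (l + 1) * (l + 2) ≤ topTest n N := by
      rw [topTest]
      gcongr
    have hT1 : 1 ≤ 8 * N * (l + 1) * (l + 2) := by
      have : 0 < 8 * N * (l + 1) * (l + 2) := by positivity
      omega
    have hT' : ((8 * N * (l + 1) * (l + 2) : ℕ) : ℝ) ≤ topTest n N := by exact_mod_cast hT
    have hT1' : (1 : ℝ) ≤ ((8 * N * (l + 1) * (l + 2) : ℕ) : ℝ) := by exact_mod_cast hT1
    refine sizeBound_anti hd hC.le (by positivity) (one_div_le_one_div_of_le (by linarith) (by linarith)) ?_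
    rw [div_le_one (by linarith)]
    linarith
  · exact Nat.lt_floor_add_one _
  · exact Nat.lt_succ_self _

/-! ### The machine program -/

/-- Cells for variables. -/
def varCells (E : Exponents) : ℕ := max E.main.varBound 2

/-- First address of the heap. -/
def heapBase (E : Exponents) : ℕ := E.varCells + E.main.depth + 3

/-- The compiled program; at the end the address of the records is stored. -/
def program (E : Exponents) : Prog :=
  .seq (E.main.comp E.varCells E.heapBase) (.instr (.const 1 E.heapBase))

theorem getD_ofFn {n d : ℕ} (A : Matrix (Fin n) (Fin d) ℤ) (a c : ℕ) :
    ((List.ofFn fun i => List.ofFn (A i)).getD a []).getD c 0 =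
      if h : a < n ∧ c < d then A ⟨a, h.1⟩ ⟨c, h.2⟩ else 0 := by
  by_cases ha : a < n
  · have h1 : (List.ofFn fun i => List.ofFn (A i)).getD a [] = List.ofFn (A ⟨a, ha⟩) := by
      rw [List.getD_eq_getElem _ _ (by simpa using ha), List.getElem_ofFn]
    rw [h1]
    by_cases hc : c < d
    · rw [dif_pos ⟨ha, hc⟩, List.getD_eq_getElem _ _ (by simpa using hc), List.getElem_ofFn]
    · rw [dif_neg fun h => hc h.2]
      exact List.getD_eq_default _ _ (by simpa using hc)
  · have h1 : (List.ofFn fun i => List.ofFn (A i)).getD a [] = [] :=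
      List.getD_eq_default _ _ (by simpa using ha)
    rw [dif_neg fun h => ha h.1, h1]
    rfl

/-- The states of the small language contain no coins, so one abstract run is simulated for every
`ω`, and `B` can be chosen before `ω`. -/
theorem returns_program {E : Exponents} {n N cap Q M Mf e S w b : ℕ} (hZ : 2 ≤ Z n N)
    (hG : E.Good n N ((Z n N ^ b : ℕ) : ℤ) cap Q M Mf C e) (hb : 1 ≤ b) (hNX : N ≤ Z n N)
    (hS : E.heapBase + cap ≤ S) (hw : Z n N ^ (b * (E.main.size E.heapBase + E.heapBase)) < 2 ^ w)
    (A : Matrix (Fin n) (Fin E.d) ℤ) (hA : ∀ i j, |A i j| ≤ Q) :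
    ∃ B : WeightedRows E.d, (∀ ω, Returns E.program S w N A ω B) ∧ B.IsSubsetOf A ∧ B.m ≤ Mf ∧
      B.Approximates A E.p (1 / N) := by
  set rows : List (List ℤ) := List.ofFn fun i => List.ofFn (A i) with hrows
  set σ : HState := ⟨fun a => if a = 0 then n else if a = 1 then N else 0, fun _ => 0, rows.flatten⟩ with hσ
  have hHB : 2 ≤ E.heapBase := by
    rw [heapBase, varCells]
    omega
  have hrow : ∀ a c, |(rows.getD a []).getD c 0| ≤ (Q : ℤ) := by
    intro a c
    rw [hrows, getD_ofFn]
    split_ifs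
    · exact hA _ _
    · simp
  obtain ⟨τ, hτ, L, h0, hst, hMf, hlen, hrec, hsorted, herr⟩ := wp_main (σ := σ) (rows := rows) hG
    (by simp [hrows]) (fun l hl => by
      rw [hrows, List.mem_ofFn] at hl
      obtain ⟨i, rfl⟩ := hl
      simp) hrow rfl rfl rfl
  have hX1 : Z n N ≤ Z n N ^ b := Nat.le_self_pow (by omega) _
  have hX : (2 : ℤ) ≤ ((Z n N ^ b : ℕ) : ℤ) := by exact_mod_cast hZ.trans hX1
  have hbound : Bounded E.varCells cap ((Z n N ^ b : ℕ) : ℤ) σ := by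
    refine ⟨fun a _ => ?_, fun a _ _ => by simp [hσ]⟩
    simp only [hσ]
    have h1 := hG.env.n_le
    split_ifs
    · rw [Nat.abs_cast]
      omega
    · rw [Nat.abs_cast]
      exact_mod_cast hNX.trans hX1
    · simp
  have hK0 : 0 < E.K n N := Nat.pow_pos (by omega)
  have hK : (0 : ℝ) < E.K n N := by exact_mod_cast hK0
  have hrowA : ∀ (a : Fin n) (c : Fin E.d), (rows.getD a []).getD c 0 = A a c := fun a c => by
    rw [hrows, getD_ofFn, dif_pos ⟨a.2, c.2⟩]
  have hpos : ∀ i : Fin L.length, L[i].pos < n := fun i => (hrec _ (List.getElem_mem i.2)).1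
  refine ⟨⟨L.length, fun i j => (rows.getD L[i].pos []).getD j 0, fun i => (L[i].u : ℝ) / E.K n N⟩,
    fun ω => ?_, ?_, hMf, ?_⟩
  · have hrep : Rep E.varCells E.heapBase (start N A ω) σ := by
      refine ⟨fun a _ => rfl, fun a => ?_, rfl⟩
      simp only [start, hσ]
      rw [if_neg (by omega), if_neg (by omega)]
    have hw' : ((Z n N ^ b : ℕ) : ℤ) ^ E.main.size E.heapBase < 2 ^ w := by
      have h1 : (Z n N ^ b) ^ E.main.size E.heapBase < 2 ^ w := by
        refine lt_of_le_of_lt ?_ hw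
        rw [← pow_mul]
        exact Nat.pow_le_pow_right (by omega) (Nat.mul_le_mul_left _ (by omega))
      exact_mod_cast h1
    have hHBw : |(E.heapBase : ℤ)| < 2 ^ w := by
      have h1 : E.heapBase < 2 ^ w := by
        refine lt_of_le_of_lt ?_ hw
        refine (self_le_pow hZ _).trans (Nat.pow_le_pow_right (by omega) ?_)
        calc E.heapBase ≤ 1 * (E.main.size E.heapBase + E.heapBase) := by omega
          _ ≤ _ := Nat.mul_le_mul_right _ hb
      rw [Nat.abs_cast]
      exact_mod_cast h1
    obtain ⟨t, hexec, hrept, -⟩ := hτ.exec_comp hX hS hbound (le_max_left _ _) le_rfl hw' _ hrep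
    refine ⟨by omega, _, Exec.seq hexec (exec_const (by omega) hHBw), ?_, E.heapBase, ?_, ?_, ?_⟩
    · simp only [Function.update_of_ne (by omega : (0 : ℕ) ≠ 1)]
      rw [hrept.v 0 (by rw [varCells]; omega), h0]
    · simp
    · refine le_trans ?_ hS
      have h1 := hG.cap_ge
      have h2 : L.length * (E.d + 2) ≤ ((Nat.log 2 n + 1) * M + 1) * (E.d + 2) :=
        Nat.mul_le_mul_right _ (by omega)
      simp only
      omega
    · intro (i : Fin L.length)
      have htag : L[i].tag = E.K n N := (hrec _ (List.getElem_mem i.2)).2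
      obtain ⟨h1, h2, h3⟩ := hst i L[i] (List.getElem?_eq_getElem i.2)
      have hmem : ∀ c : ℕ, (Function.update t.mem 1 (E.heapBase : ℤ)) (E.heapBase + i * (E.d + 2) + c) =
          τ.h (i * (E.d + 2) + c) := fun c => by
        rw [Function.update_of_ne (by omega), add_assoc, hrept.h]
        push_cast
        rfl
      have hmem' := hmem (E.d + 1)
      push_cast at hmem'
      refine ⟨fun j => (hmem j).trans (h1 j j.2), ?_, ?_⟩
      · simp only
        rw [hmem', h3, htag]
        exact_mod_cast hK0
      · simp only
        rw [hmem, hmem', h2, h3, htag]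
        push_cast
        rfl
  · refine ⟨⟨fun i => ⟨L[i].pos, hpos i⟩, fun i j hij => ?_⟩, fun i => ?_⟩
    · have hij' : L[i].pos = L[j].pos := congrArg Fin.val hij
      have hpw := List.pairwise_iff_getElem.1 hsorted
      rcases lt_trichotomy i j with h | h | h
      · exact absurd hij' (hpw i j i.2 j.2 h).ne
      · exact h
      · exact absurd hij' (hpw j i j.2 i.2 h).ne'
    · funext c
      exact hrowA ⟨L[i].pos, hpos i⟩ c
  · intro x
    have h1 := herr x
    have h2 : ∑ i : Fin n, |∑ j, (A i j : ℝ) * x j| ^ E.p =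
        ∑ a ∈ Finset.range n, rowValue E.d E.p (fun a c => (rows.getD a []).getD c 0) a x := by
      rw [Finset.sum_range]
      simp only [rowValue, hrowA]
    have h3 : ∑ i : Fin L.length, (L[i].u : ℝ) / E.K n N *
        |∑ j : Fin E.d, (((rows.getD L[i].pos []).getD j 0 : ℤ) : ℝ) * x j| ^ E.p =
        (L.map fun r => (r.u : ℝ) *
          rowValue E.d E.p (fun a c => (rows.getD a []).getD c 0) r.pos x).sum / E.K n N := by
      rw [← Fin.sum_univ_fun_getElem, Finset.sum_div]
      refine Finset.sum_congr rfl fun i _ => ?_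
      rw [rowValue]
      exact div_mul_eq_mul_div _ _ _
    rw [h2]
    simp only
    rw [h3]
    set S := ∑ a ∈ Finset.range n, rowValue E.d E.p (fun a c => (rows.getD a []).getD c 0) a x
    rw [div_sub' hK.ne', abs_div, abs_of_pos hK, div_le_iff₀ hK]
    linarith

end Exponents

end StreamRAM

/-! ### The main theorem -/

theorem sizeBound_div_le_pow {d p k : ℕ} (hd : 2 ≤ d) {C ε m : ℝ} (hC : 0 ≤ C) (hε : 0 < ε)
    (hε1 : ε < 1) (hm : 1 ≤ m) :
    sizeBound d p k C (ε / m) ≤ sizeBound d p k (C * (3 * m) ^ (k + 2)) ε := by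
  refine (sizeBound_div_le hd hC hε hε1 hm).trans ?_
  have hl2 : 1 / 2 < Real.log 2 := by linarith [Real.log_two_gt_d9]
  have hlm := Real.log_nonneg hm
  have hlm' := Real.log_le_sub_one_of_pos (by linarith : 0 < m)
  have h1 : Real.log m / Real.log 2 + 1 ≤ 3 * m := by
    have : Real.log m / Real.log 2 ≤ 2 * m := by
      rw [div_le_iff₀ (by linarith)]
      nlinarith
    linarith
  have h0 : 0 ≤ Real.log m / Real.log 2 + 1 := by positivity
  have hL : 0 ≤ Real.log (2 / ε) := Real.log_nonneg (by rw [le_div_iff₀ hε]; linarith)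
  rw [sizeBound, sizeBound]
  refine mul_le_mul_of_nonneg_right (mul_le_mul_of_nonneg_right ?_ (by positivity)) (by positivity)
  calc C * m ^ 2 * (Real.log m / Real.log 2 + 1) ^ k ≤ C * (3 * m) ^ 2 * (3 * m) ^ k := by
        gcongr
        linarith
    _ = C * (3 * m) ^ (k + 2) := by ring

/-- Brings powers of logarithms to a common exponent. The logarithms that occur may be below one,
but they are at least `1 / 2`. -/
theorem pow_le_two_pow_mul {L : ℝ} (hL : 1 / 2 ≤ L) (a b : ℕ) : L ^ a ≤ 2 ^ b * L ^ (a + b) := by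
  have h : 1 ≤ (2 * L) ^ b := one_le_pow₀ (by linarith)
  have h0 : 0 ≤ L ^ a := by positivity
  calc L ^ a ≤ L ^ a * (2 * L) ^ b := le_mul_of_one_le_right h0 h
    _ = _ := by ring

namespace StreamRAM

instance : IsProbabilityMeasure coinMeasure := by
  unfold coinMeasure
  infer_instance

namespace Exponents

variable {d p k n N : ℕ} {C ε : ℝ}

/-- The test parameter of the highest level is `O(log² n / ε)`, so compared with accuracy `ε` only a
power of `log n` is lost. -/
theorem levelSize_le (hd : 2 ≤ d) (hC : 0 ≤ C) (hε : 0 < ε) (hε1 : ε < 1) (hN1 : 1 ≤ N)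
    (hN : (N : ℝ) ≤ 2 / ε) :
    (levelSize d p k C n N : ℝ) ≤
      sizeBound d p k (C * (3 * (64 * ((Nat.log 2 n : ℝ) + 1) ^ 2)) ^ (k + 2)) ε := by
  have hl : (0 : ℝ) ≤ Nat.log 2 n := Nat.cast_nonneg _
  have hN' : (1 : ℝ) ≤ N := by exact_mod_cast hN1
  have hm : (1 : ℝ) ≤ 64 * ((Nat.log 2 n : ℝ) + 1) ^ 2 := by nlinarith
  have ht : (1 : ℝ) ≤ 2 * topTest n N := by
    have h : 0 < topTest n N := by rw [topTest]; positivity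
    have : (1 : ℝ) ≤ topTest n N := by exact_mod_cast h
    linarith
  have hL : 0 ≤ Real.log (2 / (1 / (2 * (topTest n N : ℝ)))) := by
    refine Real.log_nonneg ?_
    rw [div_div_eq_mul_div, div_one]
    linarith
  refine (Nat.floor_le ?_).trans (le_trans (sizeBound_anti hd hC (by positivity) ?_ ?_)
    (sizeBound_div_le_pow hd hC hε hε1 hm))
  · rw [sizeBound]
    positivity
  · rw [div_le_div_iff₀ (by positivity) (by linarith), topTest]
    push_cast
    rw [le_div_iff₀ hε] at hN
    have h1 : ((Nat.log 2 n : ℝ) + 1) * (Nat.log 2 n + 2) ≤ 2 * ((Nat.log 2 n : ℝ) + 1) ^ 2 := by nlinarith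
    have h2 : 0 ≤ ((Nat.log 2 n : ℝ) + 1) * (Nat.log 2 n + 2) := by positivity
    calc ε * (2 * (8 * N * ((Nat.log 2 n : ℝ) + 1) * (Nat.log 2 n + 2))) =
          16 * (N * ε) * (((Nat.log 2 n : ℝ) + 1) * (Nat.log 2 n + 2)) := by ring
      _ ≤ 16 * 2 * (2 * ((Nat.log 2 n : ℝ) + 1) ^ 2) := by gcongr
      _ = 1 * (64 * ((Nat.log 2 n : ℝ) + 1) ^ 2) := by ring
  · rw [div_le_one (by linarith)]
    exact ht

/-- The last reduction asks for accuracy `1 / (16 * N)`, in which no level occurs; this is why the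
number of returned rows does not depend on `n`. -/
theorem outputSize_le (hd : 2 ≤ d) (hC : 0 ≤ C) (hε : 0 < ε) (hε1 : ε < 1) (hN1 : 1 ≤ N)
    (hN : (N : ℝ) ≤ 2 / ε) :
    (outputSize d p k C N : ℝ) ≤ sizeBound d p k (C * (3 * 32) ^ (k + 2)) ε := by
  have hN' : (1 : ℝ) ≤ N := by exact_mod_cast hN1
  have hL : 0 ≤ Real.log (2 / (1 / (2 * ((8 * N : ℕ) : ℝ)))) := by
    refine Real.log_nonneg ?_
    rw [div_div_eq_mul_div, div_one]
    push_cast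
    linarith
  refine (Nat.floor_le ?_).trans (le_trans (sizeBound_anti hd hC (by positivity) ?_ ?_)
    (sizeBound_div_le_pow hd hC hε hε1 (by norm_num)))
  · rw [sizeBound]
    positivity
  · push_cast
    rw [div_le_div_iff₀ (by positivity) (by linarith)]
    rw [le_div_iff₀ hε] at hN
    linarith
  · push_cast
    rw [div_le_one (by linarith)]
    linarith

theorem log_two_add_one_le (hn : 1 ≤ n) : (Nat.log 2 n : ℝ) + 1 ≤ 3 * Real.log ((n : ℝ) + 1) := by
  have hl2 := Real.log_two_gt_d9
  have hn' : (1 : ℝ) ≤ n := by exact_mod_cast hn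
  have h1 : Real.log 2 ≤ Real.log ((n : ℝ) + 1) := Real.log_le_log two_pos (by linarith)
  have h2 : ((2 : ℝ) ^ Nat.log 2 n) ≤ n := by exact_mod_cast Nat.pow_log_le_self 2 (by omega)
  have h3 : (Nat.log 2 n : ℝ) * Real.log 2 ≤ Real.log ((n : ℝ) + 1) := by
    rw [← Real.log_pow]
    exact Real.log_le_log (by positivity) (by linarith)
  have h4 : (0 : ℝ) ≤ Nat.log 2 n := Nat.cast_nonneg _
  nlinarith

theorem half_le_log {x : ℝ} (hx : 2 ≤ x) : 1 / 2 ≤ Real.log x := by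
  have : Real.log 2 ≤ Real.log x := Real.log_le_log two_pos hx
  linarith [Real.log_two_gt_d9]

theorem records_le (hd : 2 ≤ d) (hC : 0 ≤ C) (hn : 1 ≤ n) (hε : 0 < ε) (hε1 : ε < 1) (hN1 : 1 ≤ N)
    (hN : (N : ℝ) ≤ 2 / ε) :
    ((Nat.log 2 n : ℝ) + 1) * levelSize d p k C n N ≤ 3 * (C * 1728 ^ (k + 2)) * 2 ^ (k + 5) *
      ((1 / ε) ^ sizeExponent d p * Real.log (2 / ε) ^ (2 * k + 5) *
        Real.log ((n : ℝ) + 1) ^ (2 * k + 5)) := by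
  have hl := log_two_add_one_le hn
  have hl0 : (0 : ℝ) ≤ Nat.log 2 n := Nat.cast_nonneg _
  have hL1 : 1 / 2 ≤ Real.log (2 / ε) := half_le_log (by rw [le_div_iff₀ hε]; linarith)
  have hpow := pow_le_two_pow_mul hL1 k (k + 5)
  rw [show k + (k + 5) = 2 * k + 5 by ring] at hpow
  have hM := levelSize_le (p := p) (k := k) (n := n) hd hC hε hε1 hN1 hN
  rw [sizeBound] at hM
  set l : ℝ := (Nat.log 2 n : ℝ) + 1 with hldef
  set L₁ := Real.log (2 / ε)
  set L₂ := Real.log ((n : ℝ) + 1)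
  have hl0' : 0 ≤ l := by linarith
  have hL2 : 0 ≤ L₂ := by linarith
  calc l * levelSize d p k C n N ≤
        3 * L₂ * (C * (3 * (64 * (3 * L₂) ^ 2)) ^ (k + 2) * (1 / ε) ^ sizeExponent d p *
          (2 ^ (k + 5) * L₁ ^ (2 * k + 5))) := by
        refine mul_le_mul hl (hM.trans ?_) (Nat.cast_nonneg _) (by positivity)
        gcongr
    _ = 3 * L₂ * (C * (1728 * L₂ ^ 2) ^ (k + 2) * (1 / ε) ^ sizeExponent d p *
          (2 ^ (k + 5) * L₁ ^ (2 * k + 5))) := by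
        rw [show 3 * (64 * (3 * L₂) ^ 2) = 1728 * L₂ ^ 2 by ring]
    _ = _ := by
        rw [mul_pow, ← pow_mul, show 2 * k + 5 = 2 * (k + 2) + 1 by ring, pow_succ L₂]
        ring

theorem cells_le (hd : 2 ≤ d) (hC : 0 ≤ C) (hn : 1 ≤ n) (hε : 0 < ε) (hε1 : ε < 1) (hN1 : 1 ≤ N)
    (hN : (N : ℝ) ≤ 2 / ε) (H : ℕ) :
    ((H + (maxRecords d p k C n N * (d + 2) + maxRecords d p k C n N + 1) : ℕ) : ℝ) ≤
      (((H : ℝ) + d + 4) * 4 ^ (2 * k + 5) + (d + 3) * (3 * (C * 1728 ^ (k + 2)) * 2 ^ (k + 5))) *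
        ((1 / ε) ^ sizeExponent d p * Real.log (2 / ε) ^ (2 * k + 5) *
          Real.log ((n : ℝ) + 1) ^ (2 * k + 5)) := by
  have hn' : (1 : ℝ) ≤ n := by exact_mod_cast hn
  have hL₁ : 1 / 2 ≤ Real.log (2 / ε) := half_le_log (by rw [le_div_iff₀ hε]; linarith)
  have hL₂ : 1 / 2 ≤ Real.log ((n : ℝ) + 1) := half_le_log (by linarith)
  have hA1 : 1 ≤ (1 / ε) ^ sizeExponent d p :=
    Real.one_le_rpow (by rw [le_div_iff₀ hε]; linarith) (sizeExponent_nonneg hd)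
  have hrec := records_le (p := p) (k := k) hd hC hn hε hε1 hN1 hN
  have h1 : 1 ≤ 4 ^ (2 * k + 5) * ((1 / ε) ^ sizeExponent d p * Real.log (2 / ε) ^ (2 * k + 5) *
      Real.log ((n : ℝ) + 1) ^ (2 * k + 5)) := by
    have h2 : 1 ≤ (2 * Real.log (2 / ε)) ^ (2 * k + 5) := one_le_pow₀ (by linarith)
    have h3 : 1 ≤ (2 * Real.log ((n : ℝ) + 1)) ^ (2 * k + 5) := one_le_pow₀ (by linarith)
    refine (one_le_mul_of_one_le_of_one_le hA1 (one_le_mul_of_one_le_of_one_le h2 h3)).trans_eq ?_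
    rw [show (4 : ℝ) = 2 * 2 by norm_num, mul_pow, mul_pow, mul_pow]
    ring
  set T := (1 / ε) ^ sizeExponent d p * Real.log (2 / ε) ^ (2 * k + 5) *
    Real.log ((n : ℝ) + 1) ^ (2 * k + 5)
  rw [maxRecords]
  push_cast
  calc _ = ((H : ℝ) + d + 4) * 1 + (d + 3) *
        (((Nat.log 2 n : ℝ) + 1) * levelSize d p k C n N) := by ring
    _ ≤ ((H : ℝ) + d + 4) * (4 ^ (2 * k + 5) * T) + (d + 3) *
        (3 * (C * 1728 ^ (k + 2)) * 2 ^ (k + 5) * T) := by gcongr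
    _ = _ := by ring

/-- The scale is at most `2 * Y ≤ Y ^ 2` with `Y = ⌈(n + 1) / ε⌉`, the number whose logarithm
defines the word length. The additional one in `2 * a + 1` makes the inequality strict. -/
theorem Z_pow_lt (hn : 1 ≤ n) (hε : 0 < ε) (hε1 : ε < 1) (hN : (N : ℝ) ≤ 2 / ε) (a : ℕ) :
    Z n N ^ a < 2 ^ wordLength (2 * a + 1) n ε := by
  set Y := ⌈((n : ℝ) + 1) / ε⌉₊ with hY
  have hn' : (1 : ℝ) ≤ n := by exact_mod_cast hn
  have hYr : ((n : ℝ) + 1) / ε ≤ Y := Nat.le_ceil _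
  have hY2 : 2 ≤ Y := by
    have : (2 : ℝ) ≤ Y := by
      refine le_trans ?_ hYr
      rw [le_div_iff₀ hε]
      linarith
    exact_mod_cast this
  have hZY : Z n N ≤ Y ^ 2 := by
    have h : (Z n N : ℝ) ≤ 2 * Y := by
      rw [Z]
      push_cast
      calc ((n : ℝ) + 1) * N ≤ (n + 1) * (2 / ε) := by gcongr
        _ = 2 * (((n : ℝ) + 1) / ε) := by ring
        _ ≤ 2 * Y := by linarith
    have h' : Z n N ≤ 2 * Y := by exact_mod_cast h
    nlinarith
  have hclog : Y ≤ 2 ^ Nat.clog 2 Y := Nat.le_pow_clog one_lt_two _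
  have hclog1 : 0 < Nat.clog 2 Y := Nat.clog_pos one_lt_two hY2
  rw [wordLength]
  calc Z n N ^ a ≤ ((2 ^ Nat.clog 2 Y) ^ 2) ^ a :=
        Nat.pow_le_pow_left (hZY.trans (Nat.pow_le_pow_left hclog 2)) a
    _ = 2 ^ (2 * a * Nat.clog 2 Y) := by
        rw [← pow_mul, ← pow_mul]
        congr 1
        ring
    _ < 2 ^ ((2 * a + 1) * Nat.clog 2 Y) := by
        refine Nat.pow_lt_pow_right one_lt_two ?_
        rw [add_mul]
        omega

end Exponents

end StreamRAM

theorem WeightedRows.Approximates.mono {n d p : ℕ} {B : WeightedRows d}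
    {A : Matrix (Fin n) (Fin d) ℤ} {δ δ' : ℝ} (h : B.Approximates A p δ) (hδ : δ ≤ δ') :
    B.Approximates A p δ' := fun x =>
  (h x).trans (mul_le_mul_of_nonneg_right hδ (Finset.sum_nonneg fun _ _ => by positivity))

theorem mainTheorem12 (d p : ℕ) (hd : 2 ≤ d) (hp : 1 ≤ p) (c q : ℕ) :
    ∃ (P : StreamRAM.Prog) (κ k : ℕ) (C : ℝ), ∀ (n : ℕ) (ε : ℝ), 1 ≤ n → 0 < ε → ε < 1 →
      ∃ S : ℕ,
        (S : ℝ) ≤ C * (1 / ε) ^ ((2 * ((d : ℝ) - 1)) / ((d : ℝ) + 2 * (p : ℝ)))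
          * Real.log (2 / ε) ^ k * Real.log ((n : ℝ) + 1) ^ k ∧
        ∀ A : Matrix (Fin n) (Fin d) ℤ, (∀ i j, |A i j| ≤ ((n : ℤ) + 1) ^ c) →
          ∃ B : (ℕ → Bool) → WeightedRows d,
            (∀ ω, StreamRAM.Returns P S (StreamRAM.wordLength κ n ε) ⌈1 / ε⌉₊ A ω (B ω)) ∧
            (∀ ω, (B ω).IsSubsetOf A) ∧
            (∀ ω, ((B ω).m : ℝ) ≤
              C * (1 / ε) ^ ((2 * ((d : ℝ) - 1)) / ((d : ℝ) + 2 * (p : ℝ)))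
                * Real.log (2 / ε) ^ k) ∧
            1 - 1 / ((n : ℝ) + 1) ^ q ≤
              StreamRAM.coinMeasure.real {ω | (B ω).Approximates A p (C * ε)} := by
  obtain ⟨C₀, k, hC₀, hcore⟩ := exists_coreset d p hd hp
  set E := StreamRAM.Exponents.choose d p c
  set b := StreamRAM.Exponents.wordExponent d p c k ⌈C₀⌉₊
  set H := E.heapBase
  set C₁ : ℝ := ((H : ℝ) + d + 4) * 4 ^ (2 * k + 5) +
    (d + 3) * (3 * (C₀ * 1728 ^ (k + 2)) * 2 ^ (k + 5)) with hC₁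
  set C₂ : ℝ := C₀ * (3 * 32) ^ (k + 2) * 2 ^ (k + 5) with hC₂
  have hC₁0 : 0 ≤ C₁ := by positivity
  have hC₂0 : 0 ≤ C₂ := by positivity
  -- `C₁` bounds the memory and `C₂` the number of returned rows. Adding one makes the constant at
  -- least one, so that the error `1 / N ≤ ε` is covered by `C * ε`.
  refine ⟨E.program, 2 * (b * (E.main.size H + H)) + 1, 2 * k + 5, C₁ + C₂ + 1,
    fun n ε hn hε hε1 => ?_⟩
  set N := ⌈1 / ε⌉₊
  have hεinv : 1 < 1 / ε := by rwa [lt_div_iff₀ hε, one_mul]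
  have hNle : 1 / ε ≤ N := Nat.le_ceil _
  have hN2 : 2 ≤ N := by
    have : 1 < N := by exact_mod_cast hεinv.trans_le hNle
    omega
  have hNle' : (N : ℝ) ≤ 2 / ε := by
    have h1 := Nat.ceil_lt_add_one (by positivity : 0 ≤ 1 / ε)
    have h2 : 2 / ε = 1 / ε + 1 / ε := by ring
    linarith
  have hL₁ : 1 / 2 ≤ Real.log (2 / ε) :=
    StreamRAM.Exponents.half_le_log (by rw [le_div_iff₀ hε]; linarith)
  have hL₂ : 0 ≤ Real.log ((n : ℝ) + 1) := Real.log_nonneg (by linarith [(Nat.cast_nonneg n : (0 : ℝ) ≤ n)])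
  have hcells := StreamRAM.Exponents.cells_le (p := p) (k := k) hd hC₀.le hn hε hε1
    (by omega : 1 ≤ N) hNle' H
  have hG := StreamRAM.Exponents.good_choose (c := c) hd hp hn hN2 hC₀ hcore
  have hout := StreamRAM.Exponents.outputSize_le (p := p) (k := k) hd hC₀.le hε hε1 (by omega) hNle'
  have hpow := pow_le_two_pow_mul hL₁ k (k + 5)
  rw [show k + (k + 5) = 2 * k + 5 by ring] at hpow
  rw [sizeBound] at hout
  rw [← hC₁] at hcells
  rw [show 2 * ((d : ℝ) - 1) / ((d : ℝ) + 2 * p) = sizeExponent d p from rfl]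
  clear_value C₁
  refine ⟨_, (hcells.trans (mul_le_mul_of_nonneg_right (by linarith : C₁ ≤ C₁ + C₂ + 1)
    (by positivity))).trans_eq (by ring), fun A hA => ?_⟩
  obtain ⟨B, hret, hsub, hcard, happ⟩ : ∃ B : WeightedRows d,
      (∀ ω, StreamRAM.Returns E.program _ _ N A ω B) ∧ B.IsSubsetOf A ∧
      B.m ≤ StreamRAM.Exponents.outputSize d p k C₀ N ∧ B.Approximates A p (1 / N) :=
    StreamRAM.Exponents.returns_program (E := E)
    (StreamRAM.Exponents.two_le_Z (n := n) hN2) hG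
    (by rw [StreamRAM.Exponents.wordExponent]; omega) (Nat.le_mul_of_pos_left _ (by omega)) le_rfl
    (StreamRAM.Exponents.Z_pow_lt hn hε hε1 hNle' _) A
    (fun i j => by exact_mod_cast hA i j)
  -- The output does not depend on the coins, so the event of success is the whole space.
  refine ⟨fun _ => B, hret, fun _ => hsub, fun _ => ?_, ?_⟩
  · calc (B.m : ℝ) ≤ StreamRAM.Exponents.outputSize d p k C₀ N := by exact_mod_cast hcard
      _ ≤ C₀ * (3 * 32) ^ (k + 2) * (1 / ε) ^ sizeExponent d p *
          (2 ^ (k + 5) * Real.log (2 / ε) ^ (2 * k + 5)) :=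
          hout.trans (mul_le_mul_of_nonneg_left hpow (by positivity))
      _ = C₂ * ((1 / ε) ^ sizeExponent d p * Real.log (2 / ε) ^ (2 * k + 5)) := by rw [hC₂]; ring
      _ ≤ (C₁ + C₂ + 1) * ((1 / ε) ^ sizeExponent d p * Real.log (2 / ε) ^ (2 * k + 5)) :=
          mul_le_mul_of_nonneg_right (by linarith) (by positivity)
      _ = _ := by ring
  · have h1 : 1 / (N : ℝ) ≤ ε := by
      rwa [div_le_iff₀ (by positivity), mul_comm, ← div_le_iff₀ hε]
    have hall : {ω : ℕ → Bool | B.Approximates A p ((C₁ + C₂ + 1) * ε)} = Set.univ :=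
      Set.eq_univ_of_forall fun _ =>
        happ.mono (h1.trans (le_mul_of_one_le_left hε.le (by linarith)))
    rw [hall, probReal_univ]
    exact sub_le_self _ (by positivity)
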